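/- **Setting.** Let $q\in\mathbb C\setminus\{0\}$, $i_q=(q^i-q^{-i})/(q-q^{-1})=\sum_{k=0}^{i-1}q^{i-1-2k}$, $V=\mathbb C^n$, and let $R\in\mathrm{Aut}(V\otimes V)$ be an R-matrix of $SL(n)$ type: $R_1R_2R_1=R_2R_1R_2$; the minimal polynomial of $R$ is $(x-q)(x+q^{-1})$; $i_q\ne0$ for $2\le i\le n$; $R$ is skew invertible, i.e. there is $\Psi$ with $\mathrm{Tr}_2R_{12}\Psi_{23}=\mathrm{Tr}_2\Psi_{12}R_{23}=P_{13}$ ($P$ the permutation); with $A^{(1)}=I$, $A^{(i)}=\frac{(i-1)_q}{i_q}A^{(i-1)}\bigl(\frac{q^{i-1}}{(i-1)_q}-R_{i-1}\bigr)A^{(i-1)}$ one has $A^{(n)}\bigl(\frac{q^n}{n_q}-R_n\bigr)A^{(n)}=0$, $\mathrm{rk}A^{(n)}=1$ and $\mathrm{Tr}_{2,\dots,n+1}(P_1\cdots P_nA^{(n)})\propto I_1$. Put $\mathrm{Tr}_R X=\mathrm{Tr}(D_RX)$ with $(D_R)_1=\mathrm{Tr}_2\Psi_{12}$; $\mathrm{Tr}_{R_{op}}$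 is the same for $R_{op}=PRP$. Let $\gamma^n=q$. In the $SL$ case assume $n_q+q^n(q-q^{-1})\neq0$ and put $\kappa_q=\frac{q^n(q-q^{-1})}{n_q+q^n(q-q^{-1})}$. **The calculus.** $\mathfrak{DC}_{gl}[R]$ is the unital associative $\mathbb C$-algebra generated by the entries of $n\times n$ matrices $T$ (invertible), $\Omega,L,K$ with relations $RT_1T_2=T_1T_2R$, $R\Omega_1R\Omega_1=-\Omega_1R\Omega_1R^{-1}$, $R\Omega_1R^{-1}T_1=T_1\Omega_2$, $RL_1RL_1=L_1RL_1R$, $RL_1RT_1=\gamma^2T_1L_2$, $RL_1R\Omega_1=\Omega_1RL_1R$, $RK_2RK_2=K_2RK_2R$, $T_2RK_2R=\gamma^2K_1T_2$, $K_1X_2=X_2K_1$ ($X=\Omega,L$). $\mathfrak{DC}_{sl}[R]$ is obtained by replacing the relation for $\Omega$ with itself by $R\Omega_1R\Omega_1+\Omega_1R\Omega_1R^{-1}=\kappa_q(\Omega_1^2+R\Omega_1^2R)$ and adding $\mathrm{Tr}(A^{(n)}T_1\cdots T_n)=1$, $\mathrm{Tr}_R\Omega=0$, $a_n=b_n=q^{-1}$.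 Here $a_0=b_0=c_0=1$ and, for $i\ge1$, $$a_i=\mathrm{Tr}_{R(1,\dots,i)}(A^{(i)}L_{\overline1}\cdots L_{\overline i}),\quad b_i=\mathrm{Tr}_{R_{op}(1,\dots,i)}(A^{(i)}K_{\underline i}\cdots K_{\underline 1}),\quad c_i=\mathrm{Tr}_{R(1,\dots,i)}(A^{(i)}F_{\overline1}\cdots F_{\overline i}),$$ where $X_{\overline1}=X_1$, $X_{\overline{j}}=R_{j-1}X_{\overline{j-1}}R_{j-1}^{-1}$, and (for $b_i$) $K_{\underline i}=K_i$, $K_{\underline j}=R_jK_{\underline{j+1}}R_j^{-1}$ for $j<i$. Moreover $F=LTKT^{-1}$, $\Theta=T^{-1}\Omega T$, $G=T^{-1}FT$. Let $\mathcal F_{sl}[R]=\mathcal F[R]$ be the Hopf algebra generated by the entries of $T$ with $RT_1T_2=T_1T_2R$ and $\mathrm{Tr}(A^{(n)}T_1\cdots T_n)=1$, and let $\mathcal F_{gl}[R]$ be the one where $\mathrm{Tr}(A^{(n)}T_1\cdots T_n)$ is only inverted; in both, $\Delta(T_{ij})=\sum_kT_{ik}\otimes T_{kj}$, $\varepsilon(T_{ij})=\delta_{ij}$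 and the antipode sends $T$ to $T^{-1}$. **Spectral extension.** Let $\mathcal S$ be the commutative algebra generated by $\mu_\alpha^{\pm1},\nu_\alpha^{\pm1},\rho_\alpha^{\pm1}$ ($1\le\alpha\le n$) and the inverses of $\mu_\alpha-\mu_\beta$, $\nu_\alpha-\nu_\beta$, $\rho_\alpha-\rho_\beta$ ($\alpha\ne\beta$), with $\prod\mu_\alpha=\prod\nu_\alpha=q^{-1}$, $\prod\rho_\alpha=q^{-n^2}$. Put $P^\alpha=\prod_{\beta\ne\alpha}\frac{L-q\mu_\beta}{q(\mu_\alpha-\mu_\beta)}$, $Q^\alpha=\prod_{\beta\ne\alpha}\frac{K-q\nu_\beta}{q(\nu_\alpha-\nu_\beta)}$, $S^\alpha=\prod_{\beta\ne\alpha}\frac{F-q\rho_\beta}{q(\rho_\alpha-\rho_\beta)}$. The spectral extension $\widehat{\mathfrak{DC}}_{gl/sl}[R]$ is the algebra generated by the generators of $\mathfrak{DC}_{gl/sl}[R]$ and of $\mathcal S$ subject to the relations of both, the parameterization $a_i=e_i(\mu)$, $b_i=e_i(\nu)$, $c_i=e_i(\rho)$ ($0\le i\le n$; $e_i$ elementary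 symmetric), and, for all $\alpha,\beta,\sigma$: (1) $\mu_\alpha X=X\mu_\alpha$ for $X=L,K,\Theta,G$; $\nu_\alpha X=X\nu_\alpha$ for $X=L,K,\Omega,F$; $\rho_\alpha X=X\rho_\alpha$ for $X=T,L,K,F,G$; (2) $\gamma^2(P^\beta T)\mu_\alpha=q^{2\delta_{\alpha\beta}}\mu_\alpha(P^\beta T)$; $\gamma^2\nu_\alpha(TQ^\beta)=q^{2\delta_{\alpha\beta}}(TQ^\beta)\nu_\alpha$; $q^{2\delta_{\alpha\sigma}}(P^\beta XP^\sigma)\mu_\alpha=q^{2\delta_{\alpha\beta}}\mu_\alpha(P^\beta XP^\sigma)$ for $X=\Omega,F$; $q^{2\delta_{\alpha\sigma}}(Q^\beta YQ^\sigma)\nu_\alpha=q^{2\delta_{\alpha\beta}}\nu_\alpha(Q^\beta YQ^\sigma)$ for $Y=\Theta,G$; $q^{2\delta_{\alpha\sigma}}(S^\beta\Omega S^\sigma)\rho_\alpha=q^{2\delta_{\alpha\beta}}\rho_\alpha(S^\beta\Omega S^\sigma)$; (3) $[\rho_\alpha,\mathrm{Tr}_RX]=0$ for every matrix monomial $X$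 in $\Omega$ and $F$. **Theorem.** In both cases the following holds. (i) *Consistency.* In any algebra with matrices satisfying the relations of the calculus, the $a_i,b_i,c_i$ ($0\le i\le n$) commute with each other; $a_i$ commutes with the entries of $L,K,\Theta,G$, $b_i$ with those of $L,K,\Omega,F$, $c_i$ with those of $T,L,K,F,G$ and with all $\mathrm{Tr}_RX$ of (3); and $$\gamma^{2i}Ta_i=a_iT-(q^2-1)\sum_{j=1}^i(-q)^{-j}a_{i-j}L^jT,\qquad \gamma^{2i}b_iT=Tb_i-(q^2-1)\sum_{j=1}^i(-q)^{-j}TK^jb_{i-j},$$ $$[X,a_i]=(q^2-1)\sum_{j=1}^i(-q)^{-j}[X,a_{i-j}L^j]\quad(X=\Omega,F),$$ and likewise for $(b_i,K)$ with $X=\Theta,G$ and for $(c_i,F)$ with $X=\Omega$. If an algebra contains matrices and spectral variables satisfying the relations of the calculus, those of $\mathcal S$, the factorized identities $\prod_\alpha(L-q\mu_\alpha)=\prod_\alpha(K-q\nu_\alpha)=\prod_\alpha(F-q\rho_\alpha)=0$ and (1)–(3), but not necessarily the parameterization, then $e_i(\mu),e_i(\nu),e_i(\rho)$ satisfy exactly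 the same relations in place of $a_i,b_i,c_i$. (ii) In any algebra in which the relations of the calculus, those of $\mathcal S$, the parameterization and (1) hold: $\prod_\alpha(L-q\mu_\alpha)=0$, $P^\alpha P^\beta=\delta_{\alpha\beta}P^\alpha$, $\sum_\alpha P^\alpha=I$, $LP^\alpha=P^\alpha L=q\mu_\alpha P^\alpha$, and the same for $(K,\nu,Q)$ and $(F,\rho,S)$. There, for every $\alpha$, each of the relations in (2) (for all $\beta,\sigma$) is equivalent to the corresponding one of $\gamma^2T\mu_\alpha=\mu_\alpha T+(q-q^{-1})LP^\alpha T$; $\gamma^2\nu_\alpha T=T\nu_\alpha+(q-q^{-1})TKQ^\alpha$; $[X,\mu_\alpha]=(q-q^{-1})[LP^\alpha,X]$ ($X=\Omega,F$); $[Y,\nu_\alpha]=(q-q^{-1})[KQ^\alpha,Y]$ ($Y=\Theta,G$); $[\Omega,\rho_\alpha]=(q-q^{-1})[FS^\alpha,\Omega]$. (iii) The defining relations hold in $\widehat{\mathfrak{DC}}_{gl/sl}[R]$, and there are homomorphisms from $\mathfrak{DC}_{gl/sl}[R]$ and from $\mathcal S$ to it, identical on generators; the first sends $a_i,b_i,c_i$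 to $e_i(\mu),e_i(\nu),e_i(\rho)$. (iv) $\widehat{\mathfrak{DC}}_{gl/sl}[R]$ is a bicovariant bimodule over the Hopf algebra $\mathcal F_{gl/sl}[R]$ (acting by multiplication by functions of $T$), with coactions that are algebra homomorphisms and are given by $\delta_{\ell/r}(T_{ij})=\sum_kT_{ik}\otimes T_{kj}$; $\delta_\ell(X_{ij})=\sum_{k,p}T_{ik}(T^{-1})_{pj}\otimes X_{kp}$, $\delta_r(X_{ij})=X_{ij}\otimes1$ for $X=\Omega,L,F$; $\delta_\ell(Y_{ij})=1\otimes Y_{ij}$, $\delta_r(Y_{ij})=\sum_{k,p}Y_{kp}\otimes(T^{-1})_{ik}T_{pj}$ for $Y=\Theta,K,G$; $\delta_\ell\xi=1\otimes\xi$, $\delta_r\xi=\xi\otimes1$ for $\xi=\mu_\alpha,\nu_\alpha,\rho_\alpha$. By the same formulas $\mathcal F[R]=\mathcal F_{sl}[R]$ has commuting left and right comodule algebra structures on the extension also in the $GL$ case. -/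

import Mathlib

open scoped Kronecker TensorProduct BigOperators

universe u

noncomputable section

namespace QCalc

/-! R-matrices and operators on tensor powers. Operators on `V ⊗ V` are matrices indexed by
pairs, operators on the `k`-th tensor power of `V` are matrices indexed by `Fin k → Fin n`.
Tensor factors are counted from `0`. -/

/-- The q-number `(q ^ i - q ^ (-i)) / (q - q⁻¹)`, written as the Laurent polynomial
`q ^ (i - 1) + q ^ (i - 3) + ... + q ^ (1 - i)`, which makes sense at `q = 1` and `q = -1` too. -/
def qnum (q : ℂ) (i : ℕ) : ℂ := ∑ k ∈ Finset.range i, q ^ ((i : ℤ) - 1 - 2 * (k : ℤ))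

abbrev Mat1 (n : ℕ) (A : Type*) := Matrix (Fin n) (Fin n) A

abbrev Mat2 (n : ℕ) (A : Type*) := Matrix (Fin n × Fin n) (Fin n × Fin n) A

abbrev MatT (n k : ℕ) (A : Type*) := Matrix (Fin k → Fin n) (Fin k → Fin n) A

section Operators

variable {n : ℕ} {A : Type*} [Ring A]

/-- `X` acting in the tensor factor `i` of the `k`-th tensor power, identity elsewhere. -/
def site (k i : ℕ) (X : Mat1 n A) : MatT n k A := Matrix.of fun a b =>
  if h : i < k then
    if ∀ j : Fin k, j ≠ ⟨i, h⟩ → a j = b j then X (a ⟨i, h⟩) (b ⟨i, h⟩) else 0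
  else 0

/-- `X` acting in the tensor factors `i` and `i + 1`, identity elsewhere. -/
def site2 (k i : ℕ) (X : Mat2 n A) : MatT n k A := Matrix.of fun a b =>
  if h : i + 1 < k then
    if ∀ j : Fin k, j ≠ ⟨i, by omega⟩ → j ≠ ⟨i + 1, h⟩ → a j = b j then
      X (a ⟨i, by omega⟩, a ⟨i + 1, h⟩) (b ⟨i, by omega⟩, b ⟨i + 1, h⟩)
    else 0
  else 0

/-- The permutation `u ⊗ v ↦ v ⊗ u`. -/
def perm (n : ℕ) : Mat2 n ℂ := Matrix.of fun a b => if a.1 = b.2 ∧ a.2 = b.1 then 1 else 0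

/-- `X` acting in the first of two tensor factors. -/
def fst (X : Mat1 n A) : Mat2 n A := X ⊗ₖ (1 : Mat1 n A)

/-- `X` acting in the second of two tensor factors. -/
def snd (X : Mat1 n A) : Mat2 n A := (1 : Mat1 n A) ⊗ₖ X

/-- The scalar matrix with `x` on the diagonal. -/
def sc (n : ℕ) {A : Type*} [Ring A] (x : A) : Mat1 n A := Matrix.scalar (Fin n) x

variable [Algebra ℂ A]

/-- The weighted trace `tr (D X)`. -/
def wtr (D : Mat1 n ℂ) (X : Mat1 n A) : A := ∑ a, ∑ b, D a b • X b a

/-- The weighted trace `tr ((D ⊗ ... ⊗ D) X)` over all `k` tensor factors. -/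
def wtrT (k : ℕ) (D : Mat1 n ℂ) (X : MatT n k A) : A :=
  ∑ a : Fin k → Fin n, ∑ b : Fin k → Fin n, (∏ i, D (a i) (b i)) • X b a

end Operators

/-- Numerical data of the construction: `q`, `γ`, the operator `R`, its skew inverse `Ψ`. -/
structure RData (n : ℕ) where
  q : ℂ
  γ : ℂ
  R : Mat2 n ℂ
  Ψ : Mat2 n ℂ

namespace RData

variable {n : ℕ} (𝓡 : RData n)

/-- q-antisymmetrizer on the first `i` tensor factors of the `k`-th tensor power. -/
def antisym (k : ℕ) : ℕ → MatT n k ℂ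
  | 0 => 1
  | 1 => 1
  | i + 2 => (qnum 𝓡.q (i + 1) / qnum 𝓡.q (i + 2)) •
      (antisym k (i + 1) *
        ((𝓡.q ^ (i + 1) / qnum 𝓡.q (i + 1)) • (1 : MatT n k ℂ) - site2 k i 𝓡.R) *
        antisym k (i + 1))

/-- `tr₂ Ψ₁₂`, the weight matrix of the R-trace. -/
def D : Mat1 n ℂ := Matrix.of fun a b => ∑ c, 𝓡.Ψ (a, c) (b, c)

/-- The weight matrix of the R-trace of `R_op = P R P`, whose skew inverse is `P Ψ P`. -/
def Dop : Mat1 n ℂ := Matrix.of fun a b => ∑ c, 𝓡.Ψ (c, a) (c, b)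

/-- `R` is an R-matrix of `SL(n)` type with eigenvalues `q` and `-q⁻¹`, and `Ψ` is its (unique)
skew inverse. -/
structure IsSLType : Prop where
  q_ne_zero : 𝓡.q ≠ 0
  isUnit_R : IsUnit 𝓡.R
  braid : site2 3 0 𝓡.R * site2 3 1 𝓡.R * site2 3 0 𝓡.R =
    site2 3 1 𝓡.R * site2 3 0 𝓡.R * site2 3 1 𝓡.R
  /-- `tr₂ (R₁₂ Ψ₂₃) = P₁₃` -/
  skew_left : ∀ a c a' c' : Fin n,
    ∑ b, ∑ b', 𝓡.R (a, b) (a', b') * 𝓡.Ψ (b', c) (b, c') = perm n (a, c) (a', c')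
  /-- `tr₂ (Ψ₁₂ R₂₃) = P₁₃` -/
  skew_right : ∀ a c a' c' : Fin n,
    ∑ b, ∑ b', 𝓡.Ψ (a, b) (a', b') * 𝓡.R (b', c) (b, c') = perm n (a, c) (a', c')
  hecke : minpoly ℂ 𝓡.R =
    (Polynomial.X - Polynomial.C 𝓡.q) * (Polynomial.X + Polynomial.C 𝓡.q⁻¹)
  qnum_ne_zero : ∀ i, 2 ≤ i → i ≤ n → qnum 𝓡.q i ≠ 0
  antisym_top : 𝓡.antisym (n + 1) n *
      ((𝓡.q ^ n / qnum 𝓡.q n) • (1 : MatT n (n + 1) ℂ) - site2 (n + 1) (n - 1) 𝓡.R) *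
      𝓡.antisym (n + 1) n = 0
  rank_antisym : (𝓡.antisym n n).rank = 1
  /-- the trace of `P₁ P₂ ... Pₙ A⁽ⁿ⁾` over all factors but the first is a scalar matrix -/
  special : ∃ t : ℂ, ∀ a b : Fin n,
    ∑ s : Fin n → Fin n,
      (((List.range n).map fun i => site2 (n + 1) i (perm n)).prod * 𝓡.antisym (n + 1) n)
        (Fin.cons a s) (Fin.cons b s) = if a = b then t else 0

/-- The coefficient in the quadratic relations for the R-traceless forms. -/
def κ : ℂ := 𝓡.q ^ n * (𝓡.q - 𝓡.q⁻¹) / (qnum 𝓡.q n + 𝓡.q ^ n * (𝓡.q - 𝓡.q⁻¹))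

section OverAlgebra

variable (A : Type*) [Ring A] [Algebra ℂ A]

/-- `R` as a matrix over `A`. -/
def Rm : Mat2 n A := 𝓡.R.map (algebraMap ℂ A)

/-- `R⁻¹` as a matrix over `A`. -/
def Ri : Mat2 n A := 𝓡.R⁻¹.map (algebraMap ℂ A)

/-- `A⁽ᵏ⁾` as a matrix over `A`. -/
def Am (k : ℕ) : MatT n k A := (𝓡.antisym k k).map (algebraMap ℂ A)

variable {A}

/-- `detR T = tr (A⁽ⁿ⁾ T₁ ... Tₙ)`. -/
def detT (T : Mat1 n A) : A :=
  Matrix.trace (𝓡.Am A n * ((List.range n).map fun i => site n i T).prod)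

/-- The overlined copies of `X` in the `k`-th tensor power: the copy number `0` is `X` in the
first factor, and every next copy is `Rᵢ (previous copy) Rᵢ⁻¹`. -/
def overCopy (k : ℕ) (X : Mat1 n A) : ℕ → MatT n k A
  | 0 => site k 0 X
  | i + 1 => site2 k i (𝓡.Rm A) * overCopy k X i * site2 k i (𝓡.Ri A)

/-- The underlined copies of `X` in the `k`-th tensor power, counted from the right: number `0`
is `X` in the last factor, number `m + 1` is `Rᵢ (number m) Rᵢ⁻¹`, with `Rᵢ` acting in the
factors number `m + 1` and `m` from the right. -/
def underCopy (k : ℕ) (X : Mat1 n A) : ℕ → MatT n k A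
  | 0 => site k (k - 1) X
  | m + 1 => site2 k (k - 2 - m) (𝓡.Rm A) * underCopy k X m * site2 k (k - 2 - m) (𝓡.Ri A)

/-- The coefficients of the characteristic polynomial of a right-invariant matrix (`aᵢ` for
`X = L`, `cᵢ` for `X = F`). The coefficient number `n` is the quantum determinant. -/
def coeffR (X : Mat1 n A) (i : ℕ) : A :=
  wtrT i 𝓡.D (𝓡.Am A i * ((List.range i).map fun j => 𝓡.overCopy i X j).prod)

/-- The coefficients of the characteristic polynomial of a left-invariant matrix (`bᵢ` for
`X = K`). The coefficient number `n` is the quantum determinant. -/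
def coeffL (X : Mat1 n A) (i : ℕ) : A :=
  wtrT i 𝓡.Dop (𝓡.Am A i * ((List.range i).map fun j => 𝓡.underCopy i X j).prod)

end OverAlgebra

end RData

/-- The two versions of the calculus, over `GL_q(n)` and over `SL_q(n)`. -/
inductive Kind
  | gl
  | sl

/-- All equations `x = y` listed by `r` hold. -/
def Holds {A : Type*} (r : A → A → Prop) : Prop := ∀ x y, r x y → x = y

/-! Functions on the quantum group. `T'` stands for the inverse of the matrix `T`; for the RTT
algebra invertibility of the matrix `T` and of its quantum determinant amount to the same. -/

section Functions

variable {n : ℕ} (𝓡 : RData n) (s : Kind)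

inductive FunRel {A : Type*} [Ring A] [Algebra ℂ A] (T T' : Mat1 n A) : A → A → Prop
  | rtt (i j) : FunRel T T' ((𝓡.Rm A * fst T * snd T) i j) ((fst T * snd T * 𝓡.Rm A) i j)
  | mul_inv (i j) : FunRel T T' ((T * T') i j) ((1 : Mat1 n A) i j)
  | inv_mul (i j) : FunRel T T' ((T' * T) i j) ((1 : Mat1 n A) i j)
  | det_T (h : s = Kind.sl) : FunRel T T' (𝓡.detT T) 1

inductive FunGen (n : ℕ)
  | T (i j : Fin n)
  | T' (i j : Fin n)

/-- The algebra of functions over the quantum group: for `Kind.sl` this is `F[R]`, for `Kind.gl`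
it is the RTT algebra with invertible quantum determinant. -/
abbrev Fun : Type :=
  RingQuot (FunRel 𝓡 s (A := FreeAlgebra ℂ (FunGen n))
    (Matrix.of fun i j => FreeAlgebra.ι ℂ (FunGen.T i j))
    (Matrix.of fun i j => FreeAlgebra.ι ℂ (FunGen.T' i j)))

def Fun.T : Mat1 n (Fun 𝓡 s) :=
  Matrix.of fun i j => RingQuot.mkAlgHom ℂ _ (FreeAlgebra.ι ℂ (FunGen.T i j))

def Fun.T' : Mat1 n (Fun 𝓡 s) :=
  Matrix.of fun i j => RingQuot.mkAlgHom ℂ _ (FreeAlgebra.ι ℂ (FunGen.T' i j))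

end Functions

/-! The differential calculus. -/

/-- Matrices `T`, `T' = T⁻¹`, `Ω` (that is `Ω^g` in the `GL` case), `L`, `K` over an algebra. -/
structure Calc (n : ℕ) (A : Type*) where
  T : Mat1 n A
  T' : Mat1 n A
  Ω : Mat1 n A
  L : Mat1 n A
  K : Mat1 n A

namespace Calc

variable {n : ℕ} {A : Type*} [Ring A] (D : Calc n A)

def F : Mat1 n A := D.L * D.T * D.K * D.T'

/-- left-invariant forms -/
def Θ : Mat1 n A := D.T' * D.Ω * D.T

def G : Mat1 n A := D.T' * D.F * D.T

end Calc

section Calculus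

variable {n : ℕ} (𝓡 : RData n) (s : Kind)

/-- The defining relations of the differential calculus. -/
inductive CalcRel {A : Type*} [Ring A] [Algebra ℂ A] (D : Calc n A) : A → A → Prop
  | functions (x y) (h : FunRel 𝓡 s D.T D.T' x y) : CalcRel D x y
  | forms_gl (h : s = Kind.gl) (i j) : CalcRel D
      ((𝓡.Rm A * fst D.Ω * 𝓡.Rm A * fst D.Ω) i j)
      ((-(fst D.Ω * 𝓡.Rm A * fst D.Ω * 𝓡.Ri A)) i j)
  | forms_sl (h : s = Kind.sl) (i j) : CalcRel D
      ((𝓡.Rm A * fst D.Ω * 𝓡.Rm A * fst D.Ω + fst D.Ω * 𝓡.Rm A * fst D.Ω * 𝓡.Ri A) i j)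
      ((𝓡.κ • (fst D.Ω * fst D.Ω + 𝓡.Rm A * (fst D.Ω * fst D.Ω) * 𝓡.Rm A)) i j)
  | Ω_T (i j) : CalcRel D
      ((𝓡.Rm A * fst D.Ω * 𝓡.Ri A * fst D.T) i j) ((fst D.T * snd D.Ω) i j)
  | L_L (i j) : CalcRel D
      ((𝓡.Rm A * fst D.L * 𝓡.Rm A * fst D.L) i j) ((fst D.L * 𝓡.Rm A * fst D.L * 𝓡.Rm A) i j)
  | L_T (i j) : CalcRel D
      ((𝓡.Rm A * fst D.L * 𝓡.Rm A * fst D.T) i j) ((𝓡.γ ^ 2 • (fst D.T * snd D.L)) i j)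
  | L_Ω (i j) : CalcRel D
      ((𝓡.Rm A * fst D.L * 𝓡.Rm A * fst D.Ω) i j) ((fst D.Ω * 𝓡.Rm A * fst D.L * 𝓡.Rm A) i j)
  | K_K (i j) : CalcRel D
      ((𝓡.Rm A * snd D.K * 𝓡.Rm A * snd D.K) i j) ((snd D.K * 𝓡.Rm A * snd D.K * 𝓡.Rm A) i j)
  | K_T (i j) : CalcRel D
      ((snd D.T * 𝓡.Rm A * snd D.K * 𝓡.Rm A) i j) ((𝓡.γ ^ 2 • (fst D.K * snd D.T)) i j)
  | K_Ω (i j) : CalcRel D ((fst D.K * snd D.Ω) i j) ((snd D.Ω * fst D.K) i j)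
  | K_L (i j) : CalcRel D ((fst D.K * snd D.L) i j) ((snd D.L * fst D.K) i j)
  | tr_Ω (h : s = Kind.sl) : CalcRel D (wtr 𝓡.D D.Ω) 0
  | det_L (h : s = Kind.sl) : CalcRel D (𝓡.coeffR D.L n) (algebraMap ℂ A 𝓡.q⁻¹)
  | det_K (h : s = Kind.sl) : CalcRel D (𝓡.coeffL D.K n) (algebraMap ℂ A 𝓡.q⁻¹)

inductive CalcGen (n : ℕ)
  | T (i j : Fin n)
  | T' (i j : Fin n)
  | Ω (i j : Fin n)
  | L (i j : Fin n)
  | K (i j : Fin n)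

/-- The matrices of generators, with the generators sent to an algebra by `f`. -/
def Calc.ofGen {A : Type*} (f : CalcGen n → A) : Calc n A where
  T := Matrix.of fun i j => f (.T i j)
  T' := Matrix.of fun i j => f (.T' i j)
  Ω := Matrix.of fun i j => f (.Ω i j)
  L := Matrix.of fun i j => f (.L i j)
  K := Matrix.of fun i j => f (.K i j)

/-- The algebra of the differential calculus over `GL_q(n)` or `SL_q(n)`. -/
abbrev DC : Type :=
  RingQuot (CalcRel 𝓡 s (Calc.ofGen (n := n) (FreeAlgebra.ι ℂ)))

def DC.calc : Calc n (DC 𝓡 s) :=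
  Calc.ofGen fun g => RingQuot.mkAlgHom ℂ _ (FreeAlgebra.ι ℂ g)

end Calculus

/-! Spectral variables. -/

/-- A family `x`, its inverses `x'` and the inverses `d α β` of the differences `x α - x β`,
`α ≠ β` (the entries `d α α` are dummies, which are set to zero below). -/
structure Eig (n : ℕ) (A : Type*) where
  x : Fin n → A
  x' : Fin n → A
  d : Fin n → Fin n → A

/-- The eigenvalues of `L`, `K` and `F`. -/
structure Spec (n : ℕ) (A : Type*) where
  μ : Eig n A
  ν : Eig n A
  ρ : Eig n A

section Spectral

variable {n : ℕ} {A : Type*} [Ring A]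

/-- The elementary symmetric polynomial of degree `i`. -/
def esymm (x : Fin n → A) (i : ℕ) : A :=
  ∑ t ∈ Finset.powersetCard i (Finset.univ : Finset (Fin n)),
    (((List.finRange n).filter fun α => α ∈ t).map x).prod

variable [Algebra ℂ A]

/-- The idempotent with number `α` of the matrix `X` with eigenvalues `q x_β`: the product over
`β ≠ α` of `(X - q x_β) / (q (x_α - x_β))`. -/
def proj (q : ℂ) (X : Mat1 n A) (e : Eig n A) (α : Fin n) : Mat1 n A :=
  (((List.finRange n).filter fun β => β ≠ α).map fun β =>
    (X - q • sc n (e.x β)) * sc n (q⁻¹ • e.d α β)).prod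

/-- The product of `X - q x_α` over all `α`. -/
def charProd (q : ℂ) (X : Mat1 n A) (e : Eig n A) : Mat1 n A :=
  ((List.finRange n).map fun α => X - q • sc n (e.x α)).prod

end Spectral

section SpectralRelations

variable {n : ℕ} (𝓡 : RData n)

/-- Relations for one family of eigenvalues with product `c`. -/
inductive EigRel (c : ℂ) {A : Type*} [Ring A] [Algebra ℂ A] (e : Eig n A) : A → A → Prop
  | mul_inv (α) : EigRel c e (e.x α * e.x' α) 1
  | inv_mul (α) : EigRel c e (e.x' α * e.x α) 1
  | diff_mul_inv (α β) (h : α ≠ β) : EigRel c e ((e.x α - e.x β) * e.d α β) 1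
  | inv_mul_diff (α β) (h : α ≠ β) : EigRel c e (e.d α β * (e.x α - e.x β)) 1
  | diag (α) : EigRel c e (e.d α α) 0
  | prod : EigRel c e ((List.finRange n).map e.x).prod (algebraMap ℂ A c)

variable {A : Type*} [Ring A] [Algebra ℂ A]

/-- The Abelian algebra of spectral variables. -/
inductive SpecRel (S : Spec n A) : A → A → Prop
  | eig_μ (x y) (h : EigRel 𝓡.q⁻¹ S.μ x y) : SpecRel S x y
  | eig_ν (x y) (h : EigRel 𝓡.q⁻¹ S.ν x y) : SpecRel S x y
  | eig_ρ (x y) (h : EigRel (𝓡.q ^ (n ^ 2))⁻¹ S.ρ x y) : SpecRel S x y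
  | μ_μ (α β) : SpecRel S (S.μ.x α * S.μ.x β) (S.μ.x β * S.μ.x α)
  | ν_ν (α β) : SpecRel S (S.ν.x α * S.ν.x β) (S.ν.x β * S.ν.x α)
  | ρ_ρ (α β) : SpecRel S (S.ρ.x α * S.ρ.x β) (S.ρ.x β * S.ρ.x α)
  | μ_ν (α β) : SpecRel S (S.μ.x α * S.ν.x β) (S.ν.x β * S.μ.x α)
  | μ_ρ (α β) : SpecRel S (S.μ.x α * S.ρ.x β) (S.ρ.x β * S.μ.x α)
  | ν_ρ (α β) : SpecRel S (S.ν.x α * S.ρ.x β) (S.ρ.x β * S.ν.x α)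

/-- The parameterization of the coefficients `aᵢ`, `bᵢ`, `cᵢ`. -/
inductive ParamRel (D : Calc n A) (S : Spec n A) : A → A → Prop
  | a (i) (h : i ≤ n) : ParamRel D S (𝓡.coeffR D.L i) (esymm S.μ.x i)
  | b (i) (h : i ≤ n) : ParamRel D S (𝓡.coeffL D.K i) (esymm S.ν.x i)
  | c (i) (h : i ≤ n) : ParamRel D S (𝓡.coeffR D.F i) (esymm S.ρ.x i)

/-- The matrices whose entries commute with the `μ_α`. -/
def muCommutant (D : Calc n A) : Set (Mat1 n A) := {D.L, D.K, D.Θ, D.G}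

/-- The matrices whose entries commute with the `ν_α`. -/
def nuCommutant (D : Calc n A) : Set (Mat1 n A) := {D.L, D.K, D.Ω, D.F}

/-- The matrices whose entries commute with the `ρ_α`. -/
def rhoCommutant (D : Calc n A) : Set (Mat1 n A) := {D.T, D.L, D.K, D.F, D.G}

/-- The commutation relations of the spectral variables. -/
inductive CommRel (D : Calc n A) (S : Spec n A) : A → A → Prop
  | μ (X) (hX : X ∈ muCommutant D) (α i j) : CommRel D S (S.μ.x α * X i j) (X i j * S.μ.x α)
  | ν (X) (hX : X ∈ nuCommutant D) (α i j) : CommRel D S (S.ν.x α * X i j) (X i j * S.ν.x α)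
  | ρ (X) (hX : X ∈ rhoCommutant D) (α i j) : CommRel D S (S.ρ.x α * X i j) (X i j * S.ρ.x α)

/-- The matrix monomial in `Ω` and `F` given by a word (`true` stands for `Ω`). -/
def monomial (D : Calc n A) (w : List Bool) : Mat1 n A :=
  (w.map fun b => if b then D.Ω else D.F).prod

/-- `ρ_α` commutes with the R-traces of all matrix monomials in `Ω` and `F`. -/
inductive TraceRel (D : Calc n A) (S : Spec n A) : A → A → Prop
  | tr (α) (w : List Bool) : TraceRel D S
      (S.ρ.x α * wtr 𝓡.D (monomial D w)) (wtr 𝓡.D (monomial D w) * S.ρ.x α)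

/-- Labels of the non-trivial exchange relations: which matrix is exchanged with which spectral
variable. -/
inductive Label (n : ℕ)
  | T_μ (α : Fin n)
  | T_ν (α : Fin n)
  | Ω_μ (α : Fin n)
  | F_μ (α : Fin n)
  | Θ_ν (α : Fin n)
  | G_ν (α : Fin n)
  | Ω_ρ (α : Fin n)

/-- `q ^ (2 δ_{αβ})`. -/
def q2δ (q : ℂ) {n : ℕ} (α β : Fin n) : ℂ := if α = β then q ^ 2 else 1

/-- Left-hand side of the exchange relation of `E^β X E^σ` with `x_α`, where `E^β` are the
idempotents of `M`. -/
def sandwichL (q : ℂ) (M X : Mat1 n A) (e : Eig n A) (α β σ : Fin n) : Mat1 n A :=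
  q2δ q α σ • (proj q M e β * X * proj q M e σ * sc n (e.x α))

/-- Right-hand side of the same relation. -/
def sandwichR (q : ℂ) (M X : Mat1 n A) (e : Eig n A) (α β σ : Fin n) : Mat1 n A :=
  q2δ q α β • (sc n (e.x α) * (proj q M e β * X * proj q M e σ))

/-- The exchange relations in terms of idempotents. -/
inductive Exch1 (D : Calc n A) (S : Spec n A) : Label n → A → A → Prop
  | T_μ (α β i j) : Exch1 D S (.T_μ α)
      ((𝓡.γ ^ 2 • ((proj 𝓡.q D.L S.μ β * D.T) * sc n (S.μ.x α))) i j)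
      ((q2δ 𝓡.q α β • (sc n (S.μ.x α) * (proj 𝓡.q D.L S.μ β * D.T))) i j)
  | T_ν (α β i j) : Exch1 D S (.T_ν α)
      ((𝓡.γ ^ 2 • (sc n (S.ν.x α) * (D.T * proj 𝓡.q D.K S.ν β))) i j)
      ((q2δ 𝓡.q α β • ((D.T * proj 𝓡.q D.K S.ν β) * sc n (S.ν.x α))) i j)
  | Ω_μ (α β σ i j) : Exch1 D S (.Ω_μ α)
      (sandwichL 𝓡.q D.L D.Ω S.μ α β σ i j) (sandwichR 𝓡.q D.L D.Ω S.μ α β σ i j)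
  | F_μ (α β σ i j) : Exch1 D S (.F_μ α)
      (sandwichL 𝓡.q D.L D.F S.μ α β σ i j) (sandwichR 𝓡.q D.L D.F S.μ α β σ i j)
  | Θ_ν (α β σ i j) : Exch1 D S (.Θ_ν α)
      (sandwichL 𝓡.q D.K D.Θ S.ν α β σ i j) (sandwichR 𝓡.q D.K D.Θ S.ν α β σ i j)
  | G_ν (α β σ i j) : Exch1 D S (.G_ν α)
      (sandwichL 𝓡.q D.K D.G S.ν α β σ i j) (sandwichR 𝓡.q D.K D.G S.ν α β σ i j)
  | Ω_ρ (α β σ i j) : Exch1 D S (.Ω_ρ α)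
      (sandwichL 𝓡.q D.F D.Ω S.ρ α β σ i j) (sandwichR 𝓡.q D.F D.Ω S.ρ α β σ i j)

/-- Left-hand side of `[X, x_α] = (q - q⁻¹) [M E^α, X]`. -/
def commL (X : Mat1 n A) (e : Eig n A) (α : Fin n) : Mat1 n A :=
  X * sc n (e.x α) - sc n (e.x α) * X

/-- Right-hand side of the same relation. -/
def commR (q : ℂ) (M X : Mat1 n A) (e : Eig n A) (α : Fin n) : Mat1 n A :=
  (q - q⁻¹) • (M * proj q M e α * X - X * (M * proj q M e α))

/-- The exchange relations in the second form. -/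
inductive Exch2 (D : Calc n A) (S : Spec n A) : Label n → A → A → Prop
  | T_μ (α i j) : Exch2 D S (.T_μ α)
      ((𝓡.γ ^ 2 • (D.T * sc n (S.μ.x α))) i j)
      ((sc n (S.μ.x α) * D.T +
        (𝓡.q - 𝓡.q⁻¹) • (D.L * proj 𝓡.q D.L S.μ α * D.T)) i j)
  | T_ν (α i j) : Exch2 D S (.T_ν α)
      ((𝓡.γ ^ 2 • (sc n (S.ν.x α) * D.T)) i j)
      ((D.T * sc n (S.ν.x α) +
        (𝓡.q - 𝓡.q⁻¹) • (D.T * D.K * proj 𝓡.q D.K S.ν α)) i j)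
  | Ω_μ (α i j) : Exch2 D S (.Ω_μ α)
      (commL D.Ω S.μ α i j) (commR 𝓡.q D.L D.Ω S.μ α i j)
  | F_μ (α i j) : Exch2 D S (.F_μ α)
      (commL D.F S.μ α i j) (commR 𝓡.q D.L D.F S.μ α i j)
  | Θ_ν (α i j) : Exch2 D S (.Θ_ν α)
      (commL D.Θ S.ν α i j) (commR 𝓡.q D.K D.Θ S.ν α i j)
  | G_ν (α i j) : Exch2 D S (.G_ν α)
      (commL D.G S.ν α i j) (commR 𝓡.q D.K D.G S.ν α i j)
  | Ω_ρ (α i j) : Exch2 D S (.Ω_ρ α)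
      (commL D.Ω S.ρ α i j) (commR 𝓡.q D.F D.Ω S.ρ α i j)

/-- The defining relations of the spectrally extended calculus. -/
inductive HatRel (s : Kind) (D : Calc n A) (S : Spec n A) : A → A → Prop
  | calc (x y) (h : CalcRel 𝓡 s D x y) : HatRel s D S x y
  | spec (x y) (h : SpecRel 𝓡 S x y) : HatRel s D S x y
  | param (x y) (h : ParamRel 𝓡 D S x y) : HatRel s D S x y
  | comm (x y) (h : CommRel D S x y) : HatRel s D S x y
  | exch (l x y) (h : Exch1 𝓡 D S l x y) : HatRel s D S x y
  | trace (x y) (h : TraceRel 𝓡 D S x y) : HatRel s D S x y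

end SpectralRelations

inductive EigGen (n : ℕ)
  | x (α : Fin n)
  | x' (α : Fin n)
  | d (α β : Fin n)

inductive SpecGen (n : ℕ)
  | μ (g : EigGen n)
  | ν (g : EigGen n)
  | ρ (g : EigGen n)

def Eig.ofGen {n : ℕ} {A : Type*} (f : EigGen n → A) : Eig n A where
  x α := f (.x α)
  x' α := f (.x' α)
  d α β := f (.d α β)

def Spec.ofGen {n : ℕ} {A : Type*} (f : SpecGen n → A) : Spec n A where
  μ := Eig.ofGen fun g => f (.μ g)
  ν := Eig.ofGen fun g => f (.ν g)
  ρ := Eig.ofGen fun g => f (.ρ g)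

section Extension

variable {n : ℕ} (𝓡 : RData n) (s : Kind)

/-- The Abelian algebra of the spectral variables. -/
abbrev SpecAlg : Type := RingQuot (SpecRel 𝓡 (Spec.ofGen (n := n) (FreeAlgebra.ι ℂ)))

def SpecAlg.spec : Spec n (SpecAlg 𝓡) :=
  Spec.ofGen fun g => RingQuot.mkAlgHom ℂ _ (FreeAlgebra.ι ℂ g)

/-- The spectral extension of the differential calculus. -/
abbrev Hat : Type :=
  RingQuot (HatRel 𝓡 s (A := FreeAlgebra ℂ (CalcGen n ⊕ SpecGen n))
    (Calc.ofGen fun g => FreeAlgebra.ι ℂ (Sum.inl g))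
    (Spec.ofGen fun g => FreeAlgebra.ι ℂ (Sum.inr g)))

def Hat.calc : Calc n (Hat 𝓡 s) :=
  Calc.ofGen fun g => RingQuot.mkAlgHom ℂ _ (FreeAlgebra.ι ℂ (Sum.inl g))

def Hat.spec : Spec n (Hat 𝓡 s) :=
  Spec.ofGen fun g => RingQuot.mkAlgHom ℂ _ (FreeAlgebra.ι ℂ (Sum.inr g))

end Extension

/-! Consistency of the extension. -/

section Consistency

variable {n : ℕ} (𝓡 : RData n) {A : Type*} [Ring A] [Algebra ℂ A]

/-- The sum of `(-q)^(-j) a_{i-j} X^j` over `j = 1, ..., i`. -/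
def tailSum (q : ℂ) (a : ℕ → A) (X : Mat1 n A) (i : ℕ) : Mat1 n A :=
  ∑ j ∈ Finset.Icc 1 i, ((-q) ^ j)⁻¹ • (sc n (a (i - j)) * X ^ j)

/-- The relation `[X, a_i] = (q² - 1) ∑_{j=1}^i (-q)^(-j) [X, a_{i-j} M^j]`. -/
def CoeffComm (q : ℂ) (a : ℕ → A) (M X : Mat1 n A) (i : ℕ) : Prop :=
  X * sc n (a i) - sc n (a i) * X =
    (q ^ 2 - 1) • (X * tailSum q a M i - tailSum q a M i * X)

/-- The permutation relations of the coefficients `aᵢ`, `bᵢ`, `cᵢ` of the characteristic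
polynomials of `L`, `K`, `F` with each other and with the generators of the calculus. -/
structure CoeffExchange (D : Calc n A) (a b c : ℕ → A) : Prop where
  a_T : ∀ i ≤ n, 𝓡.γ ^ (2 * i) • (D.T * sc n (a i)) =
    sc n (a i) * D.T - (𝓡.q ^ 2 - 1) • (tailSum 𝓡.q a D.L i * D.T)
  b_T : ∀ i ≤ n, 𝓡.γ ^ (2 * i) • (sc n (b i) * D.T) =
    D.T * sc n (b i) - (𝓡.q ^ 2 - 1) •
      ∑ j ∈ Finset.Icc 1 i, ((-𝓡.q) ^ j)⁻¹ • (D.T * D.K ^ j * sc n (b (i - j)))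
  a_Ω : ∀ i ≤ n, CoeffComm 𝓡.q a D.L D.Ω i
  a_F : ∀ i ≤ n, CoeffComm 𝓡.q a D.L D.F i
  b_Θ : ∀ i ≤ n, CoeffComm 𝓡.q b D.K D.Θ i
  b_G : ∀ i ≤ n, CoeffComm 𝓡.q b D.K D.G i
  c_Ω : ∀ i ≤ n, CoeffComm 𝓡.q c D.F D.Ω i
  a_comm : ∀ i ≤ n, ∀ X ∈ muCommutant D, Commute (sc n (a i)) X
  b_comm : ∀ i ≤ n, ∀ X ∈ nuCommutant D, Commute (sc n (b i)) X
  c_comm : ∀ i ≤ n, ∀ X ∈ rhoCommutant D, Commute (sc n (c i)) X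
  c_tr : ∀ i ≤ n, ∀ w, Commute (c i) (wtr 𝓡.D (monomial D w))
  aa : ∀ i ≤ n, ∀ j ≤ n, Commute (a i) (a j)
  bb : ∀ i ≤ n, ∀ j ≤ n, Commute (b i) (b j)
  cc : ∀ i ≤ n, ∀ j ≤ n, Commute (c i) (c j)
  ab : ∀ i ≤ n, ∀ j ≤ n, Commute (a i) (b j)
  ac : ∀ i ≤ n, ∀ j ≤ n, Commute (a i) (c j)
  bc : ∀ i ≤ n, ∀ j ≤ n, Commute (b i) (c j)

/-- `X` has the spectral resolution with the eigenvalues `q x_α`: the factorized characteristic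
identity holds and the `proj q X e α` are a complete set of orthogonal idempotents. -/
structure HasSpectralResolution (q : ℂ) (X : Mat1 n A) (e : Eig n A) : Prop where
  char_factor : charProd q X e = 0
  mul_proj : ∀ α β, proj q X e α * proj q X e β = if α = β then proj q X e α else 0
  sum_proj : ∑ α, proj q X e α = 1
  left : ∀ α, X * proj q X e α = q • (sc n (e.x α) * proj q X e α)
  right : ∀ α, proj q X e α * X = q • (sc n (e.x α) * proj q X e α)

end Consistency

/-! Hopf algebras and bicovariant bimodules. -/

/-- The coalgebra structure makes the algebra `H` a Hopf algebra with the antipode `S`. -/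
structure IsHopf (H : Type*) [Ring H] [Algebra ℂ H] [Coalgebra ℂ H] (S : H →ₗ[ℂ] H) : Prop where
  counit_one : Coalgebra.counit (R := ℂ) (1 : H) = 1
  counit_mul : ∀ x y : H, Coalgebra.counit (R := ℂ) (x * y) =
    Coalgebra.counit (R := ℂ) x * Coalgebra.counit (R := ℂ) y
  comul_one : Coalgebra.comul (R := ℂ) (1 : H) = 1
  comul_mul : ∀ x y : H, Coalgebra.comul (R := ℂ) (x * y) =
    Coalgebra.comul (R := ℂ) x * Coalgebra.comul (R := ℂ) y
  antipode_left : ∀ x : H, LinearMap.mul' ℂ H (S.rTensor H (Coalgebra.comul (R := ℂ) x)) =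
    algebraMap ℂ H (Coalgebra.counit (R := ℂ) x)
  antipode_right : ∀ x : H, LinearMap.mul' ℂ H (S.lTensor H (Coalgebra.comul (R := ℂ) x)) =
    algebraMap ℂ H (Coalgebra.counit (R := ℂ) x)

section Bicovariance

variable {H M : Type*} [Ring H] [Algebra ℂ H] [Coalgebra ℂ H] [Ring M] [Algebra ℂ M]

/-- `M` is a left and right comodule algebra over `H` with commuting coactions. -/
structure IsBicomodule (δl : M →ₐ[ℂ] H ⊗[ℂ] M) (δr : M →ₐ[ℂ] M ⊗[ℂ] H) : Prop where
  left_coassoc : ∀ m, TensorProduct.assoc ℂ H H M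
      ((Coalgebra.comul (R := ℂ) (A := H)).rTensor M (δl m)) =
    δl.toLinearMap.lTensor H (δl m)
  left_counit : ∀ m, (Coalgebra.counit (R := ℂ) (A := H)).rTensor M (δl m) = 1 ⊗ₜ[ℂ] m
  right_coassoc : ∀ m, TensorProduct.assoc ℂ M H H (δr.toLinearMap.rTensor H (δr m)) =
    (Coalgebra.comul (R := ℂ) (A := H)).lTensor M (δr m)
  right_counit : ∀ m, (Coalgebra.counit (R := ℂ) (A := H)).lTensor M (δr m) = m ⊗ₜ[ℂ] 1
  left_right : ∀ m, TensorProduct.assoc ℂ H M H (δl.toLinearMap.rTensor H (δr m)) =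
    δr.toLinearMap.lTensor H (δl m)

/-- `M` is a bicovariant bimodule over `H`, where `H` acts from both sides by multiplication by
the images `ι a`. -/
structure IsBicovariant (ι : H →ₐ[ℂ] M) (δl : M →ₐ[ℂ] H ⊗[ℂ] M) (δr : M →ₐ[ℂ] M ⊗[ℂ] H) :
    Prop extends IsBicomodule δl δr where
  left_cov : ∀ (x y : H) (m : M), δl (ι x * m * ι y) =
    ι.toLinearMap.lTensor H (Coalgebra.comul (R := ℂ) x) * δl m *
      ι.toLinearMap.lTensor H (Coalgebra.comul (R := ℂ) y)
  right_cov : ∀ (x y : H) (m : M), δr (ι x * m * ι y) =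
    ι.toLinearMap.rTensor H (Coalgebra.comul (R := ℂ) x) * δr m *
      ι.toLinearMap.rTensor H (Coalgebra.comul (R := ℂ) y)

end Bicovariance

section Coactions

variable {n : ℕ} {H M : Type*} [Ring H] [Algebra ℂ H] [Ring M] [Algebra ℂ M]

/-- The values of the coactions on the generators and on the spectral variables; `t` is the
matrix of functions in `H` and `t'` its inverse. -/
structure CoactionValues (t t' : Mat1 n H) (D : Calc n M) (S : Spec n M)
    (δl : M →ₐ[ℂ] H ⊗[ℂ] M) (δr : M →ₐ[ℂ] M ⊗[ℂ] H) : Prop where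
  T_left : ∀ i j, δl (D.T i j) = ∑ k, t i k ⊗ₜ[ℂ] D.T k j
  T_right : ∀ i j, δr (D.T i j) = ∑ k, D.T i k ⊗ₜ[ℂ] t k j
  X_left : ∀ X ∈ ({D.Ω, D.L, D.F} : Set (Mat1 n M)), ∀ i j,
    δl (X i j) = ∑ k, ∑ p, (t i k * t' p j) ⊗ₜ[ℂ] X k p
  X_right : ∀ X ∈ ({D.Ω, D.L, D.F} : Set (Mat1 n M)), ∀ i j, δr (X i j) = X i j ⊗ₜ[ℂ] 1
  Y_left : ∀ Y ∈ ({D.Θ, D.K, D.G} : Set (Mat1 n M)), ∀ i j, δl (Y i j) = 1 ⊗ₜ[ℂ] Y i j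
  Y_right : ∀ Y ∈ ({D.Θ, D.K, D.G} : Set (Mat1 n M)), ∀ i j,
    δr (Y i j) = ∑ k, ∑ p, Y k p ⊗ₜ[ℂ] (t' i k * t p j)
  spec_left : ∀ α, ∀ ξ ∈ ({S.μ.x α, S.ν.x α, S.ρ.x α} : Set M), δl ξ = 1 ⊗ₜ[ℂ] ξ
  spec_right : ∀ α, ∀ ξ ∈ ({S.μ.x α, S.ν.x α, S.ρ.x α} : Set M), δr ξ = ξ ⊗ₜ[ℂ] 1

end Coactions

/-- The coalgebra structure and the antipode of the algebra of functions on the generators: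
`Δ T = T ⊗ T`, `ε T = 1`, `S T = T⁻¹`. -/
structure FunHopfValues {n : ℕ} (𝓡 : RData n) (s : Kind) [Coalgebra ℂ (Fun 𝓡 s)]
    (S : Fun 𝓡 s →ₗ[ℂ] Fun 𝓡 s) : Prop where
  comul_T : ∀ i j, Coalgebra.comul (R := ℂ) (Fun.T 𝓡 s i j) =
    ∑ k, Fun.T 𝓡 s i k ⊗ₜ[ℂ] Fun.T 𝓡 s k j
  counit_T : ∀ i j, Coalgebra.counit (R := ℂ) (Fun.T 𝓡 s i j) = if i = j then 1 else 0
  antipode_T : ∀ i j, S (Fun.T 𝓡 s i j) = Fun.T' 𝓡 s i j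

end QCalc

end

/-!
# The spectral extension of the differential calculus over a quantum group

Everything is derived from three facts about a skew invertible Hecke R-matrix. The trace `tr_R` with
the weight `D` satisfies `tr₂ (D₂ R X₁ R⁻¹) = tr (D X)` for every matrix `X`
(`ptr2_conj_scalar`): skew invertibility lets one strip off an R-matrix, so that the formula is a
braid relation. Conjugation by products of R-matrices moves the copies of a matrix through the
tensor factors compatibly with the antisymmetrizers (`HeckeSys`). Finally, since `A⁽ⁿ⁾` has rank
one, a trace over all factors but the first one turns the top antisymmetrized product into a scalar.

*The coefficients.* Let `Φ_i` be the trace of `A⁽ⁱ⁾ X_1 ... X_i` over all factors but the first one,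
for a matrix `X` obeying the reflection equation. The recursion for the antisymmetrizers gives a
recursion between `Φ_i` and the coefficients `a_i` of the characteristic polynomial, which is solved
by the Cayley-Hamilton-Newton identities (`wedgePow_eq`); in degree `n` these become the
Cayley-Hamilton identity (`cayley_hamilton`). An exchange relation of a matrix `T` with `X₁` in the
first two factors carries over to the trace of the copies of `X` in the factors after the first
(`coTrace_intertwine`). If the operator in the relation is `R X₁ R`, then this trace is `a_i` minus
`q² - 1` times the sum of the `(-q)^(-j) a_{i-j} X^j` (`coTrace_R_R`), and if it is `R X₁ R⁻¹` or
`X₂`, then it is just `a_i`. So all permutation relations of the coefficients reduce to matrix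
relations between `T`, `Ω`, `L`, `K`, `F`, which follow directly from the defining ones
(`CalcEqs.coeffExchange`). The statements about `K` are those about `L` for the R-matrix `P R P`.

*The spectral variables.* A matrix together with eigenvalues that commute with it and with each
other generates a commutative algebra, where the idempotents are Lagrange polynomials
(`EigFor.resolved`). An idempotent turns the eigenvalue number `α`, corrected by a multiple of
`L P^α`, into a multiple of it by `q²` or `1`; since the idempotents are complete, both forms of the
exchange relations are equivalent (`exch_iff`). The same argument for the elementary symmetric
functions, of which each block of a matrix sees a version with one variable multiplied by `q²`, shows
that they are exchanged like the coefficients (`esymm_coeffExchange`).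

*The quantum group.* The algebras are given by generators and relations, so that homomorphisms from
them are matrices obeying the relations. A product of two matrices of functions with mutually
commuting entries is one again, and translating the matrices of the calculus from the left or from
the right by a matrix of functions preserves all relations (`holds_hatRel_leftTranslate`,
`holds_hatRel_rightTranslate`): the R-matrix commutes with `t₁ t₂`, and traces, coefficients and
determinants are invariant. This yields the comultiplication and the coactions. The antipode needs an
inverse of `t⁻¹` in the opposite algebra; it is `D t D⁻¹`, where `D⁻¹` is a multiple of the weight
matrix for `P R P` (`D_mul_Dop`, `holds_funRel_op`). The axioms are equalities between
homomorphisms, and it suffices to compare these on the generators.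
-/

open scoped Kronecker TensorProduct BigOperators

noncomputable section

set_option linter.unusedSectionVars false

namespace QCalc

/-! ### Operators acting in some of the tensor factors -/

section Local

variable {n : ℕ} {A : Type*} [Ring A] {p r t : Type*} [Fintype p] [Fintype r] [Fintype t]
  [DecidableEq p] [DecidableEq r] [DecidableEq t]

open Classical in
/-- The operator `X` on the tensor factors labelled by `p`, acting in the factors `f i` of the
tensor power labelled by `r`, and the identity in the other factors. -/
def loc (f : p → r) (X : Matrix (p → Fin n) (p → Fin n) A) : Matrix (r → Fin n) (r → Fin n) A :=
  Matrix.of fun a b => if ∀ j ∉ Set.range f, a j = b j then X (a ∘ f) (b ∘ f) else 0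

theorem extend_comp_inj {f : p → r} (hf : f.Injective) (z : p → Fin n) (a : r → Fin n) :
    Function.extend f z a ∘ f = z := by
  ext i; simp [hf.extend_apply]

theorem extend_eq_of_off {f : p → r} (hf : f.Injective) (a b : r → Fin n)
    (h : ∀ j ∉ Set.range f, a j = b j) : Function.extend f (b ∘ f) a = b := by
  ext j
  by_cases hj : j ∈ Set.range f
  · obtain ⟨i, rfl⟩ := hj
    simp [hf.extend_apply]
  · rw [Function.extend_apply' _ _ _ (fun ⟨i, hi⟩ => hj ⟨i, hi⟩), h j hj]

/-- Only the indices in the range of `f` are summed over: the others are kept fixed by `loc f X`. -/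
theorem loc_mul_apply {κ : Type*} {f : p → r} (hf : f.Injective)
    (X : Matrix (p → Fin n) (p → Fin n) A)
    (Z : Matrix (r → Fin n) κ A) (a b) :
    (loc f X * Z) a b = ∑ z, X (a ∘ f) z * Z (Function.extend f z a) b := by
  rw [Matrix.mul_apply]
  symm
  apply Finset.sum_of_injOn (fun z => Function.extend f z a)
  · intro z _ z' _ h
    have := congrArg (fun y => y ∘ f) h
    simpa [extend_comp_inj hf] using this
  · intro z _; simp
  · intro c _ hc
    have : ¬ ∀ j ∉ Set.range f, a j = c j := fun h =>
      hc ⟨c ∘ f, by simp, extend_eq_of_off hf a c h⟩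
    simp only [loc, Matrix.of_apply, if_neg this, zero_mul]
  · intro z _
    have : ∀ j ∉ Set.range f, a j = Function.extend f z a j := fun j hj => by
      rw [Function.extend_apply' _ _ _ (fun ⟨i, hi⟩ => hj ⟨i, hi⟩)]
    simp only [loc, Matrix.of_apply, if_pos this, extend_comp_inj hf]

theorem mul_loc_apply {κ : Type*} {f : p → r} (hf : f.Injective)
    (X : Matrix (p → Fin n) (p → Fin n) A)
    (Z : Matrix κ (r → Fin n) A) (a b) :
    (Z * loc f X) a b = ∑ z, Z a (Function.extend f z b) * X z (b ∘ f) := by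
  rw [Matrix.mul_apply]
  symm
  apply Finset.sum_of_injOn (fun z => Function.extend f z b)
  · intro z _ z' _ h
    have := congrArg (fun y => y ∘ f) h
    simpa [extend_comp_inj hf] using this
  · intro z _; simp
  · intro c _ hc
    have : ¬ ∀ j ∉ Set.range f, c j = b j := fun h =>
      hc ⟨c ∘ f, by simp, extend_eq_of_off hf b c fun j hj => (h j hj).symm⟩
    simp only [loc, Matrix.of_apply, if_neg this, mul_zero]
  · intro z _
    have : ∀ j ∉ Set.range f, Function.extend f z b j = b j := fun j hj => by
      rw [Function.extend_apply' _ _ _ (fun ⟨i, hi⟩ => hj ⟨i, hi⟩)]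
    simp only [loc, Matrix.of_apply, if_pos this, extend_comp_inj hf]

theorem loc_mul {f : p → r} (hf : f.Injective) (X Y : Matrix (p → Fin n) (p → Fin n) A) :
    loc f (X * Y) = loc f X * loc f Y := by
  ext a b
  rw [loc_mul_apply hf]
  have key : ∀ z, (∀ j ∉ Set.range f, Function.extend f z a j = b j) ↔
      ∀ j ∉ Set.range f, a j = b j := fun z => by
    refine forall₂_congr fun j hj => ?_
    rw [Function.extend_apply' _ _ _ (fun ⟨i, hi⟩ => hj ⟨i, hi⟩)]
  simp only [loc, Matrix.of_apply, key, extend_comp_inj hf]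
  split_ifs
  · rw [Matrix.mul_apply]
  · simp

theorem loc_one (f : p → r) :
    loc f (1 : Matrix (p → Fin n) (p → Fin n) A) = 1 := by
  ext a b
  simp only [loc, Matrix.of_apply, Matrix.one_apply]
  by_cases h : a = b
  · subst h; simp
  · rw [if_neg h]
    split_ifs with h1 h2
    · exfalso
      apply h
      ext j
      by_cases hj : j ∈ Set.range f
      · obtain ⟨i, rfl⟩ := hj
        exact congrArg Fin.val (congrFun h2 i)
      · exact congrArg Fin.val (h1 j hj)
    · rfl
    · rfl

theorem loc_comp {f : p → r} {g : r → t} (hg : g.Injective)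
    (X : Matrix (p → Fin n) (p → Fin n) A) : loc g (loc f X) = loc (g ∘ f) X := by
  ext a b
  simp only [loc, Matrix.of_apply, Function.comp_assoc]
  rw [← ite_and]
  congr 1
  apply propext
  constructor
  · rintro ⟨h1, h2⟩ j hj
    by_cases hjg : j ∈ Set.range g
    · obtain ⟨i, rfl⟩ := hjg
      refine h2 i fun ⟨k, hk⟩ => hj ⟨k, ?_⟩
      simp [hk]
    · exact h1 j hjg
  · intro h
    refine ⟨fun j hj => h j fun ⟨k, hk⟩ => hj ⟨f k, hk⟩, fun i hi => h (g i) fun ⟨k, hk⟩ => hi ⟨k, ?_⟩⟩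
    exact hg hk

/-- Product of operators in disjoint sets of factors, in components. -/
theorem loc_mul_loc_apply {f : p → t} {g : r → t} (hf : f.Injective)
    (hfg : ∀ i j, f i ≠ g j) (X : Matrix (p → Fin n) (p → Fin n) A)
    (Y : Matrix (r → Fin n) (r → Fin n) A) (a b) [Decidable (∀ j, j ∉ Set.range f → j ∉ Set.range g → a j = b j)] :
    (loc f X * loc g Y) a b = if ∀ j, j ∉ Set.range f → j ∉ Set.range g → a j = b j then
      X (a ∘ f) (b ∘ f) * Y (a ∘ g) (b ∘ g) else 0 := by
  have hg' : ∀ z, Function.extend f z a ∘ g = a ∘ g := fun z => by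
    ext i
    simp [Function.extend_apply' _ _ _ (fun ⟨k, hk⟩ => hfg k i hk)]
  rw [loc_mul_apply hf, Finset.sum_eq_single (b ∘ f)]
  · simp only [loc, Matrix.of_apply, hg']
    have : (∀ j ∉ Set.range g, Function.extend f (b ∘ f) a j = b j) ↔
        ∀ j, j ∉ Set.range f → j ∉ Set.range g → a j = b j := by
      constructor
      · intro h j hj hj'
        have := h j hj'
        rwa [Function.extend_apply' _ _ _ (fun ⟨i, hi⟩ => hj ⟨i, hi⟩)] at this
      · intro h j hj
        by_cases hjf : j ∈ Set.range f
        · obtain ⟨i, rfl⟩ := hjf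
          simp [hf.extend_apply]
        · rw [Function.extend_apply' _ _ _ (fun ⟨i, hi⟩ => hjf ⟨i, hi⟩)]
          exact h j hjf hj
    simp only [this]
    split_ifs <;> simp
  · intro z _ hz
    simp only [loc, Matrix.of_apply]
    rw [if_neg, mul_zero]
    intro h
    apply hz
    ext i
    have := h (f i) (fun ⟨k, hk⟩ => hfg i k hk.symm)
    rw [hf.extend_apply] at this
    simp [this]
  · simp

theorem loc_commute {f : p → t} {g : r → t} (hf : f.Injective) (hg : g.Injective)
    (hfg : ∀ i j, f i ≠ g j) {X : Matrix (p → Fin n) (p → Fin n) A}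
    {Y : Matrix (r → Fin n) (r → Fin n) A} (h : ∀ a b c d, Commute (X a b) (Y c d)) :
    Commute (loc f X) (loc g Y) := by
  classical
  ext a b
  rw [loc_mul_loc_apply hf hfg, loc_mul_loc_apply hg fun i j => (hfg j i).symm]
  congr 1
  · exact propext ⟨fun h j h1 h2 => h j h2 h1, fun h j h1 h2 => h j h2 h1⟩
  · exact h _ _ _ _

variable [Algebra ℂ A]

/-- `loc f` as a homomorphism of algebras. -/
def locHom (f : p → r) (hf : f.Injective) :
    Matrix (p → Fin n) (p → Fin n) A →ₐ[ℂ] Matrix (r → Fin n) (r → Fin n) A :=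
  AlgHom.ofLinearMap
    { toFun := loc f
      map_add' := fun X Y => by
        ext a b; simp only [loc, Matrix.of_apply, Matrix.add_apply]; split_ifs <;> simp
      map_smul' := fun c X => by
        ext a b
        simp only [loc, Matrix.of_apply, Matrix.smul_apply, RingHom.id_apply]; split_ifs <;> simp }
    (loc_one f) (loc_mul hf)

@[simp] theorem locHom_apply (f : p → r) (hf : f.Injective)
    (X : Matrix (p → Fin n) (p → Fin n) A) : locHom f hf X = loc f X := rfl

end Local

section Sites

variable {n : ℕ} {A : Type*} [Ring A] [Algebra ℂ A]

/-- A matrix as an operator on the first tensor power. -/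
def m1 : Mat1 n A ≃ₐ[ℂ] MatT n 1 A :=
  Matrix.reindexAlgEquiv ℂ A (Equiv.funUnique (Fin 1) (Fin n)).symm

/-- A matrix indexed by pairs as an operator on the second tensor power. -/
def m2 : Mat2 n A ≃ₐ[ℂ] MatT n 2 A :=
  Matrix.reindexAlgEquiv ℂ A (finTwoArrowEquiv (Fin n)).symm

theorem m1_apply (X : Mat1 n A) (a b) : m1 X a b = X (a 0) (b 0) := rfl

theorem m2_apply (X : Mat2 n A) (a b) : m2 X a b = X (a 0, a 1) (b 0, b 1) := rfl

/-- The pair of neighbouring factors `i`, `i + 1`. -/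
def pairMap (k i : ℕ) (h : i + 1 < k) : Fin 2 → Fin k := ![⟨i, by omega⟩, ⟨i + 1, h⟩]

theorem pairMap_injective (k i : ℕ) (h : i + 1 < k) : (pairMap k i h).Injective := by
  intro a b hab
  fin_cases a <;> fin_cases b <;> simp [pairMap] at hab ⊢

/-- The factor `i`. -/
def oneMap (k i : ℕ) (h : i < k) : Fin 1 → Fin k := fun _ => ⟨i, h⟩

theorem oneMap_injective (k i : ℕ) (h : i < k) : (oneMap k i h).Injective :=
  Function.injective_of_subsingleton _

theorem site_eq_loc {k i : ℕ} (h : i < k) (X : Mat1 n A) :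
    site k i X = loc (oneMap k i h) (m1 X) := by
  ext a b
  simp only [site, loc, Matrix.of_apply, dif_pos h, m1_apply]
  congr 1
  apply propext
  refine forall_congr' fun j => ?_
  simp [oneMap, eq_comm]

theorem site2_eq_loc {k i : ℕ} (h : i + 1 < k) (X : Mat2 n A) :
    site2 k i X = loc (pairMap k i h) (m2 X) := by
  ext a b
  simp only [site2, loc, Matrix.of_apply, dif_pos h, m2_apply]
  congr 1
  apply propext
  refine forall_congr' fun j => ?_
  simpa [pairMap] using imp.swap

theorem site2_of_le {k i : ℕ} (h : k ≤ i + 1) (X : Mat2 n A) : site2 k i X = 0 := by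
  ext a b
  simp [site2, show ¬ (i + 1 < k) by omega]

/-- `site2` as a homomorphism of algebras. -/
def site2Hom (k i : ℕ) (h : i + 1 < k) : Mat2 n A →ₐ[ℂ] MatT n k A :=
  (locHom (pairMap k i h) (pairMap_injective k i h)).comp (m2 : Mat2 n A ≃ₐ[ℂ] _).toAlgHom

theorem site2_eq_hom {k i : ℕ} (h : i + 1 < k) (X : Mat2 n A) :
    site2 k i X = site2Hom k i h X := site2_eq_loc h X

/-- `site` as a homomorphism of algebras. -/
def siteHom (k i : ℕ) (h : i < k) : Mat1 n A →ₐ[ℂ] MatT n k A :=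
  (locHom (oneMap k i h) (oneMap_injective k i h)).comp (m1 : Mat1 n A ≃ₐ[ℂ] _).toAlgHom

theorem site_eq_hom {k i : ℕ} (h : i < k) (X : Mat1 n A) :
    site k i X = siteHom k i h X := site_eq_loc h X

theorem m2_fst (X : Mat1 n A) : m2 (fst X) = loc (oneMap 2 0 (by omega)) (m1 X) := by
  ext a b
  have h : (∀ j ∉ Set.range (oneMap 2 0 (by omega)), a j = b j) ↔ a 1 = b 1 := by
    simp [oneMap, Fin.forall_fin_two]
  simp only [loc, Matrix.of_apply, h, m1_apply, m2_apply, fst, Matrix.kroneckerMap_apply,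
    Matrix.one_apply, mul_ite, mul_one, mul_zero]
  rfl

theorem m2_snd (X : Mat1 n A) : m2 (snd X) = loc (oneMap 2 1 (by omega)) (m1 X) := by
  ext a b
  have h : (∀ j ∉ Set.range (oneMap 2 1 (by omega)), a j = b j) ↔ a 0 = b 0 := by
    simp [oneMap, Fin.forall_fin_two]
  simp only [loc, Matrix.of_apply, h, m1_apply, m2_apply, snd, Matrix.kroneckerMap_apply,
    Matrix.one_apply, ite_mul, one_mul, zero_mul]
  rfl

theorem site2_fst {k i : ℕ} (h : i + 1 < k) (X : Mat1 n A) :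
    site2 k i (fst X) = site k i X := by
  rw [site2_eq_loc h, site_eq_loc (by omega), m2_fst, loc_comp (pairMap_injective _ _ _)]
  congr 1

theorem site2_snd {k i : ℕ} (h : i + 1 < k) (X : Mat1 n A) :
    site2 k i (snd X) = site k (i + 1) X := by
  rw [site2_eq_loc h, site_eq_loc (by omega), m2_snd, loc_comp (pairMap_injective _ _ _)]
  congr 1

theorem site2_far {k i j : ℕ} (hij : i + 2 ≤ j) (hj : j + 1 < k) {X Y : Mat2 n A}
    (h : ∀ a b c d, Commute (X a b) (Y c d)) : Commute (site2 k i X) (site2 k j Y) := by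
  rw [site2_eq_loc (by omega), site2_eq_loc hj]
  refine loc_commute (pairMap_injective _ _ _) (pairMap_injective _ _ _) ?_ fun a b c d => h _ _ _ _
  intro a b
  fin_cases a <;> fin_cases b <;> simp [pairMap] <;> omega

theorem site_commute_site2 {k i j : ℕ} (hij : i ≠ j) (hij' : i ≠ j + 1) (hi : i < k)
    {X : Mat1 n A} {Y : Mat2 n A}
    (h : ∀ a b c d, Commute (X a b) (Y c d)) : Commute (site k i X) (site2 k j Y) := by
  by_cases hj : j + 1 < k
  · rw [site_eq_loc hi, site2_eq_loc hj]
    refine loc_commute (oneMap_injective _ _ _) (pairMap_injective _ _ _) ?_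
      fun a b c d => h _ _ _ _
    intro a b
    fin_cases b <;> simp [pairMap, oneMap] <;> omega
  · rw [site2_of_le (by omega)]
    exact Commute.zero_right _

theorem site_commute_site {k i j : ℕ} (hij : i ≠ j) (hi : i < k) (hj : j < k)
    {X Y : Mat1 n A} (h : ∀ a b c d, Commute (X a b) (Y c d)) :
    Commute (site k i X) (site k j Y) := by
  rw [site_eq_loc hi, site_eq_loc hj]
  refine loc_commute (oneMap_injective _ _ _) (oneMap_injective _ _ _) ?_
    fun a b c d => h _ _ _ _
  intro a b
  simp [oneMap, hij]

/-- The identity operator added in a new last factor. -/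
def emb (k : ℕ) : MatT n k A →ₐ[ℂ] MatT n (k + 1) A :=
  locHom Fin.castSucc (Fin.castSucc_injective k)

/-- The identity operator added in a new first factor. -/
def sh (k : ℕ) : MatT n k A →ₐ[ℂ] MatT n (k + 1) A :=
  locHom Fin.succ (Fin.succ_injective k)

theorem emb_site2 {k i : ℕ} (h : i + 1 < k) (X : Mat2 n A) :
    emb k (site2 k i X) = site2 (k + 1) i X := by
  rw [site2_eq_loc h, site2_eq_loc (by omega), emb, locHom_apply,
    loc_comp (Fin.castSucc_injective k)]
  congr 1
  ext j
  fin_cases j <;> rfl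

theorem sh_site2 {k i : ℕ} (h : i + 1 < k) (X : Mat2 n A) :
    sh k (site2 k i X) = site2 (k + 1) (i + 1) X := by
  rw [site2_eq_loc h, site2_eq_loc (by omega), sh, locHom_apply,
    loc_comp (Fin.succ_injective k)]
  congr 1
  ext j
  fin_cases j <;> rfl

theorem emb_site {k i : ℕ} (h : i < k) (X : Mat1 n A) :
    emb k (site k i X) = site (k + 1) i X := by
  rw [site_eq_loc h, site_eq_loc (by omega), emb, locHom_apply,
    loc_comp (Fin.castSucc_injective k)]
  congr 1

theorem sh_site {k i : ℕ} (h : i < k) (X : Mat1 n A) :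
    sh k (site k i X) = site (k + 1) (i + 1) X := by
  rw [site_eq_loc h, site_eq_loc (by omega), sh, locHom_apply,
    loc_comp (Fin.succ_injective k)]
  congr 1

theorem site_one (X : Mat1 n A) : site 1 0 X = m1 X := by
  rw [site_eq_loc (by omega), show oneMap 1 0 (by omega) = id from
    funext fun i => Subsingleton.elim _ _]
  ext a b
  simp [loc]

/-- The braid relation, transported to three neighbouring factors. -/
theorem site2_braid {k i : ℕ} (h : i + 2 < k) {X : Mat2 n A}
    (hX : site2 3 0 X * site2 3 1 X * site2 3 0 X = site2 3 1 X * site2 3 0 X * site2 3 1 X) :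
    site2 k i X * site2 k (i + 1) X * site2 k i X =
      site2 k (i + 1) X * site2 k i X * site2 k (i + 1) X := by
  let f : Fin 3 → Fin k := ![⟨i, by omega⟩, ⟨i + 1, by omega⟩, ⟨i + 2, h⟩]
  have hf : f.Injective := by
    intro a b hab
    fin_cases a <;> fin_cases b <;> simp [f] at hab ⊢
  have h0 : site2 k i X = loc f (site2 3 0 X) := by
    rw [site2_eq_loc (show 0 + 1 < 3 by omega), loc_comp hf, site2_eq_loc (by omega)]
    congr 1
    ext j
    fin_cases j <;> rfl
  have h1 : site2 k (i + 1) X = loc f (site2 3 1 X) := by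
    rw [site2_eq_loc (show 1 + 1 < 3 by omega), loc_comp hf, site2_eq_loc (by omega)]
    congr 1
    ext j
    fin_cases j <;> rfl
  simp only [h0, h1, ← loc_mul hf, hX]

theorem site2_map {B : Type*} [Ring B] (φ : A →+* B) (k i : ℕ) (X : Mat2 n A) :
    (site2 k i X).map φ = site2 k i (X.map φ) := by
  ext a b
  simp only [site2, Matrix.of_apply, Matrix.map_apply]
  split_ifs <;> simp

theorem site_map {B : Type*} [Ring B] (φ : A →+* B) (k i : ℕ) (X : Mat1 n A) :
    (site k i X).map φ = site k i (X.map φ) := by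
  ext a b
  simp only [site, Matrix.of_apply, Matrix.map_apply]
  split_ifs <;> simp

end Sites


/-! ### The weighted partial trace over the last tensor factor -/

section PartialTrace

variable {n : ℕ} {A : Type*} [Ring A] [Algebra ℂ A]

/-- A multi-index extended by a last entry. -/
def snoc {k : ℕ} (a : Fin k → Fin n) (x : Fin n) : Fin (k + 1) → Fin n := Fin.snoc a x

@[simp] theorem snoc_last {k : ℕ} (a : Fin k → Fin n) (x : Fin n) :
    snoc a x (Fin.last k) = x := by simp [snoc]

@[simp] theorem snoc_castSucc {k : ℕ} (a : Fin k → Fin n) (x : Fin n) (i : Fin k) :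
    snoc a x i.castSucc = a i := by simp [snoc]

theorem snoc_comp_castSucc {k : ℕ} (a : Fin k → Fin n) (x : Fin n) :
    snoc a x ∘ Fin.castSucc = a := by ext i; simp

theorem sum_snoc {M : Type*} [AddCommMonoid M] {k : ℕ} (f : (Fin (k + 1) → Fin n) → M) :
    ∑ c, f c = ∑ a : Fin k → Fin n, ∑ x, f (snoc a x) := by
  rw [← Fintype.sum_prod_type']
  exact (Fintype.sum_equiv
    ((Equiv.prodComm _ _).trans (Fin.snocEquiv (fun _ => Fin n))) _ _ (fun x => rfl)).symm

theorem exists_snoc {k : ℕ} (a : Fin (k + 1) → Fin n) : ∃ b x, a = snoc b x :=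
  ⟨Fin.init a, a (Fin.last k), (Fin.snoc_init_self a).symm⟩

theorem snoc_inj {k : ℕ} {a b : Fin k → Fin n} {x y : Fin n} :
    snoc a x = snoc b y ↔ a = b ∧ x = y := by
  constructor
  · intro h
    refine ⟨?_, by simpa using congrFun h (Fin.last k)⟩
    rw [← snoc_comp_castSucc a x, h, snoc_comp_castSucc]
  · rintro ⟨rfl, rfl⟩; rfl

theorem emb_snoc {k : ℕ} (X : MatT n k A) (a b : Fin k → Fin n) (x y : Fin n) :
    emb k X (snoc a x) (snoc b y) = if x = y then X a b else 0 := by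
  have : (∀ j ∉ Set.range (Fin.castSucc : Fin k → _), snoc a x j = snoc b y j) ↔ x = y := by
    constructor
    · intro h
      simpa using h (Fin.last k) (by simp [Fin.range_castSucc])
    · rintro rfl j hj
      induction j using Fin.lastCases with
      | last => simp
      | cast i => exact absurd ⟨i, rfl⟩ hj
  simp only [emb, locHom_apply, loc, Matrix.of_apply, this, snoc_comp_castSucc]

/-- The trace with the weight `D` over the last tensor factor. -/
def ptr (D : Mat1 n ℂ) (k : ℕ) : MatT n (k + 1) A →ₗ[ℂ] MatT n k A where
  toFun X := Matrix.of fun a b => ∑ c, ∑ d, D c d • X (snoc a d) (snoc b c)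
  map_add' X Y := by
    ext a b; simp [Finset.sum_add_distrib]
  map_smul' z X := by
    ext a b; simp [Finset.smul_sum, smul_comm z]

theorem ptr_apply (D : Mat1 n ℂ) {k : ℕ} (X : MatT n (k + 1) A) (a b) :
    ptr D k X a b = ∑ c, ∑ d, D c d • X (snoc a d) (snoc b c) := rfl

theorem ptr_emb_mul (D : Mat1 n ℂ) {k : ℕ} (X : MatT n k A) (Z : MatT n (k + 1) A) :
    ptr D k (emb k X * Z) = X * ptr D k Z := by
  ext a b
  have h : ∀ d c, (emb k X * Z) (snoc a d) (snoc b c) = ∑ e, X a e * Z (snoc e d) (snoc b c) := by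
    intro d c
    rw [Matrix.mul_apply, sum_snoc]
    simp [emb_snoc]
  simp only [ptr_apply, Matrix.mul_apply, h, Finset.smul_sum, Finset.mul_sum]
  rw [Finset.sum_congr rfl fun c _ => Finset.sum_comm, Finset.sum_comm]
  simp

theorem ptr_mul_emb (D : Mat1 n ℂ) {k : ℕ} (X : MatT n k A) (Z : MatT n (k + 1) A) :
    ptr D k (Z * emb k X) = ptr D k Z * X := by
  ext a b
  have h : ∀ d c, (Z * emb k X) (snoc a d) (snoc b c) = ∑ e, Z (snoc a d) (snoc e c) * X e b := by
    intro d c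
    rw [Matrix.mul_apply, sum_snoc]
    simp [emb_snoc]
  simp only [ptr_apply, Matrix.mul_apply, h, Finset.smul_sum, Finset.sum_mul]
  rw [Finset.sum_congr rfl fun c _ => Finset.sum_comm, Finset.sum_comm]
  simp

theorem wtrT_succ (D : Mat1 n ℂ) (k : ℕ) (X : MatT n (k + 1) A) :
    wtrT (k + 1) D X = wtrT k D (ptr D k X) := by
  simp only [wtrT, sum_snoc, Fin.prod_univ_castSucc, snoc_last, snoc_castSucc, ptr_apply,
    Finset.smul_sum, mul_smul]
  refine Finset.sum_congr rfl fun a _ => ?_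
  rw [Finset.sum_comm]

theorem wtrT_zero (D : Mat1 n ℂ) (X : MatT n 0 A) : wtrT 0 D X = X default default := by
  simp [wtrT]

/-- The block of an operator at fixed indices in all factors but the last one. -/
def blk1 {k : ℕ} (a b : Fin k → Fin n) : MatT n (k + 1) A →ₗ[ℂ] Mat1 n A where
  toFun Z := Matrix.of fun x y => Z (snoc a x) (snoc b y)
  map_add' _ _ := rfl
  map_smul' _ _ := rfl

/-- The block of an operator at fixed indices in all factors but the last two. -/
def blk2 {k : ℕ} (a b : Fin k → Fin n) : MatT n (k + 2) A →ₗ[ℂ] Mat2 n A where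
  toFun Z := Matrix.of fun x y => Z (snoc (snoc a x.1) x.2) (snoc (snoc b y.1) y.2)
  map_add' _ _ := rfl
  map_smul' _ _ := rfl

theorem blk1_apply {k : ℕ} (a b : Fin k → Fin n) (Z : MatT n (k + 1) A) (x y) :
    blk1 a b Z x y = Z (snoc a x) (snoc b y) := rfl

theorem blk2_apply {k : ℕ} (a b : Fin k → Fin n) (Z : MatT n (k + 2) A) (x y x' y') :
    blk2 a b Z (x, y) (x', y') = Z (snoc (snoc a x) y) (snoc (snoc b x') y') := rfl

/-- The trace with the weight `D` over the second of two factors. -/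
def ptr2 (D : Mat1 n ℂ) : Mat2 n A →ₗ[ℂ] Mat1 n A where
  toFun M := Matrix.of fun x y => ∑ c, ∑ d, D c d • M (x, d) (y, c)
  map_add' X Y := by
    ext a b; simp [Finset.sum_add_distrib]
  map_smul' z X := by
    ext a b; simp [Finset.smul_sum, smul_comm z]

theorem ptr2_apply (D : Mat1 n ℂ) (M : Mat2 n A) (x y) :
    ptr2 D M x y = ∑ c, ∑ d, D c d • M (x, d) (y, c) := rfl

theorem blk1_ptr (D : Mat1 n ℂ) {k : ℕ} (a b : Fin k → Fin n) (Z : MatT n (k + 2) A) :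
    blk1 a b (ptr D (k + 1) Z) = ptr2 D (blk2 a b Z) := rfl

theorem ptr_eq_wtr (D : Mat1 n ℂ) {k : ℕ} (a b : Fin k → Fin n) (Z : MatT n (k + 1) A) :
    ptr D k Z a b = wtr D (blk1 a b Z) := rfl

theorem ext_blk1 {k : ℕ} {X Y : MatT n (k + 1) A} (h : ∀ a b, blk1 a b X = blk1 a b Y) :
    X = Y := by
  ext a b
  obtain ⟨a, x, rfl⟩ := exists_snoc a
  obtain ⟨b, y, rfl⟩ := exists_snoc b
  exact congrFun (congrFun (h a b) x) y

theorem blk2_emb {k : ℕ} (a b : Fin k → Fin n) (Y : MatT n (k + 1) A) :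
    blk2 a b (emb (k + 1) Y) = fst (blk1 a b Y) := by
  ext ⟨x, y⟩ ⟨x', y'⟩
  simp [blk2_apply, blk1_apply, emb_snoc, fst, Matrix.kroneckerMap_apply, Matrix.one_apply]

theorem blk1_emb {k : ℕ} (a b : Fin k → Fin n) (Y : MatT n k A) :
    blk1 a b (emb k Y) = sc n (Y a b) := by
  ext x y
  simp [blk1_apply, emb_snoc, sc, Matrix.diagonal_apply]

theorem extend_pair {k : ℕ} (a : Fin k → Fin n) (x y : Fin n) (z : Fin 2 → Fin n) :
    Function.extend (pairMap (k + 2) k (by omega)) z (snoc (snoc a x) y) =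
      snoc (snoc a (z 0)) (z 1) := by
  have hinj := pairMap_injective (k + 2) k (by omega)
  have h0 : pairMap (k + 2) k (by omega) 0 = (Fin.last k).castSucc := rfl
  have h1 : pairMap (k + 2) k (by omega) 1 = Fin.last (k + 1) := rfl
  ext j
  induction j using Fin.lastCases with
  | last => rw [← h1, hinj.extend_apply, h1]; simp
  | cast j =>
    induction j using Fin.lastCases with
    | last => rw [← h0, hinj.extend_apply, h0]; simp
    | cast j =>
      rw [Function.extend_apply']
      · simp
      · rintro ⟨i, hi⟩
        have := j.2
        fin_cases i <;> simp [pairMap, Fin.ext_iff] at hi <;> omega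

theorem sum_pair {M : Type*} [AddCommMonoid M] (f : Fin n → Fin n → M) :
    ∑ z : Fin 2 → Fin n, f (z 0) (z 1) = ∑ p : Fin n × Fin n, f p.1 p.2 :=
  Fintype.sum_equiv (finTwoArrowEquiv (Fin n)) _ _ fun _ => rfl

theorem pair_comp {k : ℕ} (a : Fin k → Fin n) (x y : Fin n) :
    snoc (snoc a x) y ∘ pairMap (k + 2) k (by omega) = ![x, y] := by
  have h0 : pairMap (k + 2) k (by omega) 0 = (Fin.last k).castSucc := rfl
  have h1 : pairMap (k + 2) k (by omega) 1 = Fin.last (k + 1) := rfl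
  ext i
  fin_cases i
  · simp [h0]
  · simp [h1]

theorem blk2_site2_mul {k : ℕ} (a b : Fin k → Fin n) (X : Mat2 n A) (Z : MatT n (k + 2) A) :
    blk2 a b (site2 (k + 2) k X * Z) = X * blk2 a b Z := by
  ext ⟨x, y⟩ ⟨x', y'⟩
  rw [site2_eq_loc (by omega), blk2_apply]
  rw [loc_mul_apply (pairMap_injective _ _ _), Matrix.mul_apply]
  simp only [extend_pair, pair_comp, m2_apply]
  exact sum_pair fun u v => X (x, y) (u, v) * Z (snoc (snoc a u) v) (snoc (snoc b x') y')

theorem blk2_mul_site2 {k : ℕ} (a b : Fin k → Fin n) (X : Mat2 n A) (Z : MatT n (k + 2) A) :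
    blk2 a b (Z * site2 (k + 2) k X) = blk2 a b Z * X := by
  ext ⟨x, y⟩ ⟨x', y'⟩
  rw [site2_eq_loc (by omega), blk2_apply]
  rw [mul_loc_apply (pairMap_injective _ _ _), Matrix.mul_apply]
  simp only [extend_pair, pair_comp, m2_apply]
  exact sum_pair fun u v => Z (snoc (snoc a x) y) (snoc (snoc b u) v) * X (u, v) (x', y')

theorem blk2_one {k : ℕ} (a b : Fin k → Fin n) :
    blk2 a b (1 : MatT n (k + 2) A) = if a = b then 1 else 0 := by
  ext ⟨x, y⟩ ⟨x', y'⟩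
  rw [blk2_apply, Matrix.one_apply]
  by_cases h : a = b <;> simp [h, Matrix.one_apply, snoc_inj]

theorem blk1_one {k : ℕ} (a b : Fin k → Fin n) :
    blk1 a b (1 : MatT n (k + 1) A) = if a = b then 1 else 0 := by
  ext x x'
  rw [blk1_apply, Matrix.one_apply]
  by_cases h : a = b <;> simp [h, Matrix.one_apply, snoc_inj]

theorem ptr2_mul_fst (D : Mat1 n ℂ) (Z : Mat2 n A) (Y : Mat1 n A) :
    ptr2 D (Z * fst Y) = ptr2 D Z * Y := by
  ext a b
  have h : ∀ d c, (Z * fst Y) (a, d) (b, c) = ∑ e, Z (a, d) (e, c) * Y e b := by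
    intro d c
    rw [Matrix.mul_apply, Fintype.sum_prod_type]
    simp [fst, Matrix.kroneckerMap_apply, Matrix.one_apply]
  simp only [ptr2_apply, Matrix.mul_apply, h, Finset.smul_sum, Finset.sum_mul]
  rw [Finset.sum_congr rfl fun c _ => Finset.sum_comm, Finset.sum_comm]
  simp

theorem ptr2_fst_mul (D : Mat1 n ℂ) (Z : Mat2 n A) (Y : Mat1 n A) :
    ptr2 D (fst Y * Z) = Y * ptr2 D Z := by
  ext a b
  have h : ∀ d c, (fst Y * Z) (a, d) (b, c) = ∑ e, Y a e * Z (e, d) (b, c) := by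
    intro d c
    rw [Matrix.mul_apply, Fintype.sum_prod_type]
    simp [fst, Matrix.kroneckerMap_apply, Matrix.one_apply]
  simp only [ptr2_apply, Matrix.mul_apply, h, Finset.smul_sum, Finset.mul_sum]
  rw [Finset.sum_congr rfl fun c _ => Finset.sum_comm, Finset.sum_comm]
  simp

end PartialTrace

/-! ### Skew invertible Hecke R-matrices -/

namespace RData

/-- The conditions on `R` that remain when the antisymmetrizers are not used: an invertible
skew invertible Hecke R-matrix. -/
structure IsHecke {n : ℕ} (𝓡 : RData n) : Prop where
  q_ne_zero : 𝓡.q ≠ 0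
  hecke : 𝓡.R * 𝓡.R = 1 + (𝓡.q - 𝓡.q⁻¹) • 𝓡.R
  braid : site2 3 0 𝓡.R * site2 3 1 𝓡.R * site2 3 0 𝓡.R =
    site2 3 1 𝓡.R * site2 3 0 𝓡.R * site2 3 1 𝓡.R
  skew_left : ∀ a c a' c' : Fin n,
    ∑ b, ∑ b', 𝓡.R (a, b) (a', b') * 𝓡.Ψ (b', c) (b, c') = perm n (a, c) (a', c')
  skew_right : ∀ a c a' c' : Fin n,
    ∑ b, ∑ b', 𝓡.Ψ (a, b) (a', b') * 𝓡.R (b', c) (b, c') = perm n (a, c) (a', c')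

namespace IsHecke

variable {n : ℕ} {𝓡 : RData n} {A : Type*} [Ring A] [Algebra ℂ A]

theorem R_mul_sub (h : 𝓡.IsHecke) : 𝓡.R * (𝓡.R - (𝓡.q - 𝓡.q⁻¹) • (1 : Mat2 n ℂ)) = 1 := by
  rw [mul_sub, h.hecke]; simp

theorem inv_eq (h : 𝓡.IsHecke) : 𝓡.R⁻¹ = 𝓡.R - (𝓡.q - 𝓡.q⁻¹) • (1 : Mat2 n ℂ) :=
  Matrix.inv_eq_right_inv h.R_mul_sub

theorem R_mul_inv (h : 𝓡.IsHecke) : 𝓡.R * 𝓡.R⁻¹ = 1 := by rw [h.inv_eq, h.R_mul_sub]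

theorem inv_mul_R (h : 𝓡.IsHecke) : 𝓡.R⁻¹ * 𝓡.R = 1 := by
  rw [mul_eq_one_comm]; exact h.R_mul_inv

/-- `R` as a homomorphic image. -/
theorem Rm_eq : 𝓡.Rm A = (Algebra.ofId ℂ A).mapMatrix 𝓡.R := rfl

theorem Ri_eq (h : 𝓡.IsHecke) : 𝓡.Ri A = 𝓡.Rm A - (𝓡.q - 𝓡.q⁻¹) • (1 : Mat2 n A) := by
  have : 𝓡.Ri A = (Algebra.ofId ℂ A).mapMatrix 𝓡.R⁻¹ := rfl
  rw [this, h.inv_eq, Rm_eq, map_sub, map_smul, map_one]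

theorem Rm_mul_Ri (h : 𝓡.IsHecke) : 𝓡.Rm A * 𝓡.Ri A = 1 := by
  have := congrArg (Algebra.ofId ℂ A).mapMatrix h.R_mul_inv
  rwa [map_mul, map_one] at this

theorem Ri_mul_Rm (h : 𝓡.IsHecke) : 𝓡.Ri A * 𝓡.Rm A = 1 := by
  have := congrArg (Algebra.ofId ℂ A).mapMatrix h.inv_mul_R
  rwa [map_mul, map_one] at this

theorem Rm_sq (h : 𝓡.IsHecke) : 𝓡.Rm A * 𝓡.Rm A = 1 + (𝓡.q - 𝓡.q⁻¹) • 𝓡.Rm A := by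
  have := congrArg (Algebra.ofId ℂ A).mapMatrix h.hecke
  rwa [map_mul, map_add, map_one, map_smul] at this

/-- The trace of `R` over the second factor is the identity. -/
theorem ptr2_R (h : 𝓡.IsHecke) : ptr2 𝓡.D (𝓡.Rm A) = 1 := by
  ext a b
  have key : ∑ c, ∑ d, 𝓡.D c d * 𝓡.R (a, d) (b, c) = if a = b then 1 else 0 := by
    have : ∀ e, _ := fun e => h.skew_left a e b e
    have h2 : ∑ c, ∑ d, 𝓡.D c d * 𝓡.R (a, d) (b, c) =
        ∑ e, ∑ d, ∑ c, 𝓡.R (a, d) (b, c) * 𝓡.Ψ (c, e) (d, e) := by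
      simp only [RData.D, Matrix.of_apply, Finset.sum_mul]
      rw [Finset.sum_congr rfl fun c _ => Finset.sum_comm, Finset.sum_comm]
      refine Finset.sum_congr rfl fun e _ => ?_
      rw [Finset.sum_comm]
      exact Finset.sum_congr rfl fun _ _ => Finset.sum_congr rfl fun _ _ => mul_comm _ _
    rw [h2, Finset.sum_congr rfl fun e _ => this e]
    simp only [perm, Matrix.of_apply]
    rw [Finset.sum_eq_single a]
    · simp
    · intro e _ he; simp [Ne.symm he]
    · simp
  have : ptr2 𝓡.D (𝓡.Rm A) a b =
      algebraMap ℂ A (∑ c, ∑ d, 𝓡.D c d * 𝓡.R (a, d) (b, c)) := by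
    simp only [ptr2_apply, Rm, Matrix.map_apply, map_sum, map_mul, Algebra.smul_def]
  rw [this, key, Matrix.one_apply]
  split_ifs <;> simp

theorem ptr_site2_R (h : 𝓡.IsHecke) (k : ℕ) :
    ptr 𝓡.D (k + 1) (site2 (k + 2) k (𝓡.Rm A)) = 1 := by
  refine ext_blk1 fun a b => ?_
  rw [blk1_ptr, ← mul_one (site2 _ _ _), blk2_site2_mul, blk2_one, blk1_one]
  split_ifs
  · rw [mul_one, h.ptr2_R]
  · simp

/-- The matrix of entries of `R` in the second factor at fixed indices in the first one. -/
def slice2 (S : Mat2 n ℂ) (u u' : Fin n) : Mat1 n ℂ := Matrix.of fun x y => S (u, x) (u', y)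

/-- Skew invertibility: a linear map is determined by its values on the second components
of `R`. -/
theorem eq_zero_of_slice2 (h : 𝓡.IsHecke) {M : Type*} [AddCommGroup M] [Module ℂ M]
    (f : Mat1 n ℂ →ₗ[ℂ] M) (hf : ∀ u u', f (slice2 𝓡.R u u') = 0) : f = 0 := by
  have key : ∀ a a', Matrix.single a' a (1 : ℂ) =
      ∑ u', ∑ u, 𝓡.Ψ (a, u') (a', u) • slice2 𝓡.R u u' := by
    intro a a'
    ext x x'
    simp only [Matrix.sum_apply, Matrix.smul_apply, slice2, Matrix.of_apply, smul_eq_mul]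
    rw [h.skew_right]
    simp only [perm, Matrix.of_apply, Matrix.single_apply]
    congr 1
    exact propext ⟨fun h => ⟨h.2, h.1.symm⟩, fun h => ⟨h.2.symm, h.1⟩⟩
  refine Matrix.ext_linearMap _ fun a' a => ?_
  ext
  simp [key, hf]

/-- The coefficients of the map `X ↦ tr₂ (S X₁ S')`. -/
theorem ptr2_conj_apply (D : Mat1 n ℂ) (S S' : Mat2 n ℂ) (Y : Mat1 n A) (a a') :
    ptr2 D (S.map (algebraMap ℂ A) * fst Y * S'.map (algebraMap ℂ A)) a a' =
      ∑ x, ∑ x', (∑ c, ∑ d, ∑ v, D c d * (S (a, d) (x, v) * S' (x', v) (a', c))) • Y x x' := by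
  have h1 : ∀ d c, (S.map (algebraMap ℂ A) * fst Y * S'.map (algebraMap ℂ A)) (a, d) (a', c) =
      ∑ x, ∑ x', ∑ v, (S (a, d) (x, v) * S' (x', v) (a', c)) • Y x x' := by
    intro d c
    simp only [Matrix.mul_apply, Fintype.sum_prod_type, fst, Matrix.kroneckerMap_apply,
      Matrix.one_apply, Matrix.map_apply]
    simp only [mul_ite, mul_one, mul_zero, Finset.sum_ite_eq', Finset.mem_univ,
      if_true, Finset.sum_mul]
    rw [Finset.sum_congr rfl fun _ _ => Finset.sum_comm, Finset.sum_comm]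
    refine Finset.sum_congr rfl fun x _ => Finset.sum_congr rfl fun x' _ =>
      Finset.sum_congr rfl fun v _ => ?_
    rw [← Algebra.commutes, ← mul_assoc, ← map_mul, Algebra.smul_def, mul_comm (S' _ _)]
  simp only [ptr2_apply, h1, Finset.smul_sum, Finset.sum_smul, ← mul_smul]
  rw [Finset.sum_congr rfl fun _ _ => Finset.sum_comm, Finset.sum_comm]
  refine Finset.sum_congr rfl fun x _ => ?_
  rw [Finset.sum_congr rfl fun _ _ => Finset.sum_comm, Finset.sum_comm]

/-- The formula `tr₂ (D₂ S Y₁ S') = tr (D Y)` is linear in the entries of `Y`, so that it suffices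
to know it for complex matrices. -/
theorem ptr2_conj_of_scalar {D : Mat1 n ℂ} {S S' : Mat2 n ℂ}
    (hS : ∀ Y : Mat1 n ℂ, ptr2 D (S * fst Y * S') = sc n (wtr D Y)) (Y : Mat1 n A) :
    ptr2 D (S.map (algebraMap ℂ A) * fst Y * S'.map (algebraMap ℂ A)) = sc n (wtr D Y) := by
  ext a a'
  have hc : ∀ x x', ∑ c, ∑ d, ∑ v, D c d * (S (a, d) (x, v) * S' (x', v) (a', c)) =
      if a = a' then D x' x else 0 := by
    intro x x'
    have h1 := congrFun (congrFun (hS (Matrix.single x x' 1)) a) a'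
    have h2 := ptr2_conj_apply (A := ℂ) D S S' (Matrix.single x x' 1) a a'
    simp only [Algebra.algebraMap_self, RingHom.coe_id, Matrix.map_id] at h2
    rw [h2] at h1
    simpa [Matrix.single_apply, sc, Matrix.diagonal_apply, wtr, ite_and] using h1
  simp only [ptr2_conj_apply, hc, sc, Matrix.scalar_apply, Matrix.diagonal_apply, wtr]
  split_ifs
  · rw [Finset.sum_comm]
  · simp

/-- The formula `tr₂ (D₂ S Y₁ S') = tr (D Y)` for operators `S` with the braid relation: since `R` is
skew invertible, the matrices `Y` obtained by fixing the indices of `R` in one factor span all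
matrices, and for these `Y` the formula is the trace of the braid relation over the last factor. -/
theorem ptr2_conj_scalar (h : 𝓡.IsHecke) {S S' : Mat2 n ℂ}
    (hS : site2 3 1 S * site2 3 0 𝓡.R * site2 3 1 S' =
      site2 3 0 S' * site2 3 1 𝓡.R * site2 3 0 S) (hS' : S' * S = 1) (Y : Mat1 n ℂ) :
    ptr2 𝓡.D (S * fst Y * S') = sc n (wtr 𝓡.D Y) := by
  let f : Mat1 n ℂ →ₗ[ℂ] Mat1 n ℂ :=
    { toFun := fun Y => ptr2 𝓡.D (S * fst Y * S') - sc n (wtr 𝓡.D Y)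
      map_add' := fun X Y => by
        have h1 : fst (X + Y) = fst X + fst Y := Matrix.add_kronecker _ _ _
        have h2 : wtr 𝓡.D (X + Y) = wtr 𝓡.D X + wtr 𝓡.D Y := by
          simp [wtr, mul_add, Finset.sum_add_distrib]
        rw [h1, h2, mul_add, add_mul, map_add, sc, map_add]
        simp only [sc]; abel
      map_smul' := fun c X => by
        have h1 : fst (c • X) = c • fst X := Matrix.smul_kronecker _ _ _
        have h2 : wtr 𝓡.D (c • X) = c • wtr 𝓡.D X := by
          simp only [wtr, Matrix.smul_apply, Finset.smul_sum, smul_comm c]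
        have h3 : ∀ x : ℂ, sc n (c • x) = c • sc n x := fun x => by
          ext; simp [sc, Matrix.diagonal_apply]
        rw [h1, h2, mul_smul_comm, smul_mul_assoc, map_smul, h3, smul_sub]; rfl }
  suffices f = 0 from sub_eq_zero.1 (LinearMap.congr_fun this Y)
  refine h.eq_zero_of_slice2 f fun u u' => ?_
  have hR : 𝓡.Rm ℂ = 𝓡.R := by ext; simp [Rm]
  have hb : blk1 (fun _ : Fin 1 => u) (fun _ => u') (site2 2 0 𝓡.R) = slice2 𝓡.R u u' := by
    ext x x'
    have e1 : ∀ v y : Fin n, snoc (fun _ : Fin 1 => v) y = ![v, y] := fun v y => by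
      ext i; fin_cases i <;> rfl
    rw [blk1_apply, e1, e1, site2_eq_loc (by omega)]
    rw [show pairMap 2 0 (by omega) = id from funext fun i => by fin_cases i <;> rfl]
    simp [loc, m2_apply, slice2]
  have h1 := congrArg (fun Z => blk1 (fun _ : Fin 1 => u) (fun _ => u') (ptr 𝓡.D 2 Z)) hS
  simp only [blk1_ptr] at h1
  rw [blk2_mul_site2, blk2_site2_mul, ← emb_site2 (show 0 + 1 < 2 by omega), blk2_emb, hb,
    ← blk1_ptr, ← emb_site2 (show 0 + 1 < 2 by omega), ← emb_site2 (show 0 + 1 < 2 by omega),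
    ptr_mul_emb, ptr_emb_mul, ← hR, h.ptr_site2_R, mul_one, hR,
    site2_eq_hom (show 0 + 1 < 2 by omega), site2_eq_hom (show 0 + 1 < 2 by omega), ← map_mul,
    hS', map_one, blk1_one] at h1
  have h2 : wtr 𝓡.D (slice2 𝓡.R u u') = if u = u' then 1 else 0 := by
    have := congrFun (congrFun (h.ptr2_R (A := ℂ)) u) u'
    rw [hR, Matrix.one_apply] at this
    exact this
  change ptr2 𝓡.D (S * fst (slice2 𝓡.R u u') * S') - _ = 0
  have h3 : ((fun _ : Fin 1 => u) = fun _ => u') ↔ u = u' :=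
    ⟨fun h => congrFun h 0, fun h => by rw [h]⟩
  rw [h1, h2, sub_eq_zero]
  simp only [h3]
  split_ifs <;> simp [sc]

/-- `tr₂ (R X₁ R⁻¹)` is the trace of `X`. -/
theorem ptr2_R_conj (h : 𝓡.IsHecke) (Y : Mat1 n A) :
    ptr2 𝓡.D (𝓡.Rm A * fst Y * 𝓡.Ri A) = sc n (wtr 𝓡.D Y) := by
  refine ptr2_conj_of_scalar (h.ptr2_conj_scalar ?_ h.inv_mul_R) Y
  have e0 := site2_eq_hom (n := n) (A := ℂ) (show 0 + 1 < 3 by omega)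
  have e1 := site2_eq_hom (n := n) (A := ℂ) (show 1 + 1 < 3 by omega)
  have hb := h.braid
  rw [e0, e1] at *
  rw [e0]
  have u0 : site2Hom 3 0 (by omega) 𝓡.R⁻¹ * site2Hom 3 0 (by omega) 𝓡.R = 1 := by
    rw [← map_mul, h.inv_mul_R, map_one]
  have u1 : site2Hom 3 1 (by omega) 𝓡.R * site2Hom 3 1 (by omega) 𝓡.R⁻¹ = 1 := by
    rw [← map_mul, h.R_mul_inv, map_one]
  calc _ = (site2Hom 3 0 (by omega) 𝓡.R⁻¹ * site2Hom 3 0 (by omega) 𝓡.R) * _ := by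
        rw [u0, one_mul]
    _ = site2Hom 3 0 (by omega) 𝓡.R⁻¹ * (site2Hom 3 0 (by omega) 𝓡.R *
        site2Hom 3 1 (by omega) 𝓡.R * site2Hom 3 0 (by omega) 𝓡.R) *
          site2Hom 3 1 (by omega) 𝓡.R⁻¹ := by simp only [mul_assoc, e1]
    _ = _ := by rw [hb, mul_assoc, mul_assoc, mul_assoc, u1, mul_one, ← mul_assoc]

/-- `tr₂ (R⁻¹ X₁ R)` is the trace of `X`. -/
theorem ptr2_Ri_conj (h : 𝓡.IsHecke) (Y : Mat1 n A) :
    ptr2 𝓡.D (𝓡.Ri A * fst Y * 𝓡.Rm A) = sc n (wtr 𝓡.D Y) := by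
  refine ptr2_conj_of_scalar (h.ptr2_conj_scalar ?_ h.R_mul_inv) Y
  have e0 := site2_eq_hom (n := n) (A := ℂ) (show 0 + 1 < 3 by omega)
  have e1 := site2_eq_hom (n := n) (A := ℂ) (show 1 + 1 < 3 by omega)
  have hb := h.braid
  rw [e0, e1] at *
  rw [e0, e1]
  have u0 : site2Hom 3 0 (by omega) 𝓡.R * site2Hom 3 0 (by omega) 𝓡.R⁻¹ = 1 := by
    rw [← map_mul, h.R_mul_inv, map_one]
  have u1 : site2Hom 3 1 (by omega) 𝓡.R⁻¹ * site2Hom 3 1 (by omega) 𝓡.R = 1 := by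
    rw [← map_mul, h.inv_mul_R, map_one]
  calc _ = site2Hom 3 1 (by omega) 𝓡.R⁻¹ * (site2Hom 3 0 (by omega) 𝓡.R *
        site2Hom 3 1 (by omega) 𝓡.R * site2Hom 3 0 (by omega) 𝓡.R) *
          site2Hom 3 0 (by omega) 𝓡.R⁻¹ := by simp only [mul_assoc, u0, mul_one]
    _ = _ := by rw [hb]; simp only [← mul_assoc, u1, one_mul]

theorem ptr2_R_fst_R (h : 𝓡.IsHecke) (Y : Mat1 n A) :
    ptr2 𝓡.D (𝓡.Rm A * fst Y * 𝓡.Rm A) = sc n (wtr 𝓡.D Y) + (𝓡.q - 𝓡.q⁻¹) • Y := by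
  have : 𝓡.Rm A = 𝓡.Ri A + (𝓡.q - 𝓡.q⁻¹) • (1 : Mat2 n A) := by rw [h.Ri_eq]; abel
  conv_lhs => rw [this, mul_add, ← this, map_add, h.ptr2_R_conj, mul_smul_comm, mul_one, map_smul,
    ptr2_mul_fst, h.ptr2_R, one_mul]

theorem wtr_sc_mul (D : Mat1 n ℂ) (x : A) (Y : Mat1 n A) :
    wtr D (sc n x * Y) = x * wtr D Y := by
  simp [wtr, sc, Matrix.scalar_apply, Matrix.diagonal_mul, Finset.mul_sum]

theorem wtr_mul_sc (D : Mat1 n ℂ) (x : A) (Y : Mat1 n A) :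
    wtr D (Y * sc n x) = wtr D Y * x := by
  simp [wtr, sc, Matrix.scalar_apply, Matrix.mul_diagonal, Finset.sum_mul]

theorem wtr_add (D : Mat1 n ℂ) (X Y : Mat1 n A) : wtr D (X + Y) = wtr D X + wtr D Y := by
  simp [wtr, Finset.sum_add_distrib]

theorem wtr_smul (D : Mat1 n ℂ) (c : ℂ) (X : Mat1 n A) : wtr D (c • X) = c • wtr D X := by
  simp only [wtr, Matrix.smul_apply, Finset.smul_sum, smul_comm c]

theorem wtr_ptr2 (D : Mat1 n ℂ) (M : Mat2 n A) :
    wtr D (ptr2 D M) = ∑ i, ∑ j, (D ⊗ₖ D) i j • M j i := by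
  simp only [wtr, ptr2_apply, Fintype.sum_prod_type, Matrix.kroneckerMap_apply, Finset.smul_sum,
    mul_smul]
  refine Finset.sum_congr rfl fun a _ => ?_
  rw [Finset.sum_comm]

/-- The weight `D ⊗ D` commutes with `R`. -/
theorem DD_commute (h : 𝓡.IsHecke) : (𝓡.D ⊗ₖ 𝓡.D) * 𝓡.R = 𝓡.R * (𝓡.D ⊗ₖ 𝓡.D) := by
  have hR : 𝓡.Rm ℂ = 𝓡.R := by ext; simp [Rm]
  let τ : Mat2 n ℂ → ℂ := fun Z => wtr 𝓡.D (ptr2 𝓡.D Z)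
  let f : Mat2 n ℂ →ₗ[ℂ] ℂ :=
    { toFun := fun Z => τ (𝓡.R * Z) - τ (Z * 𝓡.R)
      map_add' := fun X Y => by
        simp only [τ, mul_add, add_mul, map_add, wtr_add]; ring
      map_smul' := fun c X => by
        simp only [τ, mul_smul_comm, smul_mul_assoc, map_smul, wtr_smul, smul_eq_mul,
          RingHom.id_apply]; ring }
  have hf : ∀ X Y : Mat1 n ℂ, f (fst X * 𝓡.R * fst Y) = 0 := by
    intro X Y
    have h1 : τ (𝓡.R * (fst X * 𝓡.R * fst Y)) =
        wtr 𝓡.D ((sc n (wtr 𝓡.D X) + (𝓡.q - 𝓡.q⁻¹) • X) * Y) := by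
      rw [← h.ptr2_R_fst_R, hR, ← ptr2_mul_fst]; simp only [mul_assoc, τ]
    have h2 : τ (fst X * 𝓡.R * fst Y * 𝓡.R) =
        wtr 𝓡.D (X * (sc n (wtr 𝓡.D Y) + (𝓡.q - 𝓡.q⁻¹) • Y)) := by
      rw [← h.ptr2_R_fst_R, hR, ← ptr2_fst_mul]; simp only [mul_assoc, τ]
    change τ _ - τ _ = 0
    rw [h1, h2, add_mul, mul_add, wtr_add, wtr_add, wtr_sc_mul, wtr_mul_sc, mul_smul_comm,
      smul_mul_assoc, sub_self]
  have key : ∀ a α a' α' : Fin n, Matrix.single (a, α') (a', α) (1 : ℂ) =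
      ∑ y, ∑ x, 𝓡.Ψ (α, y) (α', x) •
        (fst (Matrix.single a x 1) * 𝓡.R * fst (Matrix.single y a' 1)) := by
    intro a α a' α'
    have e : ∀ x y, fst (Matrix.single a x (1 : ℂ)) * 𝓡.R * fst (Matrix.single y a' 1) =
        Matrix.of fun i j => if a = i.1 ∧ a' = j.1 then 𝓡.R (x, i.2) (y, j.2) else 0 := by
      intro x y
      ext ⟨i, i'⟩ ⟨j, j'⟩
      simp only [Matrix.mul_apply, Fintype.sum_prod_type, fst, Matrix.kroneckerMap_apply,
        Matrix.one_apply, Matrix.single_apply, Matrix.of_apply]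
      simp [ite_and]
      grind
    ext ⟨i, i'⟩ ⟨j, j'⟩
    simp only [Matrix.sum_apply, Matrix.smul_apply, e, Matrix.of_apply, smul_eq_mul, mul_ite,
      mul_zero]
    by_cases hij : a = i ∧ a' = j
    · simp only [hij, and_self, if_true]
      rw [h.skew_right]
      simp only [perm, Matrix.of_apply, Matrix.single_apply, Prod.mk.injEq, true_and]
      congr 1
      exact propext ⟨fun h => ⟨h.2, h.1.symm⟩, fun h => ⟨h.2.symm, h.1⟩⟩
    · simp only [hij, if_false, Finset.sum_const_zero, Matrix.single_apply, Prod.mk.injEq]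
      rw [if_neg]
      tauto
  have hf0 : ∀ i j, f (Matrix.single i j 1) = 0 := by
    rintro ⟨a, α'⟩ ⟨a', α⟩
    rw [key, map_sum]
    simp [hf]
  ext i j
  have := hf0 j i
  change τ _ - τ _ = 0 at this
  have h1 : ∀ Z : Mat2 n ℂ, τ Z = Matrix.trace ((𝓡.D ⊗ₖ 𝓡.D) * Z) := fun Z => by
    simp only [τ, wtr_ptr2, Matrix.trace, Matrix.diag_apply, Matrix.mul_apply, smul_eq_mul]
  rw [h1, h1, ← Matrix.mul_assoc, Matrix.trace_mul_single, Matrix.trace_mul_comm, Matrix.mul_assoc,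
    Matrix.trace_single_mul, sub_eq_zero] at this
  simpa using this

/-- The trace over both factors with the weight `D ⊗ D` is cyclic for `R`, because `R` commutes with
`D ⊗ D`. -/
theorem wtr_ptr2_comm (h : 𝓡.IsHecke) (M : Mat2 n A) :
    wtr 𝓡.D (ptr2 𝓡.D (𝓡.Rm A * M)) = wtr 𝓡.D (ptr2 𝓡.D (M * 𝓡.Rm A)) := by
  simp only [wtr_ptr2]
  have h1 : ∀ i, ∑ j, (𝓡.D ⊗ₖ 𝓡.D) i j • (𝓡.Rm A * M) j i =
      ∑ l, ((𝓡.D ⊗ₖ 𝓡.D) * 𝓡.R) i l • M l i := by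
    intro i
    simp only [Matrix.mul_apply, Finset.smul_sum, Finset.sum_smul, Rm, Matrix.map_apply,
      ← Algebra.smul_def, mul_smul]
    rw [Finset.sum_comm]
  have h2 : ∀ j, ∑ i, (𝓡.D ⊗ₖ 𝓡.D) i j • (M * 𝓡.Rm A) j i =
      ∑ l, (𝓡.R * (𝓡.D ⊗ₖ 𝓡.D)) l j • M j l := by
    intro j
    simp only [Matrix.mul_apply, Finset.smul_sum, Finset.sum_smul, Rm, Matrix.map_apply,
      ← Algebra.commutes, ← Algebra.smul_def]
    rw [Finset.sum_comm]
    simp only [mul_smul, smul_comm (𝓡.R _ _)]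
  simp only [h1]
  conv_rhs => rw [Finset.sum_comm]
  simp only [h2, h.DD_commute]
  rw [Finset.sum_comm]

theorem ptr_ptr_comm (h : 𝓡.IsHecke) {k : ℕ} (Z : MatT n (k + 2) A) :
    ptr 𝓡.D k (ptr 𝓡.D (k + 1) (site2 (k + 2) k (𝓡.Rm A) * Z)) =
      ptr 𝓡.D k (ptr 𝓡.D (k + 1) (Z * site2 (k + 2) k (𝓡.Rm A))) := by
  ext a b
  rw [ptr_eq_wtr, ptr_eq_wtr, blk1_ptr, blk1_ptr, blk2_site2_mul, blk2_mul_site2, h.wtr_ptr2_comm]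

theorem ptr_R_conj (h : 𝓡.IsHecke) {k : ℕ} (Y : MatT n (k + 1) A) :
    ptr 𝓡.D (k + 1) (site2 (k + 2) k (𝓡.Rm A) * emb (k + 1) Y * site2 (k + 2) k (𝓡.Ri A)) =
      emb k (ptr 𝓡.D k Y) := by
  refine ext_blk1 fun a b => ?_
  rw [blk1_ptr, blk2_mul_site2, blk2_site2_mul, blk2_emb, h.ptr2_R_conj, blk1_emb, ptr_eq_wtr]

theorem ptr_Ri_conj (h : 𝓡.IsHecke) {k : ℕ} (Y : MatT n (k + 1) A) :
    ptr 𝓡.D (k + 1) (site2 (k + 2) k (𝓡.Ri A) * emb (k + 1) Y * site2 (k + 2) k (𝓡.Rm A)) =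
      emb k (ptr 𝓡.D k Y) := by
  refine ext_blk1 fun a b => ?_
  rw [blk1_ptr, blk2_mul_site2, blk2_site2_mul, blk2_emb, h.ptr2_Ri_conj, blk1_emb, ptr_eq_wtr]

theorem ptr_R_emb_R (h : 𝓡.IsHecke) {k : ℕ} (Y : MatT n (k + 1) A) :
    ptr 𝓡.D (k + 1) (site2 (k + 2) k (𝓡.Rm A) * emb (k + 1) Y * site2 (k + 2) k (𝓡.Rm A)) =
      emb k (ptr 𝓡.D k Y) + (𝓡.q - 𝓡.q⁻¹) • Y := by
  refine ext_blk1 fun a b => ?_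
  rw [blk1_ptr, blk2_mul_site2, blk2_site2_mul, blk2_emb, h.ptr2_R_fst_R, map_add, map_smul,
    blk1_emb, ptr_eq_wtr]

theorem ptr_R_emb (h : 𝓡.IsHecke) {k : ℕ} (Y : MatT n (k + 1) A) :
    ptr 𝓡.D (k + 1) (site2 (k + 2) k (𝓡.Rm A) * emb (k + 1) Y) = Y := by
  rw [ptr_mul_emb, h.ptr_site2_R, one_mul]

end IsHecke
end RData


/-! ### q-numbers -/

theorem qnum_zero (q : ℂ) : qnum q 0 = 0 := by simp [qnum]

theorem qnum_one (q : ℂ) : qnum q 1 = 1 := by simp [qnum]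

theorem qnum_succ {q : ℂ} (hq : q ≠ 0) (i : ℕ) : qnum q (i + 1) = q ^ i + q⁻¹ * qnum q i := by
  rw [qnum, Finset.sum_range_succ', qnum, Finset.mul_sum, add_comm]
  congr 1
  · simp
  · refine Finset.sum_congr rfl fun k _ => ?_
    rw [← zpow_neg_one, ← zpow_add₀ hq]
    congr 1
    push_cast; ring

theorem qnum_succ' {q : ℂ} (hq : q ≠ 0) (i : ℕ) : qnum q (i + 1) = q⁻¹ ^ i + q * qnum q i := by
  rw [qnum, Finset.sum_range_succ, qnum, Finset.mul_sum, add_comm]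
  congr 1
  · rw [inv_pow, ← zpow_natCast, ← zpow_neg]
    congr 1
    push_cast; ring
  · refine Finset.sum_congr rfl fun k _ => ?_
    nth_rewrite 2 [← zpow_one q]
    rw [← zpow_add₀ hq]
    congr 1
    push_cast; ring

theorem qnum_mul {q : ℂ} (hq : q ≠ 0) (i : ℕ) : (q - q⁻¹) * qnum q i = q ^ i - q⁻¹ ^ i := by
  induction i with
  | zero => simp [qnum_zero]
  | succ i ih =>
    rw [qnum_succ hq, mul_add, mul_left_comm, ih]
    ring

theorem qnum_eq_sum {q : ℂ} (hq : q ≠ 0) (i : ℕ) :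
    ∑ m ∈ Finset.range (i + 1), (q⁻¹ ^ m * q⁻¹ ^ m) = q⁻¹ ^ i * qnum q (i + 1) := by
  induction i with
  | zero => simp [qnum_one]
  | succ i ih =>
    rw [Finset.sum_range_succ, ih, qnum_succ' hq (i + 1), pow_succ]
    field_simp
    ring

/-! ### Hecke systems: the antisymmetrizers and the copies of a matrix -/

/-- Elements `g 0, ..., g (N - 1)` satisfying the relations of the Hecke algebra, and their
inverses `gi`. -/
structure HeckeSys {E : Type*} [Ring E] [Algebra ℂ E] (q : ℂ) (N : ℕ) (g gi : ℕ → E) : Prop where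
  q_ne_zero : q ≠ 0
  sq : ∀ j < N, g j * g j = 1 + (q - q⁻¹) • g j
  inv : ∀ j < N, gi j = g j - (q - q⁻¹) • (1 : E)
  braid : ∀ j, j + 1 < N → g j * g (j + 1) * g j = g (j + 1) * g j * g (j + 1)
  far : ∀ i j, i + 2 ≤ j → j < N → Commute (g i) (g j)

section Hecke

variable {E F : Type*} [Ring E] [Algebra ℂ E] [Ring F] [Algebra ℂ F]

/-- The q-antisymmetrizer built from the elements `g 0, ..., g (i - 2)`. -/
def asym (q : ℂ) (g : ℕ → E) : ℕ → E
  | 0 => 1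
  | 1 => 1
  | i + 2 => (qnum q (i + 1) / qnum q (i + 2)) •
      (asym q g (i + 1) * ((q ^ (i + 1) / qnum q (i + 1)) • (1 : E) - g i) * asym q g (i + 1))

/-- The copy number `m` of `L`, transported by the elements `g`. -/
def copy (g gi : ℕ → E) (L : E) : ℕ → E
  | 0 => L
  | m + 1 => g m * copy g gi L m * gi m

/-- The product of the first `i` copies. -/
def copyProd (g gi : ℕ → E) (L : E) (i : ℕ) : E := ((List.range i).map (copy g gi L)).prod

/-- `g 0 * ... * g (i - 1)` -/
def up (g : ℕ → E) : ℕ → E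
  | 0 => 1
  | i + 1 => up g i * g i

/-- `g (i - 1) * ... * g 0` -/
def down (g : ℕ → E) : ℕ → E
  | 0 => 1
  | i + 1 => g i * down g i

theorem copyProd_zero (g gi : ℕ → E) (L : E) : copyProd g gi L 0 = 1 := by simp [copyProd]

theorem copyProd_succ (g gi : ℕ → E) (L : E) (i : ℕ) :
    copyProd g gi L (i + 1) = copyProd g gi L i * copy g gi L i := by
  simp [copyProd, List.range_succ]

theorem copy_shift (g gi : ℕ → E) (L : E) (m : ℕ) :
    copy g gi L (m + 1) = copy (fun j => g (j + 1)) (fun j => gi (j + 1)) (g 0 * L * gi 0) m := by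
  induction m with
  | zero => rfl
  | succ m ih => rw [copy, ih]; rfl

theorem copyProd_succ' (g gi : ℕ → E) (L : E) (i : ℕ) :
    copyProd g gi L (i + 1) =
      L * copyProd (fun j => g (j + 1)) (fun j => gi (j + 1)) (g 0 * L * gi 0) i := by
  simp only [copyProd, List.range_succ_eq_map, List.map_cons, List.map_map, List.prod_cons]
  congr 2
  refine List.map_congr_left fun m _ => copy_shift g gi L m

theorem copy_eq (g gi : ℕ → E) (L : E) (m : ℕ) :
    copy g gi L m = down g m * L * up gi m := by
  induction m with
  | zero => simp [copy, up, down]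
  | succ m ih => rw [copy, ih, down, up]; simp only [mul_assoc]

theorem down_succ' (g : ℕ → E) (i : ℕ) : down g (i + 1) = down (fun j => g (j + 1)) i * g 0 := by
  induction i with
  | zero => simp [down]
  | succ i ih => rw [down, ih, down, mul_assoc]

theorem up_succ' (g : ℕ → E) (i : ℕ) : up g (i + 1) = g 0 * up (fun j => g (j + 1)) i := by
  induction i with
  | zero => simp [up]
  | succ i ih => rw [up, ih, up, mul_assoc]

theorem commute_asym {q : ℂ} {g : ℕ → E} {X : E} {i : ℕ}
    (h : ∀ j, j + 1 < i → Commute X (g j)) : Commute X (asym q g i) := by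
  induction i using Nat.twoStepInduction with
  | zero => exact Commute.one_right _
  | one => exact Commute.one_right _
  | more i _ ih =>
    have := ih fun j hj => h j (by omega)
    exact ((this.mul_right (((Commute.one_right X).smul_right _).sub_right
      (h i (by omega)))).mul_right this).smul_right _

theorem commute_up {g : ℕ → E} {X : E} {i : ℕ} (h : ∀ j, j < i → Commute X (g j)) :
    Commute X (up g i) := by
  induction i with
  | zero => exact Commute.one_right _
  | succ i ih => exact (ih fun j hj => h j (by omega)).mul_right (h i (by omega))

theorem commute_down {g : ℕ → E} {X : E} {i : ℕ} (h : ∀ j, j < i → Commute X (g j)) :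
    Commute X (down g i) := by
  induction i with
  | zero => exact Commute.one_right _
  | succ i ih => exact (h i (by omega)).mul_right (ih fun j hj => h j (by omega))

theorem map_asym (f : E →ₐ[ℂ] F) (q : ℂ) {g : ℕ → E} {g' : ℕ → F} {i : ℕ}
    (h : ∀ j, j + 1 < i → f (g j) = g' j) : f (asym q g i) = asym q g' i := by
  induction i using Nat.twoStepInduction with
  | zero => simp [asym]
  | one => simp [asym]
  | more i _ ih =>
    have := ih fun j hj => h j (by omega)
    simp [asym, this, h i (by omega)]

theorem asym_congr (q : ℂ) {g g' : ℕ → E} {i : ℕ} (h : ∀ j, j + 1 < i → g j = g' j) :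
    asym q g i = asym q g' i := map_asym (AlgHom.id ℂ E) q h

theorem map_copy (f : E →ₐ[ℂ] F) {g gi : ℕ → E} {g' gi' : ℕ → F} {L : E} {m : ℕ}
    (h : ∀ j < m, f (g j) = g' j) (hi : ∀ j < m, f (gi j) = gi' j) :
    f (copy g gi L m) = copy g' gi' (f L) m := by
  induction m with
  | zero => rfl
  | succ m ih =>
    rw [copy, map_mul, map_mul, h m (by omega), hi m (by omega),
      ih (fun j hj => h j (by omega)) (fun j hj => hi j (by omega)), copy]

theorem map_copyProd (f : E →ₐ[ℂ] F) {g gi : ℕ → E} {g' gi' : ℕ → F} {L : E} {i : ℕ}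
    (h : ∀ j, j + 1 < i → f (g j) = g' j) (hi : ∀ j, j + 1 < i → f (gi j) = gi' j) :
    f (copyProd g gi L i) = copyProd g' gi' (f L) i := by
  rw [copyProd, map_list_prod, List.map_map, copyProd]
  congr 1
  refine List.map_congr_left fun m hm => ?_
  rw [List.mem_range] at hm
  exact map_copy f (fun j hj => h j (by omega)) (fun j hj => hi j (by omega))

theorem map_up (f : E →ₐ[ℂ] F) {g : ℕ → E} {g' : ℕ → F} {i : ℕ}
    (h : ∀ j < i, f (g j) = g' j) : f (up g i) = up g' i := by
  induction i with
  | zero => simp [up]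
  | succ i ih => rw [up, map_mul, ih fun j hj => h j (by omega), h i (by omega), up]

theorem map_down (f : E →ₐ[ℂ] F) {g : ℕ → E} {g' : ℕ → F} {i : ℕ}
    (h : ∀ j < i, f (g j) = g' j) : f (down g i) = down g' i := by
  induction i with
  | zero => simp [down]
  | succ i ih => rw [down, map_mul, ih fun j hj => h j (by omega), h i (by omega), down]

/-- Conjugation with an invertible element. -/
def conjHom (W W' : E) (h : W * W' = 1) (h' : W' * W = 1) : E →ₐ[ℂ] E :=
  AlgHom.ofLinearMap
    { toFun := fun X => W * X * W'
      map_add' := fun X Y => by simp [mul_add, add_mul]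
      map_smul' := fun c X => by simp }
    (by simp [h])
    (fun X Y => by
      change W * (X * Y) * W' = W * X * W' * (W * Y * W')
      simp only [mul_assoc]
      rw [← mul_assoc W' W, h', one_mul])

theorem conjHom_apply {W W' : E} (h : W * W' = 1) (h' : W' * W = 1) (X : E) :
    conjHom W W' h h' X = W * X * W' := rfl

/-- If `X` is not changed by left multiplication with `-q g j`, then it is not changed by the
antisymmetrizer. -/
theorem asym_mul_of_absorb {q : ℂ} (hq : q ≠ 0) {g : ℕ → E} {Y : E} {i : ℕ}
    (hn : ∀ j, 1 ≤ j → j ≤ i → qnum q j ≠ 0)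
    (h : ∀ j, j + 1 < i → g j * Y = (-q⁻¹) • Y) : asym q g i * Y = Y := by
  induction i using Nat.twoStepInduction with
  | zero => simp [asym]
  | one => simp [asym]
  | more i _ ih =>
    have ih' := ih (fun j h1 h2 => hn j h1 (by omega)) fun j hj => h j (by omega)
    have h1 := hn (i + 1) (by omega) (by omega)
    have h2 := hn (i + 2) (by omega) (by omega)
    rw [asym, smul_mul_assoc, mul_assoc, ih', mul_assoc, sub_mul, h i (by omega), smul_mul_assoc,
      one_mul, ← sub_smul, mul_smul_comm, ih', smul_smul]
    rw [show qnum q (i + 1) / qnum q (i + 2) * (q ^ (i + 1) / qnum q (i + 1) - -q⁻¹) = 1 by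
      have := qnum_succ hq (i + 1)
      field_simp
      rw [this]; field_simp; ring, one_smul]

theorem asym_op (q : ℂ) (g : ℕ → E) (i : ℕ) :
    asym q (fun j => MulOpposite.op (g j)) i = MulOpposite.op (asym q g i) := by
  induction i using Nat.twoStepInduction with
  | zero => rfl
  | one => rfl
  | more i _ ih => rw [asym, asym, ih]; simp [mul_assoc]

theorem mul_asym_of_absorb {q : ℂ} (hq : q ≠ 0) {g : ℕ → E} {Y : E} {i : ℕ}
    (hn : ∀ j, 1 ≤ j → j ≤ i → qnum q j ≠ 0)
    (h : ∀ j, j + 1 < i → Y * g j = (-q⁻¹) • Y) : Y * asym q g i = Y := by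
  have := asym_mul_of_absorb hq (g := fun j => MulOpposite.op (g j)) (Y := MulOpposite.op Y) hn
    fun j hj => by rw [← MulOpposite.op_mul, h j hj, MulOpposite.op_smul]
  rw [asym_op, ← MulOpposite.op_mul] at this
  exact MulOpposite.op_injective this

/-- The computation behind the absorption property of the next antisymmetrizer. -/
theorem absorb_step {q : ℂ} (hq : q ≠ 0) {a r s A : E} {x x' c : ℂ}
    (hA : A = c • (a * (x' • (1 : E) - r) * a)) (ha : a * a = a) (hAA : A * A = A)
    (rA : r * A = (-q⁻¹) • A) (sa : Commute s a) (br : r * s * r = s * r * s)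
    (sq : s * s = 1 + (q - q⁻¹) • s) (hx : x = c * x' * q) :
    s * (A * (x • (1 : E) - s) * A) = (-q⁻¹) • (A * (x • (1 : E) - s) * A) := by
  have aA : a * A = A := by rw [hA, mul_smul_comm, ← mul_assoc, ← mul_assoc, ha]
  have br' : s * r * s * A = (-q⁻¹) • (r * s * A) := by rw [← br, mul_assoc, rA, mul_smul_comm]
  have AsA : A * s * A = c • (a * (x' • (s * A) - r * s * A)) := by
    have e1 : a * (x' • (1 : E) - r) * a * s * A = a * (x' • (1 : E) - r) * s * (a * A) := by
      simp only [mul_assoc]; rw [← mul_assoc a s, ← sa.eq, mul_assoc]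
    have e2 : A * s * A = c • (a * (x' • (1 : E) - r) * a * s * A) := by
      nth_rewrite 1 [hA]
      rw [smul_mul_assoc, smul_mul_assoc]
    rw [e2, e1, aA]
    simp only [mul_sub, sub_mul, smul_mul_assoc, mul_smul_comm, mul_one, mul_assoc]
  have e1 : A * (x • (1 : E) - s) * A =
      a * (x • A - (c * x') • (s * A) + c • (r * s * A)) := by
    rw [mul_sub, sub_mul, AsA, mul_smul_comm, mul_one, smul_mul_assoc, hAA]
    simp only [mul_sub, mul_add, mul_smul_comm, aA, smul_sub, smul_smul]
    abel
  have ssA : s * (s * A) = A + (q - q⁻¹) • (s * A) := by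
    rw [← mul_assoc, sq, add_mul, one_mul, smul_mul_assoc]
  have e2 : s * (x • A - (c * x') • (s * A) + c • (r * s * A)) =
      (-q⁻¹) • (x • A - (c * x') • (s * A) + c • (r * s * A)) := by
    have e3 : s * (r * s * A) = (-q⁻¹) • (r * s * A) := by rw [← br']; simp only [mul_assoc]
    simp only [mul_add, mul_sub, mul_smul_comm, ssA, e3]
    have : q * q⁻¹ = 1 := mul_inv_cancel₀ hq
    rw [hx]
    match_scalars <;> first | ring1 | linear_combination (c * x') * this
  rw [e1, ← mul_assoc, sa.eq, mul_assoc, e2, mul_smul_comm]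

theorem up_mul_down {g gi : ℕ → E} {i : ℕ} (h : ∀ j < i, g j * gi j = 1) :
    up g i * down gi i = 1 := by
  induction i with
  | zero => simp [up, down]
  | succ i ih =>
    rw [up, down, mul_assoc, ← mul_assoc (g i), h i (by omega), one_mul,
      ih fun j hj => h j (by omega)]

theorem down_mul_up {g gi : ℕ → E} {i : ℕ} (h : ∀ j < i, g j * gi j = 1) :
    down g i * up gi i = 1 := by
  induction i generalizing g gi with
  | zero => simp [up, down]
  | succ i ih =>
    rw [up_succ', down_succ', mul_assoc, ← mul_assoc (g 0), h 0 (by omega), one_mul]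
    exact ih fun j hj => h (j + 1) (by omega)

namespace HeckeSys

variable {q : ℂ} {N : ℕ} {g gi : ℕ → E}

theorem mul_inv (h : HeckeSys q N g gi) {j : ℕ} (hj : j < N) : g j * gi j = 1 := by
  rw [h.inv j hj, mul_sub, h.sq j hj]; simp

theorem inv_mul (h : HeckeSys q N g gi) {j : ℕ} (hj : j < N) : gi j * g j = 1 := by
  rw [h.inv j hj, sub_mul, h.sq j hj]; simp

theorem commute_inv (h : HeckeSys q N g gi) {j : ℕ} (hj : j < N) {X : E} (hX : Commute X (g j)) :
    Commute X (gi j) := by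
  rw [h.inv j hj]
  exact hX.sub_right ((Commute.one_right X).smul_right _)

theorem mono (h : HeckeSys q N g gi) {N' : ℕ} (hN : N' ≤ N) : HeckeSys q N' g gi where
  q_ne_zero := h.q_ne_zero
  sq j hj := h.sq j (by omega)
  inv j hj := h.inv j (by omega)
  braid j hj := h.braid j (by omega)
  far i j hi hj := h.far i j hi (by omega)

theorem shift (h : HeckeSys q (N + 1) g gi) :
    HeckeSys q N (fun j => g (j + 1)) (fun j => gi (j + 1)) where
  q_ne_zero := h.q_ne_zero
  sq j hj := h.sq _ (by omega)
  inv j hj := h.inv _ (by omega)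
  braid j hj := h.braid _ (by omega)
  far i j hi hj := h.far _ _ (by omega) (by omega)

theorem op (h : HeckeSys q N g gi) :
    HeckeSys q N (fun j => MulOpposite.op (g j)) (fun j => MulOpposite.op (gi j)) where
  q_ne_zero := h.q_ne_zero
  sq j hj := by rw [← MulOpposite.op_mul, h.sq j hj]; simp
  inv j hj := by rw [h.inv j hj]; simp
  braid j hj := by simp only [← MulOpposite.op_mul, ← mul_assoc]; rw [h.braid j hj]
  far i j hi hj := by
    change _ * _ = _ * _
    rw [← MulOpposite.op_mul, ← MulOpposite.op_mul, (h.far i j hi hj).eq]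

/-- The same elements in reversed order. -/
theorem rev (h : HeckeSys q N g gi) {K : ℕ} (hK : K ≤ N) :
    HeckeSys q K (fun j => g (K - 1 - j)) (fun j => gi (K - 1 - j)) where
  q_ne_zero := h.q_ne_zero
  sq j hj := h.sq _ (by omega)
  inv j hj := h.inv _ (by omega)
  braid j hj := by
    have := h.braid (K - 1 - (j + 1)) (by omega)
    rw [show K - 1 - (j + 1) + 1 = K - 1 - j by omega] at this
    exact this.symm
  far i j hi hj := (h.far (K - 1 - j) (K - 1 - i) (by omega) (by omega)).symm

/-- The antisymmetrizers absorb the elements `g j` with the factor `-q⁻¹`, and are idempotent. The two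
properties are proved together, since each inductive step for one of them uses the other. -/
theorem asym_absorb_and_idem (h : HeckeSys q N g gi) {i : ℕ} (hi : i ≤ N + 1)
    (hn : ∀ j, 1 ≤ j → j ≤ i → qnum q j ≠ 0) :
    (∀ j, j + 1 < i → g j * asym q g i = (-q⁻¹) • asym q g i) ∧
      asym q g i * asym q g i = asym q g i := by
  induction i using Nat.twoStepInduction with
  | zero => exact ⟨fun j hj => by omega, by simp [asym]⟩
  | one => exact ⟨fun j hj => by omega, by simp [asym]⟩
  | more i ih0 ih1 =>
    obtain ⟨-, idem0⟩ := ih0 (by omega) fun j h1 h2 => hn j h1 (by omega)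
    obtain ⟨abs1, idem1⟩ := ih1 (by omega) fun j h1 h2 => hn j h1 (by omega)
    have hq := h.q_ne_zero
    have n1 := hn (i + 1) (by omega) (by omega)
    have n2 := hn (i + 2) (by omega) (by omega)
    have absorb : ∀ j, j + 1 < i + 2 → g j * asym q g (i + 2) = (-q⁻¹) • asym q g (i + 2) := by
      intro j hj
      by_cases hji : j + 1 < i + 1
      · rw [asym, mul_smul_comm, ← mul_assoc, ← mul_assoc, abs1 j hji]
        simp only [smul_mul_assoc, smul_comm (-q⁻¹)]
      obtain rfl : j = i := by omega
      have sq := h.sq j (by omega)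
      rw [asym, mul_smul_comm, smul_comm]
      congr 1
      rcases j with _ | j
      · have e : asym q g (0 + 1) = 1 := rfl
        rw [e, zero_add, qnum_one]
        simp only [mul_sub, sq, mul_one, pow_one, one_mul, mul_smul_comm, div_one]
        have : q * q⁻¹ = 1 := mul_inv_cancel₀ hq
        match_scalars <;> first | ring1 | linear_combination this
      · refine absorb_step hq rfl idem0 idem1 (abs1 j (by omega)) ?_ (h.braid j (by omega)) sq ?_
        · exact commute_asym fun m hm => (h.far m (j + 1) (by omega) (by omega)).symm
        · have n0 := hn (j + 1) (by omega) (by omega)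
          field_simp
          ring
    refine ⟨absorb, ?_⟩
    exact asym_mul_of_absorb hq hn absorb

theorem asym_absorb (h : HeckeSys q N g gi) {i : ℕ} (hi : i ≤ N + 1)
    (hn : ∀ j, 1 ≤ j → j ≤ i → qnum q j ≠ 0) {j : ℕ} (hj : j + 1 < i) :
    g j * asym q g i = (-q⁻¹) • asym q g i := (h.asym_absorb_and_idem hi hn).1 j hj

theorem asym_idem (h : HeckeSys q N g gi) {i : ℕ} (hi : i ≤ N + 1)
    (hn : ∀ j, 1 ≤ j → j ≤ i → qnum q j ≠ 0) :
    asym q g i * asym q g i = asym q g i := (h.asym_absorb_and_idem hi hn).2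

theorem asym_absorb' (h : HeckeSys q N g gi) {i : ℕ} (hi : i ≤ N + 1)
    (hn : ∀ j, 1 ≤ j → j ≤ i → qnum q j ≠ 0) {j : ℕ} (hj : j + 1 < i) :
    asym q g i * g j = (-q⁻¹) • asym q g i := by
  have := h.op.asym_absorb hi hn hj
  rw [asym_op, ← MulOpposite.op_mul, ← MulOpposite.op_smul] at this
  exact MulOpposite.op_injective this

/-- The antisymmetrizer does not depend on the direction in which it is built. -/
theorem asym_rev (h : HeckeSys q N g gi) {i : ℕ} (hi : i ≤ N + 1)
    (hn : ∀ j, 1 ≤ j → j ≤ i → qnum q j ≠ 0) :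
    asym q (fun j => g (i - 2 - j)) i = asym q g i := by
  have hr : HeckeSys q (i - 1) (fun j => g (i - 2 - j)) (fun j => gi (i - 2 - j)) :=
    h.rev (K := i - 1) (by omega)
  have h1 : asym q g i * asym q (fun j => g (i - 2 - j)) i =
      asym q (fun j => g (i - 2 - j)) i := by
    refine asym_mul_of_absorb h.q_ne_zero hn fun j hj => ?_
    have := hr.asym_absorb (by omega) hn (j := i - 2 - j) (by omega)
    rwa [show i - 2 - (i - 2 - j) = j by omega] at this
  have h2 : asym q g i * asym q (fun j => g (i - 2 - j)) i = asym q g i :=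
    mul_asym_of_absorb h.q_ne_zero hn fun j hj => h.asym_absorb' hi hn (by omega)
  rw [← h1, h2]

/-- The antisymmetrizer built by adding a new first factor. -/
theorem asym_succ_shift (h : HeckeSys q N g gi) {i : ℕ} (hi : i + 1 ≤ N)
    (hn : ∀ j, 1 ≤ j → j ≤ i + 2 → qnum q j ≠ 0) :
    asym q g (i + 2) = (qnum q (i + 1) / qnum q (i + 2)) •
      (asym q (fun j => g (j + 1)) (i + 1) * ((q ^ (i + 1) / qnum q (i + 1)) • (1 : E) - g 0) *
        asym q (fun j => g (j + 1)) (i + 1)) := by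
  have hs : HeckeSys q i (fun j => g (j + 1)) (fun j => gi (j + 1)) :=
    (h.mono (N' := i + 1) hi).shift
  rw [← h.asym_rev (by omega) hn, asym, ← hs.asym_rev (by omega) fun j h1 h2 => hn j h1 (by omega)]
  have : asym q (fun j => g (i + 2 - 2 - j)) (i + 1) =
      asym q (fun j => g (i + 1 - 2 - j + 1)) (i + 1) := by
    refine asym_congr q fun j hj => ?_
    congr 1
    omega
  rw [this]
  simp

theorem up_shift (h : HeckeSys q N g gi) {i : ℕ} (hi : i ≤ N) {j : ℕ} (hj : j + 1 < i) :
    up g i * g j = g (j + 1) * up g i := by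
  induction i with
  | zero => omega
  | succ i ih =>
    by_cases hji : j + 1 < i
    · rw [up, mul_assoc, ← (h.far j i (by omega) (by omega)).eq, ← mul_assoc, ih (by omega) hji,
        mul_assoc]
    · obtain rfl : j + 1 = i := by omega
      have hc : Commute (g (j + 1)) (up g j) :=
        commute_up fun m hm => (h.far m (j + 1) (by omega) (by omega)).symm
      rw [up, up, mul_assoc, mul_assoc, ← mul_assoc (g j), h.braid j (by omega)]
      simp only [← mul_assoc]
      rw [hc.eq]

theorem up_op (g : ℕ → E) (i : ℕ) :
    up (fun j => MulOpposite.op (g j)) i = MulOpposite.op (down g i) := by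
  induction i with
  | zero => rfl
  | succ i ih => rw [up, ih, down, MulOpposite.op_mul]

theorem down_shift (h : HeckeSys q N g gi) {i : ℕ} (hi : i ≤ N) {j : ℕ} (hj : j + 1 < i) :
    down g i * g (j + 1) = g j * down g i := by
  have := h.op.up_shift hi hj
  simp only [up_op, ← MulOpposite.op_mul] at this
  exact (MulOpposite.op_injective this).symm

/-- `U = g 0 * ... * g (i - 1)` shifts the elements `g j`. -/
theorem up_conj (h : HeckeSys q N g gi) {i : ℕ} (hi : i ≤ N) {j : ℕ} (hj : j + 1 < i) :
    up g i * g j * down gi i = g (j + 1) := by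
  rw [h.up_shift hi hj, mul_assoc, up_mul_down fun j hj => h.mul_inv (by omega), mul_one]

theorem upi_conj (h : HeckeSys q N g gi) {i : ℕ} (hi : i ≤ N) {j : ℕ} (hj : j + 1 < i) :
    up gi i * g j * down g i = g (j + 1) := by
  rw [mul_assoc, ← h.down_shift hi hj, ← mul_assoc,
    up_mul_down fun j hj => h.inv_mul (by omega), one_mul]

theorem down_shift_inv (h : HeckeSys q N g gi) {i : ℕ} (hi : i ≤ N) {j : ℕ} (hj : j + 1 < i) :
    down g i * gi (j + 1) = gi j * down g i := by
  rw [h.inv j (by omega), h.inv (j + 1) (by omega), mul_sub, sub_mul, h.down_shift hi hj]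
  simp

theorem up_L (h : HeckeSys q N g gi) {L : E} (hL : ∀ j, 1 ≤ j → j < N → Commute L (g j))
    {i : ℕ} (hi : i + 1 ≤ N) : up g (i + 1) * L * down gi (i + 1) = g 0 * L * gi 0 := by
  induction i with
  | zero => simp [up, down]
  | succ i ih =>
    rw [up, down, ← ih (by omega)]
    have : g (i + 1) * L * gi (i + 1) = L := by
      rw [← (hL (i + 1) (by omega) (by omega)).eq, mul_assoc, h.mul_inv (by omega), mul_one]
    calc _ = up g (i + 1) * (g (i + 1) * L * gi (i + 1)) * down gi (i + 1) := by
          simp only [mul_assoc]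
      _ = _ := by rw [this]

theorem upi_L (h : HeckeSys q N g gi) {L : E} (hL : ∀ j, 1 ≤ j → j < N → Commute L (g j))
    {i : ℕ} (hi : i + 1 ≤ N) : up gi (i + 1) * L * down g (i + 1) = gi 0 * L * g 0 := by
  induction i with
  | zero => simp [up, down]
  | succ i ih =>
    rw [up, down, ← ih (by omega)]
    have : gi (i + 1) * L * g (i + 1) = L := by
      rw [mul_assoc, (hL (i + 1) (by omega) (by omega)).eq, ← mul_assoc, h.inv_mul (by omega),
        one_mul]
    calc _ = up gi (i + 1) * (gi (i + 1) * L * g (i + 1)) * down g (i + 1) := by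
          simp only [mul_assoc]
      _ = _ := by rw [this]

/-- Conjugation with `U` shifts the antisymmetrized product of copies. -/
theorem asym_copyProd_conj (h : HeckeSys q N g gi) {L : E}
    (hL : ∀ j, 1 ≤ j → j < N → Commute L (g j)) {i : ℕ} (hi : i + 1 ≤ N) :
    up g (i + 1) * (asym q g (i + 1) * copyProd g gi L (i + 1)) * down gi (i + 1) =
      asym q (fun j => g (j + 1)) (i + 1) *
        copyProd (fun j => g (j + 1)) (fun j => gi (j + 1)) (g 0 * L * gi 0) (i + 1) := by
  have h1 := up_mul_down (i := i + 1) fun j hj => h.mul_inv (j := j) (by omega)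
  have h2 := down_mul_up (i := i + 1) fun j hj => h.inv_mul (j := j) (by omega)
  have e : ∀ j, j + 1 < i + 1 → conjHom _ _ h1 h2 (g j) = g (j + 1) := fun j hj =>
    h.up_conj hi hj
  have ei : ∀ j, j + 1 < i + 1 → conjHom _ _ h1 h2 (gi j) = gi (j + 1) := fun j hj => by
    rw [h.inv j (by omega), map_sub, e j hj, map_smul, map_one, h.inv (j + 1) (by omega)]
  rw [← conjHom_apply h1 h2, map_mul, map_asym _ q e, map_copyProd _ e ei, conjHom_apply,
    h.up_L hL hi]

theorem asym_copyProd_conj' (h : HeckeSys q N g gi) {L : E}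
    (hL : ∀ j, 1 ≤ j → j < N → Commute L (g j)) {i : ℕ} (hi : i + 1 ≤ N) :
    up gi (i + 1) * (asym q g (i + 1) * copyProd g gi L (i + 1)) * down g (i + 1) =
      asym q (fun j => g (j + 1)) (i + 1) *
        copyProd (fun j => g (j + 1)) (fun j => gi (j + 1)) (gi 0 * L * g 0) (i + 1) := by
  have h1 := up_mul_down (i := i + 1) fun j hj => h.inv_mul (j := j) (by omega)
  have h2 := down_mul_up (i := i + 1) fun j hj => h.mul_inv (j := j) (by omega)
  have e : ∀ j, j + 1 < i + 1 → conjHom _ _ h1 h2 (g j) = g (j + 1) := fun j hj =>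
    h.upi_conj hi hj
  have ei : ∀ j, j + 1 < i + 1 → conjHom _ _ h1 h2 (gi j) = gi (j + 1) := fun j hj => by
    rw [h.inv j (by omega), map_sub, e j hj, map_smul, map_one, h.inv (j + 1) (by omega)]
  rw [← conjHom_apply h1 h2, map_mul, map_asym _ q e, map_copyProd _ e ei, conjHom_apply,
    h.upi_L hL hi]

theorem commute_copy_of_le (h : HeckeSys q N g gi) {L : E}
    (hL : ∀ j, 1 ≤ j → j < N → Commute L (g j)) {j m : ℕ} (hm : m < j) (hj : j < N) :
    Commute (g j) (copy g gi L m) := by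
  induction m with
  | zero => exact (hL j (by omega) hj).symm
  | succ m ih =>
    have h1 := (h.far m j (by omega) hj).symm
    exact (h1.mul_right (ih (by omega))).mul_right (h.commute_inv (by omega) h1)

/-- Multiplication by `g 0 ... g (i - 1)` from the left and by the reversed product, instead of the
inverse, from the right takes the product of the copies of `L` to that of the shifted copies of
`g 0 L g 0`. -/
theorem copyProd_up (h : HeckeSys q N g gi) {L : E}
    (hL : ∀ j, 1 ≤ j → j < N → Commute L (g j)) {i : ℕ} (hi : i ≤ N) :
    up g i * copyProd g gi L i * down g i =
      copyProd (fun j => g (j + 1)) (fun j => gi (j + 1)) (g 0 * L * g 0) i := by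
  induction i with
  | zero => simp [up, down, copyProd_zero]
  | succ i ih =>
    have hc : Commute (g i) (copyProd g gi L i) := by
      rw [copyProd]
      refine Commute.list_prod_right _ _ fun X hX => ?_
      obtain ⟨m, hm, rfl⟩ := List.mem_map.1 hX
      exact h.commute_copy_of_le hL (List.mem_range.1 hm) (by omega)
    set V := down g (i + 1) with hV
    have v1 : V = down (fun j => g (j + 1)) i * g 0 := down_succ' g i
    have v2 : V = g i * down g i := rfl
    have v3 : V * up (fun j => gi (j + 1)) i = up gi i * V := by
      have : ∀ k ≤ i, V * up (fun j => gi (j + 1)) k = up gi k * V := by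
        intro k
        induction k with
        | zero => simp [up]
        | succ k ihk =>
          intro hk
          rw [up, ← mul_assoc, ihk (by omega), mul_assoc, h.down_shift_inv hi (by omega), up,
            mul_assoc]
      exact this i le_rfl
    have v4 : V * down (fun j => g (j + 1)) i = down g i * V := by
      have : ∀ k ≤ i, V * down (fun j => g (j + 1)) k = down g k * V := by
        intro k
        induction k with
        | zero => simp [down]
        | succ k ihk =>
          intro hk
          rw [down, ← mul_assoc, h.down_shift hi (by omega), mul_assoc, ihk (by omega), down,
            mul_assoc]
      exact this i le_rfl
    have v5 : Commute L (down (fun j => g (j + 1)) i) :=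
      commute_down fun j hj => hL (j + 1) (by omega) (by omega)
    have key : g i * copy g gi L i * V = down g i *
        copy (fun j => g (j + 1)) (fun j => gi (j + 1)) (g 0 * L * g 0) i := by
      rw [copy_eq, copy_eq]
      calc _ = V * L * (up gi i * V) := by simp only [v2, mul_assoc]
        _ = V * L * V * up (fun j => gi (j + 1)) i := by rw [← v3]; simp only [mul_assoc]
        _ = V * (L * down (fun j => g (j + 1)) i) * g 0 * up (fun j => gi (j + 1)) i := by
          nth_rewrite 2 [v1]; simp only [mul_assoc]
        _ = (V * down (fun j => g (j + 1)) i) * L * g 0 * up (fun j => gi (j + 1)) i := by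
          rw [v5.eq]; simp only [mul_assoc]
        _ = _ := by rw [v4, v1]; simp only [mul_assoc]
    rw [copyProd_succ, copyProd_succ, ← ih (by omega), up]
    calc _ = up g i * (g i * copyProd g gi L i) * copy g gi L i * V := by simp only [mul_assoc]
      _ = up g i * copyProd g gi L i * (g i * copy g gi L i * V) := by
        rw [hc.eq]; simp only [mul_assoc]
      _ = _ := by rw [key]; simp only [mul_assoc]

/-- The reflection equation for the copies. -/
theorem copy_RE (h : HeckeSys q N g gi) {L : E}
    (hL : ∀ j, 1 ≤ j → j < N → Commute L (g j)) (hRE : g 0 * L * g 0 * L = L * g 0 * L * g 0)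
    {m : ℕ} (hm : m < N) : g m * copy g gi L m * g m * copy g gi L m =
      copy g gi L m * g m * copy g gi L m * g m := by
  induction m with
  | zero => exact hRE
  | succ m ih =>
    have ih := ih (by omega)
    set X := copy g gi L m
    have cX : Commute (g (m + 1)) X := h.commute_copy_of_le hL (by omega) hm
    have h1 : g m * g (m + 1) * (gi (m + 1) * gi m) = 1 := by
      rw [mul_assoc, ← mul_assoc (g (m + 1)), h.mul_inv hm, one_mul, h.mul_inv (by omega)]
    have h2 : gi (m + 1) * gi m * (g m * g (m + 1)) = 1 := by
      rw [mul_assoc, ← mul_assoc (gi m), h.inv_mul (by omega), one_mul, h.inv_mul (by omega)]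
    have e1 : conjHom _ _ h1 h2 (g m) = g (m + 1) := by
      rw [conjHom_apply, h.braid m (by omega), mul_assoc, mul_assoc, ← mul_assoc (g m), h1,
        mul_one]
    have e2 : conjHom _ _ h1 h2 X = copy g gi L (m + 1) := by
      rw [conjHom_apply, mul_assoc (g m), cX.eq]
      simp only [mul_assoc]
      rw [← mul_assoc (g (m + 1)), h.mul_inv hm, one_mul, copy, mul_assoc]
    rw [← e1, ← e2]
    simp only [← map_mul, ih]

/-- Conjugation by `g (j + 1) g j` takes `g (j + 1)` to `g j` and the copy number `j` to the copy number
`j + 2`. -/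
theorem commute_copy_of_gt (h : HeckeSys q N g gi) {L : E}
    (hL : ∀ j, 1 ≤ j → j < N → Commute L (g j)) {j m : ℕ} (hm : j + 1 < m) (hmN : m ≤ N) :
    Commute (g j) (copy g gi L m) := by
  induction m with
  | zero => omega
  | succ m ih =>
    by_cases hjm : j + 1 < m
    · have h1 := h.far j m (by omega) (by omega)
      exact (h1.mul_right (ih hjm (by omega))).mul_right (h.commute_inv (by omega) h1)
    obtain rfl : m = j + 1 := by omega
    have cX : Commute (g (j + 1)) (copy g gi L j) := h.commute_copy_of_le hL (by omega) (by omega)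
    have h1 : g (j + 1) * g j * (gi j * gi (j + 1)) = 1 := by
      rw [mul_assoc, ← mul_assoc (g j), h.mul_inv (by omega), one_mul, h.mul_inv (by omega)]
    have h2 : gi j * gi (j + 1) * (g (j + 1) * g j) = 1 := by
      rw [mul_assoc, ← mul_assoc (gi (j + 1)), h.inv_mul (by omega), one_mul, h.inv_mul (by omega)]
    have e1 : conjHom _ _ h1 h2 (g (j + 1)) = g j := by
      rw [conjHom_apply, ← h.braid j (by omega), mul_assoc, mul_assoc, ← mul_assoc (g (j + 1)), h1,
        mul_one]
    have e2 : conjHom _ _ h1 h2 (copy g gi L j) = copy g gi L (j + 1 + 1) := by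
      rw [conjHom_apply, copy, copy]; simp only [mul_assoc]
    rw [← e1, ← e2]
    exact cX.map (conjHom _ _ h1 h2)

/-- The product of the copies commutes with the elements `g j`. -/
theorem commute_copyProd (h : HeckeSys q N g gi) {L : E}
    (hL : ∀ j, 1 ≤ j → j < N → Commute L (g j)) (hRE : g 0 * L * g 0 * L = L * g 0 * L * g 0)
    {i : ℕ} (hi : i ≤ N + 1) {j : ℕ} (hj : j + 1 < i) : Commute (g j) (copyProd g gi L i) := by
  induction i with
  | zero => omega
  | succ i ih =>
    rw [copyProd_succ]
    by_cases hji : j + 1 < i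
    · exact (ih (by omega) hji).mul_right (h.commute_copy_of_gt hL hji (by omega))
    obtain rfl : i = j + 1 := by omega
    have c1 : Commute (g j) (copyProd g gi L j) := by
      rw [copyProd]
      refine Commute.list_prod_right _ _ fun X hX => ?_
      obtain ⟨m, hm, rfl⟩ := List.mem_map.1 hX
      exact h.commute_copy_of_le hL (List.mem_range.1 hm) (by omega)
    rw [copyProd_succ, mul_assoc]
    refine c1.mul_right ?_
    have re := h.copy_RE hL hRE (m := j) (by omega)
    change _ = _
    rw [copy]
    simp only [← mul_assoc]
    rw [re, mul_assoc, h.mul_inv (by omega), mul_assoc _ (gi j), h.inv_mul (by omega)]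

end HeckeSys

end Hecke


/-! ### Characteristic polynomials of matrices obeying the reflection equation -/

/-- The copies of `R` in the tensor powers. -/
def Rs {n : ℕ} (𝓡 : RData n) (A : Type*) [Ring A] [Algebra ℂ A] (k : ℕ) : ℕ → MatT n k A :=
  fun j => site2 k j (𝓡.Rm A)

/-- The copies of `R⁻¹` in the tensor powers. -/
def Rsi {n : ℕ} (𝓡 : RData n) (A : Type*) [Ring A] [Algebra ℂ A] (k : ℕ) : ℕ → MatT n k A :=
  fun j => site2 k j (𝓡.Ri A)

/-- The trace with the weight `D` over all factors but the first one. -/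
def tr1 {n : ℕ} {A : Type*} [Ring A] [Algebra ℂ A] (D : Mat1 n ℂ) :
    ∀ k, MatT n (k + 1) A →ₗ[ℂ] Mat1 n A
  | 0 => (m1 (n := n) (A := A)).symm.toLinearMap
  | k + 1 => (tr1 D k).comp (ptr D (k + 1))

section Trace1

variable {n : ℕ} {A : Type*} [Ring A] [Algebra ℂ A] (D : Mat1 n ℂ)

theorem tr1_zero_m1 (X : Mat1 n A) : tr1 D 0 (m1 X) = X := by simp [tr1]

theorem tr1_succ (k : ℕ) (Z : MatT n (k + 2) A) :
    tr1 D (k + 1) Z = tr1 D k (ptr D (k + 1) Z) := rfl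

theorem emb_zero (Y : MatT n 0 A) : emb 0 Y = m1 (sc n (Y default default)) := by
  ext a b
  obtain ⟨a, x, rfl⟩ := exists_snoc a
  obtain ⟨b, y, rfl⟩ := exists_snoc b
  have h0 : ∀ (c : Fin 0 → Fin n) (z : Fin n), snoc c z 0 = z := fun c z => snoc_last c z
  rw [emb_snoc, m1_apply, h0, h0]
  simp [sc, Matrix.diagonal_apply, Subsingleton.elim a default, Subsingleton.elim b default]

theorem tr1_zero_emb (Y : MatT n 0 A) : tr1 D 0 (emb 0 Y) = sc n (wtrT 0 D Y) := by
  rw [emb_zero, tr1_zero_m1, wtrT_zero]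

theorem tr1_site_mul (k : ℕ) (T : Mat1 n A) (Z : MatT n (k + 1) A) :
    tr1 D k (site (k + 1) 0 T * Z) = T * tr1 D k Z := by
  induction k with
  | zero => simp [tr1, site_one]
  | succ k ih => rw [tr1_succ, ← emb_site (by omega), ptr_emb_mul, ih]; rfl

theorem tr1_mul_site (k : ℕ) (T : Mat1 n A) (Z : MatT n (k + 1) A) :
    tr1 D k (Z * site (k + 1) 0 T) = tr1 D k Z * T := by
  induction k with
  | zero => simp [tr1, site_one]
  | succ k ih => rw [tr1_succ, ← emb_site (by omega), ptr_mul_emb, ih]; rfl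

theorem wtr_tr1 (k : ℕ) (Z : MatT n (k + 1) A) : wtr D (tr1 D k Z) = wtrT (k + 1) D Z := by
  induction k with
  | zero =>
    obtain ⟨X, rfl⟩ := (m1 (n := n) (A := A)).surjective Z
    rw [tr1_zero_m1, wtrT_succ, wtrT_zero]
    rfl
  | succ k ih => rw [tr1_succ, ih, ← wtrT_succ]

end Trace1

theorem emb_Rs {n : ℕ} (𝓡 : RData n) (A : Type*) [Ring A] [Algebra ℂ A] {k j : ℕ}
    (h : j + 1 < k) : emb k (Rs 𝓡 A k j) = Rs 𝓡 A (k + 1) j := emb_site2 h _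

theorem emb_Rsi {n : ℕ} (𝓡 : RData n) (A : Type*) [Ring A] [Algebra ℂ A] {k j : ℕ}
    (h : j + 1 < k) : emb k (Rsi 𝓡 A k j) = Rsi 𝓡 A (k + 1) j := emb_site2 h _

section EmbWords

variable {n : ℕ} (𝓡 : RData n) (A : Type*) [Ring A] [Algebra ℂ A] {k i : ℕ}

theorem emb_up_Rs (h : i < k) : up (Rs 𝓡 A (k + 1)) i = emb k (up (Rs 𝓡 A k) i) :=
  (map_up (emb k) (g' := Rs 𝓡 A (k + 1)) fun _ _ => emb_Rs 𝓡 A (by omega)).symm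

theorem emb_up_Rsi (h : i < k) : up (Rsi 𝓡 A (k + 1)) i = emb k (up (Rsi 𝓡 A k) i) :=
  (map_up (emb k) (g' := Rsi 𝓡 A (k + 1)) fun _ _ => emb_Rsi 𝓡 A (by omega)).symm

theorem emb_down_Rs (h : i < k) : down (Rs 𝓡 A (k + 1)) i = emb k (down (Rs 𝓡 A k) i) :=
  (map_down (emb k) (g' := Rs 𝓡 A (k + 1)) fun _ _ => emb_Rs 𝓡 A (by omega)).symm

theorem emb_down_Rsi (h : i < k) : down (Rsi 𝓡 A (k + 1)) i = emb k (down (Rsi 𝓡 A k) i) :=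
  (map_down (emb k) (g' := Rsi 𝓡 A (k + 1)) fun _ _ => emb_Rsi 𝓡 A (by omega)).symm

theorem emb_down_Rsi' (h : i + 1 < k) : down (fun j => Rsi 𝓡 A (k + 1) (j + 1)) i =
    emb k (down (fun j => Rsi 𝓡 A k (j + 1)) i) :=
  (map_down (emb k) (g' := fun j => Rsi 𝓡 A (k + 1) (j + 1))
    fun _ _ => emb_Rsi 𝓡 A (by omega)).symm

end EmbWords

namespace RData

variable {n : ℕ} {𝓡 : RData n} {A : Type*} [Ring A] [Algebra ℂ A]

theorem commute_Rm (x : A) (i j) : Commute x (𝓡.Rm A i j) := (Algebra.commutes _ _).symm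

namespace IsHecke

theorem Rm_braid (h : 𝓡.IsHecke) : site2 3 0 (𝓡.Rm A) * site2 3 1 (𝓡.Rm A) * site2 3 0 (𝓡.Rm A) =
    site2 3 1 (𝓡.Rm A) * site2 3 0 (𝓡.Rm A) * site2 3 1 (𝓡.Rm A) := by
  have := congrArg (Algebra.ofId ℂ A).mapMatrix h.braid
  simp only [map_mul] at this
  have e : ∀ j, (Algebra.ofId ℂ A).mapMatrix (site2 3 j 𝓡.R) = site2 3 j (𝓡.Rm A) := fun j =>
    site2_map (algebraMap ℂ A) 3 j 𝓡.R
  rwa [e, e] at this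

theorem heckeSys (h : 𝓡.IsHecke) (k : ℕ) : HeckeSys 𝓡.q k (Rs 𝓡 A (k + 1)) (Rsi 𝓡 A (k + 1)) where
  q_ne_zero := h.q_ne_zero
  sq j hj := by
    simp only [Rs, site2_eq_hom (show j + 1 < k + 1 by omega), ← map_mul, h.Rm_sq, map_add, map_one,
      map_smul]
  inv j hj := by
    simp only [Rs, Rsi, site2_eq_hom (show j + 1 < k + 1 by omega), h.Ri_eq, map_sub, map_one,
      map_smul]
  braid j hj := site2_braid (by omega) h.Rm_braid
  far i j hij hj := site2_far hij (by omega) fun a b c d => commute_Rm _ _ _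

end IsHecke

theorem antisym_eq (k i : ℕ) : 𝓡.antisym k i = asym 𝓡.q (fun j => site2 k j 𝓡.R) i := by
  induction i using Nat.twoStepInduction with
  | zero => rfl
  | one => rfl
  | more i _ ih => rw [antisym, ih, asym]

theorem antisym_map (k i : ℕ) :
    (𝓡.antisym k i).map (algebraMap ℂ A) = asym 𝓡.q (Rs 𝓡 A k) i := by
  rw [antisym_eq]
  exact map_asym (Algebra.ofId ℂ A).mapMatrix 𝓡.q (g' := Rs 𝓡 A k)
    fun j _ => site2_map (algebraMap ℂ A) k j 𝓡.R

theorem Am_eq (k : ℕ) : 𝓡.Am A k = asym 𝓡.q (Rs 𝓡 A k) k := antisym_map k k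

theorem overCopy_eq (k m : ℕ) (X : Mat1 n A) :
    𝓡.overCopy k X m = copy (Rs 𝓡 A k) (Rsi 𝓡 A k) (site k 0 X) m := by
  induction m with
  | zero => rfl
  | succ m ih => rw [overCopy, ih]; rfl

/-- The antisymmetrized product `A⁽ᵏ⁾ X₁ ... Xₖ` of the overlined copies of `X`. -/
def wedge (𝓡 : RData n) (X : Mat1 n A) (k : ℕ) : MatT n k A :=
  asym 𝓡.q (Rs 𝓡 A k) k * copyProd (Rs 𝓡 A k) (Rsi 𝓡 A k) (site k 0 X) k

theorem coeffR_eq (X : Mat1 n A) (i : ℕ) : 𝓡.coeffR X i = wtrT i 𝓡.D (𝓡.wedge X i) := by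
  rw [coeffR, Am_eq, wedge, copyProd]
  congr 3
  exact List.map_congr_left fun m _ => overCopy_eq i m X

theorem coeffR_zero (X : Mat1 n A) : 𝓡.coeffR X 0 = 1 := by
  rw [coeffR_eq, wedge, wtrT_zero]
  simp [asym, copyProd]

theorem emb_wedge (X : Mat1 n A) (i : ℕ) : emb (i + 1) (𝓡.wedge X (i + 1)) =
    asym 𝓡.q (Rs 𝓡 A (i + 2)) (i + 1) *
      copyProd (Rs 𝓡 A (i + 2)) (Rsi 𝓡 A (i + 2)) (site (i + 2) 0 X) (i + 1) := by
  rw [wedge, map_mul, map_asym (emb (i + 1)) 𝓡.q (g' := Rs 𝓡 A (i + 2)) fun j hj => emb_Rs 𝓡 A (by omega),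
    map_copyProd (emb (i + 1)) (g' := Rs 𝓡 A (i + 2)) (gi' := Rsi 𝓡 A (i + 2))
      (fun j hj => emb_Rs 𝓡 A (by omega)) (fun j hj => emb_Rsi 𝓡 A (by omega)),
    emb_site (by omega)]

/-- The shifted antisymmetrized product of the copies of an operator `J` acting in the first two
factors. -/
def shWedge (𝓡 : RData n) (i : ℕ) (J : MatT n (i + 1) A) : MatT n (i + 1) A :=
  asym 𝓡.q (fun j => Rs 𝓡 A (i + 1) (j + 1)) i *
    copyProd (fun j => Rs 𝓡 A (i + 1) (j + 1)) (fun j => Rsi 𝓡 A (i + 1) (j + 1)) J i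

theorem commute_site_Rs (k : ℕ) (X : Mat1 n A) (j : ℕ) (hj : 1 ≤ j) :
    Commute (site (k + 1) 0 X) (Rs 𝓡 A (k + 1) j) :=
  site_commute_site2 (by omega) (by omega) (by omega) fun _ _ _ _ => commute_Rm _ _ _

namespace IsHecke

theorem tr1_comm (h : 𝓡.IsHecke) {k j : ℕ} (hj : 1 ≤ j) (hjk : j < k) (Z : MatT n (k + 1) A) :
    tr1 𝓡.D k (Rs 𝓡 A (k + 1) j * Z) = tr1 𝓡.D k (Z * Rs 𝓡 A (k + 1) j) := by
  induction k with
  | zero => omega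
  | succ k ih =>
    rw [tr1_succ, tr1_succ]
    by_cases hj' : j < k
    · rw [← emb_Rs 𝓡 A (by omega), ptr_emb_mul, ptr_mul_emb, ih hj']
    · obtain ⟨k, rfl⟩ : ∃ m, k = m + 1 := ⟨k - 1, by omega⟩
      obtain rfl : j = k + 1 := by omega
      rw [tr1_succ, tr1_succ]
      exact congrArg (tr1 𝓡.D k) (h.ptr_ptr_comm Z)

/-- The traces over all factors but the first one are cyclic for the antisymmetrizer of these factors. -/
theorem tr1_asym_comm (h : 𝓡.IsHecke) {k i : ℕ} (hi : i ≤ k) (Z : MatT n (k + 1) A) :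
    tr1 𝓡.D k (asym 𝓡.q (fun j => Rs 𝓡 A (k + 1) (j + 1)) i * Z) =
      tr1 𝓡.D k (Z * asym 𝓡.q (fun j => Rs 𝓡 A (k + 1) (j + 1)) i) := by
  induction i using Nat.twoStepInduction generalizing Z with
  | zero => simp [asym]
  | one => simp [asym]
  | more i _ ih =>
    have ih := ih (by omega)
    set B := asym 𝓡.q (fun j => Rs 𝓡 A (k + 1) (j + 1)) (i + 1) with hB
    have e : asym 𝓡.q (fun j => Rs 𝓡 A (k + 1) (j + 1)) (i + 2) =
        (qnum 𝓡.q (i + 1) / qnum 𝓡.q (i + 2)) •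
          (B * ((𝓡.q ^ (i + 1) / qnum 𝓡.q (i + 1)) • (1 : MatT n (k + 1) A) -
            Rs 𝓡 A (k + 1) (i + 1)) * B) := rfl
    rw [e, smul_mul_assoc, mul_smul_comm, map_smul, map_smul]
    congr 1
    have mid : ∀ Z : MatT n (k + 1) A,
        tr1 𝓡.D k (((𝓡.q ^ (i + 1) / qnum 𝓡.q (i + 1)) • (1 : MatT n (k + 1) A) -
            Rs 𝓡 A (k + 1) (i + 1)) * Z) =
          tr1 𝓡.D k (Z * ((𝓡.q ^ (i + 1) / qnum 𝓡.q (i + 1)) • (1 : MatT n (k + 1) A) -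
            Rs 𝓡 A (k + 1) (i + 1))) := fun Z => by
      rw [sub_mul, mul_sub, map_sub, map_sub, h.tr1_comm (by omega) (by omega)]
      simp
    set M := (𝓡.q ^ (i + 1) / qnum 𝓡.q (i + 1)) • (1 : MatT n (k + 1) A) -
      Rs 𝓡 A (k + 1) (i + 1)
    calc tr1 𝓡.D k (B * M * B * Z) = tr1 𝓡.D k (B * (M * (B * Z))) := by simp only [mul_assoc]
      _ = tr1 𝓡.D k (M * (B * Z * B)) := by rw [ih]; simp only [mul_assoc]
      _ = tr1 𝓡.D k (B * (Z * (B * M))) := by rw [mid]; simp only [mul_assoc]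
      _ = _ := by rw [ih]; simp only [mul_assoc]

/-- The weighted traces remove the conjugation by `R₀ ... R_{i-1}` factor by factor, from the last one
on. -/
theorem tr1_up_conj (h : 𝓡.IsHecke) (i : ℕ) (Y : MatT n i A) :
    tr1 𝓡.D i (up (Rs 𝓡 A (i + 1)) i * emb i Y * down (Rsi 𝓡 A (i + 1)) i) =
      sc n (wtrT i 𝓡.D Y) := by
  induction i with
  | zero => simp only [up, down, one_mul, mul_one, tr1_zero_emb]
  | succ i ih =>
    have e1 : up (Rs 𝓡 A (i + 2)) i = emb (i + 1) (up (Rs 𝓡 A (i + 1)) i) :=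
      emb_up_Rs 𝓡 A (by omega)
    have e2 : down (Rsi 𝓡 A (i + 2)) i = emb (i + 1) (down (Rsi 𝓡 A (i + 1)) i) :=
      emb_down_Rsi 𝓡 A (by omega)
    rw [tr1_succ, up, down, e1, e2, wtrT_succ, ← ih]
    congr 1
    rw [← h.ptr_R_conj, ← ptr_emb_mul, ← ptr_mul_emb]
    congr 1
    simp only [mul_assoc, Rs, Rsi]

theorem tr1_upi_conj (h : 𝓡.IsHecke) (i : ℕ) (Y : MatT n i A) :
    tr1 𝓡.D i (up (Rsi 𝓡 A (i + 1)) i * emb i Y * down (Rs 𝓡 A (i + 1)) i) =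
      sc n (wtrT i 𝓡.D Y) := by
  induction i with
  | zero => simp only [up, down, one_mul, mul_one, tr1_zero_emb]
  | succ i ih =>
    have e1 : up (Rsi 𝓡 A (i + 2)) i = emb (i + 1) (up (Rsi 𝓡 A (i + 1)) i) :=
      emb_up_Rsi 𝓡 A (by omega)
    have e2 : down (Rs 𝓡 A (i + 2)) i = emb (i + 1) (down (Rs 𝓡 A (i + 1)) i) :=
      emb_down_Rs 𝓡 A (by omega)
    rw [tr1_succ, up, down, e1, e2, wtrT_succ, ← ih]
    congr 1
    rw [← h.ptr_Ri_conj, ← ptr_emb_mul, ← ptr_mul_emb]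
    congr 1
    simp only [mul_assoc, Rs, Rsi]

/-- Only half of the conjugating factors: one of the traces is not complete. -/
theorem tr1_up_half (h : 𝓡.IsHecke) (i : ℕ) (Y : MatT n (i + 1) A) :
    tr1 𝓡.D (i + 1) (up (Rs 𝓡 A (i + 2)) (i + 1) * emb (i + 1) Y *
      down (fun j => Rsi 𝓡 A (i + 2) (j + 1)) i) = tr1 𝓡.D i Y := by
  induction i with
  | zero =>
    rw [tr1_succ]
    simp only [up, down, one_mul, mul_one]
    congr 1
    exact h.ptr_R_emb Y
  | succ i ih =>
    have e1 : up (Rs 𝓡 A (i + 3)) (i + 1) = emb (i + 2) (up (Rs 𝓡 A (i + 2)) (i + 1)) :=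
      emb_up_Rs 𝓡 A (by omega)
    have e2 : down (fun j => Rsi 𝓡 A (i + 3) (j + 1)) i =
        emb (i + 2) (down (fun j => Rsi 𝓡 A (i + 2) (j + 1)) i) :=
      emb_down_Rsi' 𝓡 A (by omega)
    have key : ptr 𝓡.D (i + 2) (up (Rs 𝓡 A (i + 3)) (i + 2) * emb (i + 2) Y *
        down (fun j => Rsi 𝓡 A (i + 3) (j + 1)) (i + 1)) =
        up (Rs 𝓡 A (i + 2)) (i + 1) * emb (i + 1) (ptr 𝓡.D (i + 1) Y) *
          down (fun j => Rsi 𝓡 A (i + 2) (j + 1)) i := by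
      rw [← h.ptr_R_conj, ← ptr_emb_mul, ← ptr_mul_emb]
      congr 1
      rw [up, down, e1, e2]
      simp only [mul_assoc, Rs, Rsi]
    rw [tr1_succ, key, ih, ← tr1_succ]

/-- The trace of `R₀ ... Rᵢ Y Rᵢ ... R₀` for an operator `Y` that absorbs the R-matrices from both
sides: the trace of `R Y R` over the last factor is the trace of `Y` plus `(q - q⁻¹) Y`, and in the
second term the remaining R-matrices are absorbed. These terms add up to a q-number. -/
theorem tr1_up_down (h : 𝓡.IsHecke) (i : ℕ) (Y : MatT n (i + 1) A)
    (hl : ∀ j < i, Rs 𝓡 A (i + 1) j * Y = (-𝓡.q⁻¹) • Y)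
    (hr : ∀ j < i, Y * Rs 𝓡 A (i + 1) j = (-𝓡.q⁻¹) • Y) :
    tr1 𝓡.D (i + 1) (up (Rs 𝓡 A (i + 2)) (i + 1) * emb (i + 1) Y *
      down (Rs 𝓡 A (i + 2)) (i + 1)) = sc n (wtrT (i + 1) 𝓡.D Y) +
        ((𝓡.q - 𝓡.q⁻¹) * ∑ m ∈ Finset.range (i + 1), (𝓡.q⁻¹ ^ m * 𝓡.q⁻¹ ^ m)) •
          tr1 𝓡.D i Y := by
  induction i with
  | zero =>
    rw [tr1_succ]
    simp only [up, down, one_mul, mul_one, zero_add, Finset.sum_range_one, pow_zero]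
    have := h.ptr_R_emb_R (k := 0) Y
    rw [Rs]
    refine (congrArg (tr1 𝓡.D 0) this).trans ?_
    rw [map_add, map_smul, tr1_zero_emb, wtrT_succ]
  | succ i ih =>
    have e1 : up (Rs 𝓡 A (i + 3)) (i + 1) = emb (i + 2) (up (Rs 𝓡 A (i + 2)) (i + 1)) :=
      emb_up_Rs 𝓡 A (by omega)
    have e2 : down (Rs 𝓡 A (i + 3)) (i + 1) = emb (i + 2) (down (Rs 𝓡 A (i + 2)) (i + 1)) :=
      emb_down_Rs 𝓡 A (by omega)
    have hU : ∀ m ≤ i + 1, Y * down (Rs 𝓡 A (i + 2)) m = (-𝓡.q⁻¹) ^ m • Y := by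
      intro m
      induction m with
      | zero => simp [down]
      | succ m ihm =>
        intro hm
        rw [down, ← mul_assoc, hr m (by omega), smul_mul_assoc, ihm (by omega), smul_smul,
          pow_succ']
    have hV : ∀ m ≤ i + 1, up (Rs 𝓡 A (i + 2)) m * Y = (-𝓡.q⁻¹) ^ m • Y := by
      intro m
      induction m with
      | zero => simp [up]
      | succ m ihm =>
        intro hm
        rw [up, mul_assoc, hl m (by omega), mul_smul_comm, ihm (by omega), smul_smul, pow_succ']
    have ih' := ih (ptr 𝓡.D (i + 1) Y)
      (fun j hj => by
        rw [← ptr_emb_mul, emb_Rs 𝓡 A (by omega), hl j (by omega), map_smul])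
      (fun j hj => by
        rw [← ptr_mul_emb, emb_Rs 𝓡 A (by omega), hr j (by omega), map_smul])
    have key : ptr 𝓡.D (i + 2) (up (Rs 𝓡 A (i + 3)) (i + 2) * emb (i + 2) Y *
        down (Rs 𝓡 A (i + 3)) (i + 2)) =
        up (Rs 𝓡 A (i + 2)) (i + 1) * emb (i + 1) (ptr 𝓡.D (i + 1) Y) *
          down (Rs 𝓡 A (i + 2)) (i + 1) +
        ((𝓡.q - 𝓡.q⁻¹) * (𝓡.q⁻¹ ^ (i + 1) * 𝓡.q⁻¹ ^ (i + 1))) • Y := by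
      have : ptr 𝓡.D (i + 2) (up (Rs 𝓡 A (i + 3)) (i + 2) * emb (i + 2) Y *
          down (Rs 𝓡 A (i + 3)) (i + 2)) = up (Rs 𝓡 A (i + 2)) (i + 1) *
          (emb (i + 1) (ptr 𝓡.D (i + 1) Y) + (𝓡.q - 𝓡.q⁻¹) • Y) *
          down (Rs 𝓡 A (i + 2)) (i + 1) := by
        rw [← h.ptr_R_emb_R, ← ptr_emb_mul, ← ptr_mul_emb]
        congr 1
        rw [up, down, e1, e2]
        simp only [mul_assoc, Rs]
      rw [this, mul_add, add_mul, mul_smul_comm, smul_mul_assoc, hV _ le_rfl, smul_mul_assoc,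
        hU _ le_rfl, smul_smul, smul_smul]
      congr 2
      rw [neg_pow, mul_assoc]
      congr 1
      rw [mul_mul_mul_comm, ← mul_pow, neg_mul_neg, one_mul, one_pow, one_mul]
    rw [tr1_succ, key, map_add, map_smul, ih', ← wtrT_succ, ← tr1_succ, add_assoc, ← add_smul,
      Finset.sum_range_succ _ (i + 1), mul_add]

/-- The trace of the shifted wedge power is the coefficient. -/
theorem tr1_shWedge (h : 𝓡.IsHecke) (X : Mat1 n A) (i : ℕ) :
    tr1 𝓡.D i (𝓡.shWedge i (Rs 𝓡 A (i + 1) 0 * site (i + 1) 0 X * Rsi 𝓡 A (i + 1) 0)) =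
      sc n (𝓡.coeffR X i) := by
  rw [coeffR_eq]
  cases i with
  | zero =>
    rw [shWedge, copyProd_zero, asym, mul_one, wedge, copyProd_zero, asym, mul_one,
      ← tr1_zero_emb, map_one (emb 0)]
  | succ i =>
    rw [shWedge, ← (h.heckeSys (A := A) (i + 1)).asym_copyProd_conj
      (fun j h1 _ => commute_site_Rs _ _ _ h1) le_rfl, ← emb_wedge, h.tr1_up_conj]

theorem tr1_shWedge' (h : 𝓡.IsHecke) (X : Mat1 n A) (i : ℕ) :
    tr1 𝓡.D i (𝓡.shWedge i (Rsi 𝓡 A (i + 1) 0 * site (i + 1) 0 X * Rs 𝓡 A (i + 1) 0)) =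
      sc n (𝓡.coeffR X i) := by
  rw [coeffR_eq]
  cases i with
  | zero =>
    rw [shWedge, copyProd_zero, asym, mul_one, wedge, copyProd_zero, asym, mul_one,
      ← tr1_zero_emb, map_one (emb 0)]
  | succ i =>
    rw [shWedge, ← (h.heckeSys (A := A) (i + 1)).asym_copyProd_conj'
      (fun j h1 _ => commute_site_Rs _ _ _ h1) le_rfl, ← emb_wedge, h.tr1_upi_conj]

/-- The reflection equation for a matrix with entries in an algebra. -/
def _root_.QCalc.RE (𝓡 : RData n) (X : Mat1 n A) : Prop :=
  𝓡.Rm A * fst X * 𝓡.Rm A * fst X = fst X * 𝓡.Rm A * fst X * 𝓡.Rm A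

theorem _root_.QCalc.RE.site {X : Mat1 n A} (hX : RE 𝓡 X) (k : ℕ) :
    Rs 𝓡 A (k + 2) 0 * site (k + 2) 0 X * Rs 𝓡 A (k + 2) 0 * site (k + 2) 0 X =
      site (k + 2) 0 X * Rs 𝓡 A (k + 2) 0 * site (k + 2) 0 X * Rs 𝓡 A (k + 2) 0 := by
  have := congrArg (site2Hom (k + 2) 0 (by omega)) hX
  simpa only [map_mul, ← site2_eq_hom, site2_fst (show 0 + 1 < k + 2 by omega), Rs] using this

theorem RE_site (k : ℕ) {X : Mat1 n A} (hX : RE 𝓡 X) {j : ℕ} (hj : j < k) :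
    Rs 𝓡 A (k + 1) 0 * site (k + 1) 0 X * Rs 𝓡 A (k + 1) 0 * site (k + 1) 0 X =
      site (k + 1) 0 X * Rs 𝓡 A (k + 1) 0 * site (k + 1) 0 X * Rs 𝓡 A (k + 1) 0 := by
  obtain ⟨k, rfl⟩ : ∃ m, k = m + 1 := ⟨k - 1, by omega⟩
  exact hX.site k

theorem wedge_absorb (h : 𝓡.IsHecke) (X : Mat1 n A) {i : ℕ}
    (hn : ∀ j, 1 ≤ j → j ≤ i + 1 → qnum 𝓡.q j ≠ 0) {j : ℕ} (hj : j < i) :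
    Rs 𝓡 A (i + 1) j * 𝓡.wedge X (i + 1) = (-𝓡.q⁻¹) • 𝓡.wedge X (i + 1) := by
  rw [wedge, ← mul_assoc, (h.heckeSys i).asym_absorb le_rfl hn (by omega), smul_mul_assoc]

theorem commute_Rs_copyProd (h : 𝓡.IsHecke) {X : Mat1 n A} (hX : RE 𝓡 X) {i j : ℕ}
    (hj : j < i) : Commute (Rs 𝓡 A (i + 1) j)
      (copyProd (Rs 𝓡 A (i + 1)) (Rsi 𝓡 A (i + 1)) (site (i + 1) 0 X) (i + 1)) :=
  (h.heckeSys i).commute_copyProd (fun j h1 _ => commute_site_Rs _ _ _ h1)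
    (RE_site i hX hj) le_rfl (by omega)

theorem wedge_absorb' (h : 𝓡.IsHecke) {X : Mat1 n A} (hX : RE 𝓡 X) {i : ℕ}
    (hn : ∀ j, 1 ≤ j → j ≤ i + 1 → qnum 𝓡.q j ≠ 0) {j : ℕ} (hj : j < i) :
    𝓡.wedge X (i + 1) * Rs 𝓡 A (i + 1) j = (-𝓡.q⁻¹) • 𝓡.wedge X (i + 1) := by
  rw [wedge, mul_assoc, ← (h.commute_Rs_copyProd hX hj).eq, ← mul_assoc,
    (h.heckeSys i).asym_absorb' le_rfl hn (by omega), smul_mul_assoc]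

/-- The wedge power of the matrix `X`: the trace of `A⁽ⁱ⁺¹⁾ X₁ ... Xᵢ₊₁` over all factors but the
first one. -/
def _root_.QCalc.RData.wedgePow (𝓡 : RData n) (X : Mat1 n A) (i : ℕ) : Mat1 n A :=
  tr1 𝓡.D i (𝓡.wedge X (i + 1))

/-- The weighted trace of the shifted wedge power of `R X₁ R` is the coefficient plus a multiple of the
wedge power of the matrix itself. -/
theorem tr1_shWedge_R_R (h : 𝓡.IsHecke) {X : Mat1 n A} (hX : RE 𝓡 X) (i : ℕ)
    (hn : ∀ j, 1 ≤ j → j ≤ i + 1 → qnum 𝓡.q j ≠ 0) :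
    tr1 𝓡.D (i + 1)
      (𝓡.shWedge (i + 1) (Rs 𝓡 A (i + 2) 0 * site (i + 2) 0 X * Rs 𝓡 A (i + 2) 0)) =
      sc n (𝓡.coeffR X (i + 1)) +
        ((𝓡.q - 𝓡.q⁻¹) * 𝓡.q⁻¹ ^ i * qnum 𝓡.q (i + 1)) • 𝓡.wedgePow X i := by
  have hs := h.heckeSys (A := A) (i + 1)
  have e1 : asym 𝓡.q (fun j => Rs 𝓡 A (i + 2) (j + 1)) (i + 1) * up (Rs 𝓡 A (i + 2)) (i + 1) =
      up (Rs 𝓡 A (i + 2)) (i + 1) * asym 𝓡.q (Rs 𝓡 A (i + 2)) (i + 1) := by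
    have h1 := up_mul_down (i := i + 1) fun j hj => hs.mul_inv (j := j) (by omega)
    have h2 := down_mul_up (i := i + 1) fun j hj => hs.inv_mul (j := j) (by omega)
    rw [← map_asym (conjHom _ _ h1 h2) 𝓡.q (g := Rs 𝓡 A (i + 2)) fun j hj => hs.up_conj le_rfl hj,
      conjHom_apply, mul_assoc, h2, mul_one]
  rw [shWedge, ← hs.copyProd_up (fun j h1 _ => commute_site_Rs _ _ _ h1) le_rfl, ← mul_assoc,
    ← mul_assoc, e1, mul_assoc (up _ _), ← emb_wedge, h.tr1_up_down i _
      (fun j hj => h.wedge_absorb X hn hj) (fun j hj => h.wedge_absorb' hX hn hj),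
    qnum_eq_sum h.q_ne_zero, ← coeffR_eq, ← mul_assoc, wedgePow]

/-- The recursion for the wedge powers, which leads to the Cayley-Hamilton-Newton identities. -/
theorem wedgePow_succ (h : 𝓡.IsHecke) {X : Mat1 n A} (hX : RE 𝓡 X) (i : ℕ)
    (hn : ∀ j, 1 ≤ j → j ≤ i + 2 → qnum 𝓡.q j ≠ 0) :
    qnum 𝓡.q (i + 2) • 𝓡.wedgePow X (i + 1) =
      𝓡.q ^ (i + 1) • (X * sc n (𝓡.coeffR X (i + 1))) -
        qnum 𝓡.q (i + 1) • (X * 𝓡.wedgePow X i) := by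
  have hs := h.heckeSys (A := A) (i + 1)
  have hs' := hs.shift
  set g := Rs 𝓡 A (i + 2) with hg
  set gi := Rsi 𝓡 A (i + 2) with hgi
  set B := asym 𝓡.q (fun j => g (j + 1)) (i + 1) with hB
  set L := site (i + 2) 0 X with hL
  set C := copyProd g gi L (i + 2) with hC
  have n1 := hn (i + 1) (by omega) (by omega)
  have n2 := hn (i + 2) (by omega) (by omega)
  have cC : ∀ j < i + 1, Commute (g j) C := fun j hj => h.commute_Rs_copyProd hX hj
  have cB : B * C = C * B :=
    ((commute_asym fun j hj => (cC (j + 1) (by omega)).symm : Commute C B).symm).eq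
  have cLB : Commute L B := commute_asym fun j hj => commute_site_Rs _ _ _ (by omega)
  have BB : B * B = B := hs'.asym_idem le_rfl fun j h1 h2 => hn j h1 (by omega)
  have hBC : B * C = L * 𝓡.shWedge (i + 1) (g 0 * L * gi 0) := by
    rw [hC, copyProd_succ', ← mul_assoc, ← cLB.eq, mul_assoc]; rfl
  have t1 : tr1 𝓡.D (i + 1) (B * C) = X * sc n (𝓡.coeffR X (i + 1)) := by
    rw [hBC, tr1_site_mul, h.tr1_shWedge]
  have t2 : tr1 𝓡.D (i + 1) (B * g 0 * B * C) = X * 𝓡.wedgePow X i := by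
    have e1 : B * g 0 * B * C = B * C * g 0 * B := by
      rw [mul_assoc _ B C, cB, mul_assoc B, ← mul_assoc (g 0), (cC 0 (by omega)).eq]
      simp only [← mul_assoc, cB]
    have e2 : B * (B * C * g 0) = B * C * g 0 := by rw [← mul_assoc, ← mul_assoc, BB]
    rw [e1, ← h.tr1_asym_comm (by omega), e2, hBC, mul_assoc, tr1_site_mul, shWedge,
      ← hs.asym_copyProd_conj (fun j h1 _ => commute_site_Rs _ _ _ h1) le_rfl, ← emb_wedge,
      down_succ', mul_assoc, mul_assoc (down _ _) (gi 0) (g 0),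
      hs.inv_mul (j := 0) (by omega), mul_one,
      h.tr1_up_half, wedgePow]
  have key : 𝓡.wedge X (i + 2) = (qnum 𝓡.q (i + 1) / qnum 𝓡.q (i + 2)) •
      ((𝓡.q ^ (i + 1) / qnum 𝓡.q (i + 1)) • (B * C) - B * g 0 * B * C) := by
    rw [wedge, hs.asym_succ_shift le_rfl hn, smul_mul_assoc]
    congr 1
    rw [← hC, ← hB, mul_sub, sub_mul, sub_mul, mul_smul_comm, mul_one, smul_mul_assoc, BB,
      smul_mul_assoc]
  rw [wedgePow, key, map_smul, map_sub, map_smul, t1, t2, smul_sub, smul_sub, smul_smul, smul_smul,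
    smul_smul]
  congr 2 <;> field_simp

end IsHecke
end RData


/-! ### Permutation relations of the characteristic coefficients -/

section Intertwine

variable {E : Type*} [Ring E] [Algebra ℂ E] {g gi : ℕ → E} {Z J J' : E} {c : ℂ}

theorem copy_intertwine (hg : ∀ j, Commute Z (g j)) (hgi : ∀ j, Commute Z (gi j))
    (hJ : c • (Z * J) = J' * Z) (m : ℕ) :
    c • (Z * copy g gi J m) = copy g gi J' m * Z := by
  induction m with
  | zero => exact hJ
  | succ m ih =>
    rw [copy, copy, mul_assoc _ _ Z, ← (hgi m).eq, ← mul_assoc _ Z, mul_assoc _ _ Z, ← ih,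
      ← mul_assoc, ← mul_assoc, (hg m).eq]
    simp only [mul_assoc, mul_smul_comm, smul_mul_assoc]

theorem copyProd_intertwine (hg : ∀ j, Commute Z (g j)) (hgi : ∀ j, Commute Z (gi j))
    (hJ : c • (Z * J) = J' * Z) (i : ℕ) :
    c ^ i • (Z * copyProd g gi J i) = copyProd g gi J' i * Z := by
  induction i with
  | zero => simp [copyProd_zero]
  | succ i ih =>
    rw [copyProd_succ, copyProd_succ, mul_assoc _ _ Z, ← copy_intertwine hg hgi hJ i,
      mul_smul_comm, ← mul_assoc (copyProd g gi J' i), ← ih, smul_mul_assoc, smul_smul, pow_succ',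
      mul_assoc]

end Intertwine

section Shift

variable {n : ℕ} {A : Type*} [Ring A] [Algebra ℂ A]

theorem sh_apply {k : ℕ} (Z : MatT n k A) (a b) :
    sh k Z a b = if a 0 = b 0 then Z (Fin.tail a) (Fin.tail b) else 0 := by
  have : (∀ j ∉ Set.range (Fin.succ : Fin k → Fin (k + 1)), a j = b j) ↔ a 0 = b 0 := by
    simp [Fin.range_succ]
  simp only [sh, locHom_apply, loc, Matrix.of_apply, this]
  rfl

theorem tail_snoc {k : ℕ} (a : Fin (k + 1) → Fin n) (x : Fin n) :
    (Fin.tail (snoc a x) : Fin (k + 1) → Fin n) = snoc (Fin.tail a) x := by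
  ext j
  refine Fin.lastCases ?_ (fun j => ?_) j
  · rw [Fin.tail, Fin.succ_last, snoc_last, snoc_last]
  · rw [Fin.tail, Fin.succ_castSucc, snoc_castSucc, snoc_castSucc, Fin.tail]

theorem ptr_sh (D : Mat1 n ℂ) {k : ℕ} (Z : MatT n (k + 1) A) :
    ptr D (k + 1) (sh (k + 1) Z) = sh k (ptr D k Z) := by
  ext a b
  have h0 : ∀ (c : Fin (k + 1) → Fin n) x, snoc c x 0 = c 0 := fun c x =>
    snoc_castSucc c x 0
  simp only [ptr_apply, sh_apply, h0, tail_snoc]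
  split_ifs <;> simp

theorem tr1_sh (D : Mat1 n ℂ) (k : ℕ) (Z : MatT n k A) :
    tr1 D k (sh k Z) = sc n (wtrT k D Z) := by
  induction k with
  | zero =>
    have : sh 0 Z = m1 (sc n (wtrT 0 D Z)) := by
      ext a b
      rw [sh_apply, m1_apply, wtrT_zero]
      simp [sc, Matrix.diagonal_apply, Subsingleton.elim (Fin.tail a) default,
        Subsingleton.elim (Fin.tail b) default]
    rw [this, tr1_zero_m1]
  | succ k ih => rw [tr1_succ, ptr_sh, ih, wtrT_succ]

end Shift

namespace RData

variable {n : ℕ} {𝓡 : RData n} {A : Type*} [Ring A] [Algebra ℂ A]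

/-- The trace over all factors but the first one of the antisymmetrized product of the copies, in
the factors `1, 2, ...`, of an operator `M` acting in the factors `0` and `1`. -/
def coTrace (𝓡 : RData n) (i : ℕ) (M : Mat2 n A) : Mat1 n A :=
  tr1 𝓡.D i (𝓡.shWedge i (site2 (i + 1) 0 M))

theorem coTrace_zero (M : Mat2 n A) : 𝓡.coTrace 0 M = 1 := by
  have : (1 : MatT n 1 A) = m1 1 := (map_one m1).symm
  rw [coTrace, shWedge, copyProd_zero, asym, mul_one, this, tr1_zero_m1]

/-- A relation of `T₁` with operators in the first two factors carries over to the coefficients. This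
is how the permutation relations of the coefficients follow from those of the matrices. -/
theorem coTrace_intertwine {T : Mat1 n A} {M M' : Mat2 n A} {c : ℂ}
    (hM : c • (fst T * M) = M' * fst T) (i : ℕ) :
    c ^ i • (T * 𝓡.coTrace i M) = 𝓡.coTrace i M' * T := by
  have hg : ∀ j, Commute (site (i + 1) 0 T) (Rs 𝓡 A (i + 1) (j + 1)) := fun j =>
    commute_site_Rs i T (j + 1) (by omega)
  have hgi : ∀ j, Commute (site (i + 1) 0 T) (Rsi 𝓡 A (i + 1) (j + 1)) := fun j =>
    site_commute_site2 (by omega) (by omega) (by omega) fun _ _ _ _ =>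
      (Algebra.commutes _ _).symm
  have hJ : c • (site (i + 1) 0 T * site2 (i + 1) 0 M) = site2 (i + 1) 0 M' * site (i + 1) 0 T := by
    cases i with
    | zero => simp [site2_of_le]
    | succ i =>
      have := congrArg (site2Hom (i + 2) 0 (by omega)) hM
      simpa only [map_mul, map_smul, ← site2_eq_hom, site2_fst (show 0 + 1 < i + 2 by omega)]
        using this
  rw [coTrace, coTrace, ← tr1_site_mul, ← tr1_mul_site, ← map_smul, shWedge, shWedge, ← mul_assoc,
    (commute_asym fun j _ => hg j : Commute (site (i + 1) 0 T) (asym 𝓡.q _ i)).eq, mul_assoc,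
    mul_assoc, ← mul_smul_comm, copyProd_intertwine hg hgi hJ]

theorem coTrace_snd (X : Mat1 n A) (i : ℕ) :
    𝓡.coTrace i (snd X) = sc n (𝓡.coeffR X i) := by
  cases i with
  | zero => rw [coTrace_zero, coeffR_zero, sc, map_one]
  | succ i =>
    rw [coTrace, coeffR_eq, ← tr1_sh, shWedge, wedge, map_mul (sh (i + 1)),
      map_asym (sh (i + 1)) 𝓡.q (g := Rs 𝓡 A (i + 1)) (g' := fun j => Rs 𝓡 A (i + 2) (j + 1))
        (fun j hj => sh_site2 (by omega) _),
      map_copyProd (sh (i + 1)) (g := Rs 𝓡 A (i + 1)) (gi := Rsi 𝓡 A (i + 1))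
        (g' := fun j => Rs 𝓡 A (i + 2) (j + 1))
        (gi' := fun j => Rsi 𝓡 A (i + 2) (j + 1)) (fun j hj => sh_site2 (by omega) _)
        (fun j hj => sh_site2 (by omega) _), sh_site (by omega), site2_snd (by omega)]

namespace IsHecke

theorem coTrace_conj (h : 𝓡.IsHecke) (X : Mat1 n A) (i : ℕ) :
    𝓡.coTrace i (𝓡.Rm A * fst X * 𝓡.Ri A) = sc n (𝓡.coeffR X i) := by
  cases i with
  | zero => rw [coTrace_zero, coeffR_zero, sc, map_one]
  | succ i =>
    rw [← h.tr1_shWedge, coTrace, site2_eq_hom (by omega), map_mul, map_mul, ← site2_eq_hom,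
      ← site2_eq_hom, ← site2_eq_hom, site2_fst (by omega)]
    rfl

theorem coTrace_conj' (h : 𝓡.IsHecke) (X : Mat1 n A) (i : ℕ) :
    𝓡.coTrace i (𝓡.Ri A * fst X * 𝓡.Rm A) = sc n (𝓡.coeffR X i) := by
  cases i with
  | zero => rw [coTrace_zero, coeffR_zero, sc, map_one]
  | succ i =>
    rw [← h.tr1_shWedge', coTrace, site2_eq_hom (by omega), map_mul, map_mul, ← site2_eq_hom,
      ← site2_eq_hom, ← site2_eq_hom, site2_fst (by omega)]
    rfl

theorem coeff_commute_of_conj (h : 𝓡.IsHecke) {X F : Mat1 n A}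
    (hXF : fst X * (𝓡.Rm A * fst F * 𝓡.Ri A) = 𝓡.Ri A * fst F * 𝓡.Rm A * fst X) (i : ℕ) :
    Commute (sc n (𝓡.coeffR F i)) X := by
  have := coTrace_intertwine (𝓡 := 𝓡) (c := 1) ((one_smul ℂ _).trans hXF) i
  rw [one_pow, one_smul, h.coTrace_conj, h.coTrace_conj'] at this
  exact this.symm

theorem coeff_commute_of_snd (h : 𝓡.IsHecke) {T F : Mat1 n A}
    (hTF : fst T * snd F = 𝓡.Rm A * fst F * 𝓡.Ri A * fst T) (i : ℕ) :
    Commute (sc n (𝓡.coeffR F i)) T := by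
  have := coTrace_intertwine (𝓡 := 𝓡) (c := 1) ((one_smul ℂ _).trans hTF) i
  rw [one_pow, one_smul, h.coTrace_conj, coTrace_snd] at this
  exact this.symm

end IsHecke

theorem _root_.QCalc.RE.conj (h : 𝓡.IsHecke) {X : Mat1 n A} (hX : RE 𝓡 X) :
    fst X * (𝓡.Rm A * fst X * 𝓡.Ri A) = 𝓡.Ri A * fst X * 𝓡.Rm A * fst X := by
  have h1 := congrArg (fun Z => 𝓡.Ri A * Z * 𝓡.Ri A) hX
  simp only [mul_assoc, h.Rm_mul_Ri, mul_one] at h1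
  rw [← mul_assoc (𝓡.Ri A) (𝓡.Rm A), h.Ri_mul_Rm, one_mul] at h1
  simpa only [mul_assoc] using h1

theorem _root_.QCalc.RE.commute (h : 𝓡.IsHecke) {X : Mat1 n A} (hX : RE 𝓡 X) (i : ℕ) :
    Commute (sc n (𝓡.coeffR X i)) X := h.coeff_commute_of_conj (hX.conj h) i

end RData

section Tail

variable {n : ℕ} {A : Type*} [Ring A] [Algebra ℂ A]

theorem tailSum_zero (q : ℂ) (a : ℕ → A) (X : Mat1 n A) : tailSum q a X 0 = 0 := by
  simp [tailSum]

/-- The sums over the powers of `X` obey the recursion of the wedge powers, up to normalization. -/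
theorem tail_succ {E : Type*} [Ring E] [Algebra ℂ E] (q : ℂ) (a : ℕ → E) (X : E)
    (h : ∀ k, Commute (a k) X) (i : ℕ) :
    ∑ j ∈ Finset.Icc 1 (i + 1), ((-q) ^ j)⁻¹ • (a (i + 1 - j) * X ^ j) =
      (-q)⁻¹ • (X * (a i + ∑ j ∈ Finset.Icc 1 i, ((-q) ^ j)⁻¹ • (a (i - j) * X ^ j))) := by
  have e : ∀ i, ∑ j ∈ Finset.Icc 1 i, ((-q) ^ j)⁻¹ • (a (i - j) * X ^ j) =
      ∑ j ∈ Finset.range i, ((-q) ^ (j + 1))⁻¹ • (a (i - (j + 1)) * X ^ (j + 1)) := fun i => by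
    rw [Finset.range_eq_Ico,
      Finset.sum_Ico_add' (fun j => ((-q) ^ j)⁻¹ • (a (i - j) * X ^ j)) 0 i 1]
    rfl
  rw [e, e, Finset.sum_range_succ', mul_add, smul_add, Finset.mul_sum,
    Finset.smul_sum, add_comm]
  congr 1
  · rw [zero_add, pow_one, pow_one, Nat.add_sub_cancel, (h i).eq]
  · refine Finset.sum_congr rfl fun j _ => ?_
    rw [mul_smul_comm, smul_smul, ← mul_assoc, ← (h _).eq, mul_assoc, ← pow_succ',
      show i + 1 - (j + 1 + 1) = i - (j + 1) by omega]
    congr 1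
    rw [pow_succ' (-q) (j + 1), mul_inv]

theorem tailSum_succ (q : ℂ) (a : ℕ → A) (X : Mat1 n A) (h : ∀ k, Commute (sc n (a k)) X) (i : ℕ) :
    tailSum q a X (i + 1) = (-q)⁻¹ • (X * (sc n (a i) + tailSum q a X i)) :=
  tail_succ q (fun k => sc n (a k)) X h i

end Tail

namespace RData
namespace IsHecke

variable {n : ℕ} {𝓡 : RData n} {A : Type*} [Ring A] [Algebra ℂ A]

/-- The Cayley-Hamilton-Newton identities. -/
theorem wedgePow_eq (h : 𝓡.IsHecke) {X : Mat1 n A} (hX : RE 𝓡 X) (i : ℕ)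
    (hn : ∀ j, 1 ≤ j → j ≤ i + 1 → qnum 𝓡.q j ≠ 0) :
    qnum 𝓡.q (i + 1) • 𝓡.wedgePow X i =
      -(𝓡.q ^ (i + 1)) • tailSum 𝓡.q (𝓡.coeffR X) X (i + 1) := by
  have hq := h.q_ne_zero
  rw [tailSum_succ _ _ _ (hX.commute h)]
  induction i with
  | zero =>
    have : 𝓡.wedgePow X 0 = X := by
      rw [wedgePow, wedge, copyProd_succ', copyProd_zero, mul_one, asym, one_mul, site_one,
        tr1_zero_m1]
    rw [this, tailSum_zero, coeffR_zero, qnum_one, sc, map_one, add_zero, mul_one, smul_smul]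
    congr 1
    field_simp
    simp
  | succ i ih =>
    rw [h.wedgePow_succ hX i hn, ← mul_smul_comm (qnum 𝓡.q (i + 1)),
      ih (fun j h1 h2 => hn j h1 (by omega)), ← tailSum_succ _ _ _ (hX.commute h),
      neg_smul, mul_neg, sub_neg_eq_add, mul_smul_comm, ← smul_add, ← mul_add, smul_smul]
    congr 1
    field_simp
    ring

/-- The trace of the copies of `R X₁ R` by the Cayley-Hamilton-Newton identities. -/
theorem coTrace_R_R (h : 𝓡.IsHecke) {X : Mat1 n A} (hX : RE 𝓡 X) (i : ℕ)
    (hn : ∀ j, 1 ≤ j → j ≤ i → qnum 𝓡.q j ≠ 0) :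
    𝓡.coTrace i (𝓡.Rm A * fst X * 𝓡.Rm A) =
      sc n (𝓡.coeffR X i) - (𝓡.q ^ 2 - 1) • tailSum 𝓡.q (𝓡.coeffR X) X i := by
  have hq := h.q_ne_zero
  cases i with
  | zero => rw [coTrace_zero, coeffR_zero, tailSum_zero, smul_zero, sub_zero, sc, map_one]
  | succ i =>
    have e : site2 (i + 2) 0 (𝓡.Rm A * fst X * 𝓡.Rm A) =
        Rs 𝓡 A (i + 2) 0 * site (i + 2) 0 X * Rs 𝓡 A (i + 2) 0 := by
      rw [site2_eq_hom (by omega), map_mul, map_mul, ← site2_eq_hom, ← site2_eq_hom,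
        site2_fst (by omega)]
      rfl
    rw [coTrace, e, h.tr1_shWedge_R_R hX i hn, mul_smul _ (qnum _ _), h.wedgePow_eq hX i hn,
      smul_smul, sub_eq_add_neg (sc n _), ← neg_smul]
    congr 2
    rw [inv_pow]
    field_simp
    ring

/-- `X` commutes with `R₁₂ L₁ R₁₂`. -/
def _root_.QCalc.RCommute (𝓡 : RData n) (L X : Mat1 n A) : Prop :=
  𝓡.Rm A * fst L * 𝓡.Rm A * fst X = fst X * 𝓡.Rm A * fst L * 𝓡.Rm A

theorem _root_.QCalc.RE.rcommute {X : Mat1 n A} (hX : RE 𝓡 X) : RCommute 𝓡 X X := hX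

theorem fst_mul (X Y : Mat1 n A) : fst (X * Y) = fst X * fst Y := by
  ext ⟨a, b⟩ ⟨c, d⟩
  simp [fst, Matrix.mul_apply, Matrix.kroneckerMap_apply, Fintype.sum_prod_type, Matrix.one_apply]

theorem _root_.QCalc.RCommute.mul {L X Y : Mat1 n A} (hX : RCommute 𝓡 L X) (hY : RCommute 𝓡 L Y) :
    RCommute 𝓡 L (X * Y) := by
  unfold RCommute at *
  rw [fst_mul, ← mul_assoc, hX, mul_assoc, mul_assoc, mul_assoc, ← mul_assoc (𝓡.Rm A),
    ← mul_assoc (𝓡.Rm A * _), hY]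
  simp only [mul_assoc]

theorem _root_.QCalc.RCommute.one (L : Mat1 n A) : RCommute 𝓡 L 1 := by
  simp [RCommute, fst]

theorem coeffComm (h : 𝓡.IsHecke) {L X : Mat1 n A} (hL : RE 𝓡 L) (hX : RCommute 𝓡 L X) (i : ℕ)
    (hn : ∀ j, 1 ≤ j → j ≤ i → qnum 𝓡.q j ≠ 0) :
    CoeffComm 𝓡.q (𝓡.coeffR L) L X i := by
  have h1 : (1 : ℂ) • (fst X * (𝓡.Rm A * fst L * 𝓡.Rm A)) = 𝓡.Rm A * fst L * 𝓡.Rm A * fst X := by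
    rw [one_smul, hX]; simp only [mul_assoc]
  have := coTrace_intertwine (𝓡 := 𝓡) h1 i
  rw [one_pow, one_smul, h.coTrace_R_R hL i hn, mul_sub, sub_mul, mul_smul_comm,
    smul_mul_assoc] at this
  rw [CoeffComm, smul_sub]
  rw [sub_eq_sub_iff_add_eq_add] at this ⊢
  rw [add_comm (sc n _ * X), add_comm ((_ : ℂ) • _)] at *
  rw [this]

theorem coeff_exchange (h : 𝓡.IsHecke) {L T : Mat1 n A} {c : ℂ} (hL : RE 𝓡 L)
    (hT : 𝓡.Rm A * fst L * 𝓡.Rm A * fst T = c • (fst T * snd L)) (i : ℕ)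
    (hn : ∀ j, 1 ≤ j → j ≤ i → qnum 𝓡.q j ≠ 0) :
    c ^ i • (T * sc n (𝓡.coeffR L i)) = sc n (𝓡.coeffR L i) * T -
      (𝓡.q ^ 2 - 1) • (tailSum 𝓡.q (𝓡.coeffR L) L i * T) := by
  have := coTrace_intertwine (𝓡 := 𝓡) hT.symm i
  rwa [h.coTrace_R_R hL i hn, coTrace_snd, sub_mul, smul_mul_assoc] at this

theorem wtr_mul_comm (h : 𝓡.IsHecke) {F M : Mat1 n A} (hM : RCommute 𝓡 F M) :
    wtr 𝓡.D (F * M) = wtr 𝓡.D (M * F) := by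
  have h1 : fst F * 𝓡.Rm A * fst M = 𝓡.Ri A * (fst M * 𝓡.Rm A * fst F * 𝓡.Rm A) := by
    rw [← hM]
    simp only [← mul_assoc]
    rw [h.Ri_mul_Rm, one_mul]
  have h2 : F * M = ptr2 𝓡.D (fst F * 𝓡.Rm A * fst M) := by
    rw [ptr2_mul_fst, ptr2_fst_mul, h.ptr2_R, mul_one]
  have h3 : M * F = ptr2 𝓡.D (fst M * 𝓡.Rm A * fst F) := by
    rw [ptr2_mul_fst, ptr2_fst_mul, h.ptr2_R, mul_one]
  rw [h2, h1, ← mul_assoc, ← h.wtr_ptr2_comm, ← mul_assoc, h.Rm_mul_Ri, one_mul, ← h3]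

theorem wtr_sub (D : Mat1 n ℂ) (X Y : Mat1 n A) : wtr D (X - Y) = wtr D X - wtr D Y := by
  simp [wtr, smul_sub]

theorem wtr_sum {κ : Type*} (D : Mat1 n ℂ) (s : Finset κ) (X : κ → Mat1 n A) :
    wtr D (∑ j ∈ s, X j) = ∑ j ∈ s, wtr D (X j) := by
  classical
  induction s using Finset.induction_on with
  | empty => simp [wtr]
  | insert a s ha ih => rw [Finset.sum_insert ha, Finset.sum_insert ha, wtr_add, ih]

/-- A family `a` that obeys the permutation relations of the coefficients with everything that
commutes with `R F₁ R` commutes with the traces of all such matrices. -/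
theorem commute_wtr (h : 𝓡.IsHecke) {F M : Mat1 n A} (hF : RCommute 𝓡 F F) (hM : RCommute 𝓡 F M)
    {N : ℕ} {a : ℕ → A} (ha : ∀ k ≤ N, Commute (sc n (a k)) F)
    (hc : ∀ X, RCommute 𝓡 F X → ∀ k ≤ N, CoeffComm 𝓡.q a F X k)
    {i : ℕ} (hi : i ≤ N) : Commute (a i) (wtr 𝓡.D M) := by
  have hpow : ∀ j, RCommute 𝓡 F (F ^ j) := fun j => by
    induction j with
    | zero => exact RCommute.one F
    | succ j ih => rw [pow_succ]; exact ih.mul hF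
  induction i using Nat.strong_induction_on generalizing M with
  | _ i ih =>
  have h1 := congrArg (wtr 𝓡.D) (hc M hM i hi)
  have h2 : wtr 𝓡.D (M * tailSum 𝓡.q a F i) = wtr 𝓡.D (tailSum 𝓡.q a F i * M) := by
    rw [tailSum, Finset.mul_sum, Finset.sum_mul, wtr_sum, wtr_sum]
    refine Finset.sum_congr rfl fun j hj => ?_
    rw [Finset.mem_Icc] at hj
    rw [mul_smul_comm, smul_mul_assoc, wtr_smul, wtr_smul, mul_assoc, wtr_sc_mul,
      ((ha (i - j) (by omega)).pow_right j).eq, ← mul_assoc, wtr_mul_sc,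
      ← (ih (i - j) (by omega) (hM.mul (hpow j)) (by omega)).eq]
    congr 2
    have hj1 : ∀ j, RCommute 𝓡 F (M * F ^ j) := fun j => hM.mul (hpow j)
    have : ∀ j M, RCommute 𝓡 F M → wtr 𝓡.D (M * F ^ j) = wtr 𝓡.D (F ^ j * M) := by
      intro j
      induction j with
      | zero => intro M _; simp
      | succ j ihj =>
        intro M hM
        rw [pow_succ', ← mul_assoc, ihj _ (hM.mul hF), ← mul_assoc,
          ← h.wtr_mul_comm ((hpow j).mul hM), mul_assoc]
    exact this j M hM
  rw [wtr_sub, wtr_smul, wtr_sub, h2, sub_self, smul_zero, wtr_mul_sc, wtr_sc_mul, sub_eq_zero] at h1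
  exact h1.symm

end IsHecke
end RData

section Scalars

variable {n : ℕ} {A : Type*} [Ring A]

theorem commute_sc_iff {x : A} {X : Mat1 n A} :
    Commute (sc n x) X ↔ ∀ i j, Commute x (X i j) := by
  constructor
  · intro h i j
    have := congrFun (congrFun h.eq i) j
    simpa [sc, Matrix.scalar_apply, Matrix.diagonal_mul, Matrix.mul_diagonal, commute_iff_eq] using this
  · intro h
    ext i j
    simpa [sc, Matrix.scalar_apply, Matrix.diagonal_mul, Matrix.mul_diagonal] using (h i j).eq

variable [Algebra ℂ A] {𝓡 : RData n}

/-- The subalgebra of the matrices whose entries commute with `x`. -/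
def entryCentralizer (m : Type*) [Fintype m] [DecidableEq m] (x : A) :
    Subalgebra ℂ (Matrix m m A) := Subalgebra.centralizer ℂ {Matrix.scalar m x}

theorem mem_entryCentralizer {m : Type*} [Fintype m] [DecidableEq m] {x : A} {X : Matrix m m A} :
    X ∈ entryCentralizer m x ↔ ∀ i j, Commute x (X i j) := by
  rw [entryCentralizer, Subalgebra.mem_centralizer_iff]
  simp only [Set.mem_singleton_iff, forall_eq]
  constructor
  · intro h i j
    have := congrFun (congrFun h i) j
    simpa [Matrix.scalar_apply, Matrix.diagonal_mul, Matrix.mul_diagonal, commute_iff_eq] using this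
  · intro h
    ext i j
    simpa [Matrix.scalar_apply, Matrix.diagonal_mul, Matrix.mul_diagonal] using (h i j).eq

theorem commute_wtrT {x : A} (k : ℕ) (D : Mat1 n ℂ) {Z : MatT n k A}
    (hZ : Z ∈ entryCentralizer _ x) : Commute x (wtrT k D Z) := by
  rw [mem_entryCentralizer] at hZ
  exact Commute.sum_right _ _ _ fun a _ => Commute.sum_right _ _ _ fun b _ =>
    (hZ _ _).smul_right _

theorem commute_coeffR {x : A} {X : Mat1 n A} (h : Commute (sc n x) X) (i : ℕ) :
    Commute x (𝓡.coeffR X i) := by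
  rw [commute_sc_iff] at h
  have hs : ∀ k j, site k j X ∈ entryCentralizer _ x := fun k j => by
    rw [mem_entryCentralizer]
    intro a b
    simp only [site, Matrix.of_apply]
    split_ifs
    · exact h _ _
    · exact Commute.zero_right _
    · exact Commute.zero_right _
  have hR : ∀ (S : Mat2 n ℂ) k j, site2 k j (S.map (algebraMap ℂ A)) ∈ entryCentralizer _ x :=
    fun S k j => by
      rw [mem_entryCentralizer]
      intro a b
      simp only [site2, Matrix.of_apply, Matrix.map_apply]
      split_ifs
      · exact (Algebra.commutes _ _).symm
      · exact Commute.zero_right _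
      · exact Commute.zero_right _
  have ho : ∀ m, 𝓡.overCopy i X m ∈ entryCentralizer _ x := fun m => by
    induction m with
    | zero => exact hs i 0
    | succ m ih => exact mul_mem (mul_mem (hR _ _ _) ih) (hR _ _ _)
  refine commute_wtrT i _ (mul_mem ?_ (list_prod_mem fun Y hY => ?_))
  · rw [mem_entryCentralizer]
    exact fun a b => (Algebra.commutes _ _).symm
  · obtain ⟨m, _, rfl⟩ := List.mem_map.1 hY
    exact ho m

end Scalars


/-! ### R-matrices of special linear type, and the Cayley-Hamilton identity -/

theorem exists_vecMulVec_of_rank_eq_one {m : Type*} [Fintype m] [DecidableEq m] {A : Matrix m m ℂ}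
    (h : A.rank = 1) : ∃ u v, A = Matrix.vecMulVec u v := by
  rw [Matrix.rank, finrank_eq_one_iff'] at h
  obtain ⟨⟨u, _⟩, _, hu⟩ := h
  choose c hc using fun j => hu ⟨A.mulVecLin (Pi.single j 1), LinearMap.mem_range_self _ _⟩
  refine ⟨u, c, ?_⟩
  ext i j
  have := congrFun (congrArg Subtype.val (hc j)) i
  simp only [SetLike.mk_smul_mk, Matrix.mulVecLin_apply, Matrix.mulVec_single_one, Pi.smul_apply,
    smul_eq_mul, Matrix.col_apply] at this
  rw [← this, Matrix.vecMulVec_apply, mul_comm]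

namespace RData

variable {n : ℕ} {𝓡 : RData n} {A : Type*} [Ring A] [Algebra ℂ A]

/-- The conditions on an R-matrix of special linear type in the form in which they are used; this
form is symmetric with respect to the exchange of `R` and `P R P`. -/
structure IsGood {n : ℕ} (𝓡 : RData n) : Prop extends IsHecke 𝓡 where
  pos : 0 < n
  qnum_ne_zero : ∀ i, 1 ≤ i → i ≤ n → qnum 𝓡.q i ≠ 0
  antisym_ne_zero : 𝓡.antisym n n ≠ 0
  antisym_eq_vecMulVec : ∃ u v, 𝓡.antisym n n = Matrix.vecMulVec u v
  trace_D : 𝓡.D.trace = 𝓡.q⁻¹ ^ n * qnum 𝓡.q n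

theorem ptr_one (D : Mat1 n ℂ) (k : ℕ) :
    ptr D k (1 : MatT n (k + 1) A) = D.trace • (1 : MatT n k A) := by
  ext a b
  simp only [ptr_apply, Matrix.one_apply, snoc_inj, Matrix.smul_apply, Matrix.trace,
    Matrix.diag_apply, Finset.sum_smul]
  refine Finset.sum_congr rfl fun c _ => ?_
  by_cases hab : a = b <;> simp [hab]

theorem asym_Rs_succ (k : ℕ) :
    asym 𝓡.q (Rs 𝓡 A (k + 2)) (k + 1) = emb (k + 1) (asym 𝓡.q (Rs 𝓡 A (k + 1)) (k + 1)) :=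
  (map_asym (emb (k + 1)) 𝓡.q (g := Rs 𝓡 A (k + 1)) (g' := Rs 𝓡 A (k + 2))
    fun j hj => emb_Rs 𝓡 A (by omega)).symm

theorem IsHecke.asym_idem (h : 𝓡.IsHecke) {k : ℕ} (hn : ∀ j, 1 ≤ j → j ≤ k → qnum 𝓡.q j ≠ 0) :
    asym 𝓡.q (Rs 𝓡 A k) k * asym 𝓡.q (Rs 𝓡 A k) k = asym 𝓡.q (Rs 𝓡 A k) k := by
  cases k with
  | zero => simp [asym]
  | succ k => exact (h.heckeSys k).asym_idem le_rfl hn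

theorem IsHecke.ptr_asym (h : 𝓡.IsHecke) (k : ℕ) (hn : ∀ j, 1 ≤ j → j ≤ k + 1 → qnum 𝓡.q j ≠ 0)
    (x : ℂ) :
    ptr 𝓡.D (k + 1) (asym 𝓡.q (Rs 𝓡 A (k + 2)) (k + 1) *
      (x • (1 : MatT n (k + 2) A) - Rs 𝓡 A (k + 2) k) * asym 𝓡.q (Rs 𝓡 A (k + 2)) (k + 1)) =
      (x * 𝓡.D.trace - 1) • asym 𝓡.q (Rs 𝓡 A (k + 1)) (k + 1) := by
  rw [asym_Rs_succ, ptr_mul_emb, ptr_emb_mul, map_sub, map_smul, ptr_one, Rs, h.ptr_site2_R,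
    smul_smul, mul_sub, mul_one, mul_smul_comm, mul_one, sub_mul, smul_mul_assoc, h.asym_idem hn,
    sub_smul, one_smul]

theorem Rm_complex : 𝓡.Rm ℂ = 𝓡.R := by ext; simp [Rm]

theorem Rs_complex (k : ℕ) : Rs 𝓡 ℂ k = fun j => site2 k j 𝓡.R := by
  funext j; rw [Rs, Rm_complex]

theorem IsSLType.isHecke (h : 𝓡.IsSLType) : 𝓡.IsHecke where
  q_ne_zero := h.q_ne_zero
  hecke := by
    have h1 := minpoly.aeval ℂ 𝓡.R
    rw [h.hecke, map_mul, map_sub, map_add, Polynomial.aeval_X, Polynomial.aeval_C,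
      Polynomial.aeval_C, Algebra.algebraMap_eq_smul_one, Algebra.algebraMap_eq_smul_one, sub_mul,
      mul_add, mul_smul_comm, mul_one, smul_mul_assoc, one_mul, smul_add, smul_smul,
      mul_inv_cancel₀ h.q_ne_zero, one_smul, sub_eq_zero] at h1
    rw [sub_smul, ← sub_eq_zero, ← sub_eq_zero.2 h1]
    abel
  braid := h.braid
  skew_left := h.skew_left
  skew_right := h.skew_right

/-- The trace of `D` is found by taking the weighted trace of `A⁽ⁿ⁾ (qⁿ / n_q - Rₙ) A⁽ⁿ⁾ = 0` over the
last factor. -/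
theorem IsSLType.isGood (h : 𝓡.IsSLType) : 𝓡.IsGood := by
  have hpos : 0 < n := by
    rcases Nat.eq_zero_or_pos n with rfl | hn
    · have h1 := h.hecke
      rw [minpoly.subsingleton] at h1
      simpa using congrArg (Polynomial.eval 𝓡.q) h1
    · exact hn
  have hq : ∀ i, 1 ≤ i → i ≤ n → qnum 𝓡.q i ≠ 0 := fun i h1 h2 => by
    rcases h1.eq_or_lt with rfl | h1
    · simp [qnum_one]
    · exact h.qnum_ne_zero i h1 h2
  have hA : 𝓡.antisym n n ≠ 0 := fun h0 => by simpa [h0] using h.rank_antisym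
  refine
    { h.isHecke with
      pos := hpos
      qnum_ne_zero := hq
      antisym_ne_zero := hA
      antisym_eq_vecMulVec := exists_vecMulVec_of_rank_eq_one h.rank_antisym
      trace_D := ?_ }
  obtain ⟨k, rfl⟩ : ∃ k, n = k + 1 := ⟨n - 1, by omega⟩
  have e := h.isHecke.ptr_asym (A := ℂ) k hq (𝓡.q ^ (k + 1) / qnum 𝓡.q (k + 1))
  have e0 := h.antisym_top
  rw [antisym_eq, Nat.add_sub_cancel] at e0
  rw [antisym_eq] at hA
  simp only [Rs_complex] at e
  rw [e0, map_zero] at e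
  have e1 := (smul_eq_zero.1 e.symm).resolve_right hA
  have := h.q_ne_zero
  have := hq (k + 1) (by omega) le_rfl
  rw [inv_pow]
  field_simp at e1 ⊢
  linear_combination e1

theorem site_sc {k : ℕ} (x : A) :
    site (k + 1) 0 (sc n x) = Matrix.scalar (Fin (k + 1) → Fin n) x := by
  ext a b
  simp only [site, Matrix.of_apply, sc, Matrix.scalar_apply, Matrix.diagonal_apply]
  rw [dif_pos (by omega)]
  by_cases hab : a = b
  · simp [hab]
  · rw [if_neg hab]
    split_ifs with h1 h2
    · exact absurd (funext fun j => if hj : j = 0 then by rw [hj]; exact h2 else h1 j hj) hab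
    · rfl
    · rfl

namespace IsGood

theorem tr1_asym (h : 𝓡.IsHecke) (k : ℕ) (hn : ∀ j, 1 ≤ j → j ≤ k + 1 → qnum 𝓡.q j ≠ 0) :
    ∃ c : ℂ, tr1 𝓡.D k (asym 𝓡.q (Rs 𝓡 A (k + 1)) (k + 1)) = c • (1 : Mat1 n A) := by
  induction k with
  | zero =>
    refine ⟨1, ?_⟩
    rw [asym, one_smul, ← map_one m1, tr1_zero_m1]
  | succ k ih =>
    obtain ⟨c, hc⟩ := ih fun j h1 h2 => hn j h1 (by omega)
    rw [tr1_succ, asym, map_smul, h.ptr_asym k (fun j h1 h2 => hn j h1 (by omega)), map_smul,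
      map_smul, hc, smul_smul, smul_smul]
    exact ⟨_, rfl⟩

theorem wtr_one (D : Mat1 n ℂ) : wtr D (1 : Mat1 n A) = algebraMap ℂ A D.trace := by
  simp only [wtr, Matrix.one_apply, Matrix.trace, Matrix.diag_apply, Algebra.algebraMap_eq_smul_one,
    Finset.sum_smul]
  simp

theorem qnum_ne' (h : 𝓡.IsGood) {i : ℕ} (hi : i ≤ n) : ∀ j, 1 ≤ j → j ≤ i → qnum 𝓡.q j ≠ 0 :=
  fun j h1 h2 => h.qnum_ne_zero j h1 (by omega)

theorem Am_idem (h : 𝓡.IsGood) : 𝓡.Am A n * 𝓡.Am A n = 𝓡.Am A n := by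
  rw [Am_eq]; exact h.toIsHecke.asym_idem (h.qnum_ne' le_rfl)

/-- As the antisymmetrizer is a projector of rank one, an operator that commutes with it acts on
its image by a scalar. -/
theorem Am_mul (h : 𝓡.IsGood) {Z : MatT n n A} (hZ : Commute (𝓡.Am A n) Z) :
    𝓡.Am A n * Z = 𝓡.Am A n * Matrix.scalar _ (𝓡.Am A n * Z).trace := by
  obtain ⟨u, v, huv⟩ := h.antisym_eq_vecMulVec
  have hA : ∀ a b, 𝓡.Am A n a b = algebraMap ℂ A (u a * v b) := fun a b => by
    rw [Am, huv]; rfl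
  have h1 : 𝓡.Am A n * Z = 𝓡.Am A n * Z * 𝓡.Am A n := by
    rw [mul_assoc, ← hZ.eq, ← mul_assoc, h.Am_idem]
  set l := ∑ c, ∑ d, (v c * u d) • Z c d with hl
  have h2 : 𝓡.Am A n * Z = 𝓡.Am A n * Matrix.scalar _ l := by
    rw [h1]
    ext a b
    simp only [Matrix.mul_apply, hA, ← Algebra.smul_def, ← Algebra.commutes, Matrix.scalar_apply,
      Matrix.diagonal_apply, hl, Finset.smul_sum, smul_smul, smul_ite, smul_zero,
      Finset.sum_ite_eq', Finset.mem_univ, if_true]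
    rw [Finset.sum_comm]
    refine Finset.sum_congr rfl fun c _ => Finset.sum_congr rfl fun d _ => ?_
    congr 1
    ring
  have h3 : ∑ a, u a * v a = 1 := by
    obtain ⟨a, b, hab⟩ : ∃ a b, u a * v b ≠ 0 := by
      by_contra! h0
      exact h.antisym_ne_zero (by rw [huv]; ext a b; exact h0 a b)
    have h5 : (∑ c, u a * v c * (u c * v b) : ℂ) = u a * v b := by
      have h6 := h.toIsHecke.asym_idem (A := ℂ) (h.qnum_ne' (i := n) le_rfl)
      rw [← Am_eq] at h6
      have h7 := congrFun (congrFun h6 a) b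
      have h8 : ∀ a b, 𝓡.Am ℂ n a b = u a * v b := fun a b => by rw [Am, huv]; rfl
      simpa only [Matrix.mul_apply, h8] using h7
    have h6 : (u a * v b) * ∑ c, u c * v c = u a * v b * 1 := by
      rw [mul_one]
      refine Eq.trans ?_ h5
      rw [Finset.mul_sum]
      exact Finset.sum_congr rfl fun c _ => by ring
    exact mul_left_cancel₀ hab h6
  have h4 : (𝓡.Am A n * Z).trace = l := by
    rw [h2, Matrix.trace]
    simp only [Matrix.diag_apply, Matrix.scalar_apply, Matrix.mul_diagonal, hA, ← Algebra.smul_def,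
      ← Finset.sum_smul, h3, one_smul]
  rw [h4, h2]

/-- The Cayley-Hamilton identity. -/
theorem cayley_hamilton (h : 𝓡.IsGood) {X : Mat1 n A} (hX : RE 𝓡 X) :
    sc n (𝓡.coeffR X n) + tailSum 𝓡.q (𝓡.coeffR X) X n = 0 := by
  obtain ⟨k, rfl⟩ : ∃ k, n = k + 1 := ⟨n - 1, by have := h.pos; omega⟩
  have hn := h.qnum_ne' le_rfl
  have hq := h.q_ne_zero
  have h1 := h.wedgePow_eq hX k hn
  obtain ⟨c, hc⟩ := tr1_asym (A := A) h.toIsHecke k hn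
  have hcomm : Commute (𝓡.Am A (k + 1))
      (copyProd (Rs 𝓡 A (k + 1)) (Rsi 𝓡 A (k + 1)) (site (k + 1) 0 X) (k + 1)) := by
    rw [Am_eq]
    exact (commute_asym fun j hj => (h.commute_Rs_copyProd hX (by omega)).symm).symm
  have h2 := h.Am_mul hcomm
  set l := (𝓡.Am A (k + 1) *
    copyProd (Rs 𝓡 A (k + 1)) (Rsi 𝓡 A (k + 1)) (site (k + 1) 0 X) (k + 1)).trace
  have h3 : 𝓡.wedgePow X k = c • sc (k + 1) l := by
    rw [wedgePow, wedge, ← Am_eq, h2, ← site_sc, tr1_mul_site, Am_eq, hc, smul_mul_assoc, one_mul]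
  have h4 : sc (k + 1) (𝓡.coeffR X (k + 1)) =
      (c * (𝓡.q⁻¹ ^ (k + 1) * qnum 𝓡.q (k + 1))) • sc (k + 1) l := by
    rw [coeffR_eq, ← wtr_tr1]
    change sc (k + 1) (wtr 𝓡.D (𝓡.wedgePow X k)) = _
    rw [h3, IsHecke.wtr_smul, ← one_mul (sc (k + 1) l), IsHecke.wtr_mul_sc, wtr_one, h.trace_D, ← Algebra.smul_def,
      smul_smul]
    ext i j
    simp [sc, Matrix.scalar_apply, Matrix.diagonal_apply]
  rw [h3, smul_smul] at h1
  have h5 : sc (k + 1) (𝓡.coeffR X (k + 1)) =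
      (𝓡.q⁻¹ ^ (k + 1)) • (qnum 𝓡.q (k + 1) * c) • sc (k + 1) l := by
    rw [h4, smul_smul]
    congr 1
    ring
  rw [h5, h1, smul_smul, mul_neg, ← mul_pow, inv_mul_cancel₀ hq, one_pow, neg_smul, one_smul,
    neg_add_cancel]

end IsGood

/-! ### The R-matrix `P R P` -/

/-- The data for the R-matrix `P R P`. -/
def op (𝓡 : RData n) : RData n where
  q := 𝓡.q
  γ := 𝓡.γ
  R := 𝓡.R.submatrix Prod.swap Prod.swap
  Ψ := 𝓡.Ψ.submatrix Prod.swap Prod.swap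

end RData

section Swap

variable {n : ℕ} {A : Type*} [Ring A] [Algebra ℂ A]

/-- Exchange of the two tensor factors. -/
def swapHom : Mat2 n A ≃ₐ[ℂ] Mat2 n A := Matrix.reindexAlgEquiv ℂ A (Equiv.prodComm _ _)

theorem swapHom_apply (M : Mat2 n A) : swapHom M = M.submatrix Prod.swap Prod.swap := rfl

theorem swapHom_fst (X : Mat1 n A) : swapHom (fst X) = snd X := by
  ext ⟨a, b⟩ ⟨c, d⟩
  simp [swapHom_apply, fst, snd, Matrix.kroneckerMap_apply, Matrix.one_apply]

theorem swapHom_snd (X : Mat1 n A) : swapHom (snd X) = fst X := by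
  ext ⟨a, b⟩ ⟨c, d⟩
  simp [swapHom_apply, fst, snd, Matrix.kroneckerMap_apply, Matrix.one_apply]

variable {𝓡 : RData n}

theorem swapHom_Rm : swapHom (𝓡.Rm A) = 𝓡.op.Rm A := rfl

theorem op_inv : 𝓡.op.R⁻¹ = 𝓡.R⁻¹.submatrix Prod.swap Prod.swap :=
  Matrix.inv_submatrix_equiv 𝓡.R (Equiv.prodComm _ _) (Equiv.prodComm _ _)

theorem swapHom_Ri : swapHom (𝓡.Ri A) = 𝓡.op.Ri A := by
  rw [RData.Ri, RData.Ri, op_inv]; rfl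

/-- Reversal of the order of the tensor factors. -/
def revHom (k : ℕ) : MatT n k A →ₐ[ℂ] MatT n k A := locHom Fin.rev Fin.rev_injective

theorem revHom_apply (k : ℕ) (Z : MatT n k A) (a b) :
    revHom k Z a b = Z (a ∘ Fin.rev) (b ∘ Fin.rev) := by
  have : ∀ j ∉ Set.range (Fin.rev : Fin k → Fin k), a j = b j := fun j hj =>
    absurd ⟨Fin.rev j, Fin.rev_rev j⟩ hj
  simp only [revHom, locHom_apply, loc, Matrix.of_apply, if_pos this]

theorem revHom_site {k i : ℕ} (h : i < k) (X : Mat1 n A) :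
    revHom k (site k i X) = site k (k - 1 - i) X := by
  rw [site_eq_loc h, site_eq_loc (by omega), revHom, locHom_apply, loc_comp Fin.rev_injective]
  congr 1
  ext j
  simp [oneMap, Fin.val_rev]
  omega

theorem revHom_site2 {k i : ℕ} (h : i + 1 < k) (X : Mat2 n A) :
    revHom k (site2 k i X) = site2 k (k - 2 - i) (swapHom X) := by
  have hs : m2 (swapHom X) = loc (Fin.rev : Fin 2 → Fin 2) (m2 X) := by
    ext a b
    have := revHom_apply 2 (m2 X) a b
    rw [revHom, locHom_apply] at this
    rw [this]
    rfl
  rw [site2_eq_loc h, site2_eq_loc (by omega), hs, loc_comp (pairMap_injective _ _ _), revHom,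
    locHom_apply, loc_comp Fin.rev_injective]
  congr 1
  ext j
  fin_cases j <;> simp [pairMap, Fin.val_rev] <;> omega

theorem wtrT_rev (k : ℕ) (D : Mat1 n ℂ) (Z : MatT n k A) :
    wtrT k D (revHom k Z) = wtrT k D Z := by
  simp only [wtrT, revHom_apply]
  refine Fintype.sum_equiv (Equiv.arrowCongr (Fin.revPerm (n := k)) (Equiv.refl (Fin n))) _ _
    fun a => ?_
  refine Fintype.sum_equiv (Equiv.arrowCongr (Fin.revPerm (n := k)) (Equiv.refl (Fin n))) _ _
    fun b => ?_
  congr 1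
  exact Fintype.prod_equiv Fin.revPerm _ _ fun i => by simp

end Swap

namespace RData

variable {n : ℕ} {𝓡 : RData n} {A : Type*} [Ring A] [Algebra ℂ A]

theorem IsHecke.op (h : 𝓡.IsHecke) : 𝓡.op.IsHecke where
  q_ne_zero := h.q_ne_zero
  hecke := by
    have := congrArg swapHom h.hecke
    rwa [map_mul, map_add, map_smul, map_one] at this
  braid := by
    have := congrArg (revHom 3) h.braid
    simp only [map_mul, revHom_site2 (show 0 + 1 < 3 by omega),
      revHom_site2 (show 1 + 1 < 3 by omega)] at this
    exact this.symm
  skew_left a c a' c' := by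
    have := h.skew_right c a c' a'
    rw [Finset.sum_comm] at this
    refine Eq.trans ?_ (this.trans ?_)
    · exact Finset.sum_congr rfl fun b _ => Finset.sum_congr rfl fun b' _ => mul_comm _ _
    · simp [perm, and_comm, eq_comm]
  skew_right a c a' c' := by
    have := h.skew_left c a c' a'
    rw [Finset.sum_comm] at this
    refine Eq.trans ?_ (this.trans ?_)
    · exact Finset.sum_congr rfl fun b _ => Finset.sum_congr rfl fun b' _ => mul_comm _ _
    · simp [perm, and_comm, eq_comm]

theorem op_D : 𝓡.op.D = 𝓡.Dop := rfl

theorem asym_op_rev (h : 𝓡.IsHecke) {k : ℕ} (hn : ∀ j, 1 ≤ j → j ≤ k → qnum 𝓡.q j ≠ 0) :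
    asym 𝓡.q (Rs 𝓡.op A k) k = revHom k (asym 𝓡.q (Rs 𝓡 A k) k) := by
  cases k with
  | zero => simp [asym]
  | succ k =>
    rw [← (h.heckeSys k).asym_rev le_rfl hn]
    refine (map_asym (revHom (k + 1)) 𝓡.q (g := fun j => Rs 𝓡 A (k + 1) (k + 1 - 2 - j))
      fun j hj => ?_).symm
    rw [Rs, revHom_site2 (by omega), swapHom_Rm, Rs]
    congr 1
    omega

/-- The reversal of the tensor factors exchanges the antisymmetrizers of `R` and of `P R P`. -/
theorem IsGood.op (h : 𝓡.IsGood) : 𝓡.op.IsGood where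
  toIsHecke := h.toIsHecke.op
  pos := h.pos
  qnum_ne_zero := h.qnum_ne_zero
  antisym_ne_zero h0 := h.antisym_ne_zero <| by
    have h1 := asym_op_rev (A := ℂ) h.toIsHecke (h.qnum_ne' (i := n) le_rfl)
    rw [antisym_eq] at h0 ⊢
    simp only [Rs_complex] at h1
    ext a b
    have h2 := congrFun (congrFun (h1.symm.trans h0) (a ∘ Fin.rev)) (b ∘ Fin.rev)
    rw [revHom_apply] at h2
    simpa [Function.comp_def] using h2
  antisym_eq_vecMulVec := by
    obtain ⟨u, v, huv⟩ := h.antisym_eq_vecMulVec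
    refine ⟨fun a => u (a ∘ Fin.rev), fun b => v (b ∘ Fin.rev), ?_⟩
    have h1 := asym_op_rev (A := ℂ) h.toIsHecke (h.qnum_ne' (i := n) le_rfl)
    simp only [Rs_complex] at h1
    rw [antisym_eq] at huv ⊢
    refine h1.trans ?_
    rw [huv]
    ext a b
    rw [revHom_apply]
    rfl
  trace_D := by
    have : 𝓡.op.D.trace = 𝓡.D.trace := by
      simp only [Matrix.trace, Matrix.diag_apply, D, Matrix.of_apply]
      exact Finset.sum_comm
    exact this.trans h.trace_D

/-- The coefficients of the characteristic polynomial of a left-invariant matrix are those of a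
right-invariant matrix for the R-matrix `P R P`. -/
theorem coeffL_eq (h : 𝓡.IsGood) (X : Mat1 n A) {i : ℕ} (hi : i ≤ n) :
    𝓡.coeffL X i = 𝓡.op.coeffR X i := by
  have hc : ∀ m < i, 𝓡.op.overCopy i X m = revHom i (𝓡.underCopy i X m) := by
    intro m
    induction m with
    | zero =>
      intro hm
      rw [overCopy, underCopy, revHom_site (by omega)]
      congr 1
      omega
    | succ m ih =>
      intro hm
      rw [overCopy, underCopy, map_mul, map_mul, ih (by omega), revHom_site2 (by omega),
        revHom_site2 (by omega), swapHom_Rm, swapHom_Ri, show i - 2 - (i - 2 - m) = m by omega]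
  rw [coeffL, coeffR, op_D, ← wtrT_rev, map_mul, map_list_prod, List.map_map, Am_eq, Am_eq,
    ← asym_op_rev h.toIsHecke (h.qnum_ne' hi)]
  congr 3
  exact List.map_congr_left fun m hm => (hc m (List.mem_range.1 hm)).symm

end RData


/-! ### Consequences of the relations of the calculus -/

section Kronecker

variable {n : ℕ} {A : Type*} [Ring A] [Algebra ℂ A]

theorem fst_one : fst (1 : Mat1 n A) = 1 := by simp [fst]

theorem snd_mul (X Y : Mat1 n A) : snd (X * Y) = snd X * snd Y := by
  rw [← swapHom_fst, RData.IsHecke.fst_mul, map_mul, swapHom_fst, swapHom_fst]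

theorem snd_one : snd (1 : Mat1 n A) = 1 := by simp [snd]

theorem fst_mul_snd_apply (X Y : Mat1 n A) (a b c d) :
    (fst X * snd Y) (a, b) (c, d) = X a c * Y b d := by
  simp [fst, snd, Matrix.mul_apply, Matrix.kroneckerMap_apply, Fintype.sum_prod_type,
    Matrix.one_apply]

theorem snd_mul_fst_apply (X Y : Mat1 n A) (a b c d) :
    (snd Y * fst X) (a, b) (c, d) = Y b d * X a c := by
  simp [fst, snd, Matrix.mul_apply, Matrix.kroneckerMap_apply, Fintype.sum_prod_type,
    Matrix.one_apply]

theorem fst_commute_snd_iff {X Y : Mat1 n A} :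
    Commute (fst X) (snd Y) ↔ ∀ a c b d, Commute (X a c) (Y b d) := by
  constructor
  · intro h a c b d
    have := congrFun (congrFun h.eq (a, b)) (c, d)
    rwa [fst_mul_snd_apply, snd_mul_fst_apply] at this
  · intro h
    ext ⟨a, b⟩ ⟨c, d⟩
    rw [fst_mul_snd_apply, snd_mul_fst_apply, (h a c b d).eq]

end Kronecker

theorem inv_intertwine {E : Type*} [Monoid E] {T T' X Y : E} (h : T * X = Y * T) (h1 : T * T' = 1)
    (h2 : T' * T = 1) : X * T' = T' * Y := by
  calc X * T' = T' * (T * X) * T' := by rw [← mul_assoc, h2, one_mul]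
    _ = T' * Y := by rw [h, ← mul_assoc, mul_assoc _ T, h1, mul_one]

theorem commute_conj {E : Type*} [Monoid E] {T T' X Y K : E} (h : T * X = Y * T) (h1 : T * T' = 1)
    (h2 : T' * T = 1) (hK : Commute K X) : Commute Y (T * K * T') := by
  have h3 := inv_intertwine h h1 h2
  rw [commute_iff_eq, mul_assoc, ← mul_assoc, ← h, mul_assoc T X, ← mul_assoc X, ← hK.eq,
    mul_assoc K, h3]
  simp only [mul_assoc]

section Calculus

variable {n : ℕ} {𝓡 : RData n} {A : Type*} [Ring A] [Algebra ℂ A]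

/-- The matrix form of the relations of the calculus that do not involve the quadratic relations
for `Ω` and the normalization conditions. -/
structure CalcEqs (𝓡 : RData n) (D : Calc n A) : Prop where
  rtt : 𝓡.Rm A * fst D.T * snd D.T = fst D.T * snd D.T * 𝓡.Rm A
  mul_inv : D.T * D.T' = 1
  inv_mul : D.T' * D.T = 1
  Ω_T : 𝓡.Rm A * fst D.Ω * 𝓡.Ri A * fst D.T = fst D.T * snd D.Ω
  L_L : RE 𝓡 D.L
  L_T : 𝓡.Rm A * fst D.L * 𝓡.Rm A * fst D.T = 𝓡.γ ^ 2 • (fst D.T * snd D.L)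
  L_Ω : RCommute 𝓡 D.L D.Ω
  K_K : 𝓡.Rm A * snd D.K * 𝓡.Rm A * snd D.K = snd D.K * 𝓡.Rm A * snd D.K * 𝓡.Rm A
  K_T : snd D.T * 𝓡.Rm A * snd D.K * 𝓡.Rm A = 𝓡.γ ^ 2 • (fst D.K * snd D.T)
  K_Ω : Commute (fst D.K) (snd D.Ω)
  K_L : Commute (fst D.K) (snd D.L)

theorem CalcEqs.of_holds {s : Kind} {D : Calc n A} (h : Holds (CalcRel 𝓡 s D)) :
    CalcEqs 𝓡 D where
  rtt := Matrix.ext fun i j => h _ _ (.functions _ _ (.rtt i j))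
  mul_inv := Matrix.ext fun i j => h _ _ (.functions _ _ (.mul_inv i j))
  inv_mul := Matrix.ext fun i j => h _ _ (.functions _ _ (.inv_mul i j))
  Ω_T := Matrix.ext fun i j => h _ _ (.Ω_T i j)
  L_L := Matrix.ext fun i j => h _ _ (.L_L i j)
  L_T := Matrix.ext fun i j => h _ _ (.L_T i j)
  L_Ω := Matrix.ext fun i j => h _ _ (.L_Ω i j)
  K_K := Matrix.ext fun i j => h _ _ (.K_K i j)
  K_T := Matrix.ext fun i j => h _ _ (.K_T i j)
  K_Ω := Matrix.ext fun i j => h _ _ (.K_Ω i j)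
  K_L := Matrix.ext fun i j => h _ _ (.K_L i j)

namespace CalcEqs

open RData.IsHecke (fst_mul)

variable {D : Calc n A} (e : CalcEqs 𝓡 D)

theorem fst_mul_inv (e : CalcEqs 𝓡 D) : fst D.T * fst D.T' = 1 := by
  rw [← fst_mul, e.mul_inv, fst_one]

theorem fst_inv_mul (e : CalcEqs 𝓡 D) : fst D.T' * fst D.T = 1 := by
  rw [← fst_mul, e.inv_mul, fst_one]

theorem snd_mul_inv (e : CalcEqs 𝓡 D) : snd D.T * snd D.T' = 1 := by
  rw [← snd_mul, e.mul_inv, snd_one]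

theorem snd_inv_mul (e : CalcEqs 𝓡 D) : snd D.T' * snd D.T = 1 := by
  rw [← snd_mul, e.inv_mul, snd_one]

theorem inv_left (e : CalcEqs 𝓡 D) : fst D.T' * (𝓡.Rm A * fst D.L * 𝓡.Rm A) =
    (𝓡.γ ^ 2 • snd D.L) * fst D.T' := by
  refine (inv_intertwine ?_ e.fst_mul_inv e.fst_inv_mul).symm
  rw [mul_smul_comm, e.L_T]

theorem inv_right (e : CalcEqs 𝓡 D) : 𝓡.Rm A * snd D.K * 𝓡.Rm A * snd D.T' =
    𝓡.γ ^ 2 • (snd D.T' * fst D.K) := by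
  rw [← mul_smul_comm]
  refine inv_intertwine ?_ e.snd_mul_inv e.snd_inv_mul
  rw [smul_mul_assoc, ← e.K_T]
  simp only [mul_assoc]

theorem commute_smul_iff (hγ : 𝓡.γ ≠ 0) {X Y : Mat2 n A} :
    Commute (𝓡.γ ^ 2 • X) Y ↔ Commute X Y :=
  ⟨fun h => by
    have := h.smul_left (𝓡.γ ^ 2)⁻¹
    rwa [smul_smul, inv_mul_cancel₀ (pow_ne_zero 2 hγ), one_smul] at this, fun h => h.smul_left _⟩

/-- Left-invariant matrices built from matrices that commute with `R L₁ R` commute with `L`. -/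
theorem commute_L_of (e : CalcEqs 𝓡 D) (hγ : 𝓡.γ ≠ 0) {X : Mat1 n A} (hX : RCommute 𝓡 D.L X) :
    Commute (snd D.L) (fst (D.T' * X * D.T)) := by
  rw [← commute_smul_iff hγ, fst_mul, fst_mul]
  refine commute_conj e.inv_left e.fst_inv_mul e.fst_mul_inv ?_
  rw [commute_iff_eq, hX]
  simp only [mul_assoc]

theorem rcommute_L_of (e : CalcEqs 𝓡 D) {X : Mat1 n A} (hX : Commute (fst X) (snd D.L)) :
    RCommute 𝓡 D.L (D.T * X * D.T') := by
  have h := commute_conj (T := fst D.T) (X := 𝓡.γ ^ 2 • snd D.L)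
    (Y := 𝓡.Rm A * fst D.L * 𝓡.Rm A) (by rw [e.L_T, mul_smul_comm]) e.fst_mul_inv e.fst_inv_mul
    (hX.smul_right _)
  rw [← fst_mul, ← fst_mul] at h
  rw [RCommute, h.eq]
  simp only [mul_assoc]

theorem commute_K_of (e : CalcEqs 𝓡 D) (hγ : 𝓡.γ ≠ 0) {X : Mat1 n A}
    (hX : Commute (snd X) (𝓡.Rm A * snd D.K * 𝓡.Rm A)) :
    Commute (fst D.K) (snd (D.T * X * D.T')) := by
  rw [← commute_smul_iff hγ, snd_mul, snd_mul]
  refine commute_conj ?_ e.snd_mul_inv e.snd_inv_mul hX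
  rw [smul_mul_assoc, ← e.K_T]
  simp only [mul_assoc]

theorem commute_RKR_of (e : CalcEqs 𝓡 D) {X : Mat1 n A} (hX : Commute (fst D.K) (snd X)) :
    Commute (𝓡.Rm A * snd D.K * 𝓡.Rm A) (snd (D.T' * X * D.T)) := by
  rw [snd_mul, snd_mul]
  refine commute_conj (X := 𝓡.γ ^ 2 • fst D.K) ?_ e.snd_inv_mul e.snd_mul_inv
    (hX.symm.smul_right _)
  rw [e.inv_right, mul_smul_comm]

theorem commute_conj_of (e : CalcEqs 𝓡 D) {X : Mat1 n A}
    (h : fst D.T * snd X = 𝓡.Rm A * fst X * 𝓡.Ri A * fst D.T)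
    (hX : Commute (fst D.K) (snd X)) :
    Commute (𝓡.Rm A * fst X * 𝓡.Ri A) (fst (D.T * D.K * D.T')) := by
  rw [fst_mul, fst_mul]
  exact commute_conj h e.fst_mul_inv e.fst_inv_mul hX

theorem F_eq (D : Calc n A) : D.F = D.L * (D.T * D.K * D.T') := by
  simp only [Calc.F, mul_assoc]

theorem K_F (e : CalcEqs 𝓡 D) (hγ : 𝓡.γ ≠ 0) : Commute (fst D.K) (snd D.F) := by
  rw [F_eq, snd_mul]
  refine e.K_L.mul_right (e.commute_K_of hγ ?_)
  rw [commute_iff_eq, ← mul_assoc, ← mul_assoc, ← e.K_K]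

theorem L_F (e : CalcEqs 𝓡 D) : RCommute 𝓡 D.L D.F := by
  rw [F_eq]
  exact e.L_L.rcommute.mul (e.rcommute_L_of e.K_L)

/-- The matrix `T K T⁻¹` is exchanged with `T` by means of `R⁻¹` and with the factor `γ²`, which is
inverse to the exchange of `L` with `T`. Therefore the factors cancel in `F = L T K T⁻¹`. -/
theorem T_M (h : 𝓡.IsHecke) (e : CalcEqs 𝓡 D) : fst D.T * snd (D.T * D.K * D.T') =
    𝓡.γ ^ 2 • (𝓡.Ri A * fst (D.T * D.K * D.T') * 𝓡.Ri A * fst D.T) := by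
  have h1 : fst D.T * snd D.T = 𝓡.Ri A * (fst D.T * snd D.T) * 𝓡.Rm A := by
    rw [mul_assoc, ← e.rtt, ← mul_assoc, ← mul_assoc, h.Ri_mul_Rm, one_mul]
  have h2 : 𝓡.Ri A * fst D.T * snd D.T = fst D.T * snd D.T * 𝓡.Ri A := by
    calc _ = 𝓡.Ri A * (fst D.T * snd D.T * 𝓡.Rm A) * 𝓡.Ri A := by
          simp only [mul_assoc, h.Rm_mul_Ri, mul_one]
      _ = _ := by
          rw [← e.rtt, ← mul_assoc, ← mul_assoc, h.Ri_mul_Rm, one_mul]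
  calc fst D.T * snd (D.T * D.K * D.T') = fst D.T * snd D.T * snd D.K * snd D.T' := by
        simp only [snd_mul, mul_assoc]
    _ = 𝓡.Ri A * fst D.T * (snd D.T * 𝓡.Rm A * snd D.K * 𝓡.Rm A) * 𝓡.Ri A * snd D.T' := by
        rw [h1]
        simp only [mul_assoc]
        rw [← mul_assoc (𝓡.Rm A) (𝓡.Ri A), h.Rm_mul_Ri, one_mul]
    _ = 𝓡.γ ^ 2 • (𝓡.Ri A * (fst D.T * fst D.K * (fst D.T' * fst D.T)) * snd D.T * 𝓡.Ri A *
          snd D.T') := by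
        rw [e.K_T, e.fst_inv_mul, mul_one]
        simp only [mul_assoc, mul_smul_comm, smul_mul_assoc]
    _ = 𝓡.γ ^ 2 • (𝓡.Ri A * fst (D.T * D.K * D.T') * (fst D.T * snd D.T * 𝓡.Ri A) *
          snd D.T') := by
        simp only [mul_assoc, fst_mul]
    _ = _ := by
        rw [← h2, ← mul_assoc, ← mul_assoc, mul_assoc _ (snd D.T), e.snd_mul_inv, mul_one]

theorem T_F (h : 𝓡.IsHecke) (e : CalcEqs 𝓡 D) (hγ : 𝓡.γ ≠ 0) :
    fst D.T * snd D.F = 𝓡.Rm A * fst D.F * 𝓡.Ri A * fst D.T := by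
  have h1 : fst D.T * snd D.L = (𝓡.γ ^ 2)⁻¹ • (𝓡.Rm A * fst D.L * 𝓡.Rm A * fst D.T) := by
    rw [e.L_T, smul_smul, inv_mul_cancel₀ (pow_ne_zero 2 hγ), one_smul]
  rw [F_eq, snd_mul, ← mul_assoc, h1, smul_mul_assoc, mul_assoc _ (fst D.T), e.T_M h,
    mul_smul_comm, smul_smul, inv_mul_cancel₀ (pow_ne_zero 2 hγ), one_smul, fst_mul D.L]
  simp only [mul_assoc]
  rw [← mul_assoc (𝓡.Rm A) (𝓡.Ri A), h.Rm_mul_Ri, one_mul]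

theorem conj_of_rcommute (h : 𝓡.IsHecke) {L X : Mat1 n A} (hX : RCommute 𝓡 L X) :
    fst L * (𝓡.Rm A * fst X * 𝓡.Ri A) = 𝓡.Ri A * fst X * 𝓡.Rm A * fst L := by
  have h1 : 𝓡.Ri A * (𝓡.Rm A * fst L * 𝓡.Rm A * fst X) * 𝓡.Ri A =
    𝓡.Ri A * (fst X * 𝓡.Rm A * fst L * 𝓡.Rm A) * 𝓡.Ri A := by rw [hX]
  simp only [mul_assoc, h.Rm_mul_Ri, mul_one] at h1
  rw [← mul_assoc (𝓡.Ri A) (𝓡.Rm A), h.Ri_mul_Rm, one_mul] at h1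
  simpa only [mul_assoc] using h1

/-- The matrix `F` obeys the reflection equation: `T K T⁻¹` commutes with `R F₁ R⁻¹`, and `L` is
exchanged with `F` like with itself. -/
theorem F_F (h : 𝓡.IsHecke) (e : CalcEqs 𝓡 D) (hγ : 𝓡.γ ≠ 0) : RE 𝓡 D.F := by
  have h1 := e.commute_conj_of (e.T_F h hγ) (e.K_F hγ)
  have h2 := conj_of_rcommute h e.L_F
  have h3 : fst D.F * (𝓡.Rm A * fst D.F * 𝓡.Ri A) = 𝓡.Ri A * fst D.F * 𝓡.Rm A * fst D.F := by
    have h0 : fst D.F = fst D.L * fst (D.T * D.K * D.T') := by rw [F_eq, fst_mul]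
    calc _ = fst D.L * fst (D.T * D.K * D.T') * (𝓡.Rm A * fst D.F * 𝓡.Ri A) := by rw [← h0]
      _ = _ := by rw [mul_assoc, ← h1.eq, ← mul_assoc, h2, mul_assoc _ (fst D.L), ← h0]
  have h4 : 𝓡.Rm A * (fst D.F * (𝓡.Rm A * fst D.F * 𝓡.Ri A)) * 𝓡.Rm A =
      𝓡.Rm A * (𝓡.Ri A * fst D.F * 𝓡.Rm A * fst D.F) * 𝓡.Rm A := by rw [h3]
  simp only [mul_assoc, h.Ri_mul_Rm, mul_one] at h4
  rw [← mul_assoc (𝓡.Rm A) (𝓡.Ri A), h.Rm_mul_Ri, one_mul] at h4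
  simpa only [RE, mul_assoc] using h4

/-- The forms are exchanged with `F` like with `L`, because `T K T⁻¹` commutes with `R Ω₁ R⁻¹`. -/
theorem F_Ω (h : 𝓡.IsHecke) (e : CalcEqs 𝓡 D) : RCommute 𝓡 D.F D.Ω := by
  have h1 := (e.commute_conj_of e.Ω_T.symm e.K_Ω).eq
  set M := D.T * D.K * D.T'
  have h2 : 𝓡.Ri A * (𝓡.Rm A * fst D.Ω * 𝓡.Ri A * fst M) * 𝓡.Rm A =
      𝓡.Ri A * (fst M * (𝓡.Rm A * fst D.Ω * 𝓡.Ri A)) * 𝓡.Rm A := by rw [h1]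
  simp only [mul_assoc, h.Ri_mul_Rm, mul_one] at h2
  rw [← mul_assoc (𝓡.Ri A) (𝓡.Rm A), h.Ri_mul_Rm, one_mul] at h2
  have h3 := e.L_Ω
  rw [RCommute] at h3 ⊢
  rw [F_eq, fst_mul]
  change 𝓡.Rm A * (fst D.L * fst M) * 𝓡.Rm A * fst D.Ω =
    fst D.Ω * 𝓡.Rm A * (fst D.L * fst M) * 𝓡.Rm A
  have h4 : fst M = 𝓡.Rm A * (𝓡.Ri A * fst M) := by
    rw [← mul_assoc, h.Rm_mul_Ri, one_mul]
  calc _ = 𝓡.Rm A * fst D.L * 𝓡.Rm A * (𝓡.Ri A * (fst M * (𝓡.Rm A * fst D.Ω))) := by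
        conv_lhs => rw [h4]
        simp only [mul_assoc]
    _ = (𝓡.Rm A * fst D.L * 𝓡.Rm A * fst D.Ω) * (𝓡.Ri A * fst M) * 𝓡.Rm A := by
        rw [← h2]
        simp only [mul_assoc]
    _ = _ := by
        rw [h3]
        conv_rhs => rw [h4]
        simp only [mul_assoc]

theorem K_K_op (e : CalcEqs 𝓡 D) : RE 𝓡.op D.K := by
  have := congrArg swapHom e.K_K
  simpa only [RE, map_mul, swapHom_snd, swapHom_Rm] using this

theorem K_T_op (e : CalcEqs 𝓡 D) : 𝓡.op.Rm A * fst D.K * 𝓡.op.Rm A * fst D.T' =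
    𝓡.γ ^ 2 • (fst D.T' * snd D.K) := by
  have := congrArg swapHom e.inv_right
  simpa only [map_mul, map_smul, swapHom_snd, swapHom_fst, swapHom_Rm] using this

theorem rcommute_K_of (e : CalcEqs 𝓡 D) {X : Mat1 n A} (hX : Commute (fst D.K) (snd X)) :
    RCommute 𝓡.op D.K (D.T' * X * D.T) := by
  have := congrArg swapHom (e.commute_RKR_of hX).eq
  simpa only [RCommute, map_mul, swapHom_snd, swapHom_Rm, mul_assoc] using this

theorem rcommute_monomial (h : 𝓡.IsHecke) (e : CalcEqs 𝓡 D) (hγ : 𝓡.γ ≠ 0) (w : List Bool) :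
    RCommute 𝓡 D.F (monomial D w) := by
  induction w with
  | nil => exact RCommute.one _
  | cons b w ih =>
    have : monomial D (b :: w) = (if b then D.Ω else D.F) * monomial D w := by simp [monomial]
    rw [this]
    cases b
    · exact (e.F_F h hγ).rcommute.mul ih
    · exact (e.F_Ω h).mul ih

theorem coeff_commute_entries {X Y : Mat1 n A} (h : Commute (fst Y) (snd X)) (i : ℕ) :
    Commute (sc n (𝓡.coeffR X i)) Y :=
  commute_sc_iff.2 fun a b => (commute_coeffR (commute_sc_iff.2 fun c d =>
    fst_commute_snd_iff.1 h a b c d) i).symm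

theorem snd_commute_fst {X Y : Mat1 n A} (h : Commute (fst X) (snd Y)) :
    Commute (fst Y) (snd X) :=
  fst_commute_snd_iff.2 fun a c b d => (fst_commute_snd_iff.1 h b d a c).symm

theorem commute_inverse {c : A} {T T' : Mat1 n A} (h1 : T * T' = 1) (h2 : T' * T = 1)
    (h : Commute (sc n c) T) : Commute (sc n c) T' := by
  rw [commute_iff_eq]
  calc sc n c * T' = T' * (T * sc n c) * T' := by rw [← mul_assoc, h2, one_mul]
    _ = T' * sc n c := by rw [← h.eq, mul_assoc, mul_assoc, h1, mul_one]

/-- The permutation relations of the coefficients of the characteristic polynomials. -/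
theorem coeffExchange (h : 𝓡.IsGood) (e : CalcEqs 𝓡 D) (hγ : 𝓡.γ ≠ 0) :
    CoeffExchange 𝓡 D (𝓡.coeffR D.L) (𝓡.coeffL D.K) (𝓡.coeffR D.F) := by
  have hH := h.toIsHecke
  have hO := h.op.toIsHecke
  have hF := e.F_F hH hγ
  have a_comm : ∀ i ≤ n, ∀ X ∈ muCommutant D, Commute (sc n (𝓡.coeffR D.L i)) X := by
    rintro i hi X (rfl | rfl | rfl | rfl)
    · exact e.L_L.commute hH i
    · exact coeff_commute_entries e.K_L i
    · exact coeff_commute_entries (e.commute_L_of hγ e.L_Ω).symm i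
    · exact coeff_commute_entries (e.commute_L_of hγ e.L_F).symm i
  have b_comm : ∀ i ≤ n, ∀ X ∈ nuCommutant D, Commute (sc n (𝓡.coeffL D.K i)) X := by
    rintro i hi X hX
    rw [RData.coeffL_eq h D.K hi]
    rcases hX with rfl | rfl | rfl | rfl
    · exact coeff_commute_entries (snd_commute_fst e.K_L) i
    · exact e.K_K_op.commute hO i
    · exact coeff_commute_entries (snd_commute_fst e.K_Ω) i
    · exact coeff_commute_entries (snd_commute_fst (e.K_F hγ)) i
  have cT : ∀ i, Commute (sc n (𝓡.coeffR D.F i)) D.T := hH.coeff_commute_of_snd (e.T_F hH hγ)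
  have cF : ∀ i, Commute (sc n (𝓡.coeffR D.F i)) D.F := hF.commute hH
  have c_comm : ∀ i ≤ n, ∀ X ∈ rhoCommutant D, Commute (sc n (𝓡.coeffR D.F i)) X := by
    rintro i hi X (rfl | rfl | rfl | rfl | rfl)
    · exact cT i
    · exact hH.coeff_commute_of_conj (conj_of_rcommute hH e.L_F) i
    · exact coeff_commute_entries (e.K_F hγ) i
    · exact cF i
    · exact ((commute_inverse e.mul_inv e.inv_mul (cT i)).mul_right (cF i)).mul_right (cT i)
  have hbK : ∀ {x : A}, Commute (sc n x) D.K → ∀ i ≤ n, Commute x (𝓡.coeffL D.K i) :=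
    fun hx i hi => by rw [RData.coeffL_eq h D.K hi]; exact commute_coeffR hx i
  have hn : ∀ i ≤ n, ∀ j, 1 ≤ j → j ≤ i → qnum 𝓡.q j ≠ 0 := fun i hi => h.qnum_ne' hi
  have b_cc : ∀ X, RCommute 𝓡.op D.K X → ∀ i ≤ n, CoeffComm 𝓡.q (𝓡.coeffL D.K) D.K X i := by
    intro X hX i hi
    have := hO.coeffComm e.K_K_op hX i (hn i hi)
    have ht : tailSum 𝓡.q (𝓡.coeffL D.K) D.K i = tailSum 𝓡.op.q (𝓡.op.coeffR D.K) D.K i :=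
      Finset.sum_congr rfl fun j hj => by
        rw [RData.coeffL_eq h D.K ((Nat.sub_le i j).trans hi)]
        rfl
    rw [CoeffComm, ht, RData.coeffL_eq h D.K hi]
    exact this
  refine
    { a_T := fun i hi => ?_
      b_T := fun i hi => ?_
      a_Ω := fun i hi => hH.coeffComm e.L_L e.L_Ω i (hn i hi)
      a_F := fun i hi => hH.coeffComm e.L_L e.L_F i (hn i hi)
      b_Θ := fun i hi => b_cc _ (e.rcommute_K_of e.K_Ω) i hi
      b_G := fun i hi => b_cc _ (e.rcommute_K_of (e.K_F hγ)) i hi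
      c_Ω := fun i hi => hH.coeffComm hF (e.F_Ω hH) i (hn i hi)
      a_comm := a_comm
      b_comm := b_comm
      c_comm := c_comm
      c_tr := fun i hi w => hH.commute_wtr hF.rcommute (e.rcommute_monomial hH hγ w)
        (fun k _ => cF k) (fun X hX k hk => hH.coeffComm hF hX k (hn k hk)) hi
      aa := fun i hi j _ => commute_coeffR (a_comm i hi D.L (by simp [muCommutant])) j
      bb := fun i hi j hj => hbK (b_comm i hi D.K (by simp [nuCommutant])) j hj
      cc := fun i hi j _ => commute_coeffR (c_comm i hi D.F (by simp [rhoCommutant])) j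
      ab := fun i hi j hj => hbK (a_comm i hi D.K (by simp [muCommutant])) j hj
      ac := fun i hi j hj => (commute_coeffR (c_comm j hj D.L (by simp [rhoCommutant])) i).symm
      bc := fun i hi j hj => (hbK (c_comm j hj D.K (by simp [rhoCommutant])) i hi).symm }
  · rw [pow_mul]
    exact hH.coeff_exchange e.L_L e.L_T i (hn i hi)
  · have h1 := hO.coeff_exchange e.K_K_op e.K_T_op i (hn i hi)
    have h2 : D.T * ((𝓡.γ ^ 2) ^ i • (D.T' * sc n (𝓡.op.coeffR D.K i))) * D.T =
        D.T * (sc n (𝓡.op.coeffR D.K i) * D.T' - (𝓡.q ^ 2 - 1) •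
          (tailSum 𝓡.q (𝓡.op.coeffR D.K) D.K i * D.T')) * D.T :=
      congrArg (fun Z => D.T * Z * D.T) h1
    rw [mul_smul_comm, ← mul_assoc, e.mul_inv, one_mul, smul_mul_assoc, mul_sub, sub_mul,
      mul_smul_comm, smul_mul_assoc, ← mul_assoc, mul_assoc _ D.T', e.inv_mul, mul_one, ← mul_assoc,
      mul_assoc _ D.T', e.inv_mul, mul_one] at h2
    rw [pow_mul, RData.coeffL_eq h D.K hi, h2, tailSum, Finset.mul_sum]
    congr 2
    refine Finset.sum_congr rfl fun j hj => ?_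
    rw [RData.coeffL_eq h D.K ((Nat.sub_le i j).trans hi), mul_smul_comm, mul_assoc,
      ((e.K_K_op.commute hO (i - j)).pow_right j).eq]

end CalcEqs
end Calculus


/-! ### Spectral resolutions -/

section ElementarySymmetric

variable {n : ℕ}

theorem list_prod_filter {C : Type*} [CommMonoid C] (p : Fin n → Prop) [DecidablePred p]
    (f : Fin n → C) : (((List.finRange n).filter fun α => p α).map f).prod =
      ∏ α ∈ Finset.univ.filter p, f α := by
  rw [← List.prod_toFinset f ((List.nodup_finRange n).filter _)]
  congr 1
  ext α
  simp

theorem esymm_eq_sum {C : Type*} [CommRing C] (x : Fin n → C) (i : ℕ) :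
    esymm x i = ∑ t ∈ Finset.powersetCard i Finset.univ, ∏ α ∈ t, x α := by
  refine Finset.sum_congr rfl fun t _ => ?_
  rw [list_prod_filter]
  simp

theorem map_esymm {B C : Type*} [Ring B] [Ring C] (f : B →+* C) (x : Fin n → B) (i : ℕ) :
    f (esymm x i) = esymm (fun α => f (x α)) i := by
  simp only [esymm, map_sum, map_list_prod, List.map_map]
  rfl

theorem prod_sub_eq_sum_esymm {C : Type*} [CommRing C] [Algebra ℂ C] (q : ℂ) (y : C)
    (x : Fin n → C) : ∏ α, (y - q • x α) =
      ∑ i ∈ Finset.range (n + 1), (-q) ^ i • (esymm x i * y ^ (n - i)) := by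
  have e : ∀ α, y - q • x α = (-q) • x α + y := fun α => by rw [neg_smul]; ring
  simp only [e]
  rw [Finset.prod_add, Finset.sum_powerset, Finset.card_univ, Fintype.card_fin]
  refine Finset.sum_congr rfl fun i _ => ?_
  rw [esymm_eq_sum, Finset.sum_mul, Finset.smul_sum]
  refine Finset.sum_congr rfl fun t ht => ?_
  obtain ⟨_, hc⟩ := Finset.mem_powersetCard.1 ht
  rw [Finset.prod_const, Finset.card_sdiff_of_subset (Finset.subset_univ _), Finset.card_univ,
    Fintype.card_fin, hc, Finset.prod_smul, Finset.prod_const, hc, smul_mul_assoc]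

theorem esymm_zero {C : Type*} [Ring C] (x : Fin n → C) : esymm x 0 = 1 := by
  simp [esymm]

/-- The elementary symmetric functions are affine in each variable. -/
theorem esymm_update_succ {C : Type*} [CommRing C] (x : Fin n → C) (β : Fin n) (z : C) (i : ℕ) :
    esymm (Function.update x β z) (i + 1) =
      esymm (Function.update x β 0) (i + 1) + z * esymm (Function.update x β 0) i := by
  have key : ∀ (z : C) (k : ℕ), esymm (Function.update x β z) k =
      (z ::ₘ (Finset.univ.erase β).val.map x).esymm k := by
    intro z k
    rw [esymm_eq_sum, ← Finset.esymm_map_val]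
    congr 1
    have h1 : (Finset.univ : Finset (Fin n)).val = β ::ₘ (Finset.univ.erase β).val := by
      rw [← Finset.insert_val_of_notMem (by simp), Finset.insert_erase (Finset.mem_univ β)]
    rw [h1, Multiset.map_cons, Function.update_self]
    congr 1
    refine Multiset.map_congr rfl fun α hα => ?_
    rw [Function.update_of_ne (Finset.ne_of_mem_erase (s := Finset.univ) hα)]
  have hs : ∀ (z : C) (s : Multiset C) k, (z ::ₘ s).esymm (k + 1) = s.esymm (k + 1) + z * s.esymm k :=
    fun z s k => by
      simp [Multiset.esymm, Multiset.powersetCard_cons, Multiset.map_map, Multiset.sum_map_mul_left]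
  have h0 : ∀ (s : Multiset C) k, (0 ::ₘ s).esymm k = s.esymm k := fun s k => by
    cases k with
    | zero => simp [Multiset.esymm]
    | succ k => rw [hs, zero_mul, add_zero]
  rw [key, key, key, hs, h0, h0]

end ElementarySymmetric

section Commutative

variable {n : ℕ} {C : Type*} [CommRing C] [Algebra ℂ C]

/-- The Lagrange idempotents in a commutative algebra. -/
def lag (q : ℂ) (y : C) (x : Fin n → C) (d : Fin n → Fin n → C) (α : Fin n) : C :=
  ∏ β ∈ Finset.univ.filter (fun β => β ≠ α), (y - q • x β) * (q⁻¹ • d α β)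

variable {q : ℂ} {y : C} {x : Fin n → C} {d : Fin n → Fin n → C}

theorem mul_lag (hy : ∏ α, (y - q • x α) = 0) (α : Fin n) :
    y * lag q y x d α = q • (x α * lag q y x d α) := by
  have h : (y - q • x α) * lag q y x d α = 0 := by
    rw [lag, Finset.prod_mul_distrib, Finset.filter_ne', ← mul_assoc,
      Finset.mul_prod_erase Finset.univ (fun α => y - q • x α) (Finset.mem_univ α), hy, zero_mul]
  rw [sub_mul, sub_eq_zero] at h
  rw [h, smul_mul_assoc]

theorem lag_mul_lag_of_ne (hy : ∏ α, (y - q • x α) = 0) {α β : Fin n} (h : α ≠ β) :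
    lag q y x d α * lag q y x d β = 0 := by
  obtain ⟨r, hr⟩ : (y - q • x α) ∣ lag q y x d β :=
    (Dvd.intro _ rfl).trans (Finset.dvd_prod_of_mem
      (fun γ => (y - q • x γ) * (q⁻¹ • d β γ)) (Finset.mem_filter.2 ⟨Finset.mem_univ α, h⟩))
  have h1 := mul_lag (d := d) hy α
  rw [hr, ← mul_assoc, mul_comm (lag q y x d α), sub_mul, h1, smul_mul_assoc, sub_self, zero_mul]

open Polynomial in
/-- By Lagrange interpolation, `∑ P_α - 1` vanishes at all roots, and hence is divisible by the
characteristic polynomial. -/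
theorem sum_lag (hq : q ≠ 0) (hd : ∀ α β, α ≠ β → (x α - x β) * d α β = 1)
    (hy : ∏ α, (y - q • x α) = 0) : ∑ α, lag q y x d α = 1 := by
  let p : C[X] := ∑ α, lag q X (fun β => Polynomial.C (x β)) (fun α β => Polynomial.C (d α β)) α - 1
  have hC : ∀ (c : ℂ) (z : C), c • (Polynomial.C z : C[X]) = Polynomial.C (c • z) := fun c z =>
    Polynomial.smul_C c z
  have hev : ∀ z, p.eval z = ∑ α, lag q z x d α - 1 := fun z => by
    simp [p, lag, Polynomial.eval_finsetSum, Polynomial.eval_prod, hC]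
  have hdiv : ∏ α : Fin n, (X - Polynomial.C (q • x α)) ∣ p := by
    refine Finset.prod_dvd_of_coprime ?_ fun γ _ => ?_
    · intro α _ β _ hαβ
      refine isCoprime_X_sub_C_of_isUnit_sub (IsUnit.of_mul_eq_one (q⁻¹ • d α β) ?_)
      rw [← smul_sub, smul_mul_smul_comm, mul_inv_cancel₀ hq, one_smul, hd α β hαβ]
    · rw [Polynomial.dvd_iff_isRoot, Polynomial.IsRoot, hev, sub_eq_zero,
        Finset.sum_eq_single γ]
      · refine Finset.prod_eq_one fun β hβ => ?_
        rw [← smul_sub, smul_mul_smul_comm, mul_inv_cancel₀ hq, one_smul,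
          hd γ β (Finset.mem_filter.1 hβ).2.symm]
      · intro α _ hα
        refine Finset.prod_eq_zero (Finset.mem_filter.2 ⟨Finset.mem_univ γ, hα.symm⟩) ?_
        rw [sub_self, zero_mul]
      · simp
  obtain ⟨r, hr⟩ := hdiv
  have := hev y
  rw [hr, Polynomial.eval_mul, Polynomial.eval_prod] at this
  simp only [Polynomial.eval_sub, Polynomial.eval_X, Polynomial.eval_C, hy, zero_mul] at this
  exact (sub_eq_zero.1 this.symm)

theorem lag_mul_self (hq : q ≠ 0) (hd : ∀ α β, α ≠ β → (x α - x β) * d α β = 1)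
    (hy : ∏ α, (y - q • x α) = 0) (α : Fin n) :
    lag q y x d α * lag q y x d α = lag q y x d α := by
  conv_rhs => rw [← mul_one (lag q y x d α), ← sum_lag hq hd hy, Finset.mul_sum,
    Finset.sum_eq_single α (fun β _ h => lag_mul_lag_of_ne hy h.symm) (by simp)]

/-- On the range of the idempotent number `β`, the matrix which replaces the coefficient becomes the
elementary symmetric function with `x β` multiplied by `q ^ 2`: the sum over the powers of `y` is
there `-x β` times the elementary symmetric function without `x β`. -/
theorem lag_mul_tail (hq : q ≠ 0) (hy : ∏ α, (y - q • x α) = 0) (β : Fin n) (i : ℕ) :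
    lag q y x d β * (esymm x i - (q ^ 2 - 1) •
      ∑ j ∈ Finset.Icc 1 i, ((-q) ^ j)⁻¹ • (esymm x (i - j) * y ^ j)) =
      esymm (Function.update x β (q ^ 2 • x β)) i * lag q y x d β := by
  have e0 : ∀ i, esymm x (i + 1) = esymm (Function.update x β 0) (i + 1) +
      x β * esymm (Function.update x β 0) i := fun i => by
    conv_lhs => rw [← Function.update_eq_self β x, esymm_update_succ]
  have e1 : ∀ i, lag q y x d β *
      ∑ j ∈ Finset.Icc 1 (i + 1), ((-q) ^ j)⁻¹ • (esymm x (i + 1 - j) * y ^ j) =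
      -(x β * esymm (Function.update x β 0) i * lag q y x d β) := by
    have hq' : (-q)⁻¹ * q = -1 := by field_simp
    intro i
    rw [tail_succ q (esymm x) y (fun _ => Commute.all _ _), mul_smul_comm, ← mul_assoc,
      mul_comm (lag q y x d β), mul_lag hy, smul_mul_assoc, smul_smul, mul_assoc, mul_add, hq',
      neg_one_smul]
    induction i with
    | zero => simp [esymm_zero]
    | succ i ih =>
      rw [tail_succ q (esymm x) y (fun _ => Commute.all _ _), mul_smul_comm, ← mul_assoc _ y,
        mul_comm (lag q y x d β) y, mul_lag hy, smul_mul_assoc, smul_smul, mul_assoc (x β),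
        mul_add (lag q y x d β), hq', neg_one_smul, ih, e0]
      ring
  cases i with
  | zero => simp [esymm_zero]
  | succ i =>
    rw [mul_sub, mul_smul_comm, e1, e0, esymm_update_succ x β (q ^ 2 • x β), smul_neg, sub_smul, one_smul]
    simp only [Algebra.smul_def]
    ring

end Commutative


section Model

variable {n : ℕ} {A : Type u} [Ring A] [Algebra ℂ A] {q : ℂ} {X : Mat1 n A} {e : Eig n A}

/-- The eigenvalues commute with each other and with the matrix, and have invertible differences. -/
structure EigFor (X : Mat1 n A) (e : Eig n A) : Prop where
  comm_x : ∀ α β, Commute (e.x α) (e.x β)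
  comm_X : ∀ α, Commute (sc n (e.x α)) X
  mul_d : ∀ α β, α ≠ β → (e.x α - e.x β) * e.d α β = 1
  d_mul : ∀ α β, α ≠ β → e.d α β * (e.x α - e.x β) = 1
  d_diag : ∀ α, e.d α α = 0

theorem commute_of_inv {E : Type*} [Monoid E] {c x d : E} (h1 : x * d = 1) (h2 : d * x = 1)
    (h : Commute c x) : Commute c d := by
  rw [commute_iff_eq]
  calc c * d = d * (x * c) * d := by rw [← mul_assoc, h2, one_mul]
    _ = d * c := by rw [← h.eq, mul_assoc, mul_assoc, h1, mul_one]

open scoped IsMulCommutative in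
/-- The matrix and its eigenvalues live in a commutative algebra. -/
theorem EigFor.exists_model (h : EigFor X e) : ∃ (C : Type u) (_ : CommRing C) (_ : Algebra ℂ C)
    (φ : C →ₐ[ℂ] Mat1 n A) (y : C) (x : Fin n → C) (d : Fin n → Fin n → C),
    Function.Injective φ ∧ φ y = X ∧ (∀ α, φ (x α) = sc n (e.x α)) ∧ (∀ α β, φ (d α β) = sc n (e.d α β)) ∧
      ∀ α β, α ≠ β → (x α - x β) * d α β = 1 := by
  let s : Set (Mat1 n A) := {X} ∪ (Set.range (fun α => sc n (e.x α)) ∪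
    Set.range (fun p : Fin n × Fin n => sc n (e.d p.1 p.2)))
  have hd : ∀ c : Mat1 n A, (∀ α, Commute c (sc n (e.x α))) → ∀ α β, Commute c (sc n (e.d α β)) := by
    intro c hc α β
    by_cases hab : α = β
    · rw [hab, h.d_diag, sc, map_zero]
      exact Commute.zero_right c
    · refine commute_of_inv (x := sc n (e.x α) - sc n (e.x β)) ?_ ?_ ((hc α).sub_right (hc β))
      · rw [sc, sc, sc, ← map_sub, ← map_mul, h.mul_d α β hab, map_one]
      · rw [sc, sc, sc, ← map_sub, ← map_mul, h.d_mul α β hab, map_one]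
  have hxx : ∀ α β, Commute (sc n (e.x α)) (sc n (e.x β)) := fun α β =>
    (h.comm_x α β).map (Matrix.scalar (Fin n))
  have hXd := hd X fun α => (h.comm_X α).symm
  have hxd := fun γ => hd (sc n (e.x γ)) (hxx γ)
  have hdd := fun γ δ => hd (sc n (e.d γ δ)) fun α => (hxd α γ δ).symm
  have hcomm : ∀ a ∈ s, ∀ b ∈ s, a * b = b * a := by
    rintro a (rfl | ⟨α, rfl⟩ | ⟨α, rfl⟩) b (rfl | ⟨β, rfl⟩ | ⟨β, rfl⟩)
    · rfl
    · exact (h.comm_X β).symm.eq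
    · exact hXd _ _
    · exact (h.comm_X α).eq
    · exact hxx _ _
    · exact hxd _ _ _
    · exact (hXd _ _).symm.eq
    · exact (hxd _ _ _).symm.eq
    · exact hdd _ _ _ _
  have := Algebra.isMulCommutative_adjoin ℂ hcomm
  refine ⟨Algebra.adjoin ℂ s, inferInstance, inferInstance, (Algebra.adjoin ℂ s).val,
    ⟨X, Algebra.subset_adjoin (Or.inl rfl)⟩,
    fun α => ⟨sc n (e.x α), Algebra.subset_adjoin (Or.inr (Or.inl ⟨α, rfl⟩))⟩,
    fun α β => ⟨sc n (e.d α β), Algebra.subset_adjoin (Or.inr (Or.inr ⟨(α, β), rfl⟩))⟩,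
    Subtype.val_injective, rfl, fun _ => rfl, fun _ _ => rfl, fun α β hab => ?_⟩
  apply Subtype.ext
  change (sc n (e.x α) - sc n (e.x β)) * sc n (e.d α β) = 1
  rw [sc, sc, sc, ← map_sub, ← map_mul, h.mul_d α β hab, map_one]

theorem sc_smul (c : ℂ) (x : A) : sc n (c • x) = c • sc n x := by
  ext i j
  simp [sc, Matrix.diagonal_apply]

variable {C : Type*} [CommRing C] [Algebra ℂ C] {φ : C →ₐ[ℂ] Mat1 n A} {y : C} {x : Fin n → C}
  {d : Fin n → Fin n → C}

theorem proj_eq_map (hy : φ y = X) (hx : ∀ α, φ (x α) = sc n (e.x α))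
    (hd : ∀ α β, φ (d α β) = sc n (e.d α β)) (α : Fin n) :
    proj q X e α = φ (lag q y x d α) := by
  rw [lag, ← list_prod_filter, map_list_prod, List.map_map, proj]
  congr 1
  refine List.map_congr_left fun β _ => ?_
  simp only [Function.comp_apply, map_mul, map_sub, map_smul, hy, hx, hd, sc_smul]

theorem charProd_eq_map (hy : φ y = X) (hx : ∀ α, φ (x α) = sc n (e.x α)) :
    charProd q X e = φ (∏ α, (y - q • x α)) := by
  rw [Fin.prod_univ_def, map_list_prod, List.map_map, charProd]
  congr 1
  refine List.map_congr_left fun β _ => ?_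
  simp only [Function.comp_apply, map_sub, map_smul, hy, hx]

theorem sc_esymm (x : Fin n → A) (i : ℕ) :
    sc n (esymm x i) = esymm (fun α => sc n (x α)) i := map_esymm (Matrix.scalar (Fin n)) x i

theorem esymm_eq_map (hx : ∀ α, φ (x α) = sc n (e.x α)) (i : ℕ) :
    sc n (esymm e.x i) = φ (esymm x i) := by
  rw [sc_esymm]
  refine Eq.trans ?_ (map_esymm φ.toRingHom x i).symm
  congr 1
  funext α
  exact (hx α).symm

theorem EigFor.charProd_eq (h : EigFor X e) : charProd q X e =
    ∑ i ∈ Finset.range (n + 1), (-q) ^ i • (sc n (esymm e.x i) * X ^ (n - i)) := by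
  obtain ⟨C, _, _, φ, y, x, d, hφ, hy, hx, hd, hxd⟩ := h.exists_model
  rw [charProd_eq_map hy hx, prod_sub_eq_sum_esymm, map_sum]
  simp only [map_smul, map_mul, map_pow, hy, esymm_eq_map hx]

/-- The family `x` with the member number `β` multiplied by `q ^ 2`. -/
def scaled (q : ℂ) (x : Fin n → A) (β : Fin n) : Fin n → A := fun α => q2δ q α β • x α

theorem scaled_eq (q : ℂ) (x : Fin n → A) (β : Fin n) :
    scaled q x β = Function.update x β (q ^ 2 • x β) := by
  funext α
  by_cases h : α = β
  · subst h; simp [scaled, q2δ]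
  · simp [scaled, q2δ, h]

end Model

section Resolution

variable {n : ℕ} {A : Type u} [Ring A] [Algebra ℂ A] {q : ℂ} {X : Mat1 n A} {e : Eig n A}

/-- The matrix `a_i - (q² - 1) ∑_{j ≥ 1} (-q)^(-j) a_{i-j} X^j` by which the coefficient `a_i` is
replaced when it is moved through a matrix. -/
def newtonSum (q : ℂ) (a : ℕ → A) (X : Mat1 n A) (i : ℕ) : Mat1 n A :=
  sc n (a i) - (q ^ 2 - 1) • tailSum q a X i

/-- The matrix by which the eigenvalue number `α` is replaced when it is moved through a
matrix. -/
def newtonEig (q : ℂ) (X : Mat1 n A) (e : Eig n A) (α : Fin n) : Mat1 n A :=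
  sc n (e.x α) + (q - q⁻¹) • (X * proj q X e α)

/-- The consequences of the factorized characteristic identity. -/
structure Resolved (q : ℂ) (X : Mat1 n A) (e : Eig n A) : Prop
    extends HasSpectralResolution q X e where
  commute_proj : ∀ α β, Commute (sc n (e.x α)) (proj q X e β)
  proj_newton : ∀ i β, proj q X e β * newtonSum q (esymm e.x) X i =
    sc n (esymm (scaled q e.x β) i) * proj q X e β
  newton_proj : ∀ i β, newtonSum q (esymm e.x) X i * proj q X e β =
    proj q X e β * sc n (esymm (scaled q e.x β) i)

/-- The matrix, the eigenvalues and the inverses of their differences generate a commutative algebra,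
in which the claims are those on Lagrange idempotents. -/
theorem EigFor.resolved (h : EigFor X e) (hq : q ≠ 0) (h0 : charProd q X e = 0) :
    Resolved q X e := by
  obtain ⟨C, _, _, φ, y, x, d, hφ, hy, hx, hd, hxd⟩ := h.exists_model
  have h1 : ∏ α, (y - q • x α) = 0 := hφ (by rw [← charProd_eq_map hy hx, h0, map_zero])
  have hp : ∀ α, proj q X e α = φ (lag q y x d α) := fun α => proj_eq_map hy hx hd α
  have hl : ∀ α, X * proj q X e α = q • (sc n (e.x α) * proj q X e α) := fun α => by
    rw [hp, ← hy, ← hx, ← map_mul, ← map_mul, ← map_smul, mul_lag h1]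
  have hN : ∀ i, newtonSum q (esymm e.x) X i = φ (esymm x i - (q ^ 2 - 1) •
      ∑ j ∈ Finset.Icc 1 i, ((-q) ^ j)⁻¹ • (esymm x (i - j) * y ^ j)) := fun i => by
    simp only [newtonSum, tailSum, map_sub, map_smul, map_sum, map_mul, map_pow, hy,
      esymm_eq_map hx]
  have hE : ∀ i β, sc n (esymm (scaled q e.x β) i) =
      φ (esymm (Function.update x β (q ^ 2 • x β)) i) := fun i β => by
    rw [← scaled_eq, sc_esymm]
    refine Eq.trans ?_ (map_esymm φ.toRingHom _ i).symm
    congr 1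
    funext α
    rw [scaled, sc_smul, ← hx, ← map_smul]
    rfl
  have hc : ∀ a b : C, Commute (φ a) (φ b) := fun a b => (Commute.all a b).map φ
  refine
    { char_factor := h0
      mul_proj := fun α β => ?_
      sum_proj := ?_
      left := hl
      right := fun α => ?_
      commute_proj := fun α β => ?_
      proj_newton := fun i β => ?_
      newton_proj := fun i β => ?_ }
  · rw [hp, hp, ← map_mul]
    split_ifs with hab
    · rw [hab, lag_mul_self hq hxd h1]
    · rw [lag_mul_lag_of_ne h1 hab, map_zero]
  · simp only [hp]
    rw [← map_sum, sum_lag hq hxd h1, map_one]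
  · rw [← hl, hp, ← hy, (hc _ _).eq]
  · rw [hp, ← hx]
    exact hc _ _
  · rw [hp, hN, hE, ← map_mul, lag_mul_tail hq h1, map_mul]
  · rw [hp, hN, hE, (hc _ _).eq, ← map_mul, lag_mul_tail hq h1, map_mul, (hc _ _).eq]

theorem esymm_intertwine {E : Type*} [Ring E] {Z : E} {a b : Fin n → E}
    (h : ∀ α, Z * a α = b α * Z) (i : ℕ) : Z * esymm a i = esymm b i * Z := by
  have hl : ∀ l : List (Fin n), Z * (l.map a).prod = (l.map b).prod * Z := fun l => by
    induction l with
    | nil => simp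
    | cons α l ih =>
      rw [List.map_cons, List.map_cons, List.prod_cons, List.prod_cons, ← mul_assoc, h, mul_assoc,
        ih, mul_assoc]
  rw [esymm, esymm, Finset.mul_sum, Finset.sum_mul]
  exact Finset.sum_congr rfl fun t _ => hl _

theorem esymm_smul {E : Type*} [Ring E] [Algebra ℂ E] (c : ℂ) (a : Fin n → E) (i : ℕ) :
    esymm (fun α => c • a α) i = c ^ i • esymm a i := by
  have hl : ∀ l : List (Fin n), (l.map fun α => c • a α).prod = c ^ l.length • (l.map a).prod :=
    fun l => by
      induction l with
      | nil => simp
      | cons α l ih =>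
        rw [List.map_cons, List.map_cons, List.prod_cons, List.prod_cons, ih, smul_mul_smul_comm,
          List.length_cons, pow_succ']
  rw [esymm, esymm, Finset.smul_sum]
  refine Finset.sum_congr rfl fun t ht => ?_
  have : ((List.finRange n).filter fun α => α ∈ t).length = i := by
    rw [← (Finset.mem_powersetCard.1 ht).2,
      ← List.toFinset_card_of_nodup ((List.nodup_finRange n).filter _)]
    congr 1
    ext α
    simp
  rw [hl, this]

namespace Resolved

variable (r : Resolved q X e)

theorem eq_of_left (r : Resolved q X e) {U V : Mat1 n A}
    (h : ∀ β, proj q X e β * U = proj q X e β * V) : U = V := by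
  rw [← one_mul U, ← one_mul V, ← r.sum_proj, Finset.sum_mul, Finset.sum_mul]
  exact Finset.sum_congr rfl fun β _ => h β

theorem eq_of_right (r : Resolved q X e) {U V : Mat1 n A}
    (h : ∀ β, U * proj q X e β = V * proj q X e β) : U = V := by
  rw [← mul_one U, ← mul_one V, ← r.sum_proj, Finset.mul_sum, Finset.mul_sum]
  exact Finset.sum_congr rfl fun β _ => h β

theorem q_mul (hq : q ≠ 0) : (q - q⁻¹) * q = q ^ 2 - 1 := by
  rw [sub_mul, inv_mul_cancel₀ hq, sq]

theorem proj_newtonEig (r : Resolved q X e) (hq : q ≠ 0) (α β : Fin n) :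
    proj q X e β * newtonEig q X e α = q2δ q α β • (sc n (e.x α) * proj q X e β) := by
  rw [newtonEig, mul_add, mul_smul_comm, r.left, mul_smul_comm, smul_smul, q_mul hq, ← mul_assoc,
    ← (r.commute_proj α β).eq, mul_assoc, r.mul_proj, q2δ]
  by_cases h : α = β
  · subst h
    simp only [if_true]
    rw [sub_smul, one_smul]
    abel
  · rw [if_neg (Ne.symm h), if_neg h, mul_zero, smul_zero, add_zero, one_smul]

theorem newtonEig_proj (r : Resolved q X e) (hq : q ≠ 0) (α β : Fin n) :
    newtonEig q X e α * proj q X e β = q2δ q α β • (proj q X e β * sc n (e.x α)) := by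
  rw [← (r.commute_proj α β).eq, newtonEig, add_mul, smul_mul_assoc, r.left, smul_mul_assoc,
    smul_smul, q_mul hq, mul_assoc, r.mul_proj, q2δ]
  by_cases h : α = β
  · subst h
    simp only [if_true]
    rw [sub_smul, one_smul]
    abel
  · rw [if_neg h, if_neg h, mul_zero, smul_zero, add_zero, one_smul]

theorem left_iff (r : Resolved q X e) (hq : q ≠ 0) (T : Mat1 n A) (c : ℂ) (α : Fin n) :
    (∀ β, c • ((proj q X e β * T) * sc n (e.x α)) =
      q2δ q α β • (sc n (e.x α) * (proj q X e β * T))) ↔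
    c • (T * sc n (e.x α)) = newtonEig q X e α * T := by
  have h1 : ∀ β, q2δ q α β • (sc n (e.x α) * (proj q X e β * T)) =
      proj q X e β * (newtonEig q X e α * T) := fun β => by
    rw [← mul_assoc (proj q X e β), r.proj_newtonEig hq, smul_mul_assoc, mul_assoc]
  have h2 : ∀ β, c • ((proj q X e β * T) * sc n (e.x α)) =
      proj q X e β * (c • (T * sc n (e.x α))) := fun β => by
    rw [mul_smul_comm, mul_assoc]
  simp only [h1, h2]
  exact ⟨r.eq_of_left, fun h β => by rw [h]⟩

theorem right_iff (r : Resolved q X e) (hq : q ≠ 0) (T : Mat1 n A) (c : ℂ) (α : Fin n) :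
    (∀ β, c • (sc n (e.x α) * (T * proj q X e β)) =
      q2δ q α β • ((T * proj q X e β) * sc n (e.x α))) ↔
    c • (sc n (e.x α) * T) = T * newtonEig q X e α := by
  have h1 : ∀ β, q2δ q α β • ((T * proj q X e β) * sc n (e.x α)) =
      (T * newtonEig q X e α) * proj q X e β := fun β => by
    rw [mul_assoc T (newtonEig q X e α), r.newtonEig_proj hq, mul_smul_comm, mul_assoc]
  have h2 : ∀ β, c • (sc n (e.x α) * (T * proj q X e β)) =
      (c • (sc n (e.x α) * T)) * proj q X e β := fun β => by
    rw [smul_mul_assoc, mul_assoc]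
  simp only [h1, h2]
  exact ⟨r.eq_of_right, fun h β => by rw [h]⟩

/-- The idempotents on both sides can be summed over, since they are complete; multiplication by one of
them turns the eigenvalue number `α` and its correction into a multiple of the eigenvalue. -/
theorem sandwich_iff (r : Resolved q X e) (hq : q ≠ 0) (Z : Mat1 n A) (α : Fin n) :
    (∀ β σ, sandwichL q X Z e α β σ = sandwichR q X Z e α β σ) ↔
      commL Z e α = commR q X Z e α := by
  have h1 : ∀ β σ, sandwichL q X Z e α β σ =
      proj q X e β * (Z * newtonEig q X e α) * proj q X e σ := fun β σ => by
    rw [sandwichL, mul_assoc (_ * _) (proj q X e σ), ← mul_smul_comm, ← r.newtonEig_proj hq]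
    simp only [mul_assoc]
  have h2 : ∀ β σ, sandwichR q X Z e α β σ =
      proj q X e β * (newtonEig q X e α * Z) * proj q X e σ := fun β σ => by
    rw [sandwichR, mul_assoc (proj q X e β) Z, ← mul_assoc (sc n (e.x α)), ← smul_mul_assoc,
      ← r.proj_newtonEig hq]
    simp only [mul_assoc]
  have h3 : commL Z e α = commR q X Z e α ↔ Z * newtonEig q X e α = newtonEig q X e α * Z := by
    rw [commL, commR, newtonEig, mul_add, add_mul, smul_sub, sub_eq_sub_iff_add_eq_add,
      mul_smul_comm, smul_mul_assoc, add_comm (_ • _) (sc n _ * Z)]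
  simp only [h1, h2, h3]
  exact ⟨fun h => r.eq_of_left fun β => r.eq_of_right fun σ => h β σ, fun h β σ => by rw [h]⟩

theorem esymm_left (r : Resolved q X e) (T : Mat1 n A) (c : ℂ)
    (h : ∀ α β, c • ((proj q X e β * T) * sc n (e.x α)) =
      q2δ q α β • (sc n (e.x α) * (proj q X e β * T))) (i : ℕ) :
    c ^ i • (T * sc n (esymm e.x i)) = newtonSum q (esymm e.x) X i * T := by
  refine r.eq_of_left fun β => ?_
  have h1 := esymm_intertwine (Z := proj q X e β * T) (a := fun α => c • sc n (e.x α))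
    (b := fun α => sc n (scaled q e.x β α))
    (fun α => by rw [mul_smul_comm, h, scaled, sc_smul, smul_mul_assoc]) i
  rw [esymm_smul, ← sc_esymm, ← sc_esymm, mul_smul_comm] at h1
  rw [← mul_assoc _ _ T, r.proj_newton, mul_smul_comm, ← mul_assoc, h1, mul_assoc]

theorem esymm_right (r : Resolved q X e) (T : Mat1 n A) (c : ℂ)
    (h : ∀ α β, c • (sc n (e.x α) * (T * proj q X e β)) =
      q2δ q α β • ((T * proj q X e β) * sc n (e.x α))) (i : ℕ) :
    c ^ i • (sc n (esymm e.x i) * T) = T * newtonSum q (esymm e.x) X i := by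
  refine r.eq_of_right fun β => ?_
  have h1 := esymm_intertwine (Z := T * proj q X e β) (b := fun α => c • sc n (e.x α))
    (a := fun α => sc n (scaled q e.x β α))
    (fun α => by rw [smul_mul_assoc, h, scaled, sc_smul, mul_smul_comm]) i
  rw [esymm_smul, ← sc_esymm, ← sc_esymm, smul_mul_assoc] at h1
  rw [mul_assoc T, r.newton_proj, smul_mul_assoc, mul_assoc, ← h1, mul_assoc]

/-- Each block between two idempotents is exchanged with a rescaled set of eigenvalues, hence with their
elementary symmetric functions; the blocks are then summed up. -/
theorem esymm_sandwich (r : Resolved q X e) (Z : Mat1 n A)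
    (h : ∀ α β σ, sandwichL q X Z e α β σ = sandwichR q X Z e α β σ) (i : ℕ) :
    CoeffComm q (esymm e.x) X Z i := by
  have h0 : Z * newtonSum q (esymm e.x) X i = newtonSum q (esymm e.x) X i * Z := by
    refine r.eq_of_left fun β => r.eq_of_right fun σ => ?_
    have h1 := esymm_intertwine (Z := proj q X e β * Z * proj q X e σ)
      (a := fun α => sc n (scaled q e.x σ α)) (b := fun α => sc n (scaled q e.x β α))
      (fun α => by
        have := h α β σ
        rw [sandwichL, sandwichR] at this
        rw [scaled, scaled, sc_smul, sc_smul, mul_smul_comm, this, smul_mul_assoc]) i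
    rw [← sc_esymm, ← sc_esymm] at h1
    calc _ = proj q X e β * Z * (newtonSum q (esymm e.x) X i * proj q X e σ) := by
          simp only [mul_assoc]
      _ = sc n (esymm (scaled q e.x β) i) * proj q X e β * Z * proj q X e σ := by
          rw [r.newton_proj, ← mul_assoc, h1]
          simp only [mul_assoc]
      _ = _ := by
          rw [← r.proj_newton]
          simp only [mul_assoc]
  rw [newtonSum, mul_sub, sub_mul, mul_smul_comm, smul_mul_assoc, sub_eq_sub_iff_add_eq_add] at h0
  rw [CoeffComm, smul_sub, sub_eq_sub_iff_add_eq_add, h0, add_comm]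

end Resolved
end Resolution


/-! ### The spectral variables of the calculus -/

section SpectralCalculus

variable {n : ℕ} {𝓡 : RData n} {A : Type u} [Ring A] [Algebra ℂ A] {D : Calc n A} {S : Spec n A}

theorem EigFor.of_rel {c : ℂ} {X : Mat1 n A} {e : Eig n A} (h : Holds (EigRel c e))
    (hx : ∀ α β, e.x α * e.x β = e.x β * e.x α) (hX : ∀ α i j, e.x α * X i j = X i j * e.x α) :
    EigFor X e where
  comm_x := hx
  comm_X α := commute_sc_iff.2 fun i j => hX α i j
  mul_d α β hab := h _ _ (.diff_mul_inv α β hab)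
  d_mul α β hab := h _ _ (.inv_mul_diff α β hab)
  d_diag α := h _ _ (.diag α)

theorem eigFor_μ (hS : Holds (SpecRel 𝓡 S)) (hC : Holds (CommRel D S)) : EigFor D.L S.μ :=
  .of_rel (fun x y h => hS x y (.eig_μ x y h)) (fun α β => hS _ _ (.μ_μ α β))
    fun α i j => hC _ _ (.μ _ (by simp [muCommutant]) α i j)

theorem eigFor_ν (hS : Holds (SpecRel 𝓡 S)) (hC : Holds (CommRel D S)) : EigFor D.K S.ν :=
  .of_rel (fun x y h => hS x y (.eig_ν x y h)) (fun α β => hS _ _ (.ν_ν α β))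
    fun α i j => hC _ _ (.ν _ (by simp [nuCommutant]) α i j)

theorem eigFor_ρ (hS : Holds (SpecRel 𝓡 S)) (hC : Holds (CommRel D S)) : EigFor D.F S.ρ :=
  .of_rel (fun x y h => hS x y (.eig_ρ x y h)) (fun α β => hS _ _ (.ρ_ρ α β))
    fun α i j => hC _ _ (.ρ _ (by simp [rhoCommutant]) α i j)

/-- The characteristic polynomial in terms of the sums which occur in the permutation relations. -/
theorem char_sum {q : ℂ} (hq : q ≠ 0) (a : ℕ → A) (X : Mat1 n A) :
    ∑ i ∈ Finset.range (n + 1), (-q) ^ i • (sc n (a i) * X ^ (n - i)) =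
      (-q) ^ n • (sc n (a n) + tailSum q a X n) := by
  have hq' : -q ≠ 0 := neg_ne_zero.2 hq
  have e : sc n (a n) + tailSum q a X n =
      ∑ j ∈ Finset.range (n + 1), ((-q) ^ j)⁻¹ • (sc n (a (n - j)) * X ^ j) := by
    rw [Finset.range_eq_Ico, Finset.sum_eq_sum_Ico_succ_bot (by omega)]
    congr 1
    simp
  rw [e, Finset.smul_sum, ← Finset.sum_range_reflect]
  refine Finset.sum_congr rfl fun j hj => ?_
  have hj' : j ≤ n := Nat.lt_succ_iff.1 (Finset.mem_range.1 hj)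
  rw [show n + 1 - 1 - j = n - j by omega, show n - (n - j) = j by omega, smul_smul]
  congr 1
  rw [pow_sub₀ _ hq' hj']

/-- The factorized characteristic identity is the Cayley-Hamilton identity, once the coefficients are
parameterized by the eigenvalues. -/
theorem charProd_eq_zero (h : 𝓡.IsGood) {X : Mat1 n A} (hX : RE 𝓡 X) {e : Eig n A}
    (he : EigFor X e) (hp : ∀ i ≤ n, 𝓡.coeffR X i = esymm e.x i) : charProd 𝓡.q X e = 0 := by
  rw [he.charProd_eq]
  have : ∀ i ∈ Finset.range (n + 1), (-𝓡.q) ^ i • (sc n (esymm e.x i) * X ^ (n - i)) =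
      (-𝓡.q) ^ i • (sc n (𝓡.coeffR X i) * X ^ (n - i)) := fun i hi => by
    rw [hp i (Nat.lt_succ_iff.1 (Finset.mem_range.1 hi))]
  rw [Finset.sum_congr rfl this, char_sum h.q_ne_zero, h.cayley_hamilton hX, smul_zero]

/-- The parameterization resolves the matrices `L`, `K` and `F` spectrally; for `K` the Cayley-Hamilton
identity of `P R P` is used. -/
theorem CalcEqs.resolved (h : 𝓡.IsGood) (hγ : 𝓡.γ ≠ 0) (hD : CalcEqs 𝓡 D)
    (hS : Holds (SpecRel 𝓡 S)) (hP : Holds (ParamRel 𝓡 D S)) (hC : Holds (CommRel D S)) :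
    Resolved 𝓡.q D.L S.μ ∧ Resolved 𝓡.q D.K S.ν ∧ Resolved 𝓡.q D.F S.ρ := by
  refine ⟨(eigFor_μ hS hC).resolved h.q_ne_zero ?_, (eigFor_ν hS hC).resolved h.q_ne_zero ?_,
    (eigFor_ρ hS hC).resolved h.q_ne_zero ?_⟩
  · exact charProd_eq_zero h hD.L_L (eigFor_μ hS hC) fun i hi => hP _ _ (.a i hi)
  · exact charProd_eq_zero h.op hD.K_K_op (eigFor_ν hS hC) fun i hi =>
      (RData.coeffL_eq h D.K hi).symm.trans (hP _ _ (.b i hi))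
  · exact charProd_eq_zero h (hD.F_F h.toIsHecke hγ) (eigFor_ρ hS hC) fun i hi => hP _ _ (.c i hi)

theorem exch_iff (hq : 𝓡.q ≠ 0) (rL : Resolved 𝓡.q D.L S.μ) (rK : Resolved 𝓡.q D.K S.ν)
    (rF : Resolved 𝓡.q D.F S.ρ) (l : Label n) :
    Holds (Exch1 𝓡 D S l) ↔ Holds (Exch2 𝓡 D S l) := by
  cases l with
  | T_μ α =>
    have key := rL.left_iff hq D.T (𝓡.γ ^ 2) α
    rw [newtonEig, add_mul, smul_mul_assoc] at key
    constructor
    · rintro h _ _ ⟨⟩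
      rw [key.1 fun β => Matrix.ext fun i j => h _ _ (.T_μ α β i j)]
    · rintro h _ _ ⟨⟩
      rw [key.2 (Matrix.ext fun i j => h _ _ (.T_μ α i j))]
  | T_ν α =>
    have key := rK.right_iff hq D.T (𝓡.γ ^ 2) α
    rw [newtonEig, mul_add, mul_smul_comm, ← mul_assoc] at key
    constructor
    · rintro h _ _ ⟨⟩
      rw [key.1 fun β => Matrix.ext fun i j => h _ _ (.T_ν α β i j)]
    · rintro h _ _ ⟨⟩
      rw [key.2 (Matrix.ext fun i j => h _ _ (.T_ν α i j))]
  | Ω_μ α =>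
    have key := rL.sandwich_iff hq D.Ω α
    constructor
    · rintro h _ _ ⟨⟩
      rw [key.1 fun β σ => Matrix.ext fun i j => h _ _ (.Ω_μ α β σ i j)]
    · rintro h _ _ ⟨⟩
      rw [key.2 (Matrix.ext fun i j => h _ _ (.Ω_μ α i j))]
  | F_μ α =>
    have key := rL.sandwich_iff hq D.F α
    constructor
    · rintro h _ _ ⟨⟩
      rw [key.1 fun β σ => Matrix.ext fun i j => h _ _ (.F_μ α β σ i j)]
    · rintro h _ _ ⟨⟩
      rw [key.2 (Matrix.ext fun i j => h _ _ (.F_μ α i j))]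
  | Θ_ν α =>
    have key := rK.sandwich_iff hq D.Θ α
    constructor
    · rintro h _ _ ⟨⟩
      rw [key.1 fun β σ => Matrix.ext fun i j => h _ _ (.Θ_ν α β σ i j)]
    · rintro h _ _ ⟨⟩
      rw [key.2 (Matrix.ext fun i j => h _ _ (.Θ_ν α i j))]
  | G_ν α =>
    have key := rK.sandwich_iff hq D.G α
    constructor
    · rintro h _ _ ⟨⟩
      rw [key.1 fun β σ => Matrix.ext fun i j => h _ _ (.G_ν α β σ i j)]
    · rintro h _ _ ⟨⟩
      rw [key.2 (Matrix.ext fun i j => h _ _ (.G_ν α i j))]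
  | Ω_ρ α =>
    have key := rF.sandwich_iff hq D.Ω α
    constructor
    · rintro h _ _ ⟨⟩
      rw [key.1 fun β σ => Matrix.ext fun i j => h _ _ (.Ω_ρ α β σ i j)]
    · rintro h _ _ ⟨⟩
      rw [key.2 (Matrix.ext fun i j => h _ _ (.Ω_ρ α i j))]

theorem commute_esymm {E : Type*} [Ring E] {a : Fin n → E} {Z : E} (h : ∀ α, Commute (a α) Z)
    (i : ℕ) : Commute (esymm a i) Z :=
  (esymm_intertwine (fun α => (h α).symm.eq) i).symm

theorem commute_esymm_esymm {E : Type*} [Ring E] {a b : Fin n → E}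
    (h : ∀ α β, Commute (a α) (b β)) (i j : ℕ) : Commute (esymm a i) (esymm b j) :=
  commute_esymm (fun α => (commute_esymm (fun β => (h α β).symm) j).symm) i

theorem commute_sc_esymm {a : Fin n → A} {X : Mat1 n A} (h : ∀ α i j, a α * X i j = X i j * a α)
    (i : ℕ) : Commute (sc n (esymm a i)) X :=
  commute_sc_iff.2 fun k l => commute_esymm (fun α => h α k l) i

/-- The elementary symmetric functions of the spectral variables obey the permutation relations of
the coefficients of the characteristic polynomials. -/
theorem esymm_coeffExchange (hq : 𝓡.q ≠ 0) (hS : Holds (SpecRel 𝓡 S)) (hC : Holds (CommRel D S))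
    (hE : ∀ l, Holds (Exch1 𝓡 D S l)) (hT : Holds (TraceRel 𝓡 D S))
    (hL : charProd 𝓡.q D.L S.μ = 0) (hK : charProd 𝓡.q D.K S.ν = 0)
    (hF : charProd 𝓡.q D.F S.ρ = 0) :
    CoeffExchange 𝓡 D (esymm S.μ.x) (esymm S.ν.x) (esymm S.ρ.x) := by
  have rL := (eigFor_μ hS hC).resolved hq hL
  have rK := (eigFor_ν hS hC).resolved hq hK
  have rF := (eigFor_ρ hS hC).resolved hq hF
  have b_comm : ∀ i ≤ n, ∀ X ∈ nuCommutant D, Commute (sc n (esymm S.ν.x i)) X :=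
    fun i _ X hX => commute_sc_esymm (fun α k l => hC _ _ (.ν X hX α k l)) i
  exact
    { a_T := fun i _ => by
        rw [pow_mul, rL.esymm_left D.T (𝓡.γ ^ 2) (fun α β => Matrix.ext fun k l =>
          hE _ _ _ (.T_μ α β k l)) i, newtonSum, sub_mul, smul_mul_assoc]
      b_T := fun i hi => by
        rw [pow_mul, rK.esymm_right D.T (𝓡.γ ^ 2) (fun α β => Matrix.ext fun k l =>
          hE _ _ _ (.T_ν α β k l)) i, newtonSum, mul_sub, mul_smul_comm, tailSum, Finset.mul_sum]
        congr 2
        refine Finset.sum_congr rfl fun j _ => ?_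
        rw [mul_smul_comm, mul_assoc, ((b_comm (i - j) ((Nat.sub_le _ _).trans hi) D.K
          (by simp [nuCommutant])).pow_right j).eq]
      a_Ω := fun i _ => rL.esymm_sandwich D.Ω (fun α β σ => Matrix.ext fun k l =>
        hE _ _ _ (.Ω_μ α β σ k l)) i
      a_F := fun i _ => rL.esymm_sandwich D.F (fun α β σ => Matrix.ext fun k l =>
        hE _ _ _ (.F_μ α β σ k l)) i
      b_Θ := fun i _ => rK.esymm_sandwich D.Θ (fun α β σ => Matrix.ext fun k l =>
        hE _ _ _ (.Θ_ν α β σ k l)) i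
      b_G := fun i _ => rK.esymm_sandwich D.G (fun α β σ => Matrix.ext fun k l =>
        hE _ _ _ (.G_ν α β σ k l)) i
      c_Ω := fun i _ => rF.esymm_sandwich D.Ω (fun α β σ => Matrix.ext fun k l =>
        hE _ _ _ (.Ω_ρ α β σ k l)) i
      a_comm := fun i _ X hX => commute_sc_esymm (fun α k l => hC _ _ (.μ X hX α k l)) i
      b_comm := b_comm
      c_comm := fun i _ X hX => commute_sc_esymm (fun α k l => hC _ _ (.ρ X hX α k l)) i
      c_tr := fun i _ w => commute_esymm (fun α => hT _ _ (.tr α w)) i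
      aa := fun i _ j _ => commute_esymm_esymm (fun α β => hS _ _ (.μ_μ α β)) i j
      bb := fun i _ j _ => commute_esymm_esymm (fun α β => hS _ _ (.ν_ν α β)) i j
      cc := fun i _ j _ => commute_esymm_esymm (fun α β => hS _ _ (.ρ_ρ α β)) i j
      ab := fun i _ j _ => commute_esymm_esymm (fun α β => hS _ _ (.μ_ν α β)) i j
      ac := fun i _ j _ => commute_esymm_esymm (fun α β => hS _ _ (.μ_ρ α β)) i j
      bc := fun i _ j _ => commute_esymm_esymm (fun α β => hS _ _ (.ν_ρ α β)) i j }

end SpectralCalculus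


/-! ### Functoriality of the relations -/

section Functoriality

variable {n : ℕ} {A B : Type*} [Ring A] [Algebra ℂ A] [Ring B] [Algebra ℂ B] (φ : A →ₐ[ℂ] B)

theorem map_fst (X : Mat1 n A) : φ.mapMatrix (fst X) = fst (φ.mapMatrix X) := by
  ext ⟨a, b⟩ ⟨c, d⟩
  simp [fst, Matrix.kroneckerMap_apply, Matrix.one_apply, apply_ite φ]

theorem map_snd (X : Mat1 n A) : φ.mapMatrix (snd X) = snd (φ.mapMatrix X) := by
  ext ⟨a, b⟩ ⟨c, d⟩
  simp [snd, Matrix.kroneckerMap_apply, Matrix.one_apply, apply_ite φ]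

theorem map_sc (x : A) : φ.mapMatrix (sc n x) = sc n (φ x) := by
  ext a b
  simp [sc, Matrix.diagonal_apply, apply_ite φ]

theorem map_wtr (D : Mat1 n ℂ) (X : Mat1 n A) : φ (wtr D X) = wtr D (φ.mapMatrix X) := by
  simp [wtr, map_sum]

theorem map_wtrT (k : ℕ) (D : Mat1 n ℂ) (X : MatT n k A) :
    φ (wtrT k D X) = wtrT k D (φ.mapMatrix X) := by
  simp [wtrT, map_sum]

theorem map_esymm_algHom (x : Fin n → A) (i : ℕ) : φ (esymm x i) = esymm (fun α => φ (x α)) i := by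
  simp [esymm, map_sum, map_list_prod, Function.comp_def]

theorem map_site (k i : ℕ) (X : Mat1 n A) :
    φ.mapMatrix (site k i X) = site k i (φ.mapMatrix X) := site_map φ.toRingHom k i X

theorem map_site2 (k i : ℕ) (X : Mat2 n A) :
    φ.mapMatrix (site2 k i X) = site2 k i (φ.mapMatrix X) := site2_map φ.toRingHom k i X

variable (𝓡 : RData n)

theorem map_Rm : φ.mapMatrix (𝓡.Rm A) = 𝓡.Rm B := by
  ext; simp [RData.Rm]

theorem map_Ri : φ.mapMatrix (𝓡.Ri A) = 𝓡.Ri B := by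
  ext; simp [RData.Ri]

theorem map_Am (k : ℕ) : φ.mapMatrix (𝓡.Am A k) = 𝓡.Am B k := by
  ext; simp [RData.Am]

theorem map_detT (T : Mat1 n A) : φ (𝓡.detT T) = 𝓡.detT (φ.mapMatrix T) := by
  have (m : Type) [Fintype m] [DecidableEq m] (M : Matrix m m A) :
      φ M.trace = (φ.mapMatrix M).trace := by simp [Matrix.trace, map_sum]
  rw [RData.detT, this, map_mul, map_Am, map_list_prod, List.map_map]
  simp only [Function.comp_def, map_site]
  rfl

theorem map_overCopy (k : ℕ) (X : Mat1 n A) (j : ℕ) :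
    φ.mapMatrix (𝓡.overCopy k X j) = 𝓡.overCopy k (φ.mapMatrix X) j := by
  induction j with
  | zero => exact map_site φ k 0 X
  | succ j ih =>
    rw [RData.overCopy, map_mul, map_mul, ih, map_site2, map_site2, map_Rm, map_Ri]
    rfl

theorem map_underCopy (k : ℕ) (X : Mat1 n A) (j : ℕ) :
    φ.mapMatrix (𝓡.underCopy k X j) = 𝓡.underCopy k (φ.mapMatrix X) j := by
  induction j with
  | zero => exact map_site φ k _ X
  | succ j ih =>
    rw [RData.underCopy, map_mul, map_mul, ih, map_site2, map_site2, map_Rm, map_Ri]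
    rfl

theorem map_coeffR (X : Mat1 n A) (i : ℕ) :
    φ (𝓡.coeffR X i) = 𝓡.coeffR (φ.mapMatrix X) i := by
  rw [RData.coeffR, map_wtrT, map_mul, map_Am, map_list_prod, List.map_map]
  simp only [Function.comp_def, map_overCopy]
  rfl

theorem map_coeffL (X : Mat1 n A) (i : ℕ) :
    φ (𝓡.coeffL X i) = 𝓡.coeffL (φ.mapMatrix X) i := by
  rw [RData.coeffL, map_wtrT, map_mul, map_Am, map_list_prod, List.map_map]
  simp only [Function.comp_def, map_underCopy]
  rfl

/-- The image of the matrices of a calculus under an algebra homomorphism. -/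
def Calc.map (D : Calc n A) : Calc n B where
  T := φ.mapMatrix D.T
  T' := φ.mapMatrix D.T'
  Ω := φ.mapMatrix D.Ω
  L := φ.mapMatrix D.L
  K := φ.mapMatrix D.K

/-- The image of a family of eigenvalues under an algebra homomorphism. -/
def Eig.map (e : Eig n A) : Eig n B where
  x α := φ (e.x α)
  x' α := φ (e.x' α)
  d α β := φ (e.d α β)

/-- The image of the spectral variables under an algebra homomorphism. -/
def Spec.map (S : Spec n A) : Spec n B where
  μ := S.μ.map φ
  ν := S.ν.map φ
  ρ := S.ρ.map φ

variable (D : Calc n A) (S : Spec n A)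

theorem map_F : φ.mapMatrix D.F = (D.map φ).F := by
  simp only [Calc.F, map_mul]; rfl

theorem map_Θ : φ.mapMatrix D.Θ = (D.map φ).Θ := by
  simp only [Calc.Θ, map_mul]; rfl

theorem map_G : φ.mapMatrix D.G = (D.map φ).G := by
  simp only [Calc.G, map_mul, map_F]; rfl

theorem map_proj (q : ℂ) (X : Mat1 n A) (e : Eig n A) (α : Fin n) :
    φ.mapMatrix (proj q X e α) = proj q (φ.mapMatrix X) (e.map φ) α := by
  rw [proj, map_list_prod, List.map_map]
  simp only [Function.comp_def, map_mul, map_sub, map_smul, map_sc]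
  rfl

theorem map_monomial (w : List Bool) :
    φ.mapMatrix (monomial D w) = monomial (D.map φ) w := by
  rw [monomial, map_list_prod, List.map_map, monomial]
  congr 1
  refine List.map_congr_left fun b _ => ?_
  cases b
  · exact map_F φ D
  · rfl

/-- All equations listed by `r` hold after applying `φ`. -/
def HoldsMap (r : A → A → Prop) : Prop := ∀ x y, r x y → φ x = φ y

variable {φ}

theorem Holds.holdsMap {r : A → A → Prop} (h : Holds r) : HoldsMap φ r :=
  fun x y hxy => congrArg φ (h x y hxy)

theorem entry_iff {m : Type*} [Fintype m] [DecidableEq m] {M N : Matrix m m A} {M' N' : Matrix m m B}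
    (hM : φ.mapMatrix M = M') (hN : φ.mapMatrix N = N') (i j : m) :
    M' i j = N' i j ↔ φ (M i j) = φ (N i j) := by
  subst hM hN; rfl

variable {𝓡 D S} {s : Kind}

/-- The relations for the image of the matrices are the images of the relations; the statements below
say this for the other lists of relations. -/
theorem holds_funRel_map {T T' : Mat1 n A} :
    Holds (FunRel 𝓡 s (φ.mapMatrix T) (φ.mapMatrix T')) ↔ HoldsMap φ (FunRel 𝓡 s T T') := by
  have rtt := entry_iff (φ := φ) (M := 𝓡.Rm A * fst T * snd T) (N := fst T * snd T * 𝓡.Rm A)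
    (by simp only [map_mul, map_Rm, map_fst, map_snd]; rfl)
    (by simp only [map_mul, map_Rm, map_fst, map_snd]; rfl)
  have mul_inv := entry_iff (φ := φ) (M := T * T') (N := 1) (map_mul _ _ _) (map_one _)
  have inv_mul := entry_iff (φ := φ) (M := T' * T) (N := 1) (map_mul _ _ _) (map_one _)
  constructor
  · rintro h _ _ (⟨i, j⟩ | ⟨i, j⟩ | ⟨i, j⟩ | hs)
    · exact (rtt i j).1 (h _ _ (.rtt i j))
    · exact (mul_inv i j).1 (h _ _ (.mul_inv i j))
    · exact (inv_mul i j).1 (h _ _ (.inv_mul i j))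
    · rw [map_detT, map_one]; exact h _ _ (.det_T hs)
  · rintro h _ _ (⟨i, j⟩ | ⟨i, j⟩ | ⟨i, j⟩ | hs)
    · exact (rtt i j).2 (h _ _ (.rtt i j))
    · exact (mul_inv i j).2 (h _ _ (.mul_inv i j))
    · exact (inv_mul i j).2 (h _ _ (.inv_mul i j))
    · have := h _ _ (.det_T hs)
      rwa [map_detT, map_one] at this

theorem holds_calcRel_map :
    Holds (CalcRel 𝓡 s (D.map φ)) ↔ HoldsMap φ (CalcRel 𝓡 s D) := by
  have fn := holds_funRel_map (φ := φ) (𝓡 := 𝓡) (s := s) (T := D.T) (T' := D.T')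
  have forms_gl := entry_iff (φ := φ) (M := 𝓡.Rm A * fst D.Ω * 𝓡.Rm A * fst D.Ω)
    (N := -(fst D.Ω * 𝓡.Rm A * fst D.Ω * 𝓡.Ri A))
    (by simp only [map_mul, map_Rm, map_fst]; rfl)
    (by simp only [map_neg, map_mul, map_Rm, map_Ri, map_fst]; rfl)
  have forms_sl := entry_iff (φ := φ)
    (M := 𝓡.Rm A * fst D.Ω * 𝓡.Rm A * fst D.Ω + fst D.Ω * 𝓡.Rm A * fst D.Ω * 𝓡.Ri A)
    (N := 𝓡.κ • (fst D.Ω * fst D.Ω + 𝓡.Rm A * (fst D.Ω * fst D.Ω) * 𝓡.Rm A))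
    (by simp only [map_add, map_mul, map_Rm, map_Ri, map_fst]; rfl)
    (by simp only [map_smul, map_add, map_mul, map_Rm, map_fst]; rfl)
  have Ω_T := entry_iff (φ := φ) (M := 𝓡.Rm A * fst D.Ω * 𝓡.Ri A * fst D.T)
    (N := fst D.T * snd D.Ω)
    (by simp only [map_mul, map_Rm, map_Ri, map_fst]; rfl)
    (by simp only [map_mul, map_fst, map_snd]; rfl)
  have L_L := entry_iff (φ := φ) (M := 𝓡.Rm A * fst D.L * 𝓡.Rm A * fst D.L)
    (N := fst D.L * 𝓡.Rm A * fst D.L * 𝓡.Rm A)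
    (by simp only [map_mul, map_Rm, map_fst]; rfl) (by simp only [map_mul, map_Rm, map_fst]; rfl)
  have L_T := entry_iff (φ := φ) (M := 𝓡.Rm A * fst D.L * 𝓡.Rm A * fst D.T)
    (N := 𝓡.γ ^ 2 • (fst D.T * snd D.L))
    (by simp only [map_mul, map_Rm, map_fst]; rfl)
    (by simp only [map_smul, map_mul, map_fst, map_snd]; rfl)
  have L_Ω := entry_iff (φ := φ) (M := 𝓡.Rm A * fst D.L * 𝓡.Rm A * fst D.Ω)
    (N := fst D.Ω * 𝓡.Rm A * fst D.L * 𝓡.Rm A)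
    (by simp only [map_mul, map_Rm, map_fst]; rfl) (by simp only [map_mul, map_Rm, map_fst]; rfl)
  have K_K := entry_iff (φ := φ) (M := 𝓡.Rm A * snd D.K * 𝓡.Rm A * snd D.K)
    (N := snd D.K * 𝓡.Rm A * snd D.K * 𝓡.Rm A)
    (by simp only [map_mul, map_Rm, map_snd]; rfl) (by simp only [map_mul, map_Rm, map_snd]; rfl)
  have K_T := entry_iff (φ := φ) (M := snd D.T * 𝓡.Rm A * snd D.K * 𝓡.Rm A)
    (N := 𝓡.γ ^ 2 • (fst D.K * snd D.T))
    (by simp only [map_mul, map_Rm, map_snd]; rfl)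
    (by simp only [map_smul, map_mul, map_fst, map_snd]; rfl)
  have K_Ω := entry_iff (φ := φ) (M := fst D.K * snd D.Ω) (N := snd D.Ω * fst D.K)
    (by simp only [map_mul, map_snd, map_fst]; rfl) (by simp only [map_mul, map_snd, map_fst]; rfl)
  have K_L := entry_iff (φ := φ) (M := fst D.K * snd D.L) (N := snd D.L * fst D.K)
    (by simp only [map_mul, map_snd, map_fst]; rfl) (by simp only [map_mul, map_snd, map_fst]; rfl)
  constructor
  · intro h x y hxy
    cases hxy with
    | functions _ _ h' => exact fn.1 (fun a b hab => h a b (.functions a b hab)) x y h'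
    | forms_gl hs i j => exact (forms_gl i j).1 (h _ _ (.forms_gl hs i j))
    | forms_sl hs i j => exact (forms_sl i j).1 (h _ _ (.forms_sl hs i j))
    | Ω_T i j => exact (Ω_T i j).1 (h _ _ (.Ω_T i j))
    | L_L i j => exact (L_L i j).1 (h _ _ (.L_L i j))
    | L_T i j => exact (L_T i j).1 (h _ _ (.L_T i j))
    | L_Ω i j => exact (L_Ω i j).1 (h _ _ (.L_Ω i j))
    | K_K i j => exact (K_K i j).1 (h _ _ (.K_K i j))
    | K_T i j => exact (K_T i j).1 (h _ _ (.K_T i j))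
    | K_Ω i j => exact (K_Ω i j).1 (h _ _ (.K_Ω i j))
    | K_L i j => exact (K_L i j).1 (h _ _ (.K_L i j))
    | tr_Ω hs => rw [map_wtr, map_zero]; exact h _ _ (.tr_Ω hs)
    | det_L hs => rw [map_coeffR, AlgHom.commutes]; exact h _ _ (.det_L hs)
    | det_K hs => rw [map_coeffL, AlgHom.commutes]; exact h _ _ (.det_K hs)
  · intro h x y hxy
    cases hxy with
    | functions _ _ h' => exact fn.2 (fun a b hab => h a b (.functions a b hab)) x y h'
    | forms_gl hs i j => exact (forms_gl i j).2 (h _ _ (.forms_gl hs i j))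
    | forms_sl hs i j => exact (forms_sl i j).2 (h _ _ (.forms_sl hs i j))
    | Ω_T i j => exact (Ω_T i j).2 (h _ _ (.Ω_T i j))
    | L_L i j => exact (L_L i j).2 (h _ _ (.L_L i j))
    | L_T i j => exact (L_T i j).2 (h _ _ (.L_T i j))
    | L_Ω i j => exact (L_Ω i j).2 (h _ _ (.L_Ω i j))
    | K_K i j => exact (K_K i j).2 (h _ _ (.K_K i j))
    | K_T i j => exact (K_T i j).2 (h _ _ (.K_T i j))
    | K_Ω i j => exact (K_Ω i j).2 (h _ _ (.K_Ω i j))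
    | K_L i j => exact (K_L i j).2 (h _ _ (.K_L i j))
    | tr_Ω hs =>
      have := h _ _ (.tr_Ω hs)
      rwa [map_wtr, map_zero] at this
    | det_L hs =>
      have := h _ _ (.det_L hs)
      rwa [map_coeffR, AlgHom.commutes] at this
    | det_K hs =>
      have := h _ _ (.det_K hs)
      rwa [map_coeffL, AlgHom.commutes] at this

theorem holds_eigRel_map {c : ℂ} {e : Eig n A} :
    Holds (EigRel c (e.map φ)) ↔ HoldsMap φ (EigRel c e) := by
  have hp : φ ((List.finRange n).map e.x).prod = ((List.finRange n).map (e.map φ).x).prod := by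
    rw [map_list_prod, List.map_map]; rfl
  constructor
  · rintro h _ _ (α | α | ⟨α, β, hab⟩ | ⟨α, β, hab⟩ | α | _)
    · rw [map_mul, map_one]; exact h _ _ (.mul_inv α)
    · rw [map_mul, map_one]; exact h _ _ (.inv_mul α)
    · rw [map_mul, map_one, map_sub]; exact h _ _ (.diff_mul_inv α β hab)
    · rw [map_mul, map_one, map_sub]; exact h _ _ (.inv_mul_diff α β hab)
    · rw [map_zero]; exact h _ _ (.diag α)
    · rw [hp, AlgHom.commutes]; exact h _ _ .prod
  · rintro h _ _ (α | α | ⟨α, β, hab⟩ | ⟨α, β, hab⟩ | α | _)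
    · have := h _ _ (.mul_inv α); rwa [map_mul, map_one] at this
    · have := h _ _ (.inv_mul α); rwa [map_mul, map_one] at this
    · have := h _ _ (.diff_mul_inv α β hab); rwa [map_mul, map_one, map_sub] at this
    · have := h _ _ (.inv_mul_diff α β hab); rwa [map_mul, map_one, map_sub] at this
    · have := h _ _ (.diag α); rwa [map_zero] at this
    · have := h _ _ .prod; rwa [hp, AlgHom.commutes] at this

theorem map_mul_eq_iff {a b c d : A} : φ a * φ b = φ c * φ d ↔ φ (a * b) = φ (c * d) := by
  rw [map_mul, map_mul]

theorem holds_specRel_map :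
    Holds (SpecRel 𝓡 (S.map φ)) ↔ HoldsMap φ (SpecRel 𝓡 S) := by
  constructor
  · intro h x y hxy
    cases hxy with
    | eig_μ _ _ h' => exact holds_eigRel_map.1 (fun a b hab => h a b (.eig_μ a b hab)) x y h'
    | eig_ν _ _ h' => exact holds_eigRel_map.1 (fun a b hab => h a b (.eig_ν a b hab)) x y h'
    | eig_ρ _ _ h' => exact holds_eigRel_map.1 (fun a b hab => h a b (.eig_ρ a b hab)) x y h'
    | μ_μ α β => exact map_mul_eq_iff.1 (h _ _ (.μ_μ α β))
    | ν_ν α β => exact map_mul_eq_iff.1 (h _ _ (.ν_ν α β))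
    | ρ_ρ α β => exact map_mul_eq_iff.1 (h _ _ (.ρ_ρ α β))
    | μ_ν α β => exact map_mul_eq_iff.1 (h _ _ (.μ_ν α β))
    | μ_ρ α β => exact map_mul_eq_iff.1 (h _ _ (.μ_ρ α β))
    | ν_ρ α β => exact map_mul_eq_iff.1 (h _ _ (.ν_ρ α β))
  · intro h x y hxy
    cases hxy with
    | eig_μ _ _ h' => exact holds_eigRel_map.2 (fun a b hab => h a b (.eig_μ a b hab)) x y h'
    | eig_ν _ _ h' => exact holds_eigRel_map.2 (fun a b hab => h a b (.eig_ν a b hab)) x y h'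
    | eig_ρ _ _ h' => exact holds_eigRel_map.2 (fun a b hab => h a b (.eig_ρ a b hab)) x y h'
    | μ_μ α β => exact map_mul_eq_iff.2 (h _ _ (.μ_μ α β))
    | ν_ν α β => exact map_mul_eq_iff.2 (h _ _ (.ν_ν α β))
    | ρ_ρ α β => exact map_mul_eq_iff.2 (h _ _ (.ρ_ρ α β))
    | μ_ν α β => exact map_mul_eq_iff.2 (h _ _ (.μ_ν α β))
    | μ_ρ α β => exact map_mul_eq_iff.2 (h _ _ (.μ_ρ α β))
    | ν_ρ α β => exact map_mul_eq_iff.2 (h _ _ (.ν_ρ α β))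

theorem holds_paramRel_map :
    Holds (ParamRel 𝓡 (D.map φ) (S.map φ)) ↔ HoldsMap φ (ParamRel 𝓡 D S) := by
  have a (i) : 𝓡.coeffR (D.map φ).L i = esymm (S.map φ).μ.x i ↔
      φ (𝓡.coeffR D.L i) = φ (esymm S.μ.x i) := by
    rw [map_coeffR, map_esymm_algHom]; rfl
  have b (i) : 𝓡.coeffL (D.map φ).K i = esymm (S.map φ).ν.x i ↔
      φ (𝓡.coeffL D.K i) = φ (esymm S.ν.x i) := by
    rw [map_coeffL, map_esymm_algHom]; rfl
  have c (i) : 𝓡.coeffR (D.map φ).F i = esymm (S.map φ).ρ.x i ↔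
      φ (𝓡.coeffR D.F i) = φ (esymm S.ρ.x i) := by
    rw [map_coeffR, map_esymm_algHom, map_F]; rfl
  constructor
  · rintro h _ _ (⟨i, hi⟩ | ⟨i, hi⟩ | ⟨i, hi⟩)
    · exact (a i).1 (h _ _ (.a i hi))
    · exact (b i).1 (h _ _ (.b i hi))
    · exact (c i).1 (h _ _ (.c i hi))
  · rintro h _ _ (⟨i, hi⟩ | ⟨i, hi⟩ | ⟨i, hi⟩)
    · exact (a i).2 (h _ _ (.a i hi))
    · exact (b i).2 (h _ _ (.b i hi))
    · exact (c i).2 (h _ _ (.c i hi))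

theorem image_muCommutant : φ.mapMatrix '' muCommutant D = muCommutant (D.map φ) := by
  simp only [muCommutant, Set.image_insert_eq, Set.image_singleton, map_Θ, map_G]; rfl

theorem image_nuCommutant : φ.mapMatrix '' nuCommutant D = nuCommutant (D.map φ) := by
  simp only [nuCommutant, Set.image_insert_eq, Set.image_singleton, map_F]; rfl

theorem image_rhoCommutant : φ.mapMatrix '' rhoCommutant D = rhoCommutant (D.map φ) := by
  simp only [rhoCommutant, Set.image_insert_eq, Set.image_singleton, map_F, map_G]; rfl

theorem holds_commRel_map :
    Holds (CommRel (D.map φ) (S.map φ)) ↔ HoldsMap φ (CommRel D S) := by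
  constructor
  · rintro h _ _ (⟨X, hX, α, i, j⟩ | ⟨X, hX, α, i, j⟩ | ⟨X, hX, α, i, j⟩)
    · have hX' : φ.mapMatrix X ∈ muCommutant (D.map φ) :=
        image_muCommutant (φ := φ) (D := D) ▸ Set.mem_image_of_mem _ hX
      exact map_mul_eq_iff.1 (h _ _ (.μ _ hX' α i j))
    · have hX' : φ.mapMatrix X ∈ nuCommutant (D.map φ) :=
        image_nuCommutant (φ := φ) (D := D) ▸ Set.mem_image_of_mem _ hX
      exact map_mul_eq_iff.1 (h _ _ (.ν _ hX' α i j))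
    · have hX' : φ.mapMatrix X ∈ rhoCommutant (D.map φ) :=
        image_rhoCommutant (φ := φ) (D := D) ▸ Set.mem_image_of_mem _ hX
      exact map_mul_eq_iff.1 (h _ _ (.ρ _ hX' α i j))
  · rintro h _ _ (⟨X, hX, α, i, j⟩ | ⟨X, hX, α, i, j⟩ | ⟨X, hX, α, i, j⟩)
    · rw [← image_muCommutant] at hX
      obtain ⟨X, hX, rfl⟩ := hX
      exact map_mul_eq_iff.2 (h _ _ (.μ X hX α i j))
    · rw [← image_nuCommutant] at hX
      obtain ⟨X, hX, rfl⟩ := hX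
      exact map_mul_eq_iff.2 (h _ _ (.ν X hX α i j))
    · rw [← image_rhoCommutant] at hX
      obtain ⟨X, hX, rfl⟩ := hX
      exact map_mul_eq_iff.2 (h _ _ (.ρ X hX α i j))

theorem map_sandwichL (q : ℂ) (M X : Mat1 n A) (e : Eig n A) (α β σ : Fin n) :
    φ.mapMatrix (sandwichL q M X e α β σ) =
      sandwichL q (φ.mapMatrix M) (φ.mapMatrix X) (e.map φ) α β σ := by
  simp only [sandwichL, map_smul, map_mul, map_proj, map_sc]; rfl

theorem map_sandwichR (q : ℂ) (M X : Mat1 n A) (e : Eig n A) (α β σ : Fin n) :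
    φ.mapMatrix (sandwichR q M X e α β σ) =
      sandwichR q (φ.mapMatrix M) (φ.mapMatrix X) (e.map φ) α β σ := by
  simp only [sandwichR, map_smul, map_mul, map_proj, map_sc]; rfl

theorem holds_exch1_map (l : Label n) :
    Holds (Exch1 𝓡 (D.map φ) (S.map φ) l) ↔ HoldsMap φ (Exch1 𝓡 D S l) := by
  have sand (M X : Mat1 n A) (M' X' : Mat1 n B) (hM : φ.mapMatrix M = M') (hX : φ.mapMatrix X = X') (e : Eig n A) (α β σ) :=
    entry_iff (φ := φ) (M := sandwichL 𝓡.q M X e α β σ) (N := sandwichR 𝓡.q M X e α β σ)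
      (M' := sandwichL 𝓡.q M' X' (e.map φ) α β σ) (N' := sandwichR 𝓡.q M' X' (e.map φ) α β σ)
      (by rw [map_sandwichL, hM, hX]) (by rw [map_sandwichR, hM, hX])
  have T_μ (α β) := entry_iff (φ := φ)
    (M := 𝓡.γ ^ 2 • ((proj 𝓡.q D.L S.μ β * D.T) * sc n (S.μ.x α)))
    (N := q2δ 𝓡.q α β • (sc n (S.μ.x α) * (proj 𝓡.q D.L S.μ β * D.T)))
    (by simp only [map_smul, map_mul, map_proj, map_sc]; rfl)
    (by simp only [map_smul, map_mul, map_proj, map_sc]; rfl)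
  have T_ν (α β) := entry_iff (φ := φ)
    (M := 𝓡.γ ^ 2 • (sc n (S.ν.x α) * (D.T * proj 𝓡.q D.K S.ν β)))
    (N := q2δ 𝓡.q α β • ((D.T * proj 𝓡.q D.K S.ν β) * sc n (S.ν.x α)))
    (by simp only [map_smul, map_mul, map_proj, map_sc]; rfl)
    (by simp only [map_smul, map_mul, map_proj, map_sc]; rfl)
  constructor
  · intro h x y hxy
    cases hxy with
    | T_μ α β i j => exact (T_μ α β i j).1 (h _ _ (.T_μ α β i j))
    | T_ν α β i j => exact (T_ν α β i j).1 (h _ _ (.T_ν α β i j))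
    | Ω_μ α β σ i j => exact (sand _ _ _ _ rfl rfl _ _ _ _ i j).1 (h _ _ (.Ω_μ α β σ i j))
    | F_μ α β σ i j =>
      exact (sand _ _ _ _ rfl (map_F φ D) _ _ _ _ i j).1 (h _ _ (.F_μ α β σ i j))
    | Θ_ν α β σ i j =>
      exact (sand _ _ _ _ rfl (map_Θ φ D) _ _ _ _ i j).1 (h _ _ (.Θ_ν α β σ i j))
    | G_ν α β σ i j =>
      exact (sand _ _ _ _ rfl (map_G φ D) _ _ _ _ i j).1 (h _ _ (.G_ν α β σ i j))
    | Ω_ρ α β σ i j =>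
      exact (sand _ _ _ _ (map_F φ D) rfl _ _ _ _ i j).1 (h _ _ (.Ω_ρ α β σ i j))
  · intro h x y hxy
    cases hxy with
    | T_μ α β i j => exact (T_μ α β i j).2 (h _ _ (.T_μ α β i j))
    | T_ν α β i j => exact (T_ν α β i j).2 (h _ _ (.T_ν α β i j))
    | Ω_μ α β σ i j => exact (sand _ _ _ _ rfl rfl _ _ _ _ i j).2 (h _ _ (.Ω_μ α β σ i j))
    | F_μ α β σ i j =>
      exact (sand _ _ _ _ rfl (map_F φ D) _ _ _ _ i j).2 (h _ _ (.F_μ α β σ i j))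
    | Θ_ν α β σ i j =>
      exact (sand _ _ _ _ rfl (map_Θ φ D) _ _ _ _ i j).2 (h _ _ (.Θ_ν α β σ i j))
    | G_ν α β σ i j =>
      exact (sand _ _ _ _ rfl (map_G φ D) _ _ _ _ i j).2 (h _ _ (.G_ν α β σ i j))
    | Ω_ρ α β σ i j =>
      exact (sand _ _ _ _ (map_F φ D) rfl _ _ _ _ i j).2 (h _ _ (.Ω_ρ α β σ i j))

theorem holds_traceRel_map :
    Holds (TraceRel 𝓡 (D.map φ) (S.map φ)) ↔ HoldsMap φ (TraceRel 𝓡 D S) := by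
  have tr (α w) : (S.map φ).ρ.x α * wtr 𝓡.D (monomial (D.map φ) w) =
      wtr 𝓡.D (monomial (D.map φ) w) * (S.map φ).ρ.x α ↔
      φ (S.ρ.x α * wtr 𝓡.D (monomial D w)) = φ (wtr 𝓡.D (monomial D w) * S.ρ.x α) := by
    rw [map_mul, map_mul, map_wtr, map_monomial]; rfl
  constructor
  · rintro h _ _ ⟨α, w⟩
    exact (tr α w).1 (h _ _ (.tr α w))
  · rintro h _ _ ⟨α, w⟩
    exact (tr α w).2 (h _ _ (.tr α w))

theorem holds_hatRel_map :
    Holds (HatRel 𝓡 s (D.map φ) (S.map φ)) ↔ HoldsMap φ (HatRel 𝓡 s D S) := by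
  constructor
  · rintro h x y (⟨_, _, h'⟩ | ⟨_, _, h'⟩ | ⟨_, _, h'⟩ | ⟨_, _, h'⟩ | ⟨l, _, _, h'⟩ | ⟨_, _, h'⟩)
    · exact holds_calcRel_map.1 (fun a b hab => h a b (.calc a b hab)) x y h'
    · exact holds_specRel_map.1 (fun a b hab => h a b (.spec a b hab)) x y h'
    · exact holds_paramRel_map.1 (fun a b hab => h a b (.param a b hab)) x y h'
    · exact holds_commRel_map.1 (fun a b hab => h a b (.comm a b hab)) x y h'
    · exact (holds_exch1_map l).1 (fun a b hab => h a b (.exch l a b hab)) x y h'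
    · exact holds_traceRel_map.1 (fun a b hab => h a b (.trace a b hab)) x y h'
  · rintro h x y (⟨_, _, h'⟩ | ⟨_, _, h'⟩ | ⟨_, _, h'⟩ | ⟨_, _, h'⟩ | ⟨l, _, _, h'⟩ | ⟨_, _, h'⟩)
    · exact holds_calcRel_map.2 (fun a b hab => h a b (.calc a b hab)) x y h'
    · exact holds_specRel_map.2 (fun a b hab => h a b (.spec a b hab)) x y h'
    · exact holds_paramRel_map.2 (fun a b hab => h a b (.param a b hab)) x y h'
    · exact holds_commRel_map.2 (fun a b hab => h a b (.comm a b hab)) x y h'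
    · exact (holds_exch1_map l).2 (fun a b hab => h a b (.exch l a b hab)) x y h'
    · exact holds_traceRel_map.2 (fun a b hab => h a b (.trace a b hab)) x y h'

end Functoriality

/-! ### Universal properties -/

section Universal

variable {n : ℕ} {𝓡 : RData n} {s : Kind}

theorem holds_hat : Holds (HatRel 𝓡 s (Hat.calc 𝓡 s) (Hat.spec 𝓡 s)) :=
  holds_hatRel_map (φ := RingQuot.mkAlgHom ℂ _).2 fun _ _ h => RingQuot.mkAlgHom_rel ℂ h

theorem holds_fun : Holds (FunRel 𝓡 s (Fun.T 𝓡 s) (Fun.T' 𝓡 s)) :=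
  holds_funRel_map (φ := RingQuot.mkAlgHom ℂ _).2 fun _ _ h => RingQuot.mkAlgHom_rel ℂ h

variable {B : Type*} [Ring B] [Algebra ℂ B]

/-- The universal property of the extended calculus. -/
theorem exists_hat_lift {D : Calc n B} {S : Spec n B} (h : Holds (HatRel 𝓡 s D S)) :
    ∃ φ : Hat 𝓡 s →ₐ[ℂ] B, (Hat.calc 𝓡 s).map φ = D ∧ (Hat.spec 𝓡 s).map φ = S := by
  let g : CalcGen n ⊕ SpecGen n → B
    | .inl (.T i j) => D.T i j
    | .inl (.T' i j) => D.T' i j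
    | .inl (.Ω i j) => D.Ω i j
    | .inl (.L i j) => D.L i j
    | .inl (.K i j) => D.K i j
    | .inr (.μ (.x α)) => S.μ.x α
    | .inr (.μ (.x' α)) => S.μ.x' α
    | .inr (.μ (.d α β)) => S.μ.d α β
    | .inr (.ν (.x α)) => S.ν.x α
    | .inr (.ν (.x' α)) => S.ν.x' α
    | .inr (.ν (.d α β)) => S.ν.d α β
    | .inr (.ρ (.x α)) => S.ρ.x α
    | .inr (.ρ (.x' α)) => S.ρ.x' α
    | .inr (.ρ (.d α β)) => S.ρ.d α β
  have hg (x) : FreeAlgebra.lift ℂ g (FreeAlgebra.ι ℂ x) = g x := FreeAlgebra.lift_ι_apply g x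
  have hD : (Calc.ofGen fun x => FreeAlgebra.ι ℂ (Sum.inl x)).map (FreeAlgebra.lift ℂ g) = D := by
    obtain ⟨T, T', Ω, L, K⟩ := D
    simp only [Calc.map, Calc.mk.injEq]
    refine ⟨?_, ?_, ?_, ?_, ?_⟩ <;> ext i j <;> exact hg _
  have hS : (Spec.ofGen fun x => FreeAlgebra.ι ℂ (Sum.inr x)).map (FreeAlgebra.lift ℂ g) = S := by
    obtain ⟨⟨_, _, _⟩, ⟨_, _, _⟩, ⟨_, _, _⟩⟩ := S
    simp only [Spec.map, Eig.map, Spec.mk.injEq, Eig.mk.injEq]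
    refine ⟨⟨?_, ?_, ?_⟩, ⟨?_, ?_, ?_⟩, ⟨?_, ?_, ?_⟩⟩ <;> ext <;> exact hg _
  have hl : HoldsMap (FreeAlgebra.lift ℂ g) _ := holds_hatRel_map.1 (hD.symm ▸ hS.symm ▸ h)
  let φ : Hat 𝓡 s →ₐ[ℂ] B := RingQuot.liftAlgHom ℂ ⟨FreeAlgebra.lift ℂ g, fun x y hxy => hl x y hxy⟩
  have hφ (x) : φ (RingQuot.mkAlgHom ℂ _ x) = FreeAlgebra.lift ℂ g x :=
    RingQuot.liftAlgHom_mkAlgHom_apply ℂ _ _ x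
  refine ⟨φ, Eq.trans ?_ hD, Eq.trans ?_ hS⟩
  · simp only [Calc.map, Calc.mk.injEq]
    refine ⟨?_, ?_, ?_, ?_, ?_⟩ <;> ext i j <;> exact hφ _
  · simp only [Spec.map, Eig.map, Spec.mk.injEq, Eig.mk.injEq]
    refine ⟨⟨?_, ?_, ?_⟩, ⟨?_, ?_, ?_⟩, ⟨?_, ?_, ?_⟩⟩ <;> ext <;> exact hφ _

theorem exists_dc_lift {D : Calc n B} (h : Holds (CalcRel 𝓡 s D)) :
    ∃ φ : DC 𝓡 s →ₐ[ℂ] B, (DC.calc 𝓡 s).map φ = D := by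
  let g : CalcGen n → B
    | .T i j => D.T i j
    | .T' i j => D.T' i j
    | .Ω i j => D.Ω i j
    | .L i j => D.L i j
    | .K i j => D.K i j
  have hg (x) : FreeAlgebra.lift ℂ g (FreeAlgebra.ι ℂ x) = g x := FreeAlgebra.lift_ι_apply g x
  have hD : (Calc.ofGen (FreeAlgebra.ι ℂ)).map (FreeAlgebra.lift ℂ g) = D := by
    obtain ⟨T, T', Ω, L, K⟩ := D
    simp only [Calc.map, Calc.mk.injEq]
    refine ⟨?_, ?_, ?_, ?_, ?_⟩ <;> ext i j <;> exact hg _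
  have hl : HoldsMap (FreeAlgebra.lift ℂ g) _ := holds_calcRel_map.1 (hD.symm ▸ h)
  let φ : DC 𝓡 s →ₐ[ℂ] B := RingQuot.liftAlgHom ℂ ⟨FreeAlgebra.lift ℂ g, fun x y hxy => hl x y hxy⟩
  have hφ (x) : φ (RingQuot.mkAlgHom ℂ _ x) = FreeAlgebra.lift ℂ g x :=
    RingQuot.liftAlgHom_mkAlgHom_apply ℂ _ _ x
  refine ⟨φ, Eq.trans ?_ hD⟩
  simp only [Calc.map, Calc.mk.injEq]
  refine ⟨?_, ?_, ?_, ?_, ?_⟩ <;> ext i j <;> exact hφ _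

theorem exists_specAlg_lift {S : Spec n B} (h : Holds (SpecRel 𝓡 S)) :
    ∃ φ : SpecAlg 𝓡 →ₐ[ℂ] B, (SpecAlg.spec 𝓡).map φ = S := by
  let g : SpecGen n → B
    | .μ (.x α) => S.μ.x α
    | .μ (.x' α) => S.μ.x' α
    | .μ (.d α β) => S.μ.d α β
    | .ν (.x α) => S.ν.x α
    | .ν (.x' α) => S.ν.x' α
    | .ν (.d α β) => S.ν.d α β
    | .ρ (.x α) => S.ρ.x α
    | .ρ (.x' α) => S.ρ.x' α
    | .ρ (.d α β) => S.ρ.d α β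
  have hg (x) : FreeAlgebra.lift ℂ g (FreeAlgebra.ι ℂ x) = g x := FreeAlgebra.lift_ι_apply g x
  have hS : (Spec.ofGen (FreeAlgebra.ι ℂ)).map (FreeAlgebra.lift ℂ g) = S := by
    obtain ⟨⟨_, _, _⟩, ⟨_, _, _⟩, ⟨_, _, _⟩⟩ := S
    simp only [Spec.map, Eig.map, Spec.mk.injEq, Eig.mk.injEq]
    refine ⟨⟨?_, ?_, ?_⟩, ⟨?_, ?_, ?_⟩, ⟨?_, ?_, ?_⟩⟩ <;> ext <;> exact hg _
  have hl : HoldsMap (FreeAlgebra.lift ℂ g) _ := holds_specRel_map.1 (hS.symm ▸ h)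
  let φ : SpecAlg 𝓡 →ₐ[ℂ] B :=
    RingQuot.liftAlgHom ℂ ⟨FreeAlgebra.lift ℂ g, fun x y hxy => hl x y hxy⟩
  have hφ (x) : φ (RingQuot.mkAlgHom ℂ _ x) = FreeAlgebra.lift ℂ g x :=
    RingQuot.liftAlgHom_mkAlgHom_apply ℂ _ _ x
  refine ⟨φ, Eq.trans ?_ hS⟩
  simp only [Spec.map, Eig.map, Spec.mk.injEq, Eig.mk.injEq]
  refine ⟨⟨?_, ?_, ?_⟩, ⟨?_, ?_, ?_⟩, ⟨?_, ?_, ?_⟩⟩ <;> ext <;> exact hφ _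

theorem exists_fun_lift {T T' : Mat1 n B} (h : Holds (FunRel 𝓡 s T T')) :
    ∃ φ : Fun 𝓡 s →ₐ[ℂ] B, φ.mapMatrix (Fun.T 𝓡 s) = T ∧ φ.mapMatrix (Fun.T' 𝓡 s) = T' := by
  let g : FunGen n → B
    | .T i j => T i j
    | .T' i j => T' i j
  have hg (x) : FreeAlgebra.lift ℂ g (FreeAlgebra.ι ℂ x) = g x := FreeAlgebra.lift_ι_apply g x
  have hT : (FreeAlgebra.lift ℂ g).mapMatrix (Matrix.of fun i j => FreeAlgebra.ι ℂ (FunGen.T i j)) =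
      T := by
    ext i j; exact hg _
  have hT' : (FreeAlgebra.lift ℂ g).mapMatrix
      (Matrix.of fun i j => FreeAlgebra.ι ℂ (FunGen.T' i j)) = T' := by
    ext i j; exact hg _
  have hl : HoldsMap (FreeAlgebra.lift ℂ g) _ := holds_funRel_map.1 (hT.symm ▸ hT'.symm ▸ h)
  let φ : Fun 𝓡 s →ₐ[ℂ] B :=
    RingQuot.liftAlgHom ℂ ⟨FreeAlgebra.lift ℂ g, fun x y hxy => hl x y hxy⟩
  have hφ (x) : φ (RingQuot.mkAlgHom ℂ _ x) = FreeAlgebra.lift ℂ g x :=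
    RingQuot.liftAlgHom_mkAlgHom_apply ℂ _ _ x
  refine ⟨φ, Eq.trans ?_ hT, Eq.trans ?_ hT'⟩ <;> ext i j <;> exact hφ _

/-- The extended calculus is generated by the matrix entries and the spectral variables. -/
theorem hat_algHom_ext {f g : Hat 𝓡 s →ₐ[ℂ] B} (hD : (Hat.calc 𝓡 s).map f = (Hat.calc 𝓡 s).map g)
    (hS : (Hat.spec 𝓡 s).map f = (Hat.spec 𝓡 s).map g) : f = g := by
  refine RingQuot.ringQuot_ext' ℂ f g (FreeAlgebra.hom_ext (funext fun x => ?_))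
  have e1 {i j} (M : Calc n B → Mat1 n B) := congrArg (fun D => M D i j) hD
  rcases x with (⟨i, j⟩ | ⟨i, j⟩ | ⟨i, j⟩ | ⟨i, j⟩ | ⟨i, j⟩) |
    ((α | α | ⟨α, β⟩) | (α | α | ⟨α, β⟩) | (α | α | ⟨α, β⟩))
  · exact e1 Calc.T
  · exact e1 Calc.T'
  · exact e1 Calc.Ω
  · exact e1 Calc.L
  · exact e1 Calc.K
  · exact congrArg (fun S => S.μ.x α) hS
  · exact congrArg (fun S => S.μ.x' α) hS
  · exact congrArg (fun S => S.μ.d α β) hS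
  · exact congrArg (fun S => S.ν.x α) hS
  · exact congrArg (fun S => S.ν.x' α) hS
  · exact congrArg (fun S => S.ν.d α β) hS
  · exact congrArg (fun S => S.ρ.x α) hS
  · exact congrArg (fun S => S.ρ.x' α) hS
  · exact congrArg (fun S => S.ρ.d α β) hS

end Universal


/-! ### Invariance of traces and coefficients under the quantum group -/

section Invariance

variable {n : ℕ} {𝓡 : RData n} {B : Type*} [Ring B] [Algebra ℂ B]

/-- An invertible matrix `t` with the relation `R t₁ t₂ = t₁ t₂ R`. -/
structure FunEqs (𝓡 : RData n) (t t' : Mat1 n B) : Prop where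
  rtt : Commute (𝓡.Rm B) (fst t * snd t)
  mul_inv : t * t' = 1
  inv_mul : t' * t = 1

theorem FunEqs.of_holds {s : Kind} {t t' : Mat1 n B} (h : Holds (FunRel 𝓡 s t t')) :
    FunEqs 𝓡 t t' where
  rtt := Matrix.ext fun i j => by rw [← mul_assoc]; exact h _ _ (.rtt i j)
  mul_inv := Matrix.ext fun i j => h _ _ (.mul_inv i j)
  inv_mul := Matrix.ext fun i j => h _ _ (.inv_mul i j)

namespace FunEqs

open RData.IsHecke (fst_mul slice2)

variable {t t' : Mat1 n B}

theorem fst_mul_inv (e : FunEqs 𝓡 t t') : fst t * fst t' = 1 := by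
  rw [← fst_mul, e.mul_inv, fst_one]

theorem fst_inv_mul (e : FunEqs 𝓡 t t') : fst t' * fst t = 1 := by
  rw [← fst_mul, e.inv_mul, fst_one]

theorem snd_mul_inv (e : FunEqs 𝓡 t t') : snd t * snd t' = 1 := by
  rw [← snd_mul, e.mul_inv, snd_one]

theorem snd_inv_mul (e : FunEqs 𝓡 t t') : snd t' * snd t = 1 := by
  rw [← snd_mul, e.inv_mul, snd_one]

theorem pair_mul_inv (e : FunEqs 𝓡 t t') : fst t * snd t * (snd t' * fst t') = 1 := by
  rw [mul_assoc, ← mul_assoc (snd t), e.snd_mul_inv, one_mul, e.fst_mul_inv]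

theorem pair_inv_mul (e : FunEqs 𝓡 t t') : snd t' * fst t' * (fst t * snd t) = 1 := by
  rw [mul_assoc, ← mul_assoc (fst t'), e.fst_inv_mul, one_mul, e.snd_inv_mul]

theorem rtt_inv (e : FunEqs 𝓡 t t') : Commute (𝓡.Rm B) (snd t' * fst t') :=
  inv_intertwine e.rtt.symm.eq e.pair_mul_inv e.pair_inv_mul

theorem rtt_Ri (h : 𝓡.IsHecke) {X : Mat2 n B} (hX : Commute (𝓡.Rm B) X) :
    Commute (𝓡.Ri B) X := by
  rw [h.Ri_eq]
  exact hX.sub_left ((Commute.one_left _).smul_left _)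

/-- The inverse matrix satisfies the same relation for `R_op`. -/
theorem op (e : FunEqs 𝓡 t t') : FunEqs 𝓡.op t' t where
  rtt := by
    have := e.rtt_inv.map swapHom
    rwa [map_mul, swapHom_Rm, swapHom_fst, swapHom_snd] at this
  mul_inv := e.inv_mul
  inv_mul := e.mul_inv

theorem conj_eq (e : FunEqs 𝓡 t t') : fst t' * 𝓡.Rm B * fst t = snd t * 𝓡.Rm B * snd t' := by
  calc fst t' * 𝓡.Rm B * fst t = fst t' * (𝓡.Rm B * (fst t * snd t)) * snd t' := by
        simp only [mul_assoc, e.snd_mul_inv, mul_one]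
    _ = snd t * 𝓡.Rm B * snd t' := by
        rw [e.rtt.eq, ← mul_assoc, ← mul_assoc, e.fst_inv_mul, one_mul]

/-- Block of an operator on `V ⊗ V` with fixed indices in the first factor. -/
def sndBlock (M : Mat2 n B) (i j : Fin n) : Mat1 n B := Matrix.of fun x y => M (i, x) (j, y)

theorem sndBlock_conj (t t' : Mat1 n B) (M : Mat2 n B) (i j) :
    sndBlock (snd t * M * snd t') i j = t * sndBlock M i j * t' := by
  ext x y
  simp [sndBlock, snd, Matrix.mul_apply, Matrix.kroneckerMap_apply, Fintype.sum_prod_type,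
    Matrix.one_apply]

theorem ptr2_eq_wtr (D : Mat1 n ℂ) (M : Mat2 n B) (i j) :
    ptr2 D M i j = wtr D (sndBlock M i j) := rfl

/-- The invariance of the weighted trace under `t`, as an identity between the entries of `t` and
`t'`. By skew invertibility it suffices to test it on the matrices cut out of `R`, and for these it
follows from `t₁⁻¹ R t₁ = t₂ R t₂⁻¹`. -/
theorem sum_conj (h : 𝓡.IsHecke) (e : FunEqs 𝓡 t t') (c d : Fin n) :
    ∑ a, ∑ b, 𝓡.D a b • (t b c * t' d a) = algebraMap ℂ B (𝓡.D d c) := by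
  let f : Mat1 n ℂ →ₗ[ℂ] B :=
    { toFun := fun Y => wtr 𝓡.D (t * Y.map (algebraMap ℂ B) * t') - algebraMap ℂ B (wtr 𝓡.D Y)
      map_add' := fun X Y => by
        rw [Matrix.map_add _ (map_add _), mul_add, add_mul, RData.IsHecke.wtr_add,
          RData.IsHecke.wtr_add, map_add]
        abel
      map_smul' := fun x Y => by
        have : (x • Y).map (algebraMap ℂ B) = x • Y.map (algebraMap ℂ B) := by
          ext i j; simp [Matrix.smul_apply, Algebra.smul_def x (algebraMap ℂ B _)]
        rw [this, mul_smul_comm, smul_mul_assoc, RData.IsHecke.wtr_smul, RData.IsHecke.wtr_smul,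
          smul_eq_mul, map_mul, RingHom.id_apply, smul_sub, Algebra.smul_def, Algebra.smul_def] }
  have hf : f = 0 := h.eq_zero_of_slice2 f fun i j => by
    have h1 : wtr 𝓡.D (t * (slice2 𝓡.R i j).map (algebraMap ℂ B) * t') =
        ptr2 𝓡.D (snd t * 𝓡.Rm B * snd t') i j := by
      rw [ptr2_eq_wtr, sndBlock_conj]; rfl
    have h2 : algebraMap ℂ B (wtr 𝓡.D (slice2 𝓡.R i j)) = ptr2 𝓡.D (𝓡.Rm B) i j := by
      simp [wtr, slice2, ptr2_apply, RData.Rm, Algebra.smul_def]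
    change wtr 𝓡.D _ - algebraMap ℂ B _ = 0
    rw [h1, h2, ← e.conj_eq, ptr2_mul_fst, ptr2_fst_mul, h.ptr2_R, mul_one, e.inv_mul, sub_self]
  have := congrArg (fun f => f (Matrix.single c d 1)) hf
  change wtr 𝓡.D _ - algebraMap ℂ B _ = 0 at this
  rw [sub_eq_zero] at this
  have h3 : wtr 𝓡.D (Matrix.single c d (1 : ℂ)) = 𝓡.D d c := by
    simp [wtr, Matrix.single_apply, ite_and]
  rw [h3] at this
  rw [← this, wtr]
  refine Finset.sum_congr rfl fun a _ => Finset.sum_congr rfl fun b _ => ?_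
  congr 1
  simp [Matrix.mul_apply, Matrix.single_apply, ite_and]

theorem wtr_conj (h : 𝓡.IsHecke) (e : FunEqs 𝓡 t t') {X : Mat1 n B}
    (hX : ∀ a b c d, Commute (t a b) (X c d)) : wtr 𝓡.D (t * X * t') = wtr 𝓡.D X := by
  have h1 : wtr 𝓡.D (t * X * t') =
      ∑ d, ∑ c, X c d * ∑ a, ∑ b, 𝓡.D a b • (t b c * t' d a) := by
    simp only [wtr, Matrix.mul_apply, Finset.mul_sum, Finset.sum_mul, Finset.smul_sum]
    have h2 : ∀ a b c d, 𝓡.D a b • (t b c * X c d * t' d a) =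
        X c d * 𝓡.D a b • (t b c * t' d a) := fun a b c d => by
      rw [(hX _ _ _ _).eq, mul_assoc, mul_smul_comm]
    simp only [h2]
    calc _ = ∑ a, ∑ d, ∑ b, ∑ c, X c d * 𝓡.D a b • (t b c * t' d a) :=
          Finset.sum_congr rfl fun a _ => Finset.sum_comm
      _ = ∑ d, ∑ a, ∑ b, ∑ c, X c d * 𝓡.D a b • (t b c * t' d a) := Finset.sum_comm
      _ = ∑ d, ∑ a, ∑ c, ∑ b, X c d * 𝓡.D a b • (t b c * t' d a) :=
          Finset.sum_congr rfl fun d _ => Finset.sum_congr rfl fun a _ => Finset.sum_comm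
      _ = _ := Finset.sum_congr rfl fun d _ => Finset.sum_comm
  rw [h1]
  simp only [e.sum_conj h]
  rw [wtr]
  refine Finset.sum_congr rfl fun d _ => Finset.sum_congr rfl fun c _ => ?_
  rw [← Algebra.commutes, Algebra.smul_def]

end FunEqs

/-- The product `t₁ t₂ ... tₘ` in the `k`-th tensor power. -/
def sites (k : ℕ) (t : Mat1 n B) : ℕ → MatT n k B
  | 0 => 1
  | m + 1 => sites k t m * site k m t

/-- The product `tₘ ... t₂ t₁` in the `k`-th tensor power. -/
def sitesRev (k : ℕ) (t : Mat1 n B) : ℕ → MatT n k B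
  | 0 => 1
  | m + 1 => site k m t * sitesRev k t m

theorem sites_eq_prod (k : ℕ) (t : Mat1 n B) (m : ℕ) :
    sites k t m = ((List.range m).map fun i => site k i t).prod := by
  induction m with
  | zero => rfl
  | succ m ih => rw [sites, ih, List.range_succ, List.map_append, List.prod_append]; simp

variable {t t' : Mat1 n B}

theorem site_mul {k i : ℕ} (hi : i < k) (X Y : Mat1 n B) :
    site k i (X * Y) = site k i X * site k i Y := by
  simp only [site_eq_hom hi, map_mul]

theorem site_one_eq {k i : ℕ} (hi : i < k) : site k i (1 : Mat1 n B) = 1 := by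
  rw [site_eq_hom hi, map_one]

theorem FunEqs.sites_mul_rev (e : FunEqs 𝓡 t t') (k : ℕ) {m : ℕ} (hm : m ≤ k) :
    sites k t m * sitesRev k t' m = 1 := by
  induction m with
  | zero => exact mul_one 1
  | succ m ih =>
    rw [sites, sitesRev, mul_assoc, ← mul_assoc (site k m t), ← site_mul hm, e.mul_inv,
      site_one_eq hm, one_mul, ih (by omega)]

theorem commute_sites {k m : ℕ} {Z : MatT n k B} (h : ∀ i < m, Commute Z (site k i t)) :
    Commute Z (sites k t m) := by
  induction m with
  | zero => exact Commute.one_right _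
  | succ m ih => exact (ih fun i hi => h i (by omega)).mul_right (h m (by omega))

theorem emb_sites {k m : ℕ} (hm : m ≤ k) : emb k (sites k t m) = sites (k + 1) t m := by
  induction m with
  | zero => exact map_one _
  | succ m ih => rw [sites, map_mul, ih (by omega), emb_site hm]; rfl

theorem emb_sitesRev {k m : ℕ} (hm : m ≤ k) : emb k (sitesRev k t m) = sitesRev (k + 1) t m := by
  induction m with
  | zero => exact map_one _
  | succ m ih => rw [sitesRev, map_mul, ih (by omega), emb_site hm]; rfl

/-- Either both or none of the factors on which `R` acts carry a matrix `t`. -/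
theorem FunEqs.commute_sites_Rs (e : FunEqs 𝓡 t t') {k m j : ℕ} (hj : j + 1 < k) (hm : m ≤ k)
    (hmj : m ≤ j ∨ j + 2 ≤ m) : Commute (sites k t m) (Rs 𝓡 B k j) := by
  have far (i) (hi : i < k) (h1 : i ≠ j) (h2 : i ≠ j + 1) : Commute (site k i t) (Rs 𝓡 B k j) :=
    site_commute_site2 h1 h2 hi fun a b c d => (Algebra.commutes _ _).symm
  rcases hmj with hmj | hmj
  · exact (commute_sites fun i hi => (far i (by omega) (by omega) (by omega)).symm).symm
  · obtain ⟨d, rfl⟩ := Nat.exists_eq_add_of_le hmj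
    clear hmj
    induction d with
    | zero =>
      have h1 : Commute (site k j t * site k (j + 1) t) (Rs 𝓡 B k j) := by
        rw [← site2_fst hj, ← site2_snd hj, Rs, site2_eq_hom hj, site2_eq_hom hj, site2_eq_hom hj,
          ← map_mul]
        exact e.rtt.symm.map _
      have h2 : Commute (sites k t j) (Rs 𝓡 B k j) :=
        (commute_sites fun i hi => (far i (by omega) (by omega) (by omega)).symm).symm
      have : sites k t (j + 2 + 0) = sites k t j * (site k j t * site k (j + 1) t) :=
        mul_assoc _ _ _
      rw [this]
      exact h2.mul_left h1
    | succ d ih =>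
      have hd : j + 2 + d < k := hm
      exact (ih hd.le).mul_left (far (j + 2 + d) hd (by omega) (by omega))

theorem FunEqs.commute_sites_all (e : FunEqs 𝓡 t t') (k j : ℕ) :
    Commute (sites k t k) (Rs 𝓡 B k j) := by
  rcases Nat.lt_or_ge (j + 1) k with hj | hj
  · exact e.commute_sites_Rs hj le_rfl (Or.inr hj)
  · rw [Rs, site2_of_le hj]; exact Commute.zero_right _

theorem FunEqs.commute_sites_all' (h : 𝓡.IsHecke) (e : FunEqs 𝓡 t t') (k j : ℕ) :
    Commute (sites k t k) (Rsi 𝓡 B k j) := by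
  rcases Nat.lt_or_ge (j + 1) k with hj | hj
  · have := e.commute_sites_all k j
    rw [Rs, site2_eq_hom hj] at this
    rw [Rsi, site2_eq_hom hj, h.Ri_eq, map_sub, map_smul, map_one]
    exact this.sub_right ((Commute.one_right _).smul_right _)
  · rw [Rsi, site2_of_le hj]; exact Commute.zero_right _

theorem sites_conj {X : Mat1 n B} (htX : ∀ a b c d, Commute (X a b) (t c d))
    (e : FunEqs 𝓡 t t') {k m : ℕ} (hm : m + 1 ≤ k) :
    sites k t (m + 1) * site k 0 X = site k 0 (t * X * t') * sites k t (m + 1) := by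
  induction m with
  | zero =>
    have : sites k t (0 + 1) = site k 0 t := one_mul _
    rw [this, ← site_mul hm, ← site_mul hm, mul_assoc _ t', e.inv_mul, mul_one]
  | succ m ih =>
    rw [sites, mul_assoc, ← (site_commute_site (by omega) (by omega) (by omega) htX :
      Commute (site k 0 X) (site k (m + 1) t)).eq, ← mul_assoc, ih (by omega), mul_assoc]

theorem extend_last {k : ℕ} (a : Fin k → Fin n) (x : Fin n) (z : Fin 1 → Fin n) :
    Function.extend (oneMap (k + 1) k (by omega)) z (snoc a x) = snoc a (z 0) := by
  have hinj := oneMap_injective (k + 1) k (by omega)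
  have h0 : oneMap (k + 1) k (by omega) 0 = Fin.last k := rfl
  ext j
  induction j using Fin.lastCases with
  | last => rw [← h0, hinj.extend_apply, h0]; simp
  | cast j =>
    rw [Function.extend_apply']
    · simp
    · rintro ⟨i, hi⟩
      have := congrArg Fin.val hi
      simp [oneMap] at this
      omega

theorem blk1_site_mul {k : ℕ} (a b : Fin k → Fin n) (Z : MatT n (k + 1) B) :
    blk1 a b (site (k + 1) k t * Z) = t * blk1 a b Z := by
  ext x y
  rw [site_eq_loc (by omega), blk1_apply, loc_mul_apply (oneMap_injective _ _ _), Matrix.mul_apply]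
  simp only [extend_last, m1_apply]
  have h0 : snoc a x (oneMap (k + 1) k (by omega) 0) = x := snoc_last a x
  simp only [Function.comp_def, h0]
  exact Fintype.sum_equiv (Equiv.funUnique (Fin 1) (Fin n)) _ _ fun _ => rfl

theorem blk1_mul_site {k : ℕ} (a b : Fin k → Fin n) (Z : MatT n (k + 1) B) :
    blk1 a b (Z * site (k + 1) k t) = blk1 a b Z * t := by
  ext x y
  rw [site_eq_loc (by omega), blk1_apply, mul_loc_apply (oneMap_injective _ _ _), Matrix.mul_apply]
  simp only [extend_last, m1_apply]
  have h0 : snoc b y (oneMap (k + 1) k (by omega) 0) = y := snoc_last b y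
  simp only [Function.comp_def, h0]
  exact Fintype.sum_equiv (Equiv.funUnique (Fin 1) (Fin n)) _ _ fun _ => rfl

/-- The invariance of the weighted trace, factor by factor from the last one on. -/
theorem FunEqs.wtrT_conj (h : 𝓡.IsHecke) (e : FunEqs 𝓡 t t') (k : ℕ) {Z : MatT n k B}
    (hZ : ∀ a b c d, Commute (t a b) (Z c d)) :
    wtrT k 𝓡.D (sites k t k * Z * sitesRev k t' k) = wtrT k 𝓡.D Z := by
  induction k with
  | zero => simp [sites, sitesRev]
  | succ k ih =>
    have h1 : sites (k + 1) t (k + 1) * Z * sitesRev (k + 1) t' (k + 1) =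
        emb k (sites k t k) * (site (k + 1) k t * Z * site (k + 1) k t') *
          emb k (sitesRev k t' k) := by
      rw [emb_sites le_rfl, emb_sitesRev le_rfl, sites, sitesRev]
      simp only [mul_assoc]
    have h2 : ptr 𝓡.D k (site (k + 1) k t * Z * site (k + 1) k t') = ptr 𝓡.D k Z := by
      ext a b
      rw [ptr_eq_wtr, ptr_eq_wtr, blk1_mul_site, blk1_site_mul]
      exact e.wtr_conj h fun _ _ _ _ => hZ _ _ _ _
    rw [wtrT_succ, wtrT_succ, h1, ptr_mul_emb, ptr_emb_mul, h2]
    refine ih fun a b c d => ?_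
    rw [ptr_apply]
    exact Commute.sum_right _ _ _ fun x _ => Commute.sum_right _ _ _ fun y _ =>
      (hZ _ _ _ _).smul_right _

theorem wedge_eq_prod (X : Mat1 n B) (k : ℕ) : 𝓡.wedge X k =
    𝓡.Am B k * ((List.range k).map fun j => 𝓡.overCopy k X j).prod := by
  rw [RData.wedge, RData.Am_eq, copyProd]
  congr 2
  exact List.map_congr_left fun m _ => (RData.overCopy_eq k m X).symm

/-- The coefficients of the characteristic polynomial are invariant under `X ↦ t X t⁻¹`. -/
theorem FunEqs.coeffR_conj (h : 𝓡.IsHecke) (e : FunEqs 𝓡 t t') {M : Type*} [Ring M] [Algebra ℂ M]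
    (g : M →ₐ[ℂ] B) (hc : ∀ a b y, Commute (t a b) (g y)) (X : Mat1 n M) (i : ℕ) :
    𝓡.coeffR (t * g.mapMatrix X * t') i = 𝓡.coeffR (g.mapMatrix X) i := by
  rcases i with _ | i
  · rw [RData.coeffR_zero, RData.coeffR_zero]
  set k := i + 1 with hk
  have key : 𝓡.wedge (t * g.mapMatrix X * t') k =
      sites k t k * 𝓡.wedge (g.mapMatrix X) k * sitesRev k t' k := by
    have h1 := copyProd_intertwine (c := 1) (Z := sites k t k) (g := Rs 𝓡 B k) (gi := Rsi 𝓡 B k)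
      (e.commute_sites_all k) (e.commute_sites_all' h k)
      (J := site k 0 (g.mapMatrix X)) (J' := site k 0 (t * g.mapMatrix X * t'))
      (by rw [one_smul]; exact sites_conj (fun a b c d => (hc c d _).symm) e le_rfl) k
    rw [one_pow, one_smul] at h1
    have h2 : Commute (sites k t k) (asym 𝓡.q (Rs 𝓡 B k) k) :=
      commute_asym fun j _ => e.commute_sites_all k j
    rw [RData.wedge, RData.wedge, ← mul_assoc, h2.eq, mul_assoc _ (sites k t k), h1,
      ← mul_assoc, mul_assoc _ (sites k t k), e.sites_mul_rev k le_rfl, mul_one]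
  have hw : 𝓡.wedge (g.mapMatrix X) k = g.mapMatrix (𝓡.wedge X k) := by
    have h3 : ∀ j, 𝓡.overCopy k (g.mapMatrix X) j = g.mapMatrix (𝓡.overCopy k X j) :=
      fun j => (map_overCopy g 𝓡 k X j).symm
    rw [wedge_eq_prod, wedge_eq_prod, map_mul, map_Am, map_list_prod, List.map_map]
    simp only [h3]
    rfl
  rw [RData.coeffR_eq, RData.coeffR_eq, key, hw]
  exact e.wtrT_conj h k fun a b c d => hc a b _

/-- The coefficients of the characteristic polynomial are invariant under `Y ↦ u⁻¹ Y u`. -/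
theorem FunEqs.coeffL_conj (h : 𝓡.IsGood) (e : FunEqs 𝓡 t t') {M : Type*} [Ring M] [Algebra ℂ M]
    (g : M →ₐ[ℂ] B) (hc : ∀ a b y, Commute (t' a b) (g y)) (X : Mat1 n M) {i : ℕ} (hi : i ≤ n) :
    𝓡.coeffL (t' * g.mapMatrix X * t) i = 𝓡.coeffL (g.mapMatrix X) i := by
  rw [RData.coeffL_eq h _ hi, RData.coeffL_eq h _ hi]
  exact e.op.coeffR_conj h.toIsHecke.op g hc X i

/-- The quantum determinant is multiplicative on matrices with commuting entries. -/
theorem FunEqs.detT_mul (h : 𝓡.IsGood) (e : FunEqs 𝓡 t t') {u : Mat1 n B}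
    (hc : ∀ a b c d, Commute (t a b) (u c d)) : 𝓡.detT (t * u) = 𝓡.detT t * 𝓡.detT u := by
  have h1 : ∀ m ≤ n, sites n (t * u) m = sites n t m * sites n u m := by
    intro m hm
    induction m with
    | zero => exact (mul_one 1).symm
    | succ m ih =>
      have : Commute (site n m t) (sites n u m) := commute_sites fun i hi =>
        site_commute_site (by omega) (by omega) (by omega) hc
      rw [sites, sites, sites, ih (by omega), site_mul hm, mul_assoc, mul_assoc,
        ← mul_assoc (sites n u m), ← this.eq, mul_assoc]
  have h2 (T : Mat1 n B) : 𝓡.detT T = (𝓡.Am B n * sites n T n).trace := by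
    rw [RData.detT, sites_eq_prod]
  have h3 : Commute (𝓡.Am B n) (sites n t n) := by
    rw [RData.Am_eq]
    exact (commute_asym fun j _ => e.commute_sites_all n j).symm
  have h4 : Commute (𝓡.Am B n) (Matrix.scalar _ (𝓡.detT t)) := by
    ext a b
    simp [Matrix.scalar_apply, Matrix.mul_diagonal, Matrix.diagonal_mul, RData.Am,
      (Algebra.commutes _ _).symm]
  rw [h2, h1 n le_rfl, ← mul_assoc, h.Am_mul h3, ← h2, h4.eq, mul_assoc, h2 u]
  simp [Matrix.trace, Matrix.scalar_apply, Matrix.diagonal_mul, Finset.mul_sum]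

end Invariance


/-! ### Covariance of the relations -/

section Covariance

variable {n : ℕ} {𝓡 : RData n} {B : Type*} [Ring B] [Algebra ℂ B]

open RData.IsHecke (fst_mul)

theorem conjHom_of_commute {E : Type*} [Ring E] [Algebra ℂ E] {P P' Z : E} (h1 : P * P' = 1)
    (h2 : P' * P = 1) (hZ : Commute Z P) : conjHom P P' h1 h2 Z = Z := by
  rw [conjHom_apply, ← hZ.eq, mul_assoc, h1, mul_one]

variable {t t' T T' : Mat1 n B}

theorem pair_mul (hc : ∀ a b c d, Commute (t a b) (T c d)) :
    fst (t * T) * snd (t * T) = (fst t * snd t) * (fst T * snd T) := by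
  have : Commute (fst T) (snd t) := fst_commute_snd_iff.2 fun a b c d => (hc c d a b).symm
  rw [fst_mul, snd_mul, mul_assoc, ← mul_assoc (fst T), this.eq]
  simp only [mul_assoc]

/-- The product of two matrices of functions whose entries commute with each other is a matrix of
functions. -/
theorem holds_funRel_mul (h : 𝓡.IsGood) {s₁ s₂ s : Kind} (h₁ : s = .sl → s₁ = .sl)
    (h₂ : s = .sl → s₂ = .sl) (ht : Holds (FunRel 𝓡 s₁ t t')) (hT : Holds (FunRel 𝓡 s₂ T T'))
    (hc : ∀ a b c d, Commute (t a b) (T c d)) : Holds (FunRel 𝓡 s (t * T) (T' * t')) := by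
  have et := FunEqs.of_holds ht
  have eT := FunEqs.of_holds hT
  rintro _ _ (⟨i, j⟩ | ⟨i, j⟩ | ⟨i, j⟩ | hs)
  · rw [mul_assoc, pair_mul hc, (et.rtt.mul_right eT.rtt).eq]
  · rw [mul_assoc, ← mul_assoc T, eT.mul_inv, one_mul, et.mul_inv]
  · rw [mul_assoc, ← mul_assoc t', et.inv_mul, one_mul, eT.inv_mul]
  · rw [et.detT_mul h hc, ht _ _ (.det_T (h₁ hs)), hT _ _ (.det_T (h₂ hs)), one_mul]

/-- The left translation of the matrices of the calculus by `t`. -/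
def Calc.leftTranslate (t t' : Mat1 n B) (D : Calc n B) : Calc n B where
  T := t * D.T
  T' := D.T' * t'
  Ω := t * D.Ω * t'
  L := t * D.L * t'
  K := D.K

/-- The right translation of the matrices of the calculus by `t`. -/
def Calc.rightTranslate (t t' : Mat1 n B) (D : Calc n B) : Calc n B where
  T := D.T * t
  T' := t' * D.T'
  Ω := D.Ω
  L := D.L
  K := t' * D.K * t

theorem FunEqs.leftTranslate_F (e : FunEqs 𝓡 t t') (D : Calc n B) :
    (D.leftTranslate t t').F = t * D.F * t' := by
  simp only [Calc.F, Calc.leftTranslate, mul_assoc, ← mul_assoc t' t, e.inv_mul, one_mul]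

theorem FunEqs.leftTranslate_Θ (e : FunEqs 𝓡 t t') (D : Calc n B) :
    (D.leftTranslate t t').Θ = D.Θ := by
  simp only [Calc.Θ, Calc.leftTranslate, mul_assoc, ← mul_assoc t' t, e.inv_mul, one_mul]

theorem FunEqs.leftTranslate_G (e : FunEqs 𝓡 t t') (D : Calc n B) :
    (D.leftTranslate t t').G = D.G := by
  rw [Calc.G, e.leftTranslate_F]
  simp only [Calc.G, Calc.leftTranslate, mul_assoc, ← mul_assoc t' t, e.inv_mul, one_mul]

theorem FunEqs.rightTranslate_F (e : FunEqs 𝓡 t t') (D : Calc n B) :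
    (D.rightTranslate t t').F = D.F := by
  simp only [Calc.F, Calc.rightTranslate, mul_assoc, ← mul_assoc t t', e.mul_inv, one_mul]

theorem FunEqs.rightTranslate_Θ (D : Calc n B) :
    (D.rightTranslate t t').Θ = t' * D.Θ * t := by
  simp only [Calc.Θ, Calc.rightTranslate, mul_assoc]

theorem FunEqs.rightTranslate_G (e : FunEqs 𝓡 t t') (D : Calc n B) :
    (D.rightTranslate t t').G = t' * D.G * t := by
  rw [Calc.G, e.rightTranslate_F]
  simp only [Calc.G, Calc.rightTranslate, mul_assoc]

/-- Conjugation of operators on `V ⊗ V` by `t₁ t₂`. -/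
def FunEqs.conj2 (e : FunEqs 𝓡 t t') : Mat2 n B →ₐ[ℂ] Mat2 n B :=
  conjHom _ _ e.pair_mul_inv e.pair_inv_mul

/-- Conjugation of operators on `V ⊗ V` by the inverse of `t₁ t₂`. -/
def FunEqs.conj2' (e : FunEqs 𝓡 t t') : Mat2 n B →ₐ[ℂ] Mat2 n B :=
  conjHom _ _ e.pair_inv_mul e.pair_mul_inv

theorem FunEqs.conj2_Rm (e : FunEqs 𝓡 t t') : e.conj2 (𝓡.Rm B) = 𝓡.Rm B :=
  conjHom_of_commute _ _ e.rtt

theorem FunEqs.conj2'_Rm (e : FunEqs 𝓡 t t') : e.conj2' (𝓡.Rm B) = 𝓡.Rm B :=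
  conjHom_of_commute _ _ e.rtt_inv

theorem FunEqs.conj2_Ri (e : FunEqs 𝓡 t t') (h : 𝓡.IsHecke) : e.conj2 (𝓡.Ri B) = 𝓡.Ri B :=
  conjHom_of_commute _ _ (FunEqs.rtt_Ri h e.rtt)

theorem FunEqs.conj2_fst (e : FunEqs 𝓡 t t') {X : Mat1 n B} (hX : Commute (snd t) (fst X)) :
    e.conj2 (fst X) = fst (t * X * t') := by
  rw [conj2, conjHom_apply, fst_mul, fst_mul, mul_assoc, mul_assoc, mul_assoc, ← mul_assoc (snd t),
    hX.eq, mul_assoc, ← mul_assoc (snd t), e.snd_mul_inv, one_mul]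

theorem FunEqs.conj2'_snd (e : FunEqs 𝓡 t t') {X : Mat1 n B} (hX : Commute (fst t') (snd X)) :
    e.conj2' (snd X) = snd (t' * X * t) := by
  rw [conj2', conjHom_apply, snd_mul, snd_mul, mul_assoc, mul_assoc, mul_assoc,
    ← mul_assoc (fst t'), hX.eq, mul_assoc, ← mul_assoc (fst t'), e.fst_inv_mul, one_mul]

variable {M : Type*} [Ring M] [Algebra ℂ M]

/-- The entries of `t` commute with the image of `g`. -/
def Independent (t : Mat1 n B) (g : M →ₐ[ℂ] B) : Prop := ∀ a b y, Commute (t a b) (g y)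

namespace Independent

variable {g : M →ₐ[ℂ] B}

theorem fst_snd (hc : Independent t g) (X : Mat1 n M) :
    Commute (fst t) (snd (g.mapMatrix X)) := fst_commute_snd_iff.2 fun a b _ _ => hc a b _

theorem snd_fst (hc : Independent t g) (X : Mat1 n M) :
    Commute (snd t) (fst (g.mapMatrix X)) :=
  (fst_commute_snd_iff.2 fun _ _ a b => (hc a b _).symm).symm

theorem sc (hc : Independent t g) (y : M) : Commute (sc n (g y)) t :=
  commute_sc_iff.2 fun a b => (hc a b y).symm

end Independent

theorem FunEqs.conj_proj (e : FunEqs 𝓡 t t') {g : M →ₐ[ℂ] B} (hc : Independent t g) (q : ℂ)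
    (X : Mat1 n B) (E : Eig n M) (α : Fin n) :
    proj q (t * X * t') (E.map g) α = t * proj q X (E.map g) α * t' := by
  rw [← conjHom_apply e.mul_inv e.inv_mul, ← conjHom_apply e.mul_inv e.inv_mul (proj _ _ _ _), proj,
    proj, map_list_prod, List.map_map]
  congr 1
  refine List.map_congr_left fun β _ => ?_
  have hs (y) : conjHom t t' e.mul_inv e.inv_mul (QCalc.sc n (g y)) = QCalc.sc n (g y) :=
    conjHom_of_commute _ _ (hc.sc y)
  have h1 := hs (E.x β)
  have h2 := hs (q⁻¹ • E.d α β)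
  rw [map_smul] at h2
  simp only [Function.comp_apply, map_mul, map_sub, map_smul]
  exact congrArg₂ (· * ·) (congrArg (fun Z => _ - q • Z) h1.symm) h2.symm

theorem exch_conj {E : Type*} [Ring E] [Algebra ℂ E] {z P P' X : E} {a b : ℂ} (hP : Commute z P)
    (hP' : Commute z P') (hX : a • (X * z) = b • (z * X)) :
    a • (P * X * P' * z) = b • (z * (P * X * P')) := by
  have := congrArg (fun Y => P * Y * P') hX
  simp only [mul_smul_comm, smul_mul_assoc] at this
  rw [mul_assoc _ P', ← hP'.eq, ← mul_assoc z, ← mul_assoc z, hP.eq]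
  simpa only [mul_assoc] using this

theorem exch_conj' {E : Type*} [Ring E] [Algebra ℂ E] {z P P' X : E} {a b : ℂ} (hP : Commute z P)
    (hP' : Commute z P') (hX : a • (z * X) = b • (X * z)) :
    a • (z * (P * X * P')) = b • (P * X * P' * z) := (exch_conj hP hP' hX.symm).symm

theorem FunEqs.sandwich_conj (e : FunEqs 𝓡 t t') {g : M →ₐ[ℂ] B} (hc : Independent t g) {q : ℂ}
    {N X : Mat1 n B} {E : Eig n M} {α β σ : Fin n} (h1 : Commute (sc n (g (E.x α))) t)
    (h2 : Commute (sc n (g (E.x α))) t')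
    (hX : sandwichL q N X (E.map g) α β σ = sandwichR q N X (E.map g) α β σ) :
    sandwichL q (t * N * t') (t * X * t') (E.map g) α β σ =
      sandwichR q (t * N * t') (t * X * t') (E.map g) α β σ := by
  have h3 : t * proj q N (E.map g) β * t' * (t * X * t') * (t * proj q N (E.map g) σ * t') =
      t * (proj q N (E.map g) β * X * proj q N (E.map g) σ) * t' := by
    simp only [mul_assoc, ← mul_assoc t' t, e.inv_mul, one_mul]
  have := exch_conj h1 h2 hX
  rwa [sandwichL, sandwichR, e.conj_proj hc, e.conj_proj hc, h3]

theorem FunEqs.conj_monomial (e : FunEqs 𝓡 t t') (D : Calc n B) (w : List Bool) :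
    monomial (D.leftTranslate t t') w = t * monomial D w * t' := by
  rw [← conjHom_apply e.mul_inv e.inv_mul, monomial, monomial, map_list_prod, List.map_map]
  congr 1
  refine List.map_congr_left fun b _ => ?_
  cases b
  · exact e.leftTranslate_F D
  · rfl

variable {s s₀ : Kind} {D : Calc n M} {S : Spec n M} {g : M →ₐ[ℂ] B}

/-- Left translations preserve the relations of the calculus: the quadratic relations for `Ω` and `L`
are conjugated by `t₁ t₂`, which commutes with `R`, and the traces and coefficients are invariant. -/
theorem holds_calcRel_leftTranslate (h : 𝓡.IsGood) (hs : s = .sl → s₀ = .sl)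
    (hD : Holds (CalcRel 𝓡 s D)) (ht : Holds (FunRel 𝓡 s₀ t t')) (hc : Independent t g)
    (hc' : Independent t' g) : Holds (CalcRel 𝓡 s ((D.map g).leftTranslate t t')) := by
  have hB := holds_calcRel_map.2 (hD.holdsMap (φ := g))
  have e := FunEqs.of_holds ht
  have E := CalcEqs.of_holds hB
  have cR := e.conj2_Rm
  have cRi := e.conj2_Ri h.toIsHecke
  have cΩ : e.conj2 (fst (D.map g).Ω) = fst (t * (D.map g).Ω * t') := e.conj2_fst (hc.snd_fst D.Ω)
  have cL : e.conj2 (fst (D.map g).L) = fst (t * (D.map g).L * t') := e.conj2_fst (hc.snd_fst D.L)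
  have lift {X Y : Mat2 n B} (hXY : X = Y) : e.conj2 X = e.conj2 Y := congrArg _ hXY
  -- the exchange of a conjugated operator with `t₁ T₁`
  have exch (X0 : Mat1 n M) {X : Mat2 n B}
      (hX : X * fst (D.map g).T = fst (D.map g).T * snd (g.mapMatrix X0)) :
      e.conj2 X * fst (t * (D.map g).T) =
        fst (t * (D.map g).T) * snd (t * g.mapMatrix X0 * t') := by
    have c1 : Commute (snd t) (fst (D.map g).T) := hc.snd_fst D.T
    have c2 : Commute (snd t') (fst (D.map g).T) := hc'.snd_fst D.T
    calc e.conj2 X * fst (t * (D.map g).T)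
        = fst t * snd t * X * (snd t' * (fst t' * fst t)) * fst (D.map g).T := by
          rw [FunEqs.conj2, conjHom_apply, fst_mul]; simp only [mul_assoc]
      _ = fst t * snd t * (X * fst (D.map g).T) * snd t' := by
          rw [e.fst_inv_mul, mul_one, mul_assoc, c2.eq]; simp only [mul_assoc]
      _ = fst t * (snd t * fst (D.map g).T) * snd (g.mapMatrix X0) * snd t' := by
          rw [hX]; simp only [mul_assoc]
      _ = fst (t * (D.map g).T) * snd (t * g.mapMatrix X0 * t') := by
          rw [c1.eq, fst_mul, snd_mul, snd_mul]; simp only [mul_assoc]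
  intro x y hxy
  cases hxy with
  | functions _ _ h' =>
    exact holds_funRel_mul h hs id ht (fun x y hxy => hB x y (.functions x y hxy))
      (fun a b _ _ => hc a b _) x y h'
  | forms_gl hs i j =>
    have := lift (Matrix.ext fun i j => hB _ _ (.forms_gl hs i j))
    simp only [map_mul, map_neg, cR, cRi, cΩ] at this
    exact congrFun (congrFun this i) j
  | forms_sl hs i j =>
    have := lift (Matrix.ext fun i j => hB _ _ (.forms_sl hs i j))
    simp only [map_mul, map_add, map_smul, cR, cRi, cΩ] at this
    exact congrFun (congrFun this i) j
  | Ω_T i j =>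
    have := exch D.Ω E.Ω_T
    simp only [map_mul, cR, cRi, cΩ] at this
    exact congrFun (congrFun this i) j
  | L_L i j =>
    have := lift E.L_L
    simp only [map_mul, cR, cL] at this
    exact congrFun (congrFun this i) j
  | L_T i j =>
    have h1 : 𝓡.Rm B * fst (D.map g).L * 𝓡.Rm B * fst (D.map g).T =
        fst (D.map g).T * snd (g.mapMatrix (𝓡.γ ^ 2 • D.L)) := by
      rw [E.L_T, map_smul]
      simp only [snd, Matrix.kronecker_smul, mul_smul_comm]
      rfl
    have := exch _ h1
    simp only [map_mul, cR, cL, map_smul, mul_smul_comm, smul_mul_assoc] at this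
    rw [show snd (𝓡.γ ^ 2 • (t * g.mapMatrix D.L * t')) = 𝓡.γ ^ 2 • snd (t * g.mapMatrix D.L * t')
      from Matrix.kronecker_smul _ _ _, mul_smul_comm] at this
    exact congrFun (congrFun this i) j
  | L_Ω i j =>
    have := lift E.L_Ω
    simp only [map_mul, cR, cL, cΩ] at this
    exact congrFun (congrFun this i) j
  | K_K i j => exact hB _ _ (.K_K i j)
  | K_T i j =>
    have := congrArg (snd t * ·) E.K_T
    simp only [mul_smul_comm, ← mul_assoc, ← snd_mul] at this
    have h1 : Commute (snd t) (fst (D.map g).K) := hc.snd_fst D.K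
    rw [h1.eq, mul_assoc (fst (D.map g).K), ← snd_mul] at this
    exact congrFun (congrFun this i) j
  | K_Ω i j =>
    have : Commute (fst (D.map g).K) (snd (t * (D.map g).Ω * t')) := by
      rw [snd_mul, snd_mul]
      exact ((hc.snd_fst D.K).symm.mul_right E.K_Ω).mul_right (hc'.snd_fst D.K).symm
    exact congrFun (congrFun this.eq i) j
  | K_L i j =>
    have : Commute (fst (D.map g).K) (snd (t * (D.map g).L * t')) := by
      rw [snd_mul, snd_mul]
      exact ((hc.snd_fst D.K).symm.mul_right E.K_L).mul_right (hc'.snd_fst D.K).symm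
    exact congrFun (congrFun this.eq i) j
  | tr_Ω hs => exact (e.wtr_conj h.toIsHecke fun a b _ _ => hc a b _).trans (hB _ _ (.tr_Ω hs))
  | det_L hs => exact (e.coeffR_conj h.toIsHecke g hc D.L n).trans (hB _ _ (.det_L hs))
  | det_K hs => exact hB _ _ (.det_K hs)

/-- Left translations preserve the relations of the extended calculus. -/
theorem holds_hatRel_leftTranslate (h : 𝓡.IsGood) (hs : s = .sl → s₀ = .sl)
    (hD : Holds (HatRel 𝓡 s D S)) (ht : Holds (FunRel 𝓡 s₀ t t')) (hc : Independent t g)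
    (hc' : Independent t' g) :
    Holds (HatRel 𝓡 s ((D.map g).leftTranslate t t') (S.map g)) := by
  have hB := holds_hatRel_map.2 (hD.holdsMap (φ := g))
  have e := FunEqs.of_holds ht
  have hC : Holds (CommRel (D.map g) (S.map g)) := fun x y hxy => hB x y (.comm x y hxy)
  have hP : Holds (ParamRel 𝓡 (D.map g) (S.map g)) := fun x y hxy => hB x y (.param x y hxy)
  have conj_comm {ξ : M} {X : Mat1 n B} (hX : Commute (sc n (g ξ)) X) (i j) :
      g ξ * (t * X * t') i j = (t * X * t') i j * g ξ :=
    commute_sc_iff.1 (((hc.sc ξ).mul_right hX).mul_right (hc'.sc ξ)) i j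
  have mul_comm' {ξ : M} {X : Mat1 n B} (hX : Commute (sc n (g ξ)) X) (i j) :
      g ξ * (t * X) i j = (t * X) i j * g ξ :=
    commute_sc_iff.1 ((hc.sc ξ).mul_right hX) i j
  have cμ {X} (hX : X ∈ muCommutant (D.map g)) (α) : Commute (sc n (g (S.μ.x α))) X :=
    commute_sc_iff.2 fun i j => hC _ _ (.μ X hX α i j)
  have cν {X} (hX : X ∈ nuCommutant (D.map g)) (α) : Commute (sc n (g (S.ν.x α))) X :=
    commute_sc_iff.2 fun i j => hC _ _ (.ν X hX α i j)
  have cρ {X} (hX : X ∈ rhoCommutant (D.map g)) (α) : Commute (sc n (g (S.ρ.x α))) X :=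
    commute_sc_iff.2 fun i j => hC _ _ (.ρ X hX α i j)
  have eF := e.leftTranslate_F (D.map g)
  have eΘ := e.leftTranslate_Θ (D.map g)
  have eG := e.leftTranslate_G (D.map g)
  rintro x y (⟨_, _, h'⟩ | ⟨_, _, h'⟩ | ⟨_, _, h'⟩ | ⟨_, _, h'⟩ | ⟨l, _, _, h'⟩ | ⟨_, _, h'⟩)
  · exact holds_calcRel_leftTranslate h hs (fun x y hxy => hD x y (.calc x y hxy)) ht hc hc' x y h'
  · exact hB x y (.spec x y h')
  · rcases h' with ⟨i, hi⟩ | ⟨i, hi⟩ | ⟨i, hi⟩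
    · exact (e.coeffR_conj h.toIsHecke g hc D.L i).trans (hP _ _ (.a i hi))
    · exact hP _ _ (.b i hi)
    · have := (e.coeffR_conj h.toIsHecke g hc D.F i)
      rw [map_F, ← eF] at this
      exact this.trans (hP _ _ (.c i hi))
  · rcases h' with ⟨X, hX, α, i, j⟩ | ⟨X, hX, α, i, j⟩ | ⟨X, hX, α, i, j⟩
    · simp only [muCommutant, Set.mem_insert_iff, Set.mem_singleton_iff, eΘ, eG] at hX
      rcases hX with rfl | rfl | rfl | rfl
      · exact conj_comm (cμ (by simp [muCommutant]) α) i j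
      · exact hC _ _ (.μ _ (by simp [muCommutant, Calc.leftTranslate]) α i j)
      · exact hC _ _ (.μ _ (by simp [muCommutant]) α i j)
      · exact hC _ _ (.μ _ (by simp [muCommutant]) α i j)
    · simp only [nuCommutant, Set.mem_insert_iff, Set.mem_singleton_iff, eF] at hX
      rcases hX with rfl | rfl | rfl | rfl
      · exact conj_comm (cν (by simp [nuCommutant]) α) i j
      · exact hC _ _ (.ν _ (by simp [nuCommutant, Calc.leftTranslate]) α i j)
      · exact conj_comm (cν (by simp [nuCommutant]) α) i j
      · exact conj_comm (cν (by simp [nuCommutant]) α) i j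
    · simp only [rhoCommutant, Set.mem_insert_iff, Set.mem_singleton_iff, eF, eG] at hX
      rcases hX with rfl | rfl | rfl | rfl | rfl
      · exact mul_comm' (cρ (by simp [rhoCommutant]) α) i j
      · exact conj_comm (cρ (by simp [rhoCommutant]) α) i j
      · exact hC _ _ (.ρ _ (by simp [rhoCommutant, Calc.leftTranslate]) α i j)
      · exact conj_comm (cρ (by simp [rhoCommutant]) α) i j
      · exact hC _ _ (.ρ _ (by simp [rhoCommutant]) α i j)
  · have hE := fun x y hxy => hB x y (.exch l x y hxy)
    cases h' with
    | T_μ α β i j =>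
      have := exch_conj (hc.sc (S.μ.x α)) (Commute.one_right _)
        (Matrix.ext fun i j => hE _ _ (.T_μ α β i j))
      have h1 : proj 𝓡.q ((D.map g).leftTranslate t t').L (S.map g).μ β *
          ((D.map g).leftTranslate t t').T =
          t * (proj 𝓡.q (D.map g).L (S.map g).μ β * (D.map g).T) * 1 := by
        simp only [Calc.leftTranslate, Spec.map, e.conj_proj hc, mul_one]
        simp only [mul_assoc, ← mul_assoc t' t, e.inv_mul, one_mul]
      rw [h1]
      exact congrFun (congrFun this i) j
    | T_ν α β i j =>
      have := exch_conj' (hc.sc (S.ν.x α)) (Commute.one_right _)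
        (Matrix.ext fun i j => hE _ _ (.T_ν α β i j))
      rw [mul_one, ← mul_assoc t] at this
      exact congrFun (congrFun this i) j
    | Ω_μ α β σ i j =>
      exact congrFun (congrFun (e.sandwich_conj hc (hc.sc _) (hc'.sc _)
        (Matrix.ext fun i j => hE _ _ (.Ω_μ α β σ i j))) i) j
    | F_μ α β σ i j =>
      rw [eF]
      exact congrFun (congrFun (e.sandwich_conj hc (hc.sc _) (hc'.sc _)
        (Matrix.ext fun i j => hE _ _ (.F_μ α β σ i j))) i) j
    | Θ_ν α β σ i j => rw [eΘ]; exact hE _ _ (.Θ_ν α β σ i j)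
    | G_ν α β σ i j => rw [eG]; exact hE _ _ (.G_ν α β σ i j)
    | Ω_ρ α β σ i j =>
      rw [eF]
      exact congrFun (congrFun (e.sandwich_conj hc (hc.sc _) (hc'.sc _)
        (Matrix.ext fun i j => hE _ _ (.Ω_ρ α β σ i j))) i) j
  · obtain ⟨α, w⟩ := h'
    have := e.wtr_conj h.toIsHecke (X := g.mapMatrix (monomial D w)) fun a b _ _ => hc a b _
    rw [map_monomial, ← e.conj_monomial] at this
    rw [this]
    exact hB _ _ (.trace _ _ (.tr α w))

/-- Right translations preserve the relations of the calculus; here the relation for `K` is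
conjugated. -/
theorem holds_calcRel_rightTranslate (h : 𝓡.IsGood) (hs : s = .sl → s₀ = .sl)
    (hD : Holds (CalcRel 𝓡 s D)) (ht : Holds (FunRel 𝓡 s₀ t t')) (hc : Independent t g)
    (hc' : Independent t' g) : Holds (CalcRel 𝓡 s ((D.map g).rightTranslate t t')) := by
  have hB := holds_calcRel_map.2 (hD.holdsMap (φ := g))
  have e := FunEqs.of_holds ht
  have E := CalcEqs.of_holds hB
  have cR := e.conj2'_Rm
  have cK : e.conj2' (snd (D.map g).K) = snd (t' * (D.map g).K * t) := e.conj2'_snd (hc'.fst_snd D.K)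
  have c1 : Commute (fst t') (snd (D.map g).T) := hc'.fst_snd D.T
  have c2 : Commute (fst t) (snd (D.map g).T) := hc.fst_snd D.T
  intro x y hxy
  cases hxy with
  | functions _ _ h' =>
    exact holds_funRel_mul h id hs (fun x y hxy => hB x y (.functions x y hxy)) ht
      (fun _ _ a b => (hc a b _).symm) x y h'
  | forms_gl hs i j => exact hB _ _ (.forms_gl hs i j)
  | forms_sl hs i j => exact hB _ _ (.forms_sl hs i j)
  | Ω_T i j =>
    have h1 : Commute (fst t) (snd (D.map g).Ω) := hc.fst_snd D.Ω
    have : 𝓡.Rm B * fst (D.map g).Ω * 𝓡.Ri B * fst ((D.map g).T * t) =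
        fst ((D.map g).T * t) * snd (D.map g).Ω := by
      rw [fst_mul, ← mul_assoc, E.Ω_T, mul_assoc, ← h1.eq, mul_assoc]
    exact congrFun (congrFun this i) j
  | L_L i j => exact hB _ _ (.L_L i j)
  | L_T i j =>
    have h1 : Commute (fst t) (snd (D.map g).L) := hc.fst_snd D.L
    have : 𝓡.Rm B * fst (D.map g).L * 𝓡.Rm B * fst ((D.map g).T * t) =
        𝓡.γ ^ 2 • (fst ((D.map g).T * t) * snd (D.map g).L) := by
      rw [fst_mul, ← mul_assoc, E.L_T, smul_mul_assoc, mul_assoc, ← h1.eq, mul_assoc]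
    exact congrFun (congrFun this i) j
  | L_Ω i j => exact hB _ _ (.L_Ω i j)
  | K_K i j =>
    have := congrArg e.conj2' E.K_K
    simp only [map_mul, cR, cK] at this
    exact congrFun (congrFun this i) j
  | K_T i j =>
    have h1 : snd ((D.map g).T * t) * 𝓡.Rm B * snd (t' * (D.map g).K * t) * 𝓡.Rm B =
        𝓡.γ ^ 2 • (fst (t' * (D.map g).K * t) * snd ((D.map g).T * t)) := by
      calc snd ((D.map g).T * t) * 𝓡.Rm B * snd (t' * (D.map g).K * t) * 𝓡.Rm B
          = snd ((D.map g).T * t) * e.conj2' (𝓡.Rm B * snd (D.map g).K * 𝓡.Rm B) := by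
            simp only [map_mul, cR, cK, mul_assoc]
        _ = snd (D.map g).T * (snd t * snd t') * fst t' *
              (𝓡.Rm B * snd (D.map g).K * 𝓡.Rm B) * (fst t * snd t) := by
            rw [FunEqs.conj2', conjHom_apply, snd_mul]; simp only [mul_assoc]
        _ = fst t' * (snd (D.map g).T * 𝓡.Rm B * snd (D.map g).K * 𝓡.Rm B) * (fst t * snd t) := by
            rw [e.snd_mul_inv, mul_one, ← c1.eq]; simp only [mul_assoc]
        _ = 𝓡.γ ^ 2 • (fst t' * fst (D.map g).K * (snd (D.map g).T * fst t) * snd t) := by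
            rw [E.K_T]; simp only [mul_assoc, mul_smul_comm, smul_mul_assoc]
        _ = 𝓡.γ ^ 2 • (fst (t' * (D.map g).K * t) * snd ((D.map g).T * t)) := by
            rw [← c2.eq, fst_mul, fst_mul, snd_mul]; simp only [mul_assoc]
    exact congrFun (congrFun h1 i) j
  | K_Ω i j =>
    have : Commute (fst (t' * (D.map g).K * t)) (snd (D.map g).Ω) := by
      rw [fst_mul, fst_mul]
      exact ((hc'.fst_snd D.Ω).mul_left E.K_Ω).mul_left (hc.fst_snd D.Ω)
    exact congrFun (congrFun this.eq i) j
  | K_L i j =>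
    have : Commute (fst (t' * (D.map g).K * t)) (snd (D.map g).L) := by
      rw [fst_mul, fst_mul]
      exact ((hc'.fst_snd D.L).mul_left E.K_L).mul_left (hc.fst_snd D.L)
    exact congrFun (congrFun this.eq i) j
  | tr_Ω hs => exact hB _ _ (.tr_Ω hs)
  | det_L hs => exact hB _ _ (.det_L hs)
  | det_K hs => exact (e.coeffL_conj h g hc' D.K le_rfl).trans (hB _ _ (.det_K hs))

/-- Right translations preserve the relations of the extended calculus. -/
theorem holds_hatRel_rightTranslate (h : 𝓡.IsGood) (hs : s = .sl → s₀ = .sl)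
    (hD : Holds (HatRel 𝓡 s D S)) (ht : Holds (FunRel 𝓡 s₀ t t')) (hc : Independent t g)
    (hc' : Independent t' g) :
    Holds (HatRel 𝓡 s ((D.map g).rightTranslate t t') (S.map g)) := by
  have hB := holds_hatRel_map.2 (hD.holdsMap (φ := g))
  have e := FunEqs.of_holds ht
  have hC : Holds (CommRel (D.map g) (S.map g)) := fun x y hxy => hB x y (.comm x y hxy)
  have hP : Holds (ParamRel 𝓡 (D.map g) (S.map g)) := fun x y hxy => hB x y (.param x y hxy)
  have conj_comm {ξ : M} {X : Mat1 n B} (hX : Commute (sc n (g ξ)) X) (i j) :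
      g ξ * (t' * X * t) i j = (t' * X * t) i j * g ξ :=
    commute_sc_iff.1 (((hc'.sc ξ).mul_right hX).mul_right (hc.sc ξ)) i j
  have mul_comm' {ξ : M} {X : Mat1 n B} (hX : Commute (sc n (g ξ)) X) (i j) :
      g ξ * (X * t) i j = (X * t) i j * g ξ :=
    commute_sc_iff.1 (hX.mul_right (hc.sc ξ)) i j
  have cμ {X} (hX : X ∈ muCommutant (D.map g)) (α) : Commute (sc n (g (S.μ.x α))) X :=
    commute_sc_iff.2 fun i j => hC _ _ (.μ X hX α i j)
  have cν {X} (hX : X ∈ nuCommutant (D.map g)) (α) : Commute (sc n (g (S.ν.x α))) X :=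
    commute_sc_iff.2 fun i j => hC _ _ (.ν X hX α i j)
  have cρ {X} (hX : X ∈ rhoCommutant (D.map g)) (α) : Commute (sc n (g (S.ρ.x α))) X :=
    commute_sc_iff.2 fun i j => hC _ _ (.ρ X hX α i j)
  have eF := e.rightTranslate_F (D.map g)
  have eΘ := FunEqs.rightTranslate_Θ (t := t) (t' := t') (D.map g)
  have eG := e.rightTranslate_G (D.map g)
  rintro x y (⟨_, _, h'⟩ | ⟨_, _, h'⟩ | ⟨_, _, h'⟩ | ⟨_, _, h'⟩ | ⟨l, _, _, h'⟩ | ⟨_, _, h'⟩)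
  · exact holds_calcRel_rightTranslate h hs (fun x y hxy => hD x y (.calc x y hxy)) ht hc hc' x y h'
  · exact hB x y (.spec x y h')
  · rcases h' with ⟨i, hi⟩ | ⟨i, hi⟩ | ⟨i, hi⟩
    · exact hP _ _ (.a i hi)
    · exact (e.coeffL_conj h g hc' D.K hi).trans (hP _ _ (.b i hi))
    · rw [eF]; exact hP _ _ (.c i hi)
  · rcases h' with ⟨X, hX, α, i, j⟩ | ⟨X, hX, α, i, j⟩ | ⟨X, hX, α, i, j⟩
    · simp only [muCommutant, Set.mem_insert_iff, Set.mem_singleton_iff, eΘ, eG] at hX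
      rcases hX with rfl | rfl | rfl | rfl
      · exact hC _ _ (.μ _ (by simp [muCommutant, Calc.rightTranslate]) α i j)
      · exact conj_comm (cμ (by simp [muCommutant]) α) i j
      · exact conj_comm (cμ (by simp [muCommutant]) α) i j
      · exact conj_comm (cμ (by simp [muCommutant]) α) i j
    · simp only [nuCommutant, Set.mem_insert_iff, Set.mem_singleton_iff, eF] at hX
      rcases hX with rfl | rfl | rfl | rfl
      · exact hC _ _ (.ν _ (by simp [nuCommutant, Calc.rightTranslate]) α i j)
      · exact conj_comm (cν (by simp [nuCommutant]) α) i j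
      · exact hC _ _ (.ν _ (by simp [nuCommutant, Calc.rightTranslate]) α i j)
      · exact hC _ _ (.ν _ (by simp [nuCommutant]) α i j)
    · simp only [rhoCommutant, Set.mem_insert_iff, Set.mem_singleton_iff, eF, eG] at hX
      rcases hX with rfl | rfl | rfl | rfl | rfl
      · exact mul_comm' (cρ (by simp [rhoCommutant]) α) i j
      · exact hC _ _ (.ρ _ (by simp [rhoCommutant, Calc.rightTranslate]) α i j)
      · exact conj_comm (cρ (by simp [rhoCommutant]) α) i j
      · exact hC _ _ (.ρ _ (by simp [rhoCommutant]) α i j)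
      · exact conj_comm (cρ (by simp [rhoCommutant]) α) i j
  · have hE := fun x y hxy => hB x y (.exch l x y hxy)
    cases h' with
    | T_μ α β i j =>
      have := exch_conj (Commute.one_right _) (hc.sc (S.μ.x α))
        (Matrix.ext fun i j => hE _ _ (.T_μ α β i j))
      rw [one_mul, mul_assoc _ _ t] at this
      exact congrFun (congrFun this i) j
    | T_ν α β i j =>
      have := exch_conj' (Commute.one_right _) (hc.sc (S.ν.x α))
        (Matrix.ext fun i j => hE _ _ (.T_ν α β i j))
      have h1 : ((D.map g).rightTranslate t t').T *
          proj 𝓡.q ((D.map g).rightTranslate t t').K (S.map g).ν β =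
          1 * ((D.map g).T * proj 𝓡.q (D.map g).K (S.map g).ν β) * t := by
        simp only [Calc.rightTranslate, Spec.map, e.op.conj_proj hc', one_mul]
        simp only [mul_assoc, ← mul_assoc t t', e.mul_inv, one_mul]
      rw [h1]
      exact congrFun (congrFun this i) j
    | Ω_μ α β σ i j => exact hE _ _ (.Ω_μ α β σ i j)
    | F_μ α β σ i j => rw [eF]; exact hE _ _ (.F_μ α β σ i j)
    | Θ_ν α β σ i j =>
      rw [eΘ]
      exact congrFun (congrFun (e.op.sandwich_conj hc' (hc'.sc _) (hc.sc _)
        (Matrix.ext fun i j => hE _ _ (.Θ_ν α β σ i j))) i) j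
    | G_ν α β σ i j =>
      rw [eG]
      exact congrFun (congrFun (e.op.sandwich_conj hc' (hc'.sc _) (hc.sc _)
        (Matrix.ext fun i j => hE _ _ (.G_ν α β σ i j))) i) j
    | Ω_ρ α β σ i j => rw [eF]; exact hE _ _ (.Ω_ρ α β σ i j)
  · obtain ⟨α, w⟩ := h'
    have : monomial ((D.map g).rightTranslate t t') w = monomial (D.map g) w := by
      rw [monomial, monomial, eF]; rfl
    rw [this]
    exact hB _ _ (.trace _ _ (.tr α w))

end Covariance


/-! ### The weight matrices -/

section Weights

variable {n : ℕ} {𝓡 : RData n}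

theorem sum_rotate {κ M : Type*} [Fintype κ] [AddCommMonoid M] (f : κ → κ → κ → κ → M) :
    ∑ c, ∑ d, ∑ v, ∑ x, f c d v x = ∑ x, ∑ c, ∑ d, ∑ v, f c d v x := by
  calc ∑ c, ∑ d, ∑ v, ∑ x, f c d v x = ∑ c, ∑ d, ∑ x, ∑ v, f c d v x :=
        Finset.sum_congr rfl fun c _ => Finset.sum_congr rfl fun d _ => Finset.sum_comm
    _ = ∑ c, ∑ x, ∑ d, ∑ v, f c d v x := Finset.sum_congr rfl fun c _ => Finset.sum_comm
    _ = ∑ x, ∑ c, ∑ d, ∑ v, f c d v x := Finset.sum_comm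

/-- The weight matrices of the R-traces for `R` and for `R_op` are inverse to each other up to a
scalar factor. -/
theorem RData.IsGood.D_mul_Dop (h : 𝓡.IsGood) :
    𝓡.D * 𝓡.Dop = (𝓡.q⁻¹ ^ n * 𝓡.q⁻¹ ^ n) • (1 : Mat1 n ℂ) := by
  have key : ptr2 𝓡.D (𝓡.R⁻¹) = 𝓡.D * 𝓡.Dop := by
    ext x' a'
    -- the matrix entries of `tr₂ (D₂ R Y₁ R⁻¹) = tr (D Y)`
    have h1 (x a) : ∑ c, ∑ d, ∑ v, 𝓡.D c d * (𝓡.R (a, d) (x, v) * 𝓡.R⁻¹ (x', v) (a', c)) =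
        if a = a' then 𝓡.D x' x else 0 := by
      have e := congrFun (congrFun (h.toIsHecke.ptr2_R_conj (Matrix.single x x' (1 : ℂ))) a) a'
      have e' := RData.IsHecke.ptr2_conj_apply 𝓡.D 𝓡.R 𝓡.R⁻¹ (Matrix.single x x' (1 : ℂ)) a a'
      change ptr2 𝓡.D (𝓡.Rm ℂ * _ * 𝓡.Ri ℂ) a a' = _ at e'
      rw [e] at e'
      have h3 : wtr 𝓡.D (Matrix.single x x' (1 : ℂ)) = 𝓡.D x' x := by
        simp [wtr, Matrix.single_apply, ite_and]
      rw [h3] at e'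
      simp only [sc, Matrix.scalar_apply, Matrix.diagonal_apply, Matrix.single_apply, ite_and,
        smul_eq_mul, mul_ite, mul_one, mul_zero, Finset.sum_ite_irrel, Finset.sum_const_zero,
        Finset.sum_ite_eq, Finset.mem_univ, if_true] at e'
      exact e'.symm
    -- contraction with the skew inverse removes `R`
    have h2 (p) : ∑ c, 𝓡.D c p * 𝓡.R⁻¹ (x', p) (a', c) = ∑ x, 𝓡.D x' x * 𝓡.Ψ (p, x) (p, a') := by
      calc ∑ c, 𝓡.D c p * 𝓡.R⁻¹ (x', p) (a', c)
          = ∑ c, ∑ d, ∑ v, 𝓡.D c d * 𝓡.R⁻¹ (x', v) (a', c) * perm n (p, d) (p, v) := by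
            refine Finset.sum_congr rfl fun c _ => ?_
            simp [perm, ite_and]
        _ = ∑ c, ∑ d, ∑ v, ∑ x, ∑ a, 𝓡.Ψ (p, x) (p, a) *
              (𝓡.D c d * (𝓡.R (a, d) (x, v) * 𝓡.R⁻¹ (x', v) (a', c))) := by
            refine Finset.sum_congr rfl fun c _ => Finset.sum_congr rfl fun d _ =>
              Finset.sum_congr rfl fun v _ => ?_
            rw [← h.skew_right p d p v, Finset.mul_sum]
            refine Finset.sum_congr rfl fun x _ => ?_
            rw [Finset.mul_sum]
            exact Finset.sum_congr rfl fun a _ => by ring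
        _ = ∑ x, ∑ a, 𝓡.Ψ (p, x) (p, a) *
              ∑ c, ∑ d, ∑ v, 𝓡.D c d * (𝓡.R (a, d) (x, v) * 𝓡.R⁻¹ (x', v) (a', c)) := by
            rw [sum_rotate]
            refine Finset.sum_congr rfl fun x _ => ?_
            rw [sum_rotate]
            simp only [Finset.mul_sum]
        _ = ∑ x, 𝓡.D x' x * 𝓡.Ψ (p, x) (p, a') := by
            simp only [h1, mul_ite, mul_zero, Finset.sum_ite_eq', Finset.mem_univ, if_true]
            exact Finset.sum_congr rfl fun x _ => mul_comm _ _
    rw [ptr2_apply, Finset.sum_comm]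
    simp only [smul_eq_mul, h2, Matrix.mul_apply, RData.Dop, Matrix.of_apply, Finset.mul_sum]
    exact Finset.sum_comm
  have h3 : ptr2 𝓡.D (1 : Mat2 n ℂ) = 𝓡.D.trace • (1 : Mat1 n ℂ) := by
    ext a b
    by_cases hab : a = b <;> simp [ptr2_apply, Matrix.one_apply, hab, Matrix.trace]
  rw [← key, h.inv_eq, map_sub, map_smul, h3, ← Rm_complex, h.toIsHecke.ptr2_R, smul_smul,
    h.trace_D, mul_left_comm, qnum_mul h.q_ne_zero, mul_sub, ← mul_pow,
    inv_mul_cancel₀ h.q_ne_zero, one_pow, sub_smul, one_smul, sub_sub_cancel]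

end Weights

/-! ### The Hopf algebra of functions on the quantum group -/

section Opposite

variable {n : ℕ} {𝓡 : RData n} {B : Type*} [Ring B] [Algebra ℂ B] {t t' : Mat1 n B}

/-- The matrix with the entries of `X` considered as elements of the opposite algebra. -/
def opMat {m : Type*} (X : Matrix m m B) : Matrix m m Bᵐᵒᵖ := X.map MulOpposite.op

/-- A matrix of complex numbers over an algebra. -/
def constMat (B : Type*) [Ring B] [Algebra ℂ B] {m : Type*} (C : Matrix m m ℂ) : Matrix m m B :=
  C.map (algebraMap ℂ B)

theorem constMat_mul {m : Type*} [Fintype m] (C C' : Matrix m m ℂ) :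
    constMat B (C * C') = constMat B C * constMat B C' := Matrix.map_mul

theorem constMat_smul_one {m : Type*} [Fintype m] [DecidableEq m] (c : ℂ) :
    constMat B (c • (1 : Matrix m m ℂ)) = c • (1 : Matrix m m B) := by
  ext i j
  by_cases hij : i = j <;> simp [constMat, hij, Algebra.algebraMap_eq_smul_one]

theorem constMat_mul_opMat {m : Type*} [Fintype m] (C : Matrix m m ℂ) (X : Matrix m m B) :
    constMat Bᵐᵒᵖ C * opMat X = opMat (constMat B C * X) := by
  ext i j
  simp [constMat, opMat, Matrix.mul_apply, MulOpposite.algebraMap_apply, ← MulOpposite.op_mul,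
    Algebra.commutes]

theorem opMat_mul_constMat {m : Type*} [Fintype m] (C : Matrix m m ℂ) (X : Matrix m m B) :
    opMat X * constMat Bᵐᵒᵖ C = opMat (X * constMat B C) := by
  ext i j
  simp [constMat, opMat, Matrix.mul_apply, MulOpposite.algebraMap_apply, ← MulOpposite.op_mul,
    Algebra.commutes]

theorem fst_mul_snd_opMat (X : Mat1 n B) :
    fst (opMat X) * snd (opMat X) = opMat (snd X * fst X) := by
  ext ⟨a, b⟩ ⟨c, d⟩
  rw [fst_mul_snd_apply, opMat, opMat, Matrix.map_apply, Matrix.map_apply, Matrix.map_apply,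
    snd_mul_fst_apply, MulOpposite.op_mul]

theorem sites_snoc {k : ℕ} (t : Mat1 n B) (a b : Fin k → Fin n) (x y : Fin n) :
    sites (k + 1) t (k + 1) (snoc a x) (snoc b y) = sites k t k a b * t x y := by
  have := congrFun (congrFun (blk1_mul_site (t := t) a b (emb k (sites k t k))) x) y
  rw [blk1_apply, blk1_emb, emb_sites le_rfl] at this
  exact this.trans (by simp [sc])

theorem sitesRev_snoc {k : ℕ} (t : Mat1 n B) (a b : Fin k → Fin n) (x y : Fin n) :
    sitesRev (k + 1) t (k + 1) (snoc a x) (snoc b y) = t x y * sitesRev k t k a b := by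
  have := congrFun (congrFun (blk1_site_mul (t := t) a b (emb k (sitesRev k t k))) x) y
  rw [blk1_apply, blk1_emb, emb_sitesRev le_rfl] at this
  exact this.trans (by simp [sc])

theorem sites_opMat (t : Mat1 n B) (k : ℕ) : sites k (opMat t) k = opMat (sitesRev k t k) := by
  induction k with
  | zero =>
    ext a b
    simp [sites, sitesRev, opMat, Subsingleton.elim a b, Matrix.one_apply]
  | succ k ih =>
    ext a b
    obtain ⟨a, x, rfl⟩ := exists_snoc a
    obtain ⟨b, y, rfl⟩ := exists_snoc b
    rw [sites_snoc, ih, opMat, opMat, opMat, Matrix.map_apply, Matrix.map_apply, Matrix.map_apply,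
      sitesRev_snoc, MulOpposite.op_mul]

theorem detT_eq_trace (t : Mat1 n B) : 𝓡.detT t = (𝓡.Am B n * sites n t n).trace := by
  rw [RData.detT, sites_eq_prod]

theorem sites_one {k m : ℕ} (hm : m ≤ k) : sites k (1 : Mat1 n B) m = 1 := by
  induction m with
  | zero => rfl
  | succ m ih => rw [sites, ih (by omega), site_one_eq hm, one_mul]

/-- The quantum determinant is multiplicative, so that the one of the unit matrix is `0` or `1`; and
it is not `0`, since the antisymmetrizer does not vanish. -/
theorem detT_one (h : 𝓡.IsGood) : 𝓡.detT (1 : Mat1 n B) = 1 := by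
  have e (B : Type) [Ring B] [Algebra ℂ B] : FunEqs 𝓡 (1 : Mat1 n B) 1 :=
    ⟨by rw [fst_one, snd_one, one_mul]; exact Commute.one_right _, one_mul _, one_mul _⟩
  have h1 : 𝓡.detT (1 : Mat1 n ℂ) = 1 := by
    have h2 := (e ℂ).detT_mul h (u := 1) fun a b c d => Commute.all _ _
    rw [mul_one] at h2
    rcases eq_or_ne (𝓡.detT (1 : Mat1 n ℂ)) 0 with h3 | h3
    · exfalso
      rw [detT_eq_trace, sites_one le_rfl] at h3
      have h4 := h.Am_mul (Commute.one_right (𝓡.Am ℂ n))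
      rw [h3, mul_one, map_zero, mul_zero] at h4
      apply h.antisym_ne_zero
      ext a b
      exact congrFun (congrFun h4 a) b
    · exact mul_left_cancel₀ h3 (by rw [← h2, mul_one])
  have := map_detT (Algebra.ofId ℂ B) 𝓡 1
  rw [map_one, h1, map_one] at this
  exact this.symm

/-- The inverse matrix, considered over the opposite algebra, is a matrix of functions. Its inverse
there is `D t D⁻¹`. -/
theorem holds_funRel_op (h : 𝓡.IsGood) {s : Kind} (ht : Holds (FunRel 𝓡 s t t')) :
    Holds (FunRel 𝓡 s (opMat t') (opMat ((𝓡.q ^ n * 𝓡.q ^ n) •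
      (constMat B 𝓡.D * t * constMat B 𝓡.Dop)))) := by
  have e := FunEqs.of_holds ht
  have hq : 𝓡.q ^ n * 𝓡.q ^ n * (𝓡.q⁻¹ ^ n * 𝓡.q⁻¹ ^ n) = 1 := by
    rw [← mul_pow, ← mul_pow, ← mul_pow, mul_mul_mul_comm, mul_inv_cancel₀ h.q_ne_zero, one_mul,
      one_pow]
  have hDD : constMat Bᵐᵒᵖ 𝓡.D * constMat Bᵐᵒᵖ 𝓡.Dop = (𝓡.q⁻¹ ^ n * 𝓡.q⁻¹ ^ n) • 1 := by
    rw [← constMat_mul, h.D_mul_Dop, constMat_smul_one]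
  have h1 : opMat t' * opMat (constMat B 𝓡.D * t) = constMat Bᵐᵒᵖ 𝓡.D := by
    ext d c
    have := congrArg MulOpposite.op (e.sum_conj h.toIsHecke c d)
    simp only [Matrix.mul_apply, opMat, Matrix.map_apply, ← MulOpposite.op_mul, constMat]
    rw [MulOpposite.algebraMap_apply, ← this, Finset.op_sum]
    refine Finset.sum_congr rfl fun a _ => ?_
    rw [Finset.sum_mul]
    simp only [Algebra.smul_def, mul_assoc]
  have h2 : opMat (t * constMat B 𝓡.Dop) * opMat t' = constMat Bᵐᵒᵖ 𝓡.Dop := by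
    ext d c
    have := congrArg MulOpposite.op (e.op.sum_conj h.toIsHecke.op c d)
    simp only [Matrix.mul_apply, opMat, Matrix.map_apply, ← MulOpposite.op_mul, constMat]
    rw [MulOpposite.algebraMap_apply, ← RData.op_D, ← this]
    have h3 (b) : MulOpposite.op (t' b c * ∑ a, t d a * algebraMap ℂ B (𝓡.Dop a b)) =
        ∑ a, MulOpposite.op (𝓡.op.D a b • (t' b c * t d a)) := by
      rw [Finset.mul_sum, Finset.op_sum]
      refine Finset.sum_congr rfl fun a _ => ?_
      rw [← Algebra.commutes, Algebra.smul_def, ← mul_assoc, ← Algebra.commutes, mul_assoc]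
      rfl
    refine (Finset.sum_congr rfl fun b _ => h3 b).trans ?_
    rw [Finset.sum_comm]
    simp only [Finset.op_sum]
  have hsm (X : Mat1 n B) (c : ℂ) : opMat (c • X) = c • opMat X := rfl
  rintro _ _ (⟨i, j⟩ | ⟨i, j⟩ | ⟨i, j⟩ | hs)
  · have h3 : constMat Bᵐᵒᵖ 𝓡.R * opMat (snd t' * fst t') =
        opMat (snd t' * fst t') * constMat Bᵐᵒᵖ 𝓡.R := by
      rw [constMat_mul_opMat, opMat_mul_constMat]
      exact congrArg opMat e.rtt_inv.eq
    rw [mul_assoc, fst_mul_snd_opMat]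
    exact congrFun (congrFun h3 i) j
  · rw [hsm, mul_smul_comm, ← opMat_mul_constMat, ← mul_assoc, h1, hDD, smul_smul, hq, one_smul]
  · rw [hsm, smul_mul_assoc, mul_assoc (constMat B _), ← constMat_mul_opMat, mul_assoc, h2, hDD,
      smul_smul, hq, one_smul]
  · have h3 : 𝓡.Am B n = 𝓡.Am B n * sitesRev n t' n := by
      have c1 : Commute (𝓡.Am B n) (sites n t n) := by
        rw [RData.Am_eq]
        exact (commute_asym fun j _ => e.commute_sites_all n j).symm
      have h4 := h.Am_mul c1
      rw [← detT_eq_trace, ht _ _ (.det_T hs), map_one, mul_one] at h4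
      have h5 := congrArg (· * sitesRev n t' n) h4
      simpa only [mul_assoc, e.sites_mul_rev n le_rfl, mul_one] using h5
    have h5 : 𝓡.Am Bᵐᵒᵖ n * opMat (sitesRev n t' n) = opMat (𝓡.Am B n) := by
      exact (constMat_mul_opMat _ _).trans (congrArg opMat h3.symm)
    have h6 : (𝓡.Am B n).trace = 1 := by
      rw [← detT_one h (B := B), detT_eq_trace, sites_one le_rfl, mul_one]
    rw [detT_eq_trace, sites_opMat, h5]
    have := congrArg MulOpposite.op h6
    rw [Matrix.trace, Finset.op_sum] at this
    exact this

end Opposite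


section Hopf

open Algebra.TensorProduct (includeLeft includeRight)

variable {n : ℕ} {𝓡 : RData n} {s : Kind}

/-- The pair `t`, `t'` generates `H` and is universal for the relations of the algebra of functions
on the quantum group. -/
structure IsFunctionAlgebra (𝓡 : RData n) (s : Kind) {H : Type} [Ring H] [Algebra ℂ H]
    (t t' : Mat1 n H) : Prop where
  holds : Holds (FunRel 𝓡 s t t')
  lift : ∀ {B : Type} [Ring B] [Algebra ℂ B] {u u' : Mat1 n B}, Holds (FunRel 𝓡 s u u') →
    ∃ φ : H →ₐ[ℂ] B, φ.mapMatrix t = u ∧ φ.mapMatrix t' = u'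
  induction : ∀ {P : H → Prop} (_hc : ∀ c, P (algebraMap ℂ H c)) (_ht : ∀ i j, P (t i j))
    (_ht' : ∀ i j, P (t' i j)) (_hm : ∀ x y, P x → P y → P (x * y))
    (_ha : ∀ x y, P x → P y → P (x + y)) (x), P x

theorem isFunctionAlgebra_fun : IsFunctionAlgebra 𝓡 s (Fun.T 𝓡 s) (Fun.T' 𝓡 s) where
  holds := holds_fun
  lift := exists_fun_lift
  induction := by
    intro P hc hT hT' hm ha x
    obtain ⟨x, rfl⟩ := RingQuot.mkAlgHom_surjective ℂ _ x
    induction x using FreeAlgebra.induction with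
    | grade0 r => rw [AlgHom.commutes]; exact hc r
    | grade1 x =>
      cases x with
      | T i j => exact hT i j
      | T' i j => exact hT' i j
    | mul a b ha hb => rw [map_mul]; exact hm _ _ ha hb
    | add a b ha' hb => rw [map_add]; exact ha _ _ ha' hb

namespace IsFunctionAlgebra

variable {H : Type} [Ring H] [Algebra ℂ H] {t t' : Mat1 n H}

theorem eqs (hH : IsFunctionAlgebra 𝓡 s t t') : FunEqs 𝓡 t t' := .of_holds hH.holds

/-- Homomorphisms from the algebra of functions are determined by their values on `t`. -/
theorem algHom_ext (hH : IsFunctionAlgebra 𝓡 s t t') {B : Type*} [Ring B] [Algebra ℂ B]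
    {f g : H →ₐ[ℂ] B} (hT : f.mapMatrix t = g.mapMatrix t) : f = g := by
  have h1 : f.mapMatrix t' * f.mapMatrix t = 1 := by rw [← map_mul, hH.eqs.inv_mul, map_one]
  have h2 : f.mapMatrix t * g.mapMatrix t' = 1 := by
    rw [hT, ← map_mul, hH.eqs.mul_inv, map_one]
  have hT' := left_inv_eq_right_inv h1 h2
  ext x
  refine hH.induction (P := fun x => f x = g x) (fun c => by simp)
    (fun i j => congrFun (congrFun hT i) j) (fun i j => congrFun (congrFun hT' i) j)
    (fun x y hx hy => ?_) (fun x y hx hy => ?_) x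
  · rw [map_mul, map_mul, hx, hy]
  · rw [map_add, map_add, hx, hy]

end IsFunctionAlgebra

section Tensor

variable {A B C : Type*} [Ring A] [Algebra ℂ A] [Ring B] [Algebra ℂ B] [Ring C] [Algebra ℂ C]

/-- The embedding of the left factor of a tensor product. -/
abbrev inL (A B : Type*) [Ring A] [Algebra ℂ A] [Ring B] [Algebra ℂ B] : A →ₐ[ℂ] A ⊗[ℂ] B :=
  includeLeft

/-- The embedding of the right factor of a tensor product. -/
abbrev inR (A B : Type*) [Ring A] [Algebra ℂ A] [Ring B] [Algebra ℂ B] : B →ₐ[ℂ] A ⊗[ℂ] B :=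
  includeRight

theorem commute_inL_inR (a : A) (b : B) : Commute (inL A B a) (inR A B b) := by
  simp [commute_iff_eq, inL, inR]

theorem inL_mul_inR (X : Mat1 n A) (Y : Mat1 n B) (i j) :
    ((inL A B).mapMatrix X * (inR A B).mapMatrix Y) i j = ∑ k, X i k ⊗ₜ[ℂ] Y k j := by
  simp [Matrix.mul_apply, inL, inR]

theorem inL_conj (t t' : Mat1 n A) (X : Mat1 n B) (i j) :
    ((inL A B).mapMatrix t * (inR A B).mapMatrix X * (inL A B).mapMatrix t') i j =
      ∑ k, ∑ p, (t i k * t' p j) ⊗ₜ[ℂ] X k p := by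
  simp only [Matrix.mul_apply, Finset.sum_mul]
  rw [Finset.sum_comm]
  simp [inL, inR]

theorem inR_conj (t t' : Mat1 n B) (X : Mat1 n A) (i j) :
    ((inR A B).mapMatrix t * (inL A B).mapMatrix X * (inR A B).mapMatrix t') i j =
      ∑ k, ∑ p, X k p ⊗ₜ[ℂ] (t i k * t' p j) := by
  simp only [Matrix.mul_apply, Finset.sum_mul]
  rw [Finset.sum_comm]
  simp [inL, inR]

/-- The associativity isomorphism of tensor products. -/
abbrev assocHom (A B C : Type*) [Ring A] [Algebra ℂ A] [Ring B] [Algebra ℂ B] [Ring C]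
    [Algebra ℂ C] : (A ⊗[ℂ] B) ⊗[ℂ] C →ₐ[ℂ] A ⊗[ℂ] (B ⊗[ℂ] C) :=
  (Algebra.TensorProduct.assoc ℂ ℂ ℂ A B C).toAlgHom

theorem assocHom_inL :
    (assocHom A B C).comp (inL (A ⊗[ℂ] B) C) = Algebra.TensorProduct.map (.id ℂ A) (inL B C) := by
  ext x <;> simp [inL, Algebra.TensorProduct.one_def]

theorem assocHom_inR :
    (assocHom A B C).comp (inR (A ⊗[ℂ] B) C) = (inR A (B ⊗[ℂ] C)).comp (inR B C) := by
  ext x; simp [inR, Algebra.TensorProduct.one_def]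

variable {A' B' : Type*} [Ring A'] [Algebra ℂ A'] [Ring B'] [Algebra ℂ B']

theorem map_comp_inL (f : A →ₐ[ℂ] A') (g : B →ₐ[ℂ] B') :
    (Algebra.TensorProduct.map f g).comp (inL A B) = (inL A' B').comp f := by
  ext x; simp [inL]

theorem map_comp_inR (f : A →ₐ[ℂ] A') (g : B →ₐ[ℂ] B') :
    (Algebra.TensorProduct.map f g).comp (inR A B) = (inR A' B').comp g := by
  ext x; simp [inR]

end Tensor

theorem holds_funRel_one {B : Type*} [Ring B] [Algebra ℂ B] (h : 𝓡.IsGood) (s : Kind) :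
    Holds (FunRel 𝓡 s (1 : Mat1 n B) 1) := by
  rintro _ _ (⟨i, j⟩ | ⟨i, j⟩ | ⟨i, j⟩ | hs)
  · simp only [fst_one, snd_one, mul_one, one_mul]
  · rw [mul_one]
  · rw [mul_one]
  · exact detT_one h

theorem mapMatrix_comp {A B C : Type*} [Ring A] [Algebra ℂ A] [Ring B] [Algebra ℂ B] [Ring C]
    [Algebra ℂ C] (f : B →ₐ[ℂ] C) (g : A →ₐ[ℂ] B) (X : Mat1 n A) :
    (f.comp g).mapMatrix X = f.mapMatrix (g.mapMatrix X) := rfl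

/-- If the multiplication after `S ⊗ 1` takes `w` to the scalar `c`, then it takes `w z` to `c` times its
value on `z`; thus the antipode identity is inherited by products. -/
theorem antipode_closed {H : Type*} [Ring H] [Algebra ℂ H] (S : H →ₗ[ℂ] H)
    (hS : ∀ x y, S (x * y) = S y * S x) (w z : H ⊗[ℂ] H) (c : ℂ)
    (hw : LinearMap.mul' ℂ H (S.rTensor H w) = algebraMap ℂ H c) :
    LinearMap.mul' ℂ H (S.rTensor H (w * z)) =
      algebraMap ℂ H c * LinearMap.mul' ℂ H (S.rTensor H z) := by
  induction z with
  | zero => simp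
  | add x y hx hy => rw [mul_add, map_add, map_add, hx, hy, map_add, map_add, mul_add]
  | tmul a b =>
    have h1 : LinearMap.mul' ℂ H (S.rTensor H (w * a ⊗ₜ b)) =
        S a * LinearMap.mul' ℂ H (S.rTensor H w) * b := by
      clear hw
      induction w with
      | zero => simp
      | add x y hx hy => rw [add_mul, map_add, map_add, hx, hy, map_add, map_add, mul_add, add_mul]
      | tmul x y => simp [hS, mul_assoc]
    rw [h1, hw, ← Algebra.commutes, mul_assoc]
    simp

theorem antipode_closed' {H : Type*} [Ring H] [Algebra ℂ H] (S : H →ₗ[ℂ] H)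
    (hS : ∀ x y, S (x * y) = S y * S x) (w z : H ⊗[ℂ] H) (c : ℂ)
    (hz : LinearMap.mul' ℂ H (S.lTensor H z) = algebraMap ℂ H c) :
    LinearMap.mul' ℂ H (S.lTensor H (w * z)) =
      LinearMap.mul' ℂ H (S.lTensor H w) * algebraMap ℂ H c := by
  induction w with
  | zero => simp
  | add x y hx hy => rw [add_mul, map_add, map_add, hx, hy, map_add, map_add, add_mul]
  | tmul a b =>
    have h1 : LinearMap.mul' ℂ H (S.lTensor H (a ⊗ₜ b * z)) =
        a * LinearMap.mul' ℂ H (S.lTensor H z) * S b := by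
      clear hz
      induction z with
      | zero => simp
      | add x y hx hy => rw [mul_add, map_add, map_add, hx, hy, map_add, map_add, mul_add, add_mul]
      | tmul x y => simp [hS, mul_assoc]
    rw [h1, hz, mul_assoc, Algebra.commutes, ← mul_assoc]
    simp

/-- The algebra of functions on the quantum group is a Hopf algebra. -/
theorem IsFunctionAlgebra.exists_hopf (h : 𝓡.IsGood) {H : Type} [Ring H] [Algebra ℂ H]
    {t t' : Mat1 n H} (hH : IsFunctionAlgebra 𝓡 s t t') :
    ∃ (_ : Coalgebra ℂ H) (S : H →ₗ[ℂ] H), IsHopf H S ∧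
      (∀ i j, Coalgebra.comul (R := ℂ) (t i j) = ∑ k, t i k ⊗ₜ[ℂ] t k j) ∧
      (∀ i j, Coalgebra.counit (R := ℂ) (t i j) = if i = j then 1 else 0) ∧
      ∀ i j, S (t i j) = t' i j := by
  obtain ⟨Δ, hΔ, hΔ'⟩ := hH.lift (holds_funRel_mul (s := s) h id id
    (holds_funRel_map.2 (hH.holds.holdsMap (φ := inL H H)))
    (holds_funRel_map.2 (hH.holds.holdsMap (φ := inR H H))) fun _ _ _ _ => commute_inL_inR _ _)
  obtain ⟨ε, hε, hε'⟩ := hH.lift (holds_funRel_one (B := ℂ) h s)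
  have hop := holds_funRel_op h hH.holds
  obtain ⟨S, hS, hS'⟩ := hH.lift hop
  have coassoc : (assocHom H H H).comp ((Algebra.TensorProduct.map Δ (.id ℂ H)).comp Δ) =
      (Algebra.TensorProduct.map (.id ℂ H) Δ).comp Δ := by
    refine hH.algHom_ext ?_
    have e1 : (assocHom H H H).comp ((Algebra.TensorProduct.map Δ (.id ℂ H)).comp (inL H H)) =
        (Algebra.TensorProduct.map (.id ℂ H) (inL H H)).comp Δ := by
      rw [map_comp_inL, ← AlgHom.comp_assoc, assocHom_inL]
    have e2 : (assocHom H H H).comp ((Algebra.TensorProduct.map Δ (.id ℂ H)).comp (inR H H)) =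
        (inR H (H ⊗[ℂ] H)).comp (inR H H) := by
      rw [map_comp_inR, ← AlgHom.comp_assoc, assocHom_inR]; rfl
    rw [mapMatrix_comp, mapMatrix_comp, mapMatrix_comp, hΔ, map_mul, map_mul, map_mul,
      ← mapMatrix_comp, ← mapMatrix_comp, ← mapMatrix_comp, ← mapMatrix_comp, ← mapMatrix_comp,
      ← mapMatrix_comp, AlgHom.comp_assoc, AlgHom.comp_assoc, e1, e2, mapMatrix_comp _ Δ, hΔ,
      map_mul, ← mapMatrix_comp, ← mapMatrix_comp, map_comp_inL, map_comp_inR, map_comp_inL,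
      map_comp_inR, mapMatrix_comp (inR _ _) Δ, hΔ, map_mul, mul_assoc]
    rfl
  have lcounit : (Algebra.TensorProduct.map ε (.id ℂ H)).comp Δ = inR ℂ H := by
    refine hH.algHom_ext ?_
    rw [mapMatrix_comp, hΔ, map_mul, ← mapMatrix_comp, ← mapMatrix_comp, map_comp_inL,
      map_comp_inR, mapMatrix_comp _ ε, hε, map_one, one_mul]
    rfl
  have rcounit : (Algebra.TensorProduct.map (.id ℂ H) ε).comp Δ = inL H ℂ := by
    refine hH.algHom_ext ?_
    rw [mapMatrix_comp, hΔ, map_mul, ← mapMatrix_comp, ← mapMatrix_comp, map_comp_inL,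
      map_comp_inR, mapMatrix_comp _ ε, hε, map_one, mul_one]
    rfl
  let inst : Coalgebra ℂ H :=
    { comul := Δ.toLinearMap
      counit := ε.toLinearMap
      coassoc := congrArg AlgHom.toLinearMap coassoc
      rTensor_counit_comp_comul := congrArg AlgHom.toLinearMap lcounit
      lTensor_counit_comp_comul := congrArg AlgHom.toLinearMap rcounit }
  let S' : H →ₗ[ℂ] H :=
    (MulOpposite.opLinearEquiv ℂ).symm.toLinearMap ∘ₗ S.toLinearMap
  have S'_apply (x) : S' x = (S x).unop := rfl
  have S'_mul (x y) : S' (x * y) = S' y * S' x := by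
    rw [S'_apply, map_mul, MulOpposite.unop_mul]; rfl
  have ΔT (i j) : Δ (t i j) = ∑ k, t i k ⊗ₜ[ℂ] t k j :=
    (congrFun (congrFun hΔ i) j).trans (inL_mul_inR _ _ i j)
  have ΔT' (i j) : Δ (t' i j) = ∑ k, t' k j ⊗ₜ[ℂ] t' i k := by
    refine (congrFun (congrFun hΔ' i) j).trans ?_
    simp [Matrix.mul_apply, inL, inR]
  have εT (i j) : ε (t i j) = (1 : Mat1 n ℂ) i j := congrFun (congrFun hε i) j
  have εT' (i j) : ε (t' i j) = (1 : Mat1 n ℂ) i j := congrFun (congrFun hε' i) j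
  have ST (i j) : S (t i j) = opMat t' i j := congrFun (congrFun hS i) j
  have ST' (i j) : S (t' i j) = opMat _ i j := congrFun (congrFun hS' i) j
  have Se := FunEqs.of_holds hop
  have one_entry (i j) : (1 : Mat1 n H) i j =
      algebraMap ℂ H ((1 : Mat1 n ℂ) i j) := by
    rw [Matrix.one_apply, Matrix.one_apply]; split_ifs <;> simp
  have left (x) : LinearMap.mul' ℂ _ (S'.rTensor _ (Δ x)) = algebraMap ℂ _ (ε x) := by
    induction x using hH.induction with
    | _hc c => simp [Algebra.TensorProduct.algebraMap_apply, S'_apply]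
    | _ht i j =>
      rw [εT, ← one_entry, ← hH.eqs.inv_mul, ΔT]
      simp [S'_apply, ST, opMat, Matrix.mul_apply]
    | _ht' i j =>
      have := congrArg MulOpposite.unop (congrFun (congrFun Se.mul_inv i) j)
      rw [εT', ← one_entry, ΔT']
      simp only [map_sum, LinearMap.rTensor_tmul, LinearMap.mul'_apply, S'_apply, ST']
      rw [Matrix.mul_apply, Finset.unop_sum] at this
      refine Eq.trans this ?_
      rw [Matrix.one_apply, Matrix.one_apply]
      split_ifs <;> simp
    | _hm x y hx hy => rw [map_mul Δ, map_mul ε, antipode_closed S' S'_mul _ _ _ hx, hy, map_mul]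
    | _ha x y hx hy => rw [map_add, map_add, map_add, map_add, map_add, hx, hy]
  have right (x) : LinearMap.mul' ℂ _ (S'.lTensor _ (Δ x)) = algebraMap ℂ _ (ε x) := by
    induction x using hH.induction with
    | _hc c => simp [Algebra.TensorProduct.algebraMap_apply, S'_apply]
    | _ht i j =>
      rw [εT, ← one_entry, ← hH.eqs.mul_inv, ΔT]
      simp [S'_apply, ST, opMat, Matrix.mul_apply]
    | _ht' i j =>
      have := congrArg MulOpposite.unop (congrFun (congrFun Se.inv_mul i) j)
      rw [εT', ← one_entry, ΔT']
      simp only [map_sum, LinearMap.lTensor_tmul, LinearMap.mul'_apply, S'_apply, ST']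
      rw [Matrix.mul_apply, Finset.unop_sum] at this
      refine Eq.trans this ?_
      rw [Matrix.one_apply, Matrix.one_apply]
      split_ifs <;> simp
    | _hm x y hx hy => rw [map_mul Δ, map_mul ε, antipode_closed' S' S'_mul _ _ _ hy, hx, map_mul]
    | _ha x y hx hy => rw [map_add, map_add, map_add, map_add, map_add, hx, hy]
  refine ⟨inst, S', ⟨map_one ε, map_mul ε, map_one Δ, map_mul Δ, left, right⟩,
    ⟨ΔT, fun i j => (εT i j).trans Matrix.one_apply, fun i j => ?_⟩⟩
  rw [S'_apply, ST]; rfl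

end Hopf


/-! ### The coactions -/

section Coact

open Algebra.TensorProduct (map)

variable {n : ℕ} {𝓡 : RData n} {s s₀ : Kind}

section Translations

variable {A B C : Type*} [Ring A] [Algebra ℂ A] [Ring B] [Algebra ℂ B] [Ring C] [Algebra ℂ C]

theorem Calc.map_comp (f : B →ₐ[ℂ] C) (g : A →ₐ[ℂ] B) (D : Calc n A) :
    D.map (f.comp g) = (D.map g).map f := rfl

theorem Spec.map_comp (f : B →ₐ[ℂ] C) (g : A →ₐ[ℂ] B) (S : Spec n A) :
    S.map (f.comp g) = (S.map g).map f := rfl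

theorem Calc.map_leftTranslate (f : A →ₐ[ℂ] B) (t t' : Mat1 n A) (D : Calc n A) :
    (D.leftTranslate t t').map f =
      (D.map f).leftTranslate (f.mapMatrix t) (f.mapMatrix t') := by
  simp only [Calc.map, Calc.leftTranslate, map_mul]

theorem Calc.map_rightTranslate (f : A →ₐ[ℂ] B) (t t' : Mat1 n A) (D : Calc n A) :
    (D.rightTranslate t t').map f =
      (D.map f).rightTranslate (f.mapMatrix t) (f.mapMatrix t') := by
  simp only [Calc.map, Calc.rightTranslate, map_mul]

variable (t t' u u' : Mat1 n A) (D : Calc n A)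

theorem Calc.leftTranslate_leftTranslate :
    (D.leftTranslate u u').leftTranslate t t' = D.leftTranslate (t * u) (u' * t') := by
  simp only [Calc.leftTranslate, mul_assoc]

theorem Calc.rightTranslate_rightTranslate :
    (D.rightTranslate t t').rightTranslate u u' = D.rightTranslate (t * u) (u' * t') := by
  simp only [Calc.rightTranslate, mul_assoc]

theorem Calc.leftTranslate_rightTranslate :
    (D.rightTranslate u u').leftTranslate t t' = (D.leftTranslate t t').rightTranslate u u' := by
  simp only [Calc.rightTranslate, Calc.leftTranslate, mul_assoc]

theorem Calc.leftTranslate_one : D.leftTranslate 1 1 = D := by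
  simp only [Calc.leftTranslate, one_mul, mul_one]

theorem Calc.rightTranslate_one : D.rightTranslate 1 1 = D := by
  simp only [Calc.rightTranslate, one_mul, mul_one]

end Translations

variable {M : Type} [Ring M] [Algebra ℂ M]

/-- The matrices `D` and the spectral variables `S` generate `M` and are universal for the relations
of the spectrally extended calculus. -/
structure IsExtendedCalculus (𝓡 : RData n) (s : Kind) (D : Calc n M) (S : Spec n M) : Prop where
  holds : Holds (HatRel 𝓡 s D S)
  lift : ∀ {B : Type} [Ring B] [Algebra ℂ B] {D' : Calc n B} {S' : Spec n B},
    Holds (HatRel 𝓡 s D' S') → ∃ φ : M →ₐ[ℂ] B, D.map φ = D' ∧ S.map φ = S'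
  algHom_ext : ∀ {B : Type} [Ring B] [Algebra ℂ B] {f g : M →ₐ[ℂ] B}, D.map f = D.map g →
    S.map f = S.map g → f = g

theorem isExtendedCalculus_hat :
    IsExtendedCalculus 𝓡 s (Hat.calc 𝓡 s) (Hat.spec 𝓡 s) where
  holds := holds_hat
  lift := exists_hat_lift
  algHom_ext := hat_algHom_ext

variable {D : Calc n M} {S : Spec n M} {H : Type} [Ring H] [Algebra ℂ H] {t t' : Mat1 n H}

/-- The coactions on the extended calculus: since the left and right translations by a matrix of
functions preserve the defining relations, they extend to homomorphisms, and the axioms can be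
compared on the generators. -/
theorem IsExtendedCalculus.exists_coactions (h : 𝓡.IsGood) (hs : s = .sl → s₀ = .sl)
    (hM : IsExtendedCalculus 𝓡 s D S) (hH : IsFunctionAlgebra 𝓡 s₀ t t') [Coalgebra ℂ H]
    {σ : H →ₗ[ℂ] H} (hopf : IsHopf H σ)
    (comul_t : ∀ i j, Coalgebra.comul (R := ℂ) (t i j) = ∑ k, t i k ⊗ₜ[ℂ] t k j)
    (counit_t : ∀ i j, Coalgebra.counit (R := ℂ) (t i j) = if i = j then 1 else 0) :
    ∃ (δl : M →ₐ[ℂ] H ⊗[ℂ] M) (δr : M →ₐ[ℂ] M ⊗[ℂ] H),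
      IsBicomodule δl δr ∧ CoactionValues t t' D S δl δr := by
  let Δ : H →ₐ[ℂ] H ⊗[ℂ] H := AlgHom.ofLinearMap Coalgebra.comul hopf.comul_one hopf.comul_mul
  let ε : H →ₐ[ℂ] ℂ := AlgHom.ofLinearMap Coalgebra.counit hopf.counit_one hopf.counit_mul
  have hΔ : Δ.mapMatrix t = (inL H H).mapMatrix t * (inR H H).mapMatrix t := by
    ext i j
    exact (comul_t i j).trans (inL_mul_inR t t i j).symm
  have hε : ε.mapMatrix t = 1 := by
    ext i j
    exact (counit_t i j).trans Matrix.one_apply.symm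
  have inv {B : Type} [Ring B] [Algebra ℂ B] (f : H →ₐ[ℂ] B) {v v' : Mat1 n B}
      (hf : f.mapMatrix t = v) (hv : v * v' = 1) : f.mapMatrix t' = v' := by
    have h1 : f.mapMatrix t' * v = 1 := by rw [← hf, ← map_mul, hH.eqs.inv_mul, map_one]
    exact left_inv_eq_right_inv h1 hv
  have inv_map {B : Type} [Ring B] [Algebra ℂ B] (f : H →ₐ[ℂ] B) :
      f.mapMatrix t * f.mapMatrix t' = 1 := by rw [← map_mul, hH.eqs.mul_inv, map_one]
  have hΔ' : Δ.mapMatrix t' = (inR H H).mapMatrix t' * (inL H H).mapMatrix t' :=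
    inv Δ hΔ (by rw [mul_assoc, ← mul_assoc ((inR H H).mapMatrix t), inv_map, one_mul, inv_map])
  have hε' : ε.mapMatrix t' = 1 := inv ε hε (one_mul 1)
  have hl : Holds (FunRel 𝓡 s₀ ((inL H M).mapMatrix t) ((inL H M).mapMatrix t')) :=
    holds_funRel_map.2 (hH.holds.holdsMap (φ := inL H M))
  have hr : Holds (FunRel 𝓡 s₀ ((inR M H).mapMatrix t) ((inR M H).mapMatrix t')) :=
    holds_funRel_map.2 (hH.holds.holdsMap (φ := inR M H))
  obtain ⟨δl, dl, sl⟩ := hM.lift (holds_hatRel_leftTranslate (g := inR H M) h hs hM.holds hl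
    (fun _ _ _ => commute_inL_inR _ _) fun _ _ _ => commute_inL_inR _ _)
  obtain ⟨δr, dr, sr⟩ := hM.lift (holds_hatRel_rightTranslate (g := inL M H) h hs hM.holds hr
    (fun _ _ _ => (commute_inL_inR _ _).symm) fun _ _ _ => (commute_inL_inR _ _).symm)
  have el := FunEqs.of_holds hl
  have er := FunEqs.of_holds hr
  -- the iterated coactions on the two embedded factors
  have l1 : (assocHom H H M).comp ((map Δ (.id ℂ M)).comp (inL H M)) =
      (map (.id ℂ H) (inL H M)).comp Δ := by
    rw [map_comp_inL, ← AlgHom.comp_assoc, assocHom_inL]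
  have l2 : (assocHom H H M).comp ((map Δ (.id ℂ M)).comp (inR H M)) =
      (inR H (H ⊗[ℂ] M)).comp (inR H M) := by
    rw [map_comp_inR, ← AlgHom.comp_assoc, assocHom_inR]; rfl
  have r1 : (assocHom M H H).comp ((map δr (.id ℂ H)).comp (inL M H)) =
      (map (.id ℂ M) (inL H H)).comp δr := by
    rw [map_comp_inL, ← AlgHom.comp_assoc, assocHom_inL]
  have r2 : (assocHom M H H).comp ((map δr (.id ℂ H)).comp (inR M H)) =
      (inR M (H ⊗[ℂ] H)).comp (inR H H) := by
    rw [map_comp_inR, ← AlgHom.comp_assoc, assocHom_inR]; rfl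
  have m1 : (assocHom H M H).comp ((map δl (.id ℂ H)).comp (inL M H)) =
      (map (.id ℂ H) (inL M H)).comp δl := by
    rw [map_comp_inL, ← AlgHom.comp_assoc, assocHom_inL]
  have m2 : (assocHom H M H).comp ((map δl (.id ℂ H)).comp (inR M H)) =
      (inR H (M ⊗[ℂ] H)).comp (inR M H) := by
    rw [map_comp_inR, ← AlgHom.comp_assoc, assocHom_inR]; rfl
  -- values of a composition with one of the coactions on the generators
  have dl_comp {B : Type} [Ring B] [Algebra ℂ B] (f : H ⊗[ℂ] M →ₐ[ℂ] B) :
      D.map (f.comp δl) = (D.map (f.comp (inR H M))).leftTranslate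
        ((f.comp (inL H M)).mapMatrix t) ((f.comp (inL H M)).mapMatrix t') := by
    rw [Calc.map_comp, dl, Calc.map_leftTranslate]; rfl
  have dr_comp {B : Type} [Ring B] [Algebra ℂ B] (f : M ⊗[ℂ] H →ₐ[ℂ] B) :
      D.map (f.comp δr) = (D.map (f.comp (inL M H))).rightTranslate
        ((f.comp (inR M H)).mapMatrix t) ((f.comp (inR M H)).mapMatrix t') := by
    rw [Calc.map_comp, dr, Calc.map_rightTranslate]; rfl
  have sl_comp {B : Type} [Ring B] [Algebra ℂ B] (f : H ⊗[ℂ] M →ₐ[ℂ] B) :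
      S.map (f.comp δl) = S.map (f.comp (inR H M)) := by rw [Spec.map_comp, sl]; rfl
  have sr_comp {B : Type} [Ring B] [Algebra ℂ B] (f : M ⊗[ℂ] H →ₐ[ℂ] B) :
      S.map (f.comp δr) = S.map (f.comp (inL M H)) := by rw [Spec.map_comp, sr]; rfl
  have left_coassoc : ((assocHom H H M).comp (map Δ (.id ℂ M))).comp δl =
      (map (.id ℂ H) δl).comp δl := by
    refine hM.algHom_ext ?_ ?_
    · rw [dl_comp, dl_comp, AlgHom.comp_assoc, AlgHom.comp_assoc, l1, l2, map_comp_inL,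
        map_comp_inR, dl_comp, Calc.leftTranslate_leftTranslate, mapMatrix_comp _ Δ,
        mapMatrix_comp _ Δ, hΔ, hΔ', map_mul, map_mul, ← mapMatrix_comp, ← mapMatrix_comp,
        ← mapMatrix_comp, ← mapMatrix_comp, map_comp_inL, map_comp_inR]
    · rw [sl_comp, sl_comp, AlgHom.comp_assoc, l2, map_comp_inR, sl_comp]
  have left_counit : (map ε (.id ℂ M)).comp δl = inR ℂ M := by
    refine hM.algHom_ext ?_ ?_
    · rw [dl_comp, map_comp_inL, map_comp_inR, mapMatrix_comp _ ε, mapMatrix_comp _ ε, hε, hε',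
        map_one, Calc.leftTranslate_one]
      rfl
    · rw [sl_comp, map_comp_inR]; rfl
  have right_coassoc : ((assocHom M H H).comp (map δr (.id ℂ H))).comp δr =
      (map (.id ℂ M) Δ).comp δr := by
    refine hM.algHom_ext ?_ ?_
    · rw [dr_comp, dr_comp, AlgHom.comp_assoc, AlgHom.comp_assoc, r1, r2, map_comp_inL,
        map_comp_inR, dr_comp, Calc.rightTranslate_rightTranslate, mapMatrix_comp _ Δ,
        mapMatrix_comp _ Δ, hΔ, hΔ', map_mul, map_mul, ← mapMatrix_comp, ← mapMatrix_comp,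
        ← mapMatrix_comp, ← mapMatrix_comp, map_comp_inL, map_comp_inR]
    · rw [sr_comp, sr_comp, AlgHom.comp_assoc, r1, map_comp_inL, sr_comp, map_comp_inL]
  have right_counit : (map (.id ℂ M) ε).comp δr = inL M ℂ := by
    refine hM.algHom_ext ?_ ?_
    · rw [dr_comp, map_comp_inL, map_comp_inR, mapMatrix_comp _ ε, mapMatrix_comp _ ε, hε, hε',
        map_one, Calc.rightTranslate_one]
      rfl
    · rw [sr_comp, map_comp_inL]; rfl
  have left_right : ((assocHom H M H).comp (map δl (.id ℂ H))).comp δr =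
      (map (.id ℂ H) δr).comp δl := by
    refine hM.algHom_ext ?_ ?_
    · rw [dr_comp, dl_comp, AlgHom.comp_assoc, AlgHom.comp_assoc, m1, m2, map_comp_inL,
        map_comp_inR, dl_comp, dr_comp, Calc.leftTranslate_rightTranslate, map_comp_inR,
        map_comp_inL]
    · rw [sr_comp, sl_comp, AlgHom.comp_assoc, m1, sl_comp, map_comp_inR, map_comp_inR, sr_comp]
  refine ⟨δl, δr, ⟨fun m => DFunLike.congr_fun left_coassoc m,
    fun m => DFunLike.congr_fun left_counit m, fun m => DFunLike.congr_fun right_coassoc m,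
    fun m => DFunLike.congr_fun right_counit m, fun m => DFunLike.congr_fun left_right m⟩, ?_⟩
  have entry {B : Type} {X Y : Mat1 n B} (hXY : X = Y) (i j) : X i j = Y i j := by rw [hXY]
  constructor
  · exact fun i j => (entry (congrArg Calc.T dl) i j).trans (inL_mul_inR t D.T i j)
  · exact fun i j => (entry (congrArg Calc.T dr) i j).trans (inL_mul_inR D.T t i j)
  · rintro X (rfl | rfl | rfl) i j
    · exact (entry (congrArg Calc.Ω dl) i j).trans (inL_conj t t' _ i j)
    · exact (entry (congrArg Calc.L dl) i j).trans (inL_conj t t' _ i j)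
    · refine (entry ((map_F δl D).trans ?_) i j).trans (inL_conj t t' _ i j)
      rw [dl, el.leftTranslate_F, map_F]
  · rintro X (rfl | rfl | rfl) i j
    · exact entry (congrArg Calc.Ω dr) i j
    · exact entry (congrArg Calc.L dr) i j
    · refine entry (Y := (inL M H).mapMatrix D.F) ((map_F δr D).trans ?_) i j
      rw [dr, er.rightTranslate_F, map_F]
  · rintro X (rfl | rfl | rfl) i j
    · refine entry (Y := (inR H M).mapMatrix D.Θ) ((map_Θ δl D).trans ?_) i j
      rw [dl, el.leftTranslate_Θ, map_Θ]
    · exact entry (congrArg Calc.K dl) i j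
    · refine entry (Y := (inR H M).mapMatrix D.G) ((map_G δl D).trans ?_) i j
      rw [dl, el.leftTranslate_G, map_G]
  · rintro X (rfl | rfl | rfl) i j
    · refine (entry ((map_Θ δr D).trans ?_) i j).trans (inR_conj t' t _ i j)
      rw [dr, FunEqs.rightTranslate_Θ, map_Θ]
    · exact (entry (congrArg Calc.K dr) i j).trans (inR_conj t' t _ i j)
    · refine (entry ((map_G δr D).trans ?_) i j).trans (inR_conj t' t _ i j)
      rw [dr, er.rightTranslate_G, map_G]
  · rintro α ξ (rfl | rfl | rfl)
    · exact congrArg (fun S => S.μ.x α) sl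
    · exact congrArg (fun S => S.ν.x α) sl
    · exact congrArg (fun S => S.ρ.x α) sl
  · rintro α ξ (rfl | rfl | rfl)
    · exact congrArg (fun S => S.μ.x α) sr
    · exact congrArg (fun S => S.ν.x α) sr
    · exact congrArg (fun S => S.ρ.x α) sr

/-- Coactions that are compatible with the comultiplication on the functions turn the calculus into
a bicovariant bimodule. -/
theorem IsFunctionAlgebra.isBicovariant (hH : IsFunctionAlgebra 𝓡 s₀ t t') [Coalgebra ℂ H]
    {σ : H →ₗ[ℂ] H} (hopf : IsHopf H σ)
    (comul_t : ∀ i j, Coalgebra.comul (R := ℂ) (t i j) = ∑ k, t i k ⊗ₜ[ℂ] t k j)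
    {δl : M →ₐ[ℂ] H ⊗[ℂ] M} {δr : M →ₐ[ℂ] M ⊗[ℂ] H} (hδ : IsBicomodule δl δr)
    (hv : CoactionValues t t' D S δl δr) {ι : H →ₐ[ℂ] M} (hι : ι.mapMatrix t = D.T) :
    IsBicovariant ι δl δr := by
  let Δ : H →ₐ[ℂ] H ⊗[ℂ] H := AlgHom.ofLinearMap Coalgebra.comul hopf.comul_one hopf.comul_mul
  have hι' (i j) : ι (t i j) = D.T i j := congrFun (congrFun hι i) j
  have hl : δl.comp ι = (map (.id ℂ H) ι).comp Δ := by
    refine hH.algHom_ext ?_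
    ext i j
    change δl (ι (t i j)) = map (.id ℂ H) ι (Coalgebra.comul (R := ℂ) (t i j))
    rw [hι', hv.T_left, comul_t, map_sum]
    simp [hι']
  have hr : δr.comp ι = (map ι (.id ℂ H)).comp Δ := by
    refine hH.algHom_ext ?_
    ext i j
    change δr (ι (t i j)) = map ι (.id ℂ H) (Coalgebra.comul (R := ℂ) (t i j))
    rw [hι', hv.T_right, comul_t, map_sum]
    simp [hι']
  have hl' (x) : δl (ι x) = ι.toLinearMap.lTensor H (Coalgebra.comul (R := ℂ) x) :=
    DFunLike.congr_fun hl x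
  have hr' (x) : δr (ι x) = ι.toLinearMap.rTensor H (Coalgebra.comul (R := ℂ) x) :=
    DFunLike.congr_fun hr x
  exact { hδ with
    left_cov := fun x y m => by rw [map_mul, map_mul, hl', hl']
    right_cov := fun x y m => by rw [map_mul, map_mul, hr', hr'] }

end Coact


end QCalc

end

theorem mainTheorem2 {n : ℕ} (𝓡 : QCalc.RData n) (h𝓡 : 𝓡.IsSLType) (hγ : 𝓡.γ ^ n = 𝓡.q)
    (s : QCalc.Kind)
    (hκ : s = QCalc.Kind.sl → QCalc.qnum 𝓡.q n + 𝓡.q ^ n * (𝓡.q - 𝓡.q⁻¹) ≠ 0) :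
    -- permutation relations of the coefficients of the characteristic polynomials
    (∀ (A : Type u) [Ring A] [Algebra ℂ A] (D : QCalc.Calc n A),
      QCalc.Holds (QCalc.CalcRel 𝓡 s D) →
      QCalc.CoeffExchange 𝓡 D (𝓡.coeffR D.L) (𝓡.coeffL D.K) (𝓡.coeffR D.F)) ∧
    -- consistency: without imposing the parameterization, the elementary symmetric functions of
    -- the spectral variables satisfy the same permutation relations
    (∀ (A : Type u) [Ring A] [Algebra ℂ A] (D : QCalc.Calc n A) (S : QCalc.Spec n A),
      QCalc.Holds (QCalc.CalcRel 𝓡 s D) → QCalc.Holds (QCalc.SpecRel 𝓡 S) →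
      QCalc.Holds (QCalc.CommRel D S) → (∀ l, QCalc.Holds (QCalc.Exch1 𝓡 D S l)) →
      QCalc.Holds (QCalc.TraceRel 𝓡 D S) →
      QCalc.charProd 𝓡.q D.L S.μ = 0 → QCalc.charProd 𝓡.q D.K S.ν = 0 →
      QCalc.charProd 𝓡.q D.F S.ρ = 0 →
      QCalc.CoeffExchange 𝓡 D (QCalc.esymm S.μ.x) (QCalc.esymm S.ν.x) (QCalc.esymm S.ρ.x)) ∧
    -- idempotents, and the equivalence of the two forms of the exchange relations
    (∀ (A : Type u) [Ring A] [Algebra ℂ A] (D : QCalc.Calc n A) (S : QCalc.Spec n A),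
      QCalc.Holds (QCalc.CalcRel 𝓡 s D) → QCalc.Holds (QCalc.SpecRel 𝓡 S) →
      QCalc.Holds (QCalc.ParamRel 𝓡 D S) → QCalc.Holds (QCalc.CommRel D S) →
      QCalc.HasSpectralResolution 𝓡.q D.L S.μ ∧
      QCalc.HasSpectralResolution 𝓡.q D.K S.ν ∧
      QCalc.HasSpectralResolution 𝓡.q D.F S.ρ ∧
      ∀ l, QCalc.Holds (QCalc.Exch1 𝓡 D S l) ↔ QCalc.Holds (QCalc.Exch2 𝓡 D S l)) ∧
    -- the extended algebra satisfies its relations and receives the calculus and the algebra of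
    -- spectral variables
    QCalc.Holds (QCalc.HatRel 𝓡 s (QCalc.Hat.calc 𝓡 s) (QCalc.Hat.spec 𝓡 s)) ∧
    (∃ φ : QCalc.DC 𝓡 s →ₐ[ℂ] QCalc.Hat 𝓡 s,
      (QCalc.DC.calc 𝓡 s).T.map φ = (QCalc.Hat.calc 𝓡 s).T ∧
      (QCalc.DC.calc 𝓡 s).Ω.map φ = (QCalc.Hat.calc 𝓡 s).Ω ∧
      (QCalc.DC.calc 𝓡 s).L.map φ = (QCalc.Hat.calc 𝓡 s).L ∧
      (QCalc.DC.calc 𝓡 s).K.map φ = (QCalc.Hat.calc 𝓡 s).K ∧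
      ∀ i ≤ n,
        φ (𝓡.coeffR (QCalc.DC.calc 𝓡 s).L i) = QCalc.esymm (QCalc.Hat.spec 𝓡 s).μ.x i ∧
        φ (𝓡.coeffL (QCalc.DC.calc 𝓡 s).K i) = QCalc.esymm (QCalc.Hat.spec 𝓡 s).ν.x i ∧
        φ (𝓡.coeffR (QCalc.DC.calc 𝓡 s).F i) = QCalc.esymm (QCalc.Hat.spec 𝓡 s).ρ.x i) ∧
    (∃ ψ : QCalc.SpecAlg 𝓡 →ₐ[ℂ] QCalc.Hat 𝓡 s, ∀ α,
      ψ ((QCalc.SpecAlg.spec 𝓡).μ.x α) = (QCalc.Hat.spec 𝓡 s).μ.x α ∧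
      ψ ((QCalc.SpecAlg.spec 𝓡).ν.x α) = (QCalc.Hat.spec 𝓡 s).ν.x α ∧
      ψ ((QCalc.SpecAlg.spec 𝓡).ρ.x α) = (QCalc.Hat.spec 𝓡 s).ρ.x α) ∧
    -- the bicovariant bimodule structure over the Hopf algebra of functions
    (∃ (_ : Coalgebra ℂ (QCalc.Fun 𝓡 s)) (S : QCalc.Fun 𝓡 s →ₗ[ℂ] QCalc.Fun 𝓡 s)
      (ι : QCalc.Fun 𝓡 s →ₐ[ℂ] QCalc.Hat 𝓡 s)
      (δl : QCalc.Hat 𝓡 s →ₐ[ℂ] QCalc.Fun 𝓡 s ⊗[ℂ] QCalc.Hat 𝓡 s)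
      (δr : QCalc.Hat 𝓡 s →ₐ[ℂ] QCalc.Hat 𝓡 s ⊗[ℂ] QCalc.Fun 𝓡 s),
      QCalc.IsHopf (QCalc.Fun 𝓡 s) S ∧ QCalc.FunHopfValues 𝓡 s S ∧
      (QCalc.Fun.T 𝓡 s).map ι = (QCalc.Hat.calc 𝓡 s).T ∧
      QCalc.IsBicovariant ι δl δr ∧
      QCalc.CoactionValues (QCalc.Fun.T 𝓡 s) (QCalc.Fun.T' 𝓡 s)
        (QCalc.Hat.calc 𝓡 s) (QCalc.Hat.spec 𝓡 s) δl δr) ∧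
    -- in both cases the algebra of functions over the special linear quantum group coacts
    (∃ (_ : Coalgebra ℂ (QCalc.Fun 𝓡 .sl)) (S : QCalc.Fun 𝓡 .sl →ₗ[ℂ] QCalc.Fun 𝓡 .sl)
      (δl : QCalc.Hat 𝓡 s →ₐ[ℂ] QCalc.Fun 𝓡 .sl ⊗[ℂ] QCalc.Hat 𝓡 s)
      (δr : QCalc.Hat 𝓡 s →ₐ[ℂ] QCalc.Hat 𝓡 s ⊗[ℂ] QCalc.Fun 𝓡 .sl),
      QCalc.IsHopf (QCalc.Fun 𝓡 .sl) S ∧ QCalc.FunHopfValues 𝓡 .sl S ∧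
      QCalc.IsBicomodule δl δr ∧
      QCalc.CoactionValues (QCalc.Fun.T 𝓡 .sl) (QCalc.Fun.T' 𝓡 .sl)
        (QCalc.Hat.calc 𝓡 s) (QCalc.Hat.spec 𝓡 s) δl δr) := by
  have h := h𝓡.isGood
  have hq := h.q_ne_zero
  have hγ0 : 𝓡.γ ≠ 0 := fun h0 => hq (by rw [← hγ, h0, zero_pow h.pos.ne'])
  refine ⟨fun A _ _ D hD => (QCalc.CalcEqs.of_holds hD).coeffExchange h hγ0,
    fun A _ _ D S _ hS hC hE hT hL hK hF =>
      QCalc.esymm_coeffExchange hq hS hC hE hT hL hK hF,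
    fun A _ _ D S hD hS hP hC => ?_, QCalc.holds_hat, ?_, ?_, ?_, ?_⟩
  · obtain ⟨rL, rK, rF⟩ := (QCalc.CalcEqs.of_holds hD).resolved h hγ0 hS hP hC
    exact ⟨rL.toHasSpectralResolution, rK.toHasSpectralResolution, rF.toHasSpectralResolution,
      QCalc.exch_iff hq rL rK rF⟩
  · obtain ⟨φ, hφ⟩ := QCalc.exists_dc_lift (𝓡 := 𝓡) (s := s) (D := QCalc.Hat.calc 𝓡 s)
      fun x y hxy => QCalc.holds_hat x y (.calc x y hxy)
    refine ⟨φ, congrArg QCalc.Calc.T hφ, congrArg QCalc.Calc.Ω hφ, congrArg QCalc.Calc.L hφ,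
      congrArg QCalc.Calc.K hφ, fun i hi => ⟨?_, ?_, ?_⟩⟩
    · rw [QCalc.map_coeffR]
      exact (congrArg (fun D : QCalc.Calc n _ => 𝓡.coeffR D.L i) hφ).trans
        (QCalc.holds_hat _ _ (.param _ _ (.a i hi)))
    · rw [QCalc.map_coeffL]
      exact (congrArg (fun D : QCalc.Calc n _ => 𝓡.coeffL D.K i) hφ).trans
        (QCalc.holds_hat _ _ (.param _ _ (.b i hi)))
    · rw [QCalc.map_coeffR, QCalc.map_F, hφ]
      exact QCalc.holds_hat _ _ (.param _ _ (.c i hi))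
  · obtain ⟨ψ, hψ⟩ := QCalc.exists_specAlg_lift (𝓡 := 𝓡) (S := QCalc.Hat.spec 𝓡 s)
      fun x y hxy => QCalc.holds_hat x y (.spec x y hxy)
    exact ⟨ψ, fun α => ⟨congrArg (fun S => S.μ.x α) hψ, congrArg (fun S => S.ν.x α) hψ,
      congrArg (fun S => S.ρ.x α) hψ⟩⟩
  · have hH := QCalc.isFunctionAlgebra_fun (𝓡 := 𝓡) (s := s)
    obtain ⟨_, S, hopf, hcomul, hcounit, hS⟩ := hH.exists_hopf h
    obtain ⟨δl, δr, hδ, hv⟩ := (QCalc.isExtendedCalculus_hat (𝓡 := 𝓡) (s := s)).exists_coactions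
      h id hH hopf hcomul hcounit
    obtain ⟨ι, hι, -⟩ := hH.lift
      fun x y hxy => (QCalc.holds_hat (𝓡 := 𝓡) (s := s)) x y (.calc x y (.functions x y hxy))
    exact ⟨_, S, ι, δl, δr, hopf, ⟨hcomul, hcounit, hS⟩, hι,
      hH.isBicovariant hopf hcomul hδ hv hι, hv⟩
  · have hH := QCalc.isFunctionAlgebra_fun (𝓡 := 𝓡) (s := .sl)
    obtain ⟨_, S, hopf, hcomul, hcounit, hS⟩ := hH.exists_hopf h
    obtain ⟨δl, δr, hδ, hv⟩ := (QCalc.isExtendedCalculus_hat (𝓡 := 𝓡) (s := s)).exists_coactions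
      h (fun _ => rfl) hH hopf hcomul hcounit
    exact ⟨_, S, δl, δr, hopf, ⟨hcomul, hcounit, hS⟩, hδ, hv⟩
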